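/- Let $n\ge 3$, $r>0$, $\overline B{}_r^+=\{x\in\mathbb R^n: x_n\ge 0,\ \sum_i x_i^2\le r^2\}$ and $\Sigma_r=\overline B{}_r^+\cap\{x_n=0\}$. Greek indices run over $1,\dots,n-1$. **Metric.** Let $g$ be a $C^3$ Riemannian metric on $\overline B{}_r^+$ in Fermi coordinates, $g=dx^n dx^n+g_{\alpha\beta}dx^\alpha dx^\beta$, with $g\ge\theta\,\delta$ as quadratic forms for some $\theta>0$. Assume that $\Sigma_r$ is umbilic with principal curvature function $\mu$, i.e. $L_{\alpha\beta}=\mu g_{\alpha\beta}$ on $\Sigma_r$, where $L_{\alpha\beta}=\Gamma^n_{\alpha\beta}=-\tfrac12\partial_n g_{\alpha\beta}$ is the second fundamental form with respect to the unit inner normal $\partial/\partial n=\partial/\partial x_n$. Norms $|\cdot|$, covariant derivatives (a comma, or $\nabla$) and the curvature $R_{ijkl}$ are those of $g$, with $R_{ijkl}=g_{ik}g_{jl}-g_{il}g_{jk}$ on the unit sphere. **Tensor.** Let $S$ be a symmetric $(0,2)$-tensor of class $C^2$ on $\overline B{}_r^+$ such that on $\Sigma_r$ (T0) $S_{\alpha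 n}=\mu_\alpha$; (T1) $S_{\alpha\beta}+S_{nn}g_{\alpha\beta}\le R_{\alpha n\beta n}$; (T2) $S_{\alpha\beta,n}-2\mu S_{\alpha\beta}\le \mu_{\tilde\alpha\tilde\beta}-R_{\alpha n\beta n}\mu$, where the inequalities are between quadratic forms and $\mu_{\tilde\alpha\tilde\beta}$ is the covariant Hessian of $\mu$ for the induced metric $g_{\alpha\beta}$ on $\Sigma_r$. **Nonlinearity.** With $\sigma_i$ the elementary symmetric functions, let $\Gamma_k^+=\{\lambda\in\mathbb R^n:\sigma_1(\lambda),\dots,\sigma_k(\lambda)>0\}$. Let $\Gamma$ be an open convex cone in $\mathbb R^n$ with vertex at the origin, invariant under permutations of the coordinates, with $\Gamma_n^+\subset\Gamma\subset\Gamma_1^+$. Let $F\in C^\infty(\Gamma)\cap C^0(\overline\Gamma)$ be symmetric and homogeneous of degree one with $F(1,\dots,1)=1$ and $F=0$ on $\partial\Gamma$, and suppose that in $\Gamma$: (S0) $F>0$; (S1) $F$ is concave; (S2) $\partial F/\partial\lambda_i>0$ for all $i$; (S3) $\partial F/\partial\lambda_i\ge\epsilon F/\sigma_1$ for all $i$,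 with a constant $\epsilon>0$. Condition (A) with a constant $\rho>0$ is: $\sum_{j\ne i}\partial F/\partial\lambda_j\le\rho\,\partial F/\partial\lambda_i$ at every $\lambda\in\Gamma$ and for every $i$ with $\lambda_i\le0$. **Equation.** Let $f(x,z)$ be a positive $C^2$ function on $\overline B{}_r^+\times\mathbb R$ with $|\nabla_xf|\le\Lambda f$ and $|f_z|\le\Lambda f$ for a number $\Lambda$. Let $\hat\mu$ be a constant and let $u\in C^4(\overline B{}_r^+)$ satisfy $$F\big(\nabla^2u+du\otimes du-\tfrac12|\nabla u|^2g+S\big)=f(x,u)\ \text{ in }\overline B{}_r^+,\qquad \frac{\partial u}{\partial n}+\mu=\hat\mu\,e^{-u}\ \text{ on }\Sigma_r,$$ where $F$ is evaluated at the vector of eigenvalues with respect to $g$, which lies in $\Gamma$. Let $$c_{\sup}(r)=\sup_{x\in\overline B{}_r^+}\big(f+|\nabla_xf|+|f_z|+|\nabla_x^2f|+|\nabla_xf_z|+|f_{zz}|\big)(x,u(x)).$$ (a) If $\hat\mu=0$, then $\sup_{\overline B{}_{r/2}^+}(|\nabla u|^2+|\nabla^2u|)\le C$, where $C$ depends only on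 $r$, $n$, $\epsilon$, $\Lambda$, $\theta$ and on upper bounds for $\|S\|_{C^2(\overline B{}_r^+)}$, $\|g\|_{C^3(\overline B{}_r^+)}$ and $c_{\sup}(r)$. (b) If $\hat\mu>0$, if $F$ satisfies (A), and if $\Gamma_2^+\subset\Gamma$ or $\Gamma\subset\Gamma_2^+$, then $\sup_{\overline B{}_{r/2}^+}(|\nabla u|^2+|\nabla^2u|)\le C$, where $C$ depends only on $r$, $n$, $\epsilon$, $\rho$, $\hat\mu$, $\Lambda$, $\theta$, on upper bounds for $\|S\|_{C^2(\overline B{}_r^+)}$, $\|g\|_{C^3(\overline B{}_r^+)}$ and $c_{\sup}(r)$, and on a lower bound for $\inf_{\overline B{}_r^+}u$. -/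

import Mathlib

open scoped ContDiff

noncomputable section

namespace BoundaryEstimate

/-! ### Tensor calculus in one coordinate chart

`D` is the coordinate domain (a convex body, possibly with boundary); derivatives are taken
within `D`, so that they are one-sided at boundary points. -/

section Calculus

variable {ι : Type*} [Fintype ι] [DecidableEq ι]

/-- The partial derivative `∂φ/∂xᵢ`, taken within `D`. -/
def pd (D : Set (EuclideanSpace ℝ ι)) (i : ι) (φ : EuclideanSpace ℝ ι → ℝ)
    (x : EuclideanSpace ℝ ι) : ℝ :=
  fderivWithin ℝ φ D x (EuclideanSpace.single i 1)

/-- The Christoffel symbol `Γᵏᵢⱼ` of the metric `g`. -/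
def christoffel (D : Set (EuclideanSpace ℝ ι)) (g : EuclideanSpace ℝ ι → Matrix ι ι ℝ)
    (k i j : ι) (x : EuclideanSpace ℝ ι) : ℝ :=
  (1 / 2) * ∑ l, (g x)⁻¹ k l *
    (pd D i (fun y => g y j l) x + pd D j (fun y => g y i l) x - pd D l (fun y => g y i j) x)

/-- The covariant Hessian `(∇²φ)ᵢⱼ = ∂ᵢ∂ⱼφ - Γᵏᵢⱼ ∂ₖφ`. -/
def covHess (D : Set (EuclideanSpace ℝ ι)) (g : EuclideanSpace ℝ ι → Matrix ι ι ℝ)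
    (φ : EuclideanSpace ℝ ι → ℝ) (x : EuclideanSpace ℝ ι) : Matrix ι ι ℝ :=
  Matrix.of fun i j => pd D i (pd D j φ) x - ∑ k, christoffel D g k i j x * pd D k φ x

/-- The covariant derivative `Tᵢⱼ,ₖ = ∂ₖTᵢⱼ - Γˡₖᵢ Tₗⱼ - Γˡₖⱼ Tᵢₗ` of a `(0,2)`-tensor. -/
def covDeriv (D : Set (EuclideanSpace ℝ ι)) (g T : EuclideanSpace ℝ ι → Matrix ι ι ℝ)
    (i j k : ι) (x : EuclideanSpace ℝ ι) : ℝ :=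
  pd D k (fun y => T y i j) x - ∑ l, christoffel D g l k i x * T x l j
    - ∑ l, christoffel D g l k j x * T x i l

/-- The curvature tensor `Rᵢⱼₖₗ = g(R(∂ₖ, ∂ₗ)∂ⱼ, ∂ᵢ)`; on the round unit sphere it is
`gᵢₖ gⱼₗ - gᵢₗ gⱼₖ`. -/
def riemann (D : Set (EuclideanSpace ℝ ι)) (g : EuclideanSpace ℝ ι → Matrix ι ι ℝ)
    (i j k l : ι) (x : EuclideanSpace ℝ ι) : ℝ :=
  ∑ a, g x i a *
    (pd D k (christoffel D g a l j) x - pd D l (christoffel D g a k j) x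
      + ∑ p, christoffel D g a k p x * christoffel D g p l j x
      - ∑ p, christoffel D g a l p x * christoffel D g p k j x)

/-- The squared length `gⁱʲ wᵢ wⱼ` of a covector; `h` is the matrix of the metric. -/
def covectorNormSq (h : Matrix ι ι ℝ) (w : ι → ℝ) : ℝ :=
  ∑ i, ∑ j, h⁻¹ i j * w i * w j

/-- The length of a covector. -/
def covectorNorm (h : Matrix ι ι ℝ) (w : ι → ℝ) : ℝ :=
  √(covectorNormSq h w)

/-- The length `(gⁱᵏ gʲˡ Tᵢⱼ Tₖₗ)^(1/2)` of a `(0,2)`-tensor; `h` is the matrix of the metric. -/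
def tensorNorm (h T : Matrix ι ι ℝ) : ℝ :=
  √(∑ i, ∑ j, ∑ k, ∑ l, h⁻¹ i k * h⁻¹ j l * T i j * T k l)

/-- `‖T‖_{C^k(D)} ≤ M` for a matrix-valued function: all derivatives up to order `k` of all
components are bounded by `M` on `D`. -/
def CkBound (k : ℕ) (D : Set (EuclideanSpace ℝ ι)) (T : EuclideanSpace ℝ ι → Matrix ι ι ℝ)
    (M : ℝ) : Prop :=
  ∀ i j, ∀ q ≤ k, ∀ x ∈ D, ‖iteratedFDerivWithin ℝ q (fun y => T y i j) D x‖ ≤ M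

/-- The tensor `W = ∇²u + du ⊗ du - ½ |∇u|² g + S`. -/
def tensorW (D : Set (EuclideanSpace ℝ ι)) (g S : EuclideanSpace ℝ ι → Matrix ι ι ℝ)
    (u : EuclideanSpace ℝ ι → ℝ) (x : EuclideanSpace ℝ ι) : Matrix ι ι ℝ :=
  Matrix.of fun i j => covHess D g u x i j + pd D i u x * pd D j u x
    - (1 / 2) * covectorNormSq (g x) (fun k => pd D k u x) * g x i j + S x i j

/-- `lam` lists, with multiplicity, the eigenvalues of the `(0,2)`-tensor `T` with respect to the
metric with matrix `h`, that is, of the endomorphism `h⁻¹ T`. -/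
def IsEigenvaluesOf (h T : Matrix ι ι ℝ) (lam : ι → ℝ) : Prop :=
  (h⁻¹ * T).charpoly = ∏ i, (Polynomial.X - Polynomial.C (lam i))

end Calculus

/-! ### Cones and symmetric functions -/

section Cones

variable {n : ℕ}

/-- The `k`-th elementary symmetric function. -/
def sigma (k : ℕ) (lam : Fin n → ℝ) : ℝ :=
  MvPolynomial.eval lam (MvPolynomial.esymm (Fin n) ℝ k)

/-- The positive cone `Γₖ⁺`. -/
def posCone (n k : ℕ) : Set (Fin n → ℝ) :=
  {lam | ∀ i, 1 ≤ i → i ≤ k → 0 < sigma i lam}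

/-- A symmetric open convex cone with vertex at the origin between `Γₙ⁺` and `Γ₁⁺`. -/
structure IsAdmissibleCone (Γ : Set (Fin n → ℝ)) : Prop where
  isOpen : IsOpen Γ
  convex : Convex ℝ Γ
  cone : ∀ lam ∈ Γ, ∀ t : ℝ, 0 < t → t • lam ∈ Γ
  symm : ∀ lam ∈ Γ, ∀ τ : Equiv.Perm (Fin n), lam ∘ τ ∈ Γ
  contains : posCone n n ⊆ Γ
  subset : Γ ⊆ posCone n 1

/-- The partial derivative `∂F/∂λᵢ`. -/
def dF (F : (Fin n → ℝ) → ℝ) (i : Fin n) (lam : Fin n → ℝ) : ℝ :=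
  fderiv ℝ F lam (Pi.single i 1)

/-- `F` is a normalized symmetric function, homogeneous of degree one on `Γ`, smooth in `Γ`,
continuous on its closure and zero on its boundary, and satisfies the structure conditions
(S0)-(S3), the last one with the constant `ε`. -/
structure IsStructured (Γ : Set (Fin n → ℝ)) (F : (Fin n → ℝ) → ℝ) (ε : ℝ) : Prop where
  smooth : ContDiffOn ℝ ∞ F Γ
  continuous : ContinuousOn F (closure Γ)
  homogeneous : ∀ lam ∈ Γ, ∀ t : ℝ, 0 < t → F (t • lam) = t * F lam
  symm : ∀ lam ∈ Γ, ∀ τ : Equiv.Perm (Fin n), F (lam ∘ τ) = F lam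
  normalized : F (fun _ => 1) = 1
  boundary : ∀ lam ∈ frontier Γ, F lam = 0
  s0 : ∀ lam ∈ Γ, 0 < F lam
  s1 : ConcaveOn ℝ Γ F
  s2 : ∀ lam ∈ Γ, ∀ i, 0 < dF F i lam
  s3 : ∀ lam ∈ Γ, ∀ i, ε * (F lam / sigma 1 lam) ≤ dF F i lam

/-- Condition (A) with the constant `ρ`. -/
def ConditionA (Γ : Set (Fin n → ℝ)) (F : (Fin n → ℝ) → ℝ) (ρ : ℝ) : Prop :=
  ∀ lam ∈ Γ, ∀ i, lam i ≤ 0 → ∑ j ∈ Finset.univ.erase i, dF F j lam ≤ ρ * dF F i lam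

end Cones

/-! ### The half ball in Fermi coordinates

The dimension is `m + 1`; the normal coordinate is the last one, `Fin.last m`, and the tangential
indices are `α.castSucc` for `α : Fin m`. -/

section HalfBall

variable {m : ℕ}

/-- The closed half ball `{xₙ ≥ 0, ∑ xᵢ² ≤ r²}`. -/
def halfBall (m : ℕ) (r : ℝ) : Set (EuclideanSpace ℝ (Fin (m + 1))) :=
  {x | 0 ≤ x (Fin.last m) ∧ ∑ i, x i ^ 2 ≤ r ^ 2}

/-- The coordinate disc `{∑ x_α² ≤ r²}` that parametrizes the boundary piece `Σᵣ = {xₙ = 0}`. -/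
def bdryDisc (m : ℕ) (r : ℝ) : Set (EuclideanSpace ℝ (Fin m)) :=
  {y | ∑ α, y α ^ 2 ≤ r ^ 2}

/-- The point `(y, 0)` of the boundary piece. -/
def bdryPt (y : EuclideanSpace ℝ (Fin m)) : EuclideanSpace ℝ (Fin (m + 1)) :=
  WithLp.toLp 2 (Fin.snoc (fun α => y α) 0)

/-- The metric induced on the boundary piece. -/
def inducedMetric (g : EuclideanSpace ℝ (Fin (m + 1)) → Matrix (Fin (m + 1)) (Fin (m + 1)) ℝ)
    (y : EuclideanSpace ℝ (Fin m)) : Matrix (Fin m) (Fin m) ℝ :=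
  Matrix.of fun α β => g (bdryPt y) α.castSucc β.castSucc

/-- `g` is a Riemannian metric on the closed half ball, written in Fermi coordinates:
`g = dxⁿ dxⁿ + g_{αβ} dx^α dx^β`. -/
structure IsFermiMetric (r : ℝ)
    (g : EuclideanSpace ℝ (Fin (m + 1)) → Matrix (Fin (m + 1)) (Fin (m + 1)) ℝ) : Prop where
  contDiffOn : ∀ i j, ContDiffOn ℝ 3 (fun x => g x i j) (halfBall m r)
  posDef : ∀ x ∈ halfBall m r, (g x).PosDef
  normal : ∀ x ∈ halfBall m r, g x (Fin.last m) (Fin.last m) = 1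
  mixed : ∀ x ∈ halfBall m r, ∀ α : Fin m, g x α.castSucc (Fin.last m) = 0

/-- The second fundamental form `L_{αβ} = g(∇_{∂_α} ∂_β, n) = Γⁿ_{αβ}` of the boundary piece with
respect to the unit inner normal `n = ∂/∂xₙ` (positive on the boundary of a Euclidean ball). -/
def secondFF (r : ℝ)
    (g : EuclideanSpace ℝ (Fin (m + 1)) → Matrix (Fin (m + 1)) (Fin (m + 1)) ℝ)
    (α β : Fin m) (y : EuclideanSpace ℝ (Fin m)) : ℝ :=
  christoffel (halfBall m r) g (Fin.last m) α.castSucc β.castSucc (bdryPt y)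

/-- The boundary piece is umbilic with principal curvatures `μ`. -/
def IsUmbilic (r : ℝ)
    (g : EuclideanSpace ℝ (Fin (m + 1)) → Matrix (Fin (m + 1)) (Fin (m + 1)) ℝ)
    (μ : EuclideanSpace ℝ (Fin m) → ℝ) : Prop :=
  ∀ y ∈ bdryDisc m r, ∀ α β, secondFF r g α β y = μ y * inducedMetric g y α β

/-- The conditions (T0)-(T2) on the boundary piece. The inequalities between symmetric tensors
are inequalities of quadratic forms; the Hessian of `μ` is that of the induced metric. -/
structure SatisfiesT (r : ℝ)
    (g S : EuclideanSpace ℝ (Fin (m + 1)) → Matrix (Fin (m + 1)) (Fin (m + 1)) ℝ)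
    (μ : EuclideanSpace ℝ (Fin m) → ℝ) : Prop where
  t0 : ∀ y ∈ bdryDisc m r, ∀ α : Fin m,
    S (bdryPt y) α.castSucc (Fin.last m) = pd (bdryDisc m r) α μ y
  t1 : ∀ y ∈ bdryDisc m r, ∀ ξ : Fin m → ℝ,
    ∑ α, ∑ β, (S (bdryPt y) α.castSucc β.castSucc
        + S (bdryPt y) (Fin.last m) (Fin.last m) * inducedMetric g y α β) * ξ α * ξ β
      ≤ ∑ α, ∑ β, riemann (halfBall m r) g α.castSucc (Fin.last m) β.castSucc (Fin.last m)
          (bdryPt y) * ξ α * ξ β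
  t2 : ∀ y ∈ bdryDisc m r, ∀ ξ : Fin m → ℝ,
    ∑ α, ∑ β, (covDeriv (halfBall m r) g S α.castSucc β.castSucc (Fin.last m) (bdryPt y)
        - 2 * μ y * S (bdryPt y) α.castSucc β.castSucc) * ξ α * ξ β
      ≤ ∑ α, ∑ β, (covHess (bdryDisc m r) (inducedMetric g) μ y α β
          - riemann (halfBall m r) g α.castSucc (Fin.last m) β.castSucc (Fin.last m) (bdryPt y)
            * μ y) * ξ α * ξ β

/-- `f + |∇ₓf| + |f_z| + |∇ₓ²f| + |∇ₓf_z| + |f_zz|` at `(x, z)`. -/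
def fSize (r : ℝ)
    (g : EuclideanSpace ℝ (Fin (m + 1)) → Matrix (Fin (m + 1)) (Fin (m + 1)) ℝ)
    (f : EuclideanSpace ℝ (Fin (m + 1)) → ℝ → ℝ) (x : EuclideanSpace ℝ (Fin (m + 1)))
    (z : ℝ) : ℝ :=
  f x z + covectorNorm (g x) (fun i => pd (halfBall m r) i (fun y => f y z) x)
    + |deriv (f x) z|
    + tensorNorm (g x) (covHess (halfBall m r) g (fun y => f y z) x)
    + covectorNorm (g x) (fun i => pd (halfBall m r) i (fun y => deriv (f y) z) x)
    + |deriv (deriv (f x)) z|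

/-- `f` is a positive `C²` function of `(x, z)` with `|∇ₓf| ≤ Λ f` and `|f_z| ≤ Λ f`. -/
structure IsRightHandSide (r Λ : ℝ)
    (g : EuclideanSpace ℝ (Fin (m + 1)) → Matrix (Fin (m + 1)) (Fin (m + 1)) ℝ)
    (f : EuclideanSpace ℝ (Fin (m + 1)) → ℝ → ℝ) : Prop where
  contDiffOn : ContDiffOn ℝ 2 (fun p : EuclideanSpace ℝ (Fin (m + 1)) × ℝ => f p.1 p.2)
    (halfBall m r ×ˢ Set.univ)
  pos : ∀ x ∈ halfBall m r, ∀ z, 0 < f x z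
  grad_le : ∀ x ∈ halfBall m r, ∀ z,
    covectorNorm (g x) (fun i => pd (halfBall m r) i (fun y => f y z) x) ≤ Λ * f x z
  deriv_le : ∀ x ∈ halfBall m r, ∀ z, |deriv (f x) z| ≤ Λ * f x z

/-- `u ∈ C⁴` solves `F(∇²u + du ⊗ du - ½ |∇u|² g + S) = f(x, u)` on the closed half ball and
`∂u/∂n + μ = μ̂ e^{-u}` on its flat boundary piece; `F` is applied to the eigenvalues with respect
to `g`, which have to lie in `Γ`, the domain of `F`. -/
structure IsSolution (r : ℝ)
    (g S : EuclideanSpace ℝ (Fin (m + 1)) → Matrix (Fin (m + 1)) (Fin (m + 1)) ℝ)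
    (μ : EuclideanSpace ℝ (Fin m) → ℝ) (muHat : ℝ)
    (Γ : Set (Fin (m + 1) → ℝ)) (F : (Fin (m + 1) → ℝ) → ℝ)
    (f : EuclideanSpace ℝ (Fin (m + 1)) → ℝ → ℝ)
    (u : EuclideanSpace ℝ (Fin (m + 1)) → ℝ) : Prop where
  contDiffOn : ContDiffOn ℝ 4 u (halfBall m r)
  equation : ∀ x ∈ halfBall m r, ∃ lam ∈ Γ,
    IsEigenvaluesOf (g x) (tensorW (halfBall m r) g S u x) lam ∧ F lam = f x (u x)
  neumann : ∀ y ∈ bdryDisc m r,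
    pd (halfBall m r) (Fin.last m) u (bdryPt y) + μ y = muHat * Real.exp (-u (bdryPt y))

/-- All the data of the problem: `g` is a metric in Fermi coordinates with `‖g‖_{C³} ≤ G` and
`g ≥ θ` (as a quadratic form in the coordinates), the boundary piece is umbilic with principal
curvatures `μ`, `S` is a symmetric tensor with (T0)-(T2) and `‖S‖_{C²} ≤ s`, `F` satisfies (S0)-(S3)
in the cone `Γ`, `f` is an admissible right-hand side, `u` is a solution, and `c_sup(r) ≤ c`. -/
structure IsProblem (r ε Λ G θ s c : ℝ)
    (g S : EuclideanSpace ℝ (Fin (m + 1)) → Matrix (Fin (m + 1)) (Fin (m + 1)) ℝ)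
    (μ : EuclideanSpace ℝ (Fin m) → ℝ) (muHat : ℝ)
    (Γ : Set (Fin (m + 1) → ℝ)) (F : (Fin (m + 1) → ℝ) → ℝ)
    (f : EuclideanSpace ℝ (Fin (m + 1)) → ℝ → ℝ)
    (u : EuclideanSpace ℝ (Fin (m + 1)) → ℝ) : Prop where
  metric : IsFermiMetric r g
  metric_bound : CkBound 3 (halfBall m r) g G
  metric_lower : ∀ x ∈ halfBall m r, ∀ ξ : Fin (m + 1) → ℝ,
    θ * ∑ i, ξ i ^ 2 ≤ ∑ i, ∑ j, g x i j * ξ i * ξ j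
  umbilic : IsUmbilic r g μ
  tensor_contDiffOn : ∀ i j, ContDiffOn ℝ 2 (fun x => S x i j) (halfBall m r)
  tensor_symm : ∀ x ∈ halfBall m r, (S x).IsSymm
  tensor_bound : CkBound 2 (halfBall m r) S s
  tensor_T : SatisfiesT r g S μ
  cone : IsAdmissibleCone Γ
  structured : IsStructured Γ F ε
  rhs : IsRightHandSide r Λ g f
  solution : IsSolution r g S μ muHat Γ F f u
  rhs_bound : ∀ x ∈ halfBall m r, fSize r g f x (u x) ≤ c

/-- `|∇u|² + |∇²u|` at the point `x`. -/
def derivSize (r : ℝ)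
    (g : EuclideanSpace ℝ (Fin (m + 1)) → Matrix (Fin (m + 1)) (Fin (m + 1)) ℝ)
    (u : EuclideanSpace ℝ (Fin (m + 1)) → ℝ) (x : EuclideanSpace ℝ (Fin (m + 1))) : ℝ :=
  covectorNormSq (g x) (fun i => pd (halfBall m r) i u x)
    + tensorNorm (g x) (covHess (halfBall m r) g u x)

end HalfBall

end BoundaryEstimate

end

noncomputable section

namespace BoundaryEstimate

open Matrix Finset

/-! ### Concave symmetric functions on a cone and the Schur–Horn inequality -/

section SymmetricFunctions

variable {n : ℕ} {Γ : Set (Fin n → ℝ)} {F : (Fin n → ℝ) → ℝ} {ε : ℝ}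

/-! Put T = ∇²u + du⊗du + S, so that F is evaluated at W = T − ½|∇u|²g. The maximum principle is
applied to qK, where K = λ_max(T) + tr T and q is a weight vanishing on the spherical part of the
boundary. Since the eigenvalues of W lie in Γ ⊂ Γ₁⁺, tr T > (n/2)|∇u|²; hence K > 0, and K dominates
|∇u|² and all eigenvalues of T up to constants (`eigenvalue_bounds`). A bound for qK therefore
bounds the gradient and the Hessian where q is bounded below. The trace alone would not suffice: for
a cone as large as Γ₁⁺ it does not control the eigenvalues.

Neither λ_max nor F is differentiated twice. By Schur–Horn the diagonal of W in any orthonormal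
frame lies in Γ and has at least the same F-value; by concavity and homogeneity Σ F_a(λ₀) W_aa ≥ f
for every λ₀ in Γ, with equality at x₀ if λ₀ consists of the eigenvalues of W(x₀) and the frame
diagonalizes (`SolvesOn.le_sum`). So along a curve through a maximum point x₀, with orthonormal
frames that diagonalize T at x₀, both Σ F_a W_aa − f and (qK)(x₀) − q(T_oo + tr T) are nonnegative
and vanish at x₀. At an interior point this gives first- and second-order conditions; at a boundary
point, the sign of the inner derivatives.

Interior maximum. Quadratic coordinates built from the Christoffel symbols at x₀ make the metric
Euclidean up to second order, with errors containing no third derivative of u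
(`exists_tensor_jets`). The second-order conditions are summed with weights F_i and w_a, where w is
2 in the top direction and 1 otherwise. Fourth derivatives cancel by symmetry, third derivatives are
removed by the first-order conditions, and the remaining terms of the form du·du·∇²u cancel too
(`hessian_sum_le`). The good term ½(ΣF_i)|∇²u|² survives; it comes from −½|∇u|²g. Since ΣF_i ≥ 1,
the rest is at most C·ΣF_i·(κ² + κ²/q + κ³/√q) with κ² = 1 + K. For n ≥ 3, tr W > 0 bounds |∇u|² by
the Hessian, so K² ≤ C(1 + |∇²u|²), and qK is bounded (`exists_interior_bound`, `sq_trace_le`).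

Boundary maximum. Umbilicity, the Neumann condition and (T0) make T_{αn} vanish, so T is diagonal in
a frame consisting of tangential vectors and ∂_n. Differentiating the Neumann condition along the
boundary expresses ∂_n T_{αβ} through derivatives of u of order at most two
(`IsBoundaryData.pd_tensorT`), which gives O(1 + K) in the frame. The derivative of T_nn contains
u_nnn and is bounded below through the linearized equation. With v = μ̂e^{−u}, the derivative of a
tangential entry of W is (2μ − v)W_αα − vW_nn minus quantities that (T1) and (T2) make nonnegative;
(S3) gives f ≤ C·K·F_n; and if v ≠ 0 and W_nn ≤ 0, condition (A) bounds the sum of the tangential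
F_α by ρF_n (`normal_derivative_lower`). Thus the inner derivative of T_oo + tr T is at least −C(1 +
K), with C independent of q. A weight with ∂_n q = (C + 1)q on the flat piece then forces K ≤ C at a
boundary maximum. -/

lemma sigma_one_eq (lam : Fin n → ℝ) : sigma 1 lam = ∑ i, lam i := by
  simp [sigma]

/-- The elementary symmetric functions of (1,…,1) are binomial coefficients. This vector is the test
direction that gives ΣF_i ≥ 1. -/
lemma one_mem_cone (hΓ : IsAdmissibleCone Γ) : (fun _ => (1 : ℝ)) ∈ Γ := by
  apply hΓ.contains
  intro i _ hin
  have h : sigma i (fun _ : Fin n => (1 : ℝ)) = (n.choose i : ℝ) := by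
    simp [sigma, MvPolynomial.esymm]
  rw [h]
  exact_mod_cast Nat.choose_pos hin

lemma sum_pos_of_mem_cone (hΓ : IsAdmissibleCone Γ) {lam : Fin n → ℝ} (h : lam ∈ Γ) :
    0 < ∑ i, lam i := by
  have := hΓ.subset h 1 le_rfl le_rfl
  rwa [sigma_one_eq] at this

/-- A concave function that is homogeneous of degree one is superadditive. -/
lemma IsStructured.superadditive (hΓ : IsAdmissibleCone Γ) (hF : IsStructured Γ F ε)
    {x y : Fin n → ℝ} (hx : x ∈ Γ) (hy : y ∈ Γ) : F x + F y ≤ F (x + y) := by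
  have h := hF.s1.2 hx hy (show (0 : ℝ) ≤ 1 / 2 by norm_num) (show (0 : ℝ) ≤ 1 / 2 by norm_num)
    (by norm_num)
  have h1 := hΓ.convex hx hy (a := 1 / 2) (b := 1 / 2) (by norm_num) (by norm_num) (by norm_num)
  have h2 := hF.homogeneous _ h1 2 (by norm_num)
  have h3 : (2 : ℝ) • ((1 / 2 : ℝ) • x + (1 / 2 : ℝ) • y) = x + y := by
    ext i; simp; ring
  rw [h3] at h2
  rw [h2]
  simp only [smul_eq_mul] at h
  linarith

lemma IsStructured.hasFDerivAt (hΓ : IsAdmissibleCone Γ) (hF : IsStructured Γ F ε)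
    {x : Fin n → ℝ} (hx : x ∈ Γ) : HasFDerivAt F (fderiv ℝ F x) x :=
  ((hF.smooth.contDiffAt (hΓ.isOpen.mem_nhds hx)).differentiableAt (by simp)).hasFDerivAt

lemma fderiv_apply_eq_sum (x d : Fin n → ℝ) : fderiv ℝ F x d = ∑ i, dF F i x * d i := by
  conv_lhs => rw [← Finset.univ_sum_single d]
  rw [map_sum]
  refine Finset.sum_congr rfl fun i _ => ?_
  have : Pi.single i (d i) = (d i) • (Pi.single i (1 : ℝ) : Fin n → ℝ) := by
    rw [← Pi.single_smul]; simp
  rw [this, map_smul, dF, smul_eq_mul, mul_comm]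

lemma IsStructured.hasDerivAt_line (hΓ : IsAdmissibleCone Γ) (hF : IsStructured Γ F ε)
    {x : Fin n → ℝ} (hx : x ∈ Γ) (d : Fin n → ℝ) :
    HasDerivAt (fun t : ℝ => F (x + t • d)) (∑ i, dF F i x * d i) 0 := by
  have h1 : HasDerivAt (fun t : ℝ => x + t • d) d 0 := by
    simpa using ((hasDerivAt_id (0 : ℝ)).smul_const d).const_add x
  have h2 := (hF.hasFDerivAt hΓ hx)
  have h3 : HasFDerivAt F (fderiv ℝ F x) (x + (0 : ℝ) • d) := by simpa using h2
  have := h3.comp_hasDerivAt (0 : ℝ) h1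
  rwa [fderiv_apply_eq_sum] at this

/-- The tangent hyperplane of a concave function that is homogeneous of degree one. -/
lemma IsStructured.le_sum_dF_mul (hΓ : IsAdmissibleCone Γ) (hF : IsStructured Γ F ε)
    {x d : Fin n → ℝ} (hx : x ∈ Γ) (hd : d ∈ Γ) : F d ≤ ∑ i, dF F i x * d i := by
  have h := hF.hasDerivAt_line hΓ hx d
  have h' : HasDerivWithinAt (fun t : ℝ => F (x + t • d)) (∑ i, dF F i x * d i) (Set.Ioi 0) 0 :=
    h.hasDerivWithinAt
  rw [hasDerivWithinAt_iff_tendsto_slope' (by simp)] at h'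
  refine ge_of_tendsto h' ?_
  filter_upwards [self_mem_nhdsWithin] with t ht
  have ht : (0 : ℝ) < t := ht
  rw [slope_def_field, le_div_iff₀ (by simpa using ht)]
  -- Superadditivity and homogeneity give F(x + td) ≥ F(x) + tF(d), so every difference quotient
  -- with t > 0 is at least F(d).
  have h1 := hF.superadditive hΓ hx (hΓ.cone d hd t ht)
  rw [hF.homogeneous d hd t ht] at h1
  simp
  linarith

/-- Euler's relation. -/
lemma IsStructured.euler (hΓ : IsAdmissibleCone Γ) (hF : IsStructured Γ F ε)
    {x : Fin n → ℝ} (hx : x ∈ Γ) : ∑ i, dF F i x * x i = F x := by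
  have h := hF.hasDerivAt_line hΓ hx x
  have h2 : HasDerivAt (fun t : ℝ => (1 + t) * F x) (F x) 0 := by
    simpa using ((hasDerivAt_id (0 : ℝ)).const_add 1).mul_const (F x)
  have h3 : (fun t : ℝ => F (x + t • x)) =ᶠ[nhds 0] fun t : ℝ => (1 + t) * F x := by
    filter_upwards [lt_mem_nhds (show (-1 : ℝ) < 0 by norm_num)] with t ht
    rw [← hF.homogeneous x hx (1 + t) (by linarith), add_smul, one_smul]
  exact h.unique (h2.congr_of_eventuallyEq h3)

/-- Tangent hyperplane inequality in the direction (1,…,1), where F = 1. It allows error terms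
without a factor ΣF_i to be absorbed into terms that carry it. -/
lemma IsStructured.one_le_sum_dF (hΓ : IsAdmissibleCone Γ) (hF : IsStructured Γ F ε)
    {x : Fin n → ℝ} (hx : x ∈ Γ) : 1 ≤ ∑ i, dF F i x := by
  have := hF.le_sum_dF_mul hΓ hx (one_mem_cone hΓ)
  rw [hF.normalized] at this
  simpa using this

/-- Both lists have the same multiset of roots, so their fibres over each value have equal size, and
bijections between fibres glue to a permutation. With the symmetry of Γ and F this makes the choice
of an eigenvalue list immaterial. -/
lemma exists_perm_of_prod_eq {a b : Fin n → ℝ}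
    (h : ∏ i, (Polynomial.X - Polynomial.C (a i)) = ∏ i, (Polynomial.X - Polynomial.C (b i))) :
    ∃ τ : Equiv.Perm (Fin n), a = b ∘ τ := by
  have h1 := congrArg Polynomial.roots h
  have key : ∀ c : Fin n → ℝ, (∏ i, (Polynomial.X - Polynomial.C (c i))).roots
      = Finset.univ.val.map c := fun c => by
    have : (∏ i, (Polynomial.X - Polynomial.C (c i)))
      = ((Finset.univ.val.map c).map fun r => Polynomial.X - Polynomial.C r).prod := by
        rw [Multiset.map_map]; rfl
    rw [this, Polynomial.roots_multiset_prod_X_sub_C]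
  rw [key, key] at h1
  have h2 : ∀ y, Fintype.card {i // a i = y} = Fintype.card {i // b i = y} := by
    intro y
    have := congrArg (Multiset.count y) h1
    rw [Multiset.count_map, Multiset.count_map] at this
    rw [Fintype.card_subtype, Fintype.card_subtype]
    simp only [Finset.card, Finset.filter]
    simpa [eq_comm] using this
  classical
  let τ : Fin n ≃ Fin n :=
    (Equiv.sigmaFiberEquiv a).symm.trans
      ((Equiv.sigmaCongrRight fun y => Classical.choice (Fintype.card_eq.mp (h2 y))).trans
        (Equiv.sigmaFiberEquiv b))
  refine ⟨τ, ?_⟩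
  ext i
  have : b (τ i) = a i :=
    ((Classical.choice (Fintype.card_eq.mp (h2 (a i)))) ⟨i, rfl⟩).2
  exact this.symm

/-- The Schur-Horn inequality: passing from the eigenvalues of a symmetric matrix to its diagonal
does not decrease a symmetric concave function. -/
lemma diag_mem_and_le (hΓ : IsAdmissibleCone Γ) (hF : IsStructured Γ F ε)
    {M : Matrix (Fin n) (Fin n) ℝ} (hM : M.IsSymm) {lam : Fin n → ℝ} (hl : lam ∈ Γ)
    (hch : M.charpoly = ∏ i, (Polynomial.X - Polynomial.C (lam i))) :
    M.diag ∈ Γ ∧ F lam ≤ F M.diag := by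
  have hH : M.IsHermitian := by
    rw [Matrix.IsHermitian, conjTranspose_eq_transpose_of_trivial]; exact hM
  have h1 := hH.charpoly_eq
  rw [hch] at h1
  obtain ⟨τ, hτ⟩ := exists_perm_of_prod_eq h1.symm
  set d := hH.eigenvalues with hd
  set U : Matrix (Fin n) (Fin n) ℝ := (hH.eigenvectorUnitary : Matrix (Fin n) (Fin n) ℝ) with hU
  have hdl : (fun i => d i) = lam ∘ τ := hτ
  have hdΓ : d ∈ Γ := by
    have : d = lam ∘ τ := hτ
    rw [this]; exact hΓ.symm lam hl τ
  have hdF : F d = F lam := by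
    have : d = lam ∘ τ := hτ
    rw [this]; exact hF.symm lam hl τ
  have hspec : M = U * diagonal d * Uᵀ := by
    have := hH.spectral_theorem
    rw [Unitary.conjStarAlgAut_apply] at this
    exact this
  have hUU : U * Uᵀ = 1 := (Matrix.mem_unitaryGroup_iff).1 hH.eigenvectorUnitary.2
  have hUU' : Uᵀ * U = 1 := (Matrix.mem_unitaryGroup_iff').1 hH.eigenvectorUnitary.2
  -- The squared entries of an orthogonal matrix are doubly stochastic, and the diagonal of M is
  -- this matrix applied to the eigenvalues.
  let B : Matrix (Fin n) (Fin n) ℝ := Matrix.of fun a b => U a b ^ 2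
  have hB : B ∈ doublyStochastic ℝ (Fin n) := by
    rw [mem_doublyStochastic_iff_sum]
    refine ⟨fun i j => sq_nonneg _, fun i => ?_, fun j => ?_⟩
    · have := congrFun (congrFun hUU i) i
      simpa [B, Matrix.mul_apply, sq] using this
    · have := congrFun (congrFun hUU' j) j
      simpa [B, Matrix.mul_apply, sq] using this
  have hdiag : M.diag = B *ᵥ d := by
    ext a
    rw [Matrix.diag_apply]
    conv_lhs => rw [hspec]
    rw [Matrix.mul_apply]
    simp only [Matrix.mulVec, dotProduct, B, Matrix.of_apply, Matrix.mul_diagonal, transpose_apply]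
    exact Finset.sum_congr rfl fun b _ => by ring
  -- A convex set, since Γ is convex and F is concave. By Birkhoff's theorem it contains B once it
  -- contains the permutation matrices, where the claim is the symmetry of Γ and F.
  let s : Set (Matrix (Fin n) (Fin n) ℝ) := {C | C *ᵥ d ∈ Γ ∧ F lam ≤ F (C *ᵥ d)}
  have hs : Convex ℝ s := by
    intro C hC C' hC' a b ha hb hab
    have e : (a • C + b • C') *ᵥ d = a • (C *ᵥ d) + b • (C' *ᵥ d) := by
      rw [add_mulVec, smul_mulVec, smul_mulVec]
    refine ⟨?_, ?_⟩
    · rw [e]; exact hΓ.convex hC.1 hC'.1 ha hb hab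
    · rw [e]
      refine le_trans ?_ (hF.s1.2 hC.1 hC'.1 ha hb hab)
      have e2 : F lam = a * F lam + b * F lam := by rw [← add_mul, hab, one_mul]
      rw [e2]
      simp only [smul_eq_mul]
      exact add_le_add (mul_le_mul_of_nonneg_left hC.2 ha) (mul_le_mul_of_nonneg_left hC'.2 hb)
  have hperm : {σ : Matrix (Fin n) (Fin n) ℝ | ∃ π : Equiv.Perm (Fin n), π.permMatrix ℝ = σ} ⊆ s := by
    rintro _ ⟨π, rfl⟩
    have e : (π.permMatrix ℝ) *ᵥ d = d ∘ π := by
      rw [Matrix.permMatrix_mulVec]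
    refine ⟨?_, ?_⟩
    · rw [e]; exact hΓ.symm d hdΓ π
    · rw [e, hF.symm d hdΓ π, hdF]
  have : B ∈ s := by
    have h := convexHull_min hperm hs
    apply h
    rw [← doublyStochastic_eq_convexHull_permMatrix]
    exact hB
  rw [hdiag]
  exact this

end SymmetricFunctions

end BoundaryEstimate

end

noncomputable section

namespace BoundaryEstimate

open Matrix Finset

/-! ### Orthonormal frames and the inverse square root of a matrix near the identity -/

section Frames

variable {ι : Type*} [Fintype ι] [DecidableEq ι]

lemma exists_spectral {M : Matrix ι ι ℝ} (hM : M.IsSymm) :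
    ∃ (U : Matrix ι ι ℝ) (d : ι → ℝ), U * Uᵀ = 1 ∧ Uᵀ * U = 1 ∧ M = U * diagonal d * Uᵀ := by
  have hH : M.IsHermitian := by
    rw [Matrix.IsHermitian, conjTranspose_eq_transpose_of_trivial]; exact hM
  refine ⟨hH.eigenvectorUnitary, hH.eigenvalues,
    (Matrix.mem_unitaryGroup_iff).1 hH.eigenvectorUnitary.2,
    (Matrix.mem_unitaryGroup_iff').1 hH.eigenvectorUnitary.2, ?_⟩
  have := hH.spectral_theorem
  rw [Unitary.conjStarAlgAut_apply] at this
  exact this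

lemma abs_entry_le_one {U : Matrix ι ι ℝ} (hU : U * Uᵀ = 1) (i a : ι) : |U i a| ≤ 1 := by
  have h := congrFun (congrFun hU i) i
  rw [Matrix.mul_apply, one_apply_eq] at h
  have h2 : U i a * Uᵀ a i ≤ ∑ j, U i j * Uᵀ j i :=
    Finset.single_le_sum (f := fun j => U i j * Uᵀ j i)
      (fun j _ => by rw [transpose_apply]; exact mul_self_nonneg _) (Finset.mem_univ a)
  rw [h, transpose_apply] at h2
  exact abs_le_one_iff_mul_self_le_one.2 h2

lemma conj_diagonal_apply (U : Matrix ι ι ℝ) (d : ι → ℝ) (i j : ι) :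
    (U * diagonal d * Uᵀ) i j = ∑ a, d a * (U i a * U j a) := by
  rw [Matrix.mul_apply]
  exact Finset.sum_congr rfl fun a _ => by rw [Matrix.mul_diagonal, transpose_apply]; ring

/-- With w = √(1 + d), the remainder is (w − 1)²(w + 2)/(2w) and d² is (w − 1)²(w + 1)², so the
bound w ≥ 7/10 is enough. -/
lemma abs_invSqrt_sub_le {d : ℝ} (hd : |d| ≤ 1 / 2) : |(√(1 + d))⁻¹ - 1 + d / 2| ≤ d ^ 2 := by
  obtain ⟨h1, h2⟩ := abs_le.1 hd
  set w := √(1 + d) with hw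
  have hw2 : w ^ 2 = 1 + d := Real.sq_sqrt (by linarith)
  have hw0 : 0 ≤ w := Real.sqrt_nonneg _
  have hw7 : 7 / 10 ≤ w := by
    by_contra h
    push Not at h
    nlinarith
  have e : w⁻¹ - 1 + d / 2 = (w - 1) ^ 2 * ((w + 2) / (2 * w)) := by
    have : d = w ^ 2 - 1 := by linarith
    rw [this]; field_simp; ring
  have e2 : d ^ 2 = (w - 1) ^ 2 * (w + 1) ^ 2 := by
    have : d = w ^ 2 - 1 := by linarith
    rw [this]; ring
  rw [e, e2, abs_of_nonneg (by positivity)]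
  refine mul_le_mul_of_nonneg_left ?_ (sq_nonneg _)
  rw [div_le_iff₀ (by linarith)]
  nlinarith [mul_nonneg hw0 hw0]

/-- The inverse square root of `1 + R`, expanded to first order. -/
lemma exists_invSqrt (ι : Type*) [Fintype ι] [DecidableEq ι] :
    ∃ δ > (0 : ℝ), ∃ C : ℝ, 0 ≤ C ∧ ∀ (R : Matrix ι ι ℝ) (s : ℝ), R.IsSymm → 0 ≤ s → s ≤ δ →
      (∀ i j, |R i j| ≤ s) → ∃ N : Matrix ι ι ℝ, N.IsSymm ∧ N * (1 + R) * N = 1 ∧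
        ∀ i j, |N i j - ((1 : Matrix ι ι ℝ) i j - R i j / 2)| ≤ C * s ^ 2 := by
  set k : ℝ := (Fintype.card ι : ℝ) with hk
  have hk0 : 0 ≤ k := Nat.cast_nonneg _
  -- The entries of an orthogonal matrix are at most 1, so the eigenvalues of R are at most k²s.
  -- This choice of δ keeps them in [−½, ½], where the scalar expansion holds; each of the k
  -- spectral terms then contributes an error of at most (k²s)².
  refine ⟨1 / (2 * (k ^ 2 + 1)), by positivity, k * (k ^ 2) ^ 2, by positivity, ?_⟩
  intro R s hR hs hsδ hRs
  obtain ⟨U, d, hU, hU', hRU⟩ := exists_spectral hR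
  have hd : ∀ a, |d a| ≤ k ^ 2 * s := by
    intro a
    have e : Uᵀ * R * U = diagonal d := by
      rw [hRU]
      calc Uᵀ * (U * diagonal d * Uᵀ) * U = (Uᵀ * U) * diagonal d * (Uᵀ * U) := by
            simp only [Matrix.mul_assoc]
        _ = diagonal d := by rw [hU']; simp
    have e2 := congrFun (congrFun e a) a
    rw [diagonal_apply_eq, Matrix.mul_apply] at e2
    rw [← e2]
    have hb : ∀ j, |(Uᵀ * R) a j * U j a| ≤ k * s := by
      intro j
      rw [abs_mul, Matrix.mul_apply]
      have h1 : |∑ i, Uᵀ a i * R i j| ≤ k * s := by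
        refine (Finset.abs_sum_le_sum_abs _ _).trans ?_
        refine (Finset.sum_le_card_nsmul _ _ s fun i _ => ?_).trans ?_
        · rw [abs_mul, transpose_apply]
          calc |U i a| * |R i j| ≤ 1 * s :=
                mul_le_mul (abs_entry_le_one hU i a) (hRs i j) (abs_nonneg _) zero_le_one
            _ = s := one_mul s
        · simp [hk]
      calc |∑ i, Uᵀ a i * R i j| * |U j a| ≤ (k * s) * 1 :=
            mul_le_mul h1 (abs_entry_le_one hU j a) (abs_nonneg _) (by positivity)
        _ = k * s := mul_one _
    refine (Finset.abs_sum_le_sum_abs _ _).trans ?_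
    refine (Finset.sum_le_card_nsmul _ _ (k * s) fun j _ => hb j).trans ?_
    simp only [Finset.card_univ, nsmul_eq_mul, ← hk]
    exact le_of_eq (by ring)
  have hd2 : ∀ a, |d a| ≤ 1 / 2 := by
    intro a
    refine (hd a).trans ?_
    calc k ^ 2 * s ≤ (k ^ 2 + 1) * (1 / (2 * (k ^ 2 + 1))) :=
          mul_le_mul (by linarith) hsδ hs (by positivity)
      _ = 1 / 2 := by field_simp
  set z : ι → ℝ := fun a => (√(1 + d a))⁻¹ with hz
  have hz2 : ∀ a, z a * (1 + d a) * z a = 1 := by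
    intro a
    have h1 : 0 < 1 + d a := by linarith [(abs_le.1 (hd2 a)).1]
    have h2 : √(1 + d a) ^ 2 = 1 + d a := Real.sq_sqrt h1.le
    have h3 : √(1 + d a) ≠ 0 := (Real.sqrt_pos.2 h1).ne'
    simp only [hz]
    rw [← h2, Real.sqrt_sq (Real.sqrt_nonneg _)]
    field_simp
  refine ⟨U * diagonal z * Uᵀ, ?_, ?_, ?_⟩
  · rw [Matrix.IsSymm]; simp [Matrix.transpose_mul, Matrix.mul_assoc]
  · have e1 : 1 + R = U * diagonal (fun a => 1 + d a) * Uᵀ := by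
      have : diagonal (fun a => 1 + d a) = (1 : Matrix ι ι ℝ) + diagonal d := by
        rw [← Matrix.diagonal_one, Matrix.diagonal_add]
      rw [this, Matrix.mul_add, Matrix.add_mul, ← hRU, Matrix.mul_one, hU]
    rw [e1]
    calc U * diagonal z * Uᵀ * (U * diagonal (fun a => 1 + d a) * Uᵀ) * (U * diagonal z * Uᵀ)
        = U * diagonal z * (Uᵀ * U) * diagonal (fun a => 1 + d a) * (Uᵀ * U) * diagonal z * Uᵀ := by
          simp only [Matrix.mul_assoc]
      _ = U * (diagonal z * diagonal (fun a => 1 + d a) * diagonal z) * Uᵀ := by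
          rw [hU']; simp only [Matrix.mul_assoc, Matrix.one_mul]
      _ = 1 := by
          rw [Matrix.diagonal_mul_diagonal, Matrix.diagonal_mul_diagonal]
          simp only [hz2, Matrix.diagonal_one, Matrix.mul_one, hU]
  · intro i j
    have e1 : (1 : Matrix ι ι ℝ) i j = ∑ a, U i a * U j a := by
      rw [← hU, Matrix.mul_apply]; rfl
    rw [conj_diagonal_apply, e1, hRU, conj_diagonal_apply, Finset.sum_div, ← Finset.sum_sub_distrib,
      ← Finset.sum_sub_distrib]
    refine (Finset.abs_sum_le_sum_abs _ _).trans ?_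
    refine (Finset.sum_le_card_nsmul _ _ ((k ^ 2 * s) ^ 2) fun a _ => ?_).trans ?_
    · have e2 : z a * (U i a * U j a) - (U i a * U j a - d a * (U i a * U j a) / 2)
          = (z a - 1 + d a / 2) * (U i a * U j a) := by ring
      rw [e2, abs_mul, abs_mul]
      have h1 : |z a - 1 + d a / 2| ≤ (k ^ 2 * s) ^ 2 :=
        (abs_invSqrt_sub_le (hd2 a)).trans (by
          rw [← sq_abs (d a)]
          exact pow_le_pow_left₀ (abs_nonneg _) (hd a) 2)
      have h2 : |U i a| * |U j a| ≤ 1 := mul_le_one₀ (abs_entry_le_one hU i a) (abs_nonneg _)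
        (abs_entry_le_one hU j a)
      calc _ ≤ (k ^ 2 * s) ^ 2 * 1 := mul_le_mul h1 h2 (by positivity) (by positivity)
        _ = _ := mul_one _
    · simp only [Finset.card_univ, nsmul_eq_mul, ← hk]
      exact le_of_eq (by ring)

lemma conj_isSymm (E : Matrix ι ι ℝ) {T : Matrix ι ι ℝ} (hT : T.IsSymm) :
    (Eᵀ * T * E).IsSymm := by
  rw [Matrix.IsSymm, transpose_mul, transpose_mul, transpose_transpose, hT.eq, Matrix.mul_assoc]

/-- The columns of `E` form an orthonormal frame for the metric with matrix `h`. -/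
def IsFrame (h E : Matrix ι ι ℝ) : Prop := Eᵀ * h * E = 1

/-- A symmetric tensor is diagonal in some orthonormal frame. -/
lemma exists_frame_diagonal {h T : Matrix ι ι ℝ} (hh : h.PosDef) (hT : T.IsSymm) :
    ∃ (E : Matrix ι ι ℝ) (d : ι → ℝ), IsFrame h E ∧ Eᵀ * T * E = diagonal d := by
  have hs : h.IsSymm := by
    have := hh.isHermitian
    rwa [Matrix.IsHermitian, conjTranspose_eq_transpose_of_trivial] at this
  obtain ⟨U, e, hU, hU', hUe⟩ := exists_spectral hs
  have he : ∀ a, 0 < e a := by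
    intro a
    have e1 : Uᵀ * h * U = diagonal e := by
      rw [hUe]
      calc Uᵀ * (U * diagonal e * Uᵀ) * U = (Uᵀ * U) * diagonal e * (Uᵀ * U) := by
            simp only [Matrix.mul_assoc]
        _ = diagonal e := by rw [hU']; simp
    have hne : U *ᵥ Pi.single a 1 ≠ 0 := by
      intro h0
      have : Uᵀ *ᵥ (U *ᵥ Pi.single a (1 : ℝ)) = 0 := by rw [h0, mulVec_zero]
      rw [mulVec_mulVec, hU', one_mulVec] at this
      have := congrFun this a
      simp at this
    have := hh.dotProduct_mulVec_pos hne
    rw [star_trivial, mulVec_mulVec, dotProduct_comm, Matrix.dotProduct_mulVec,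
      ← Matrix.mulVec_transpose, mulVec_mulVec, ← Matrix.mul_assoc, e1] at this
    simpa using this
  -- Orthonormalize h first; rotating the resulting frame by the eigenvectors of T in it keeps it
  -- orthonormal and makes T diagonal.
  set E1 : Matrix ι ι ℝ := U * diagonal (fun a => (√(e a))⁻¹) with hE1
  have hE1f : E1ᵀ * h * E1 = 1 := by
    have hUhU : Uᵀ * h * U = diagonal e := by
      rw [hUe]
      calc Uᵀ * (U * diagonal e * Uᵀ) * U = (Uᵀ * U) * diagonal e * (Uᵀ * U) := by
            simp only [Matrix.mul_assoc]
        _ = diagonal e := by rw [hU']; simp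
    calc E1ᵀ * h * E1 = diagonal (fun a => (√(e a))⁻¹) * (Uᵀ * h * U)
          * diagonal (fun a => (√(e a))⁻¹) := by
          rw [hE1, Matrix.transpose_mul, diagonal_transpose]; simp only [Matrix.mul_assoc]
      _ = 1 := by
          rw [hUhU, diagonal_mul_diagonal, diagonal_mul_diagonal, ← diagonal_one]
          congr 1
          ext a
          have h2 : √(e a) ^ 2 = e a := Real.sq_sqrt (he a).le
          have h3 : √(e a) ≠ 0 := (Real.sqrt_pos.2 (he a)).ne'
          field_simp
          exact h2.symm
  have hs2 : (E1ᵀ * T * E1).IsSymm := conj_isSymm E1 hT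
  obtain ⟨V, d, hV, hV', hVd⟩ := exists_spectral hs2
  refine ⟨E1 * V, d, ?_, ?_⟩
  · calc (E1 * V)ᵀ * h * (E1 * V) = Vᵀ * (E1ᵀ * h * E1) * V := by
          rw [transpose_mul]; simp only [Matrix.mul_assoc]
      _ = 1 := by rw [hE1f, Matrix.mul_one, hV']
  · calc (E1 * V)ᵀ * T * (E1 * V) = Vᵀ * (E1ᵀ * T * E1) * V := by
          rw [transpose_mul]; simp only [Matrix.mul_assoc]
      _ = (Vᵀ * V) * diagonal d * (Vᵀ * V) := by rw [hVd]; simp only [Matrix.mul_assoc]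
      _ = diagonal d := by rw [hV']; simp

variable {h E T : Matrix ι ι ℝ}

lemma IsFrame.inv_eq (hE : IsFrame h E) : h⁻¹ = E * Eᵀ := by
  have h1 : Eᵀ * (h * E) = 1 := by rw [← Matrix.mul_assoc]; exact hE
  have h2 : h * E * Eᵀ = 1 := mul_eq_one_comm.1 h1
  exact Matrix.inv_eq_right_inv (by rw [← Matrix.mul_assoc]; exact h2)

lemma IsFrame.mul_transpose (hE : IsFrame h E) : E * (Eᵀ * h) = 1 :=
  mul_eq_one_comm.1 hE

lemma IsFrame.covectorNormSq_eq (hE : IsFrame h E) (w : ι → ℝ) :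
    covectorNormSq h w = ∑ c, (∑ i, E i c * w i) ^ 2 := by
  rw [covectorNormSq, hE.inv_eq]
  simp only [Matrix.mul_apply, transpose_apply, Finset.sum_mul, sq, Finset.mul_sum]
  rw [Finset.sum_comm' (t' := Finset.univ) (s' := fun _ => Finset.univ) (by simp)]
  have : ∀ j, ∑ i, ∑ c, E i c * E j c * w i * w j = ∑ c, ∑ i, E i c * E j c * w i * w j :=
    fun j => Finset.sum_comm
  simp only [this]
  rw [Finset.sum_comm]
  refine Finset.sum_congr rfl fun c _ => Finset.sum_congr rfl fun j _ =>
    Finset.sum_congr rfl fun i _ => by ring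

lemma conj_apply (E T : Matrix ι ι ℝ) (a b : ι) :
    (Eᵀ * T * E) a b = ∑ i, ∑ j, T i j * E i a * E j b := by
  simp only [Matrix.mul_apply, transpose_apply, Finset.sum_mul]
  rw [Finset.sum_comm]
  exact Finset.sum_congr rfl fun i _ => Finset.sum_congr rfl fun j _ => by ring

/-- Both quadruple sums are the trace of h⁻¹Th⁻¹Tᵀ, written with h⁻¹ = EEᵀ. -/
lemma IsFrame.tensorNorm_eq (hE : IsFrame h E) (T : Matrix ι ι ℝ) :
    tensorNorm h T = √(∑ a, ∑ b, ((Eᵀ * T * E) a b) ^ 2) := by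
  rw [tensorNorm]
  congr 1
  have e1 : ∀ A : Matrix ι ι ℝ, ∑ a, ∑ b, (A a b) ^ 2 = (A * Aᵀ).trace := fun A => by
    simp [Matrix.trace, Matrix.mul_apply, sq]
  rw [e1]
  have e2 : ((Eᵀ * T * E) * (Eᵀ * T * E)ᵀ).trace = (h⁻¹ * T * h⁻¹ * Tᵀ).trace := by
    rw [hE.inv_eq, transpose_mul, transpose_mul, transpose_transpose]
    rw [show (Eᵀ * T * E) * (Eᵀ * (Tᵀ * E)) = Eᵀ * (T * E * Eᵀ * Tᵀ * E) by
      simp only [Matrix.mul_assoc], Matrix.trace_mul_comm,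
      show T * E * Eᵀ * Tᵀ * E * Eᵀ = (T * (E * Eᵀ) * Tᵀ) * (E * Eᵀ) by
        simp only [Matrix.mul_assoc], Matrix.trace_mul_comm]
    simp only [Matrix.mul_assoc]
  rw [e2]
  have hs : ∀ i j, h⁻¹ i j = h⁻¹ j i := by
    intro i j
    rw [hE.inv_eq, Matrix.mul_apply, Matrix.mul_apply]
    exact Finset.sum_congr rfl fun a _ => by simp only [transpose_apply]; ring
  simp only [Matrix.trace, Matrix.diag_apply, Matrix.mul_apply, transpose_apply, Finset.sum_mul]
  have e3 : ∀ i, ∑ x, ∑ x_1, ∑ i_1, h⁻¹ i i_1 * T i_1 x_1 * h⁻¹ x_1 x * T i x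
      = ∑ x, ∑ i_1, ∑ x_1, h⁻¹ i i_1 * T i_1 x_1 * h⁻¹ x_1 x * T i x := fun i =>
    Finset.sum_congr rfl fun x _ => Finset.sum_comm
  simp only [e3]
  refine Finset.sum_congr rfl fun i _ => Finset.sum_congr rfl fun j _ =>
    Finset.sum_congr rfl fun k _ => Finset.sum_congr rfl fun l _ => ?_
  rw [hs j l]; ring

lemma IsFrame.charpoly_eq (hE : IsFrame h E) (T : Matrix ι ι ℝ) :
    (h⁻¹ * T).charpoly = (Eᵀ * T * E).charpoly := by
  rw [hE.inv_eq, Matrix.mul_assoc, Matrix.charpoly_mul_comm]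

/-- A frame vector has length one for h, hence Euclidean length at most θ^{−1/2}. This is how the
ellipticity constant enters the estimates. -/
lemma IsFrame.abs_le (hE : IsFrame h E) {θ : ℝ} (hθ : 0 < θ)
    (hlow : ∀ ξ : ι → ℝ, θ * ∑ i, ξ i ^ 2 ≤ ∑ i, ∑ j, h i j * ξ i * ξ j) (i a : ι) :
    |E i a| ≤ (√θ)⁻¹ := by
  have h1 := hlow (fun i => E i a)
  have h2 := congrFun (congrFun hE a) a
  rw [conj_apply, one_apply_eq] at h2
  rw [h2] at h1
  have h3 : E i a ^ 2 ≤ ∑ i, E i a ^ 2 :=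
    Finset.single_le_sum (f := fun i => E i a ^ 2) (fun i _ => sq_nonneg _) (Finset.mem_univ i)
  have h4 : E i a ^ 2 ≤ θ⁻¹ := by
    rw [← one_div, le_div_iff₀ hθ]
    nlinarith
  rw [← Real.sqrt_inv]
  exact Real.abs_le_sqrt h4

end Frames

end BoundaryEstimate

end

noncomputable section

namespace BoundaryEstimate

open Finset Filter Topology Asymptotics

/-! ### Second-order expansions of functions of one variable -/

section Jets

/-- `φ t = a + b t + c t² + o(t²)` as `t → 0`. -/
def Jet (φ : ℝ → ℝ) (a b c : ℝ) : Prop :=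
  (fun t => φ t - (a + b * t + c * t ^ 2)) =o[𝓝 0] fun t => t ^ 2

variable {φ ψ : ℝ → ℝ} {a b c a' b' c' : ℝ}

lemma Jet.congr' (h : Jet φ a b c) (e : φ =ᶠ[𝓝 0] ψ) : Jet ψ a b c :=
  IsLittleO.congr' h (e.mono fun t ht => by simp only [ht]) EventuallyEq.rfl

lemma Jet.congr_coeff (h : Jet φ a b c) (ha : a = a') (hb : b = b') (hc : c = c') :
    Jet φ a' b' c' := by
  subst ha hb hc; exact h

lemma Jet.add_littleO (h : Jet φ a b c) (e : (fun t => ψ t - φ t) =o[𝓝 0] fun t => t ^ 2) :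
    Jet ψ a b c :=
  (IsLittleO.add e h).congr_left fun t => by ring

lemma jet_const (a : ℝ) : Jet (fun _ => a) a 0 0 := by
  simp only [Jet, zero_mul, add_zero, sub_self]
  exact isLittleO_zero _ _

lemma jet_affine (a b : ℝ) : Jet (fun t => a + b * t) a b 0 := by
  simp only [Jet, zero_mul, add_zero, sub_self]
  exact isLittleO_zero _ _

lemma Jet.add (h : Jet φ a b c) (h' : Jet ψ a' b' c') :
    Jet (fun t => φ t + ψ t) (a + a') (b + b') (c + c') :=
  (IsLittleO.add h h').congr_left fun t => by ring

lemma Jet.const_mul (k : ℝ) (h : Jet φ a b c) : Jet (fun t => k * φ t) (k * a) (k * b) (k * c) :=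
  (IsLittleO.const_mul_left h k).congr_left fun t => by ring

lemma Jet.sub (h : Jet φ a b c) (h' : Jet ψ a' b' c') :
    Jet (fun t => φ t - ψ t) (a - a') (b - b') (c - c') :=
  (IsLittleO.sub h h').congr_left fun t => by ring

lemma Jet.sum {ι : Type*} (s : Finset ι) {φ : ι → ℝ → ℝ} {a b c : ι → ℝ}
    (h : ∀ i ∈ s, Jet (φ i) (a i) (b i) (c i)) :
    Jet (fun t => ∑ i ∈ s, φ i t) (∑ i ∈ s, a i) (∑ i ∈ s, b i) (∑ i ∈ s, c i) := by
  classical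
  induction s using Finset.induction_on with
  | empty => simpa using jet_const 0
  | insert i s his ih =>
    simp only [Finset.sum_insert his]
    exact (h i (Finset.mem_insert_self i s)).add
      (ih fun j hj => h j (Finset.mem_insert_of_mem hj))

lemma tendsto_poly (a b c : ℝ) : Tendsto (fun t : ℝ => a + b * t + c * t ^ 2) (𝓝 0) (𝓝 a) := by
  have h : Continuous fun t : ℝ => a + b * t + c * t ^ 2 := by fun_prop
  simpa using h.tendsto 0

lemma Jet.tendsto (h : Jet φ a b c) : Tendsto φ (𝓝 0) (𝓝 a) := by
  have h1 : Tendsto (fun t : ℝ => t ^ 2) (𝓝 0) (𝓝 0) := by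
    have h : Continuous fun t : ℝ => t ^ 2 := by fun_prop
    simpa using h.tendsto 0
  have h2 := (IsLittleO.trans_tendsto h h1).add (tendsto_poly a b c)
  simpa using h2

lemma Jet.mul (h : Jet φ a b c) (h' : Jet ψ a' b' c') :
    Jet (fun t => φ t * ψ t) (a * a') (a * b' + b * a') (a * c' + b * b' + c * a') := by
  have h1 : (fun t => (φ t - (a + b * t + c * t ^ 2)) * ψ t) =o[𝓝 0] fun t => t ^ 2 * 1 :=
    IsLittleO.mul_isBigO h (h'.tendsto.isBigO_one ℝ)
  have h2 : (fun t => (a + b * t + c * t ^ 2) * (ψ t - (a' + b' * t + c' * t ^ 2)))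
      =o[𝓝 0] fun t => 1 * t ^ 2 :=
    IsBigO.mul_isLittleO ((tendsto_poly a b c).isBigO_one ℝ) h'
  -- The cubic and quartic terms in the product of the two polynomials.
  have h3 : (fun t => (b * c' + c * b' + c * c' * t) * t * t ^ 2) =o[𝓝 0] fun t : ℝ => 1 * t ^ 2 := by
    refine IsLittleO.mul_isBigO ?_ (isBigO_refl _ _)
    rw [isLittleO_one_iff]
    have h : Continuous fun t : ℝ => (b * c' + c * b' + c * c' * t) * t := by fun_prop
    simpa using h.tendsto 0
  simp only [one_mul, mul_one] at h1 h2 h3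
  exact ((h1.add h2).add h3).congr_left fun t => by ring

/-- If b ≠ 0, the value at a small point of sign opposite to b is negative; once b = 0, a negative c
makes small values negative. It replaces the second derivative test because the corrected frames
used later are chosen separately for each t and are known only through their expansions. -/
lemma Jet.coeff_of_nonneg (h : Jet φ 0 b c) (hp : ∀ᶠ t in 𝓝 0, 0 ≤ φ t) : b = 0 ∧ 0 ≤ c := by
  have hb : b = 0 := by
    have h1 : (fun t => φ t - (0 + b * t + c * t ^ 2)) =o[𝓝 0] fun t : ℝ => t := by
      refine IsLittleO.trans_isBigO h ?_
      have : (fun t : ℝ => t * t) =O[𝓝 0] fun t : ℝ => 1 * t :=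
        IsBigO.mul (tendsto_id.isBigO_one ℝ) (isBigO_refl _ _)
      simpa [sq] using this
    by_contra hne
    have h2 := IsLittleO.def h1 (show 0 < |b| / 4 by positivity)
    have h3 : ∀ᶠ t in 𝓝 (0 : ℝ), |c * t| < |b| / 4 := by
      have hc : Continuous fun t : ℝ => |c * t| := by fun_prop
      have := hc.tendsto 0
      simp only [mul_zero, abs_zero] at this
      exact this.eventually (gt_mem_nhds (by positivity))
    obtain ⟨δ, hδ, hball⟩ := Metric.eventually_nhds_iff.1 ((h2.and h3).and hp)
    set s : ℝ := -(SignType.sign b : ℝ) * (δ / 2) with hs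
    have hsb : b * s = -(|b| * (δ / 2)) := by
      rw [hs, show b * (-(SignType.sign b : ℝ) * (δ / 2)) = -((SignType.sign b : ℝ) * b * (δ / 2)) by
        ring, sign_mul_self]
    have hsabs : |s| = δ / 2 := by
      rw [hs, abs_mul, abs_neg, abs_of_pos (half_pos hδ)]
      rcases lt_or_gt_of_ne hne with hb | hb
      · rw [sign_neg hb]; simp
      · rw [sign_pos hb]; simp
    obtain ⟨⟨g1, g2⟩, g3⟩ := hball (y := s) (by rw [Real.dist_eq, sub_zero, hsabs]; linarith)
    rw [Real.norm_eq_abs, Real.norm_eq_abs, hsabs] at g1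
    have g4 := (abs_le.1 g1).2
    have g5 : |c * s ^ 2| ≤ |b| / 4 * (δ / 2) := by
      rw [sq, ← mul_assoc, abs_mul, hsabs]
      exact mul_le_mul_of_nonneg_right g2.le (by linarith)
    have g6 := le_abs_self (c * s ^ 2)
    have hbp : 0 < |b| * δ := mul_pos (abs_pos.2 hne) hδ
    nlinarith
  refine ⟨hb, ?_⟩
  subst hb
  by_contra hc
  push Not at hc
  have h2 := IsLittleO.def h (show 0 < -c / 2 by linarith)
  obtain ⟨δ, hδ, hball⟩ := Metric.eventually_nhds_iff.1 (h2.and hp)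
  obtain ⟨g1, g3⟩ := hball (y := δ / 2) (by
    rw [Real.dist_eq, sub_zero, abs_of_pos (half_pos hδ)]; linarith)
  rw [Real.norm_eq_abs, Real.norm_eq_abs, abs_of_nonneg (sq_nonneg (δ / 2))] at g1
  have g4 := (abs_le.1 g1).2
  have : 0 < (δ / 2) ^ 2 := by positivity
  nlinarith

/-- Taylor's formula when the derivative is assumed differentiable only at 0: the derivative of the
remainder is o(t), and the mean value inequality integrates this. The coefficient c is half the
second derivative. -/
lemma jet_of_hasDerivAt {φ' : ℝ → ℝ} (h : ∀ᶠ t in 𝓝 0, HasDerivAt φ (φ' t) t)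
    (h' : HasDerivAt φ' (2 * c) 0) : Jet φ (φ 0) (φ' 0) c := by
  rw [Jet, isLittleO_iff]
  intro ε hε
  have h1 := hasDerivAt_iff_isLittleO_nhds_zero.1 h'
  obtain ⟨δ, hδ, hball⟩ := Metric.eventually_nhds_iff.1 ((IsLittleO.def h1 hε).and h)
  rw [Metric.eventually_nhds_iff]
  refine ⟨δ, hδ, fun {t} ht => ?_⟩
  rw [Real.dist_eq, sub_zero] at ht
  set e : ℝ → ℝ := fun t => φ t - (φ 0 + φ' 0 * t + c * t ^ 2) with he
  have hder : ∀ s ∈ Metric.closedBall (0 : ℝ) |t|,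
      HasDerivWithinAt e (φ' s - (φ' 0 + 2 * c * s)) (Metric.closedBall (0 : ℝ) |t|) s := by
    intro s hs
    rw [mem_closedBall_zero_iff, Real.norm_eq_abs] at hs
    have hs' : dist s 0 < δ := by rw [Real.dist_eq, sub_zero]; linarith
    have g := (hball hs').2
    have p : HasDerivAt (fun s : ℝ => φ 0 + φ' 0 * s + c * s ^ 2) (φ' 0 + 2 * c * s) s := by
      have := (((hasDerivAt_id s).const_mul (φ' 0)).const_add (φ 0)).add
        (((hasDerivAt_id s).pow 2).const_mul c)
      convert! this using 1
      simp; ring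
    exact (g.sub p).hasDerivWithinAt
  have hb : ∀ s ∈ Metric.closedBall (0 : ℝ) |t|, ‖φ' s - (φ' 0 + 2 * c * s)‖ ≤ ε * |t| := by
    intro s hs
    rw [mem_closedBall_zero_iff, Real.norm_eq_abs] at hs
    have hs' : dist s 0 < δ := by rw [Real.dist_eq, sub_zero]; linarith
    have g := (hball hs').1
    simp only [zero_add, smul_eq_mul, Real.norm_eq_abs] at g
    rw [Real.norm_eq_abs, show φ' s - (φ' 0 + 2 * c * s) = φ' s - φ' 0 - s * (2 * c) by ring]
    exact g.trans (mul_le_mul_of_nonneg_left hs hε.le)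
  have := (convex_closedBall (0 : ℝ) |t|).norm_image_sub_le_of_norm_hasDerivWithin_le hder hb
    (x := 0) (y := t) (by simp) (by simp)
  have e0 : e 0 = 0 := by simp [he]
  rw [e0, sub_zero, sub_zero] at this
  refine this.trans (le_of_eq ?_)
  rw [Real.norm_eq_abs, Real.norm_eq_abs, abs_of_nonneg (sq_nonneg t), mul_assoc, abs_mul_abs_self,
    sq]

/-- A function with a second order expansion whose linear and quadratic coefficients are bounded
by `M`. -/
def BJet (M : ℝ) (φ : ℝ → ℝ) (a : ℝ) : Prop :=
  ∃ b c, |b| ≤ M ∧ |c| ≤ M ∧ Jet φ a b c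

lemma BJet.sum {ι : Type*} {s : Finset ι} {φ : ι → ℝ → ℝ} {a : ι → ℝ} {M : ℝ}
    (h : ∀ i ∈ s, BJet M (φ i) (a i)) :
    BJet (s.card * M) (fun t => ∑ i ∈ s, φ i t) (∑ i ∈ s, a i) := by
  classical
  choose! b c hb hc hj using h
  refine ⟨∑ i ∈ s, b i, ∑ i ∈ s, c i, ?_, ?_, Jet.sum s hj⟩
  · refine (Finset.abs_sum_le_sum_abs _ _).trans ?_
    simpa using Finset.sum_le_card_nsmul s _ M hb
  · refine (Finset.abs_sum_le_sum_abs _ _).trans ?_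
    simpa using Finset.sum_le_card_nsmul s _ M hc

/-- The factor 3 counts the products in the quadratic coefficient. -/
lemma BJet.mul {M M' : ℝ} (h : BJet M φ a) (h' : BJet M' ψ a') (ha : |a| ≤ M) (ha' : |a'| ≤ M') :
    BJet (3 * (M * M')) (fun t => φ t * ψ t) (a * a') := by
  obtain ⟨b, c, hb, hc, hj⟩ := h
  obtain ⟨b', c', hb', hc', hj'⟩ := h'
  have hM : 0 ≤ M := (abs_nonneg _).trans ha
  have hM' : 0 ≤ M' := (abs_nonneg _).trans ha'
  have key : ∀ {x y : ℝ}, |x| ≤ M → |y| ≤ M' → |x * y| ≤ M * M' := fun hx hy => by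
    rw [abs_mul]; exact mul_le_mul hx hy (abs_nonneg _) hM
  refine ⟨_, _, ?_, ?_, hj.mul hj'⟩
  · refine (abs_add_le _ _).trans ?_
    have := key ha hb'
    have := key hb ha'
    nlinarith [mul_nonneg hM hM']
  · refine ((abs_add_le _ _).trans (add_le_add_left (abs_add_le _ _) _)).trans ?_
    have := key ha hc'
    have := key hb hb'
    have := key hc ha'
    linarith

lemma BJet.mono {M M' : ℝ} (h : BJet M φ a) (hM : M ≤ M') : BJet M' φ a := by
  obtain ⟨b, c, hb, hc, hj⟩ := h
  exact ⟨b, c, hb.trans hM, hc.trans hM, hj⟩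

end Jets

end BoundaryEstimate

end

noncomputable section

namespace BoundaryEstimate

open Finset Filter Topology

/-! ### Partial derivatives within a domain, chain rules and derivative bounds -/

section PartialDerivatives

set_option linter.unusedSectionVars false

variable {ι κ : Type*} [Fintype ι] [DecidableEq ι] [Fintype κ] [DecidableEq κ]

/-- Domains in which derivatives are unique and second derivatives are symmetric. -/
structure GoodDomain (s : Set (EuclideanSpace ℝ ι)) : Prop where
  uniqueDiffOn : UniqueDiffOn ℝ s
  subset_closure : s ⊆ closure (interior s)

lemma GoodDomain.of_isOpen {s : Set (EuclideanSpace ℝ ι)} (hs : IsOpen s) : GoodDomain s :=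
  ⟨hs.uniqueDiffOn, by rw [hs.interior_eq]; exact _root_.subset_closure⟩

lemma GoodDomain.of_convex {s : Set (EuclideanSpace ℝ ι)} (hs : Convex ℝ s)
    (hi : (interior s).Nonempty) : GoodDomain s :=
  ⟨uniqueDiffOn_convex hs hi, _root_.subset_closure.trans
    (hs.closure_interior_eq_closure_of_nonempty_interior hi).ge⟩

lemma clm_apply_eq_sum (L : EuclideanSpace ℝ ι →L[ℝ] ℝ) (w : EuclideanSpace ℝ ι) :
    L w = ∑ i, L (EuclideanSpace.single i 1) * w i := by
  conv_lhs => rw [← (EuclideanSpace.basisFun ι ℝ).sum_repr w]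
  rw [map_sum]
  refine Finset.sum_congr rfl fun i _ => ?_
  rw [map_smul, EuclideanSpace.basisFun_repr, EuclideanSpace.basisFun_apply, smul_eq_mul, mul_comm]

variable {s : Set (EuclideanSpace ℝ ι)} {φ ψ : EuclideanSpace ℝ ι → ℝ} {x : EuclideanSpace ℝ ι}

lemma pd_congr (h : Set.EqOn φ ψ s) (hx : x ∈ s) (i : ι) : pd s i φ x = pd s i ψ x := by
  rw [pd, pd, fderivWithin_congr h (h hx)]

lemma pd_const (s : Set (EuclideanSpace ℝ ι)) (i : ι) (a : ℝ) (x : EuclideanSpace ℝ ι) :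
    pd s i (fun _ => a) x = 0 := by
  simp [pd]

lemma pd_eq_zero_of_eqOn_const {a : ℝ} (h : ∀ y ∈ s, φ y = a) (hx : x ∈ s) (i : ι) :
    pd s i φ x = 0 := by
  rw [pd_congr (ψ := fun _ => a) (fun y hy => h y hy) hx, pd_const]

lemma pd_add (hs : GoodDomain s) (hx : x ∈ s) (h1 : DifferentiableWithinAt ℝ φ s x)
    (h2 : DifferentiableWithinAt ℝ ψ s x) (i : ι) :
    pd s i (fun y => φ y + ψ y) x = pd s i φ x + pd s i ψ x := by
  rw [pd, fderivWithin_fun_add (hs.uniqueDiffOn x hx) h1 h2]; rfl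

lemma pd_sub (hs : GoodDomain s) (hx : x ∈ s) (h1 : DifferentiableWithinAt ℝ φ s x)
    (h2 : DifferentiableWithinAt ℝ ψ s x) (i : ι) :
    pd s i (fun y => φ y - ψ y) x = pd s i φ x - pd s i ψ x := by
  rw [pd, fderivWithin_fun_sub (hs.uniqueDiffOn x hx) h1 h2]; rfl

lemma pd_mul (hs : GoodDomain s) (hx : x ∈ s) (h1 : DifferentiableWithinAt ℝ φ s x)
    (h2 : DifferentiableWithinAt ℝ ψ s x) (i : ι) :
    pd s i (fun y => φ y * ψ y) x = pd s i φ x * ψ x + φ x * pd s i ψ x := by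
  rw [pd, fderivWithin_fun_mul (hs.uniqueDiffOn x hx) h1 h2]
  simp [pd]; ring

lemma pd_const_mul (hs : GoodDomain s) (hx : x ∈ s) (a : ℝ) (h1 : DifferentiableWithinAt ℝ φ s x)
    (i : ι) : pd s i (fun y => a * φ y) x = a * pd s i φ x := by
  rw [pd_mul hs hx (differentiableWithinAt_const a) h1, pd_const]; ring

lemma pd_sum (hs : GoodDomain s) (hx : x ∈ s) {J : Type*} (t : Finset J)
    {φ : J → EuclideanSpace ℝ ι → ℝ} (h : ∀ j ∈ t, DifferentiableWithinAt ℝ (φ j) s x) (i : ι) :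
    pd s i (fun y => ∑ j ∈ t, φ j y) x = ∑ j ∈ t, pd s i (φ j) x := by
  rw [pd, fderivWithin_fun_sum (hs.uniqueDiffOn x hx) h]
  simp [pd]

lemma pd_eq_of_hasFDerivWithinAt (hs : GoodDomain s) (hx : x ∈ s)
    {L : EuclideanSpace ℝ ι →L[ℝ] ℝ} (h : HasFDerivWithinAt φ L s x) (i : ι) :
    pd s i φ x = L (EuclideanSpace.single i 1) := by
  rw [pd, h.fderivWithin (hs.uniqueDiffOn x hx)]

lemma contDiffOn_pd (hs : GoodDomain s) {k l : ℕ} (hφ : ContDiffOn ℝ k φ s) (hl : l + 1 ≤ k)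
    (i : ι) : ContDiffOn ℝ l (pd s i φ) s := by
  have h : ContDiffOn ℝ l (fderivWithin ℝ φ s) s :=
    hφ.fderivWithin hs.uniqueDiffOn (by exact_mod_cast hl)
  exact h.clm_apply contDiffOn_const

/-- Symmetry of the second derivative within s. At boundary points it relies on s lying in the
closure of its interior. -/
lemma pd_comm (hs : GoodDomain s) (hφ : ContDiffOn ℝ 2 φ s) (hx : x ∈ s) (i j : ι) :
    pd s i (pd s j φ) x = pd s j (pd s i φ) x := by
  have hsym : IsSymmSndFDerivWithinAt ℝ φ s x :=
    (hφ x hx).isSymmSndFDerivWithinAt (by simp) hs.uniqueDiffOn (hs.subset_closure hx) hx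
  have h : DifferentiableWithinAt ℝ (fderivWithin ℝ φ s) s x :=
    (hφ.fderivWithin (m := 1) hs.uniqueDiffOn (by norm_num)).differentiableOn (by norm_num) x hx
  have key : ∀ a b : ι, pd s a (pd s b φ) x
      = fderivWithin ℝ (fderivWithin ℝ φ s) s x (EuclideanSpace.single a 1)
        (EuclideanSpace.single b 1) := by
    intro a b
    have h1 : HasFDerivWithinAt (fun y => fderivWithin ℝ φ s y (EuclideanSpace.single b 1))
        _ s x := h.hasFDerivWithinAt.clm_apply (hasFDerivWithinAt_const _ _ _)
    have h2 := pd_eq_of_hasFDerivWithinAt hs hx h1 a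
    refine h2.trans ?_
    simp
  rw [key, key]
  exact hsym.eq _ _

/-- The chain rule along a map between coordinate domains. -/
lemma pd_comp (hs : GoodDomain s) {t : Set (EuclideanSpace ℝ κ)} (hx : x ∈ s)
    {Φ : EuclideanSpace ℝ ι → EuclideanSpace ℝ κ} {χ : EuclideanSpace ℝ κ → ℝ}
    (hm : Set.MapsTo Φ s t) (hχ : DifferentiableWithinAt ℝ χ t (Φ x))
    (hΦ : ∀ k, DifferentiableWithinAt ℝ (fun y => Φ y k) s x) (i : ι) :
    pd s i (fun y => χ (Φ y)) x = ∑ k, pd t k χ (Φ x) * pd s i (fun y => Φ y k) x := by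
  have hΦ' : DifferentiableWithinAt ℝ Φ s x := differentiableWithinAt_euclidean.2 hΦ
  have h := hχ.hasFDerivWithinAt.comp x hΦ'.hasFDerivWithinAt hm
  have h' : HasFDerivWithinAt (fun y => χ (Φ y)) _ s x := h
  rw [pd_eq_of_hasFDerivWithinAt hs hx h', ContinuousLinearMap.comp_apply, clm_apply_eq_sum]
  refine Finset.sum_congr rfl fun k _ => ?_
  have := hasFDerivWithinAt_euclidean.1 hΦ'.hasFDerivWithinAt k
  rw [pd_eq_of_hasFDerivWithinAt hs hx this]
  rfl

/-- The chain rule along a curve. -/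
lemma hasDerivWithinAt_comp_curve {t : Set (EuclideanSpace ℝ κ)} {I : Set ℝ} {τ : ℝ}
    {γ : ℝ → EuclideanSpace ℝ κ} {γ' : κ → ℝ} {χ : EuclideanSpace ℝ κ → ℝ}
    (hm : Set.MapsTo γ I t) (hχ : DifferentiableWithinAt ℝ χ t (γ τ))
    (hγ : ∀ k, HasDerivWithinAt (fun y => γ y k) (γ' k) I τ) :
    HasDerivWithinAt (fun y => χ (γ y)) (∑ k, pd t k χ (γ τ) * γ' k) I τ := by
  have hγ' : HasDerivWithinAt γ (WithLp.toLp 2 γ') I τ := by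
    rw [hasDerivWithinAt_iff_hasFDerivWithinAt, hasFDerivWithinAt_euclidean]
    intro k
    have := (hγ k).hasFDerivWithinAt
    convert! this using 1
  have h := hχ.hasFDerivWithinAt.comp_hasDerivWithinAt τ hγ' hm
  convert! h using 1
  rw [clm_apply_eq_sum]
  rfl

/-- The second order expansion of a `C²` function along the parabola `x₀ + t a + t² b`. -/
lemma jet_along_parabola (hs : GoodDomain s) (hφ : ContDiffOn ℝ 2 φ s) {x₀ : EuclideanSpace ℝ ι}
    (hx : s ∈ 𝓝 x₀) (a b : EuclideanSpace ℝ ι) :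
    Jet (fun t => φ (x₀ + t • a + t ^ 2 • b)) (φ x₀) (∑ k, pd s k φ x₀ * a k)
      (∑ k, pd s k φ x₀ * b k + 1 / 2 * ∑ k, ∑ l, pd s l (pd s k φ) x₀ * a k * a l) := by
  set γ : ℝ → EuclideanSpace ℝ ι := fun t => x₀ + t • a + t ^ 2 • b with hγ
  have hγ0 : γ 0 = x₀ := by simp [hγ]
  have hγc : Continuous γ := by fun_prop
  have hγd : ∀ t k, HasDerivAt (fun t => γ t k) (a k + 2 * t * b k) t := by
    intro t k
    have e : (fun t => γ t k) = fun t => x₀ k + t * a k + t ^ 2 * b k := by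
      ext t; simp [hγ]
    rw [e]
    have := (((hasDerivAt_id t).mul_const (a k)).const_add (x₀ k)).add
      (((hasDerivAt_id t).pow 2).mul_const (b k))
    convert! this using 1
    simp
  have hev : ∀ᶠ t in 𝓝 (0 : ℝ), s ∈ 𝓝 (γ t) := by
    have h1 : ∀ᶠ y in 𝓝 (γ 0), s ∈ 𝓝 y := by rw [hγ0]; exact eventually_mem_nhds_iff.2 hx
    exact hγc.continuousAt.eventually h1
  have hcomp : ∀ {χ : EuclideanSpace ℝ ι → ℝ}, ContDiffOn ℝ 1 χ s → ∀ t, s ∈ 𝓝 (γ t) →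
      HasDerivAt (fun t => χ (γ t)) (∑ k, pd s k χ (γ t) * (a k + 2 * t * b k)) t := by
    intro χ hχ t ht
    have hI : γ ⁻¹' s ∈ 𝓝 t := hγc.continuousAt.preimage_mem_nhds ht
    have := hasDerivWithinAt_comp_curve (t := s) (I := γ ⁻¹' s) (τ := t) (γ := γ) (χ := χ)
      (γ' := fun k => a k + 2 * t * b k) (fun _ h => h)
      (hχ.differentiableOn one_ne_zero _ (mem_of_mem_nhds ht)) (fun k => (hγd t k).hasDerivWithinAt)
    exact this.hasDerivAt hI
  have h1 : ∀ᶠ t in 𝓝 (0 : ℝ), HasDerivAt (fun t => φ (γ t))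
      (∑ k, pd s k φ (γ t) * (a k + 2 * t * b k)) t := by
    filter_upwards [hev] with t ht
    exact hcomp (hφ.of_le (by norm_num)) t ht
  have h2 : HasDerivAt (fun t => ∑ k, pd s k φ (γ t) * (a k + 2 * t * b k))
      (2 * (∑ k, pd s k φ x₀ * b k + 1 / 2 * ∑ k, ∑ l, pd s l (pd s k φ) x₀ * a k * a l)) 0 := by
    have h3 : ∀ k ∈ Finset.univ, HasDerivAt (fun t => pd s k φ (γ t) * (a k + 2 * t * b k))
        ((∑ l, pd s l (pd s k φ) (γ 0) * (a l + 2 * 0 * b l)) * (a k + 2 * 0 * b k)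
          + pd s k φ (γ 0) * (2 * b k)) 0 := by
      intro k _
      have e1 := hcomp (contDiffOn_pd hs (l := 1) (by exact_mod_cast hφ) le_rfl k) 0
        (by rw [hγ0]; exact hx)
      have e2 : HasDerivAt (fun t : ℝ => a k + 2 * t * b k) (2 * b k) 0 := by
        have := (((hasDerivAt_id (0 : ℝ)).const_mul 2).mul_const (b k)).const_add (a k)
        simpa using this
      exact e1.mul e2
    have h4 := HasDerivAt.fun_sum h3
    convert! h4 using 1
    rw [hγ0]
    simp only [mul_zero, zero_mul, add_zero, Finset.sum_add_distrib, Finset.sum_mul]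
    rw [mul_add, add_comm, Finset.mul_sum, Finset.mul_sum, Finset.mul_sum]
    congr 1
    · refine Finset.sum_congr rfl fun k _ => ?_
      rw [← mul_assoc, Finset.mul_sum]
      exact Finset.sum_congr rfl fun l _ => by ring
    · exact Finset.sum_congr rfl fun k _ => by ring
  have := jet_of_hasDerivAt h1 h2
  simp only [hγ0] at this
  refine this.congr_coeff rfl ?_ rfl
  simp

/-- The second order expansion of a `C²` function along a coordinate line. -/
lemma jet_along_line (hs : GoodDomain s) (hφ : ContDiffOn ℝ 2 φ s)
    (hx : s ∈ 𝓝 (0 : EuclideanSpace ℝ ι)) (i : ι) :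
    Jet (fun t => φ (t • EuclideanSpace.single i 1)) (φ 0) (pd s i φ 0)
      (1 / 2 * pd s i (pd s i φ) 0) := by
  have h := jet_along_parabola hs hφ hx (EuclideanSpace.single i 1) 0
  simp only [zero_add, smul_zero, add_zero] at h
  refine h.congr_coeff rfl ?_ ?_
  · simp
  · simp

/-- All partial derivatives of `φ` up to order `k` are bounded by `M` on `s`. -/
def PdBound (s : Set (EuclideanSpace ℝ ι)) : ℕ → ℝ → (EuclideanSpace ℝ ι → ℝ) → Prop
  | 0, M, φ => ∀ x ∈ s, |φ x| ≤ M
  | k + 1, M, φ => (∀ x ∈ s, |φ x| ≤ M) ∧ ∀ i, PdBound s k M (pd s i φ)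

lemma PdBound.abs_le {k : ℕ} {M : ℝ} (h : PdBound s k M φ) : ∀ x ∈ s, |φ x| ≤ M := by
  cases k with
  | zero => exact h
  | succ k => exact h.1

lemma PdBound.mono {k : ℕ} {M M' : ℝ} (h : PdBound s k M φ) (hM : M ≤ M') : PdBound s k M' φ := by
  induction k generalizing φ with
  | zero => exact fun x hx => (h x hx).trans hM
  | succ k ih => exact ⟨fun x hx => (h.1 x hx).trans hM, fun i => ih (h.2 i)⟩

lemma PdBound.of_succ {k : ℕ} {M : ℝ} (h : PdBound s (k + 1) M φ) : PdBound s k M φ := by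
  induction k generalizing φ with
  | zero => exact h.1
  | succ k ih => exact ⟨h.1, fun i => ih (h.2 i)⟩

lemma PdBound.congr {k : ℕ} {M : ℝ} (h : PdBound s k M φ) (e : Set.EqOn φ ψ s) :
    PdBound s k M ψ := by
  induction k generalizing φ ψ with
  | zero => exact fun x hx => by rw [← e hx]; exact h x hx
  | succ k ih => exact ⟨fun x hx => by rw [← e hx]; exact h.1 x hx,
      fun i => ih (h.2 i) fun x hx => pd_congr e hx i⟩

lemma pdBound_const (s : Set (EuclideanSpace ℝ ι)) (k : ℕ) (a : ℝ) :
    PdBound s k |a| (fun _ => a) := by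
  induction k generalizing a with
  | zero => exact fun x _ => le_rfl
  | succ k ih =>
    refine ⟨fun x _ => le_rfl, fun i => ?_⟩
    have := (ih 0).mono (M' := |a|) (by simp)
    exact this.congr fun x _ => (pd_const s i a x).symm

lemma PdBound.add (hs : GoodDomain s) {k : ℕ} {M M' : ℝ} (h : PdBound s k M φ)
    (h' : PdBound s k M' ψ) (hφ : ContDiffOn ℝ k φ s) (hψ : ContDiffOn ℝ k ψ s) :
    PdBound s k (M + M') (fun x => φ x + ψ x) := by
  induction k generalizing φ ψ with
  | zero => exact fun x hx => (abs_add_le _ _).trans (add_le_add (h x hx) (h' x hx))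
  | succ k ih =>
    refine ⟨fun x hx => (abs_add_le _ _).trans (add_le_add (h.1 x hx) (h'.1 x hx)), fun i => ?_⟩
    refine (ih (h.2 i) (h'.2 i) (contDiffOn_pd hs hφ le_rfl i)
      (contDiffOn_pd hs hψ le_rfl i)).congr fun x hx => ?_
    exact (pd_add hs hx (hφ.differentiableOn (by simp) x hx)
      (hψ.differentiableOn (by simp) x hx) i).symm

/-- Each application of the Leibniz rule doubles the number of terms, hence the factor 2^k. -/
lemma PdBound.mul (hs : GoodDomain s) {k : ℕ} {M M' : ℝ} (h : PdBound s k M φ)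
    (h' : PdBound s k M' ψ) (hφ : ContDiffOn ℝ k φ s) (hψ : ContDiffOn ℝ k ψ s) (hM : 0 ≤ M)
    (hM' : 0 ≤ M') : PdBound s k (2 ^ k * (M * M')) (fun x => φ x * ψ x) := by
  have h0 : ∀ x ∈ s, |φ x * ψ x| ≤ M * M' := fun x hx => by
    rw [abs_mul]; exact mul_le_mul (h.abs_le x hx) (h'.abs_le x hx) (abs_nonneg _) hM
  induction k generalizing φ ψ with
  | zero => exact fun x hx => (h0 x hx).trans (by simp)
  | succ k ih =>
    refine ⟨fun x hx => (h0 x hx).trans (le_mul_of_one_le_left (mul_nonneg hM hM')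
      (one_le_pow₀ (by norm_num))), fun i => ?_⟩
    have hφ' : ContDiffOn ℝ k φ s := hφ.of_le (by exact_mod_cast Nat.le_succ k)
    have hψ' : ContDiffOn ℝ k ψ s := hψ.of_le (by exact_mod_cast Nat.le_succ k)
    have c1 := contDiffOn_pd hs hφ le_rfl i
    have c2 := contDiffOn_pd hs hψ le_rfl i
    have key : ∀ {α β : EuclideanSpace ℝ ι → ℝ}, PdBound s k M α → PdBound s k M' β →
        ∀ x ∈ s, |α x * β x| ≤ M * M' := fun hα hβ x hx => by
      rw [abs_mul]; exact mul_le_mul (hα.abs_le x hx) (hβ.abs_le x hx) (abs_nonneg _) hM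
    have e1 := ih (h.2 i) h'.of_succ c1 hψ' (key (h.2 i) h'.of_succ)
    have e2 := ih h.of_succ (h'.2 i) hφ' c2 (key h.of_succ (h'.2 i))
    refine ((e1.add hs e2 (c1.mul hψ') (hφ'.mul c2)).mono (le_of_eq (by ring))).congr
      fun x hx => ?_
    exact (pd_mul hs hx (hφ.differentiableOn (by simp) x hx)
      (hψ.differentiableOn (by simp) x hx) i).symm

lemma PdBound.sum (hs : GoodDomain s) {k : ℕ} {J : Type*} (t : Finset J) {M : ℝ}
    {φ : J → EuclideanSpace ℝ ι → ℝ} (h : ∀ j ∈ t, PdBound s k M (φ j))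
    (hφ : ∀ j ∈ t, ContDiffOn ℝ k (φ j) s) :
    PdBound s k (t.card * M) (fun x => ∑ j ∈ t, φ j x) := by
  classical
  induction t using Finset.induction_on with
  | empty => simpa using pdBound_const s k 0
  | insert i t hi ih =>
    simp only [Finset.sum_insert hi, Finset.card_insert_of_notMem hi]
    have := (h i (Finset.mem_insert_self i t)).add hs
      (ih (fun j hj => h j (Finset.mem_insert_of_mem hj))
        (fun j hj => hφ j (Finset.mem_insert_of_mem hj)))
      (hφ i (Finset.mem_insert_self i t))
      (ContDiffOn.sum fun j hj => hφ j (Finset.mem_insert_of_mem hj))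
    refine this.mono (le_of_eq ?_)
    push_cast; ring

/-- Translates operator-norm bounds on iterated derivatives into bounds on iterated partial
derivatives; coordinate vectors have length one, so no constant is lost. -/
lemma pdBound_of_iteratedFDerivWithin (hs : GoodDomain s) {k : ℕ} {M : ℝ}
    (hφ : ContDiffOn ℝ k φ s)
    (h : ∀ q ≤ k, ∀ x ∈ s, ‖iteratedFDerivWithin ℝ q φ s x‖ ≤ M) : PdBound s k M φ := by
  induction k generalizing φ with
  | zero =>
    intro x hx
    have := h 0 le_rfl x hx
    rwa [norm_iteratedFDerivWithin_zero, Real.norm_eq_abs] at this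
  | succ k ih =>
    refine ⟨fun x hx => ?_, fun i => ih (contDiffOn_pd hs hφ le_rfl i) fun q hq x hx => ?_⟩
    · have := h 0 (Nat.zero_le _) x hx
      rwa [norm_iteratedFDerivWithin_zero, Real.norm_eq_abs] at this
    · have hd : ContDiffOn ℝ k (fderivWithin ℝ φ s) s :=
        hφ.fderivWithin hs.uniqueDiffOn (by simp)
      have := norm_iteratedFDerivWithin_clm_apply_const (c := EuclideanSpace.single i (1 : ℝ))
        (hd x hx) hs.uniqueDiffOn hx (n := q) (by exact_mod_cast hq)
      rw [norm_iteratedFDerivWithin_fderivWithin hs.uniqueDiffOn hx] at this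
      refine this.trans ?_
      simpa using h (q + 1) (by omega) x hx

end PartialDerivatives

end BoundaryEstimate

end

noncomputable section

namespace BoundaryEstimate

open Finset Filter Topology

/-! ### Uniform bounds for the inverse metric and the Christoffel symbols -/

section Metrics

set_option linter.unusedSectionVars false

variable {ι : Type*} [Fintype ι] [DecidableEq ι]

/-- A `C³` metric with `‖g‖_{C³} ≤ G` and `g ≥ θ` on a coordinate domain. -/
structure IsControlledMetric (s : Set (EuclideanSpace ℝ ι)) (θ G : ℝ)
    (g : EuclideanSpace ℝ ι → Matrix ι ι ℝ) : Prop where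
  good : GoodDomain s
  contDiffOn : ∀ i j, ContDiffOn ℝ 3 (fun x => g x i j) s
  posDef : ∀ x ∈ s, (g x).PosDef
  lower : ∀ x ∈ s, ∀ ξ : ι → ℝ, θ * ∑ i, ξ i ^ 2 ≤ ∑ i, ∑ j, g x i j * ξ i * ξ j
  bound : ∀ i j, PdBound s 3 G (fun x => g x i j)

variable {s : Set (EuclideanSpace ℝ ι)} {θ G : ℝ} {g : EuclideanSpace ℝ ι → Matrix ι ι ℝ}
  {x : EuclideanSpace ℝ ι}

lemma contDiffOn_det {k : WithTop ℕ∞} {A : EuclideanSpace ℝ ι → Matrix ι ι ℝ}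
    (h : ∀ i j, ContDiffOn ℝ k (fun x => A x i j) s) : ContDiffOn ℝ k (fun x => (A x).det) s := by
  simp only [Matrix.det_apply]
  refine ContDiffOn.sum fun σ _ => ?_
  refine ContDiffOn.const_smul _ ?_
  exact contDiffOn_prod fun i _ => h _ _

/-- By Cramer's rule an entry of the inverse is a quotient of determinants. -/
lemma contDiffOn_inv_apply {k : WithTop ℕ∞} {A : EuclideanSpace ℝ ι → Matrix ι ι ℝ}
    (h : ∀ i j, ContDiffOn ℝ k (fun x => A x i j) s) (h0 : ∀ x ∈ s, (A x).det ≠ 0) (i j : ι) :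
    ContDiffOn ℝ k (fun x => (A x)⁻¹ i j) s := by
  have e : ∀ x, (A x)⁻¹ i j = ((A x).det)⁻¹ * ((A x).updateRow j (Pi.single i 1)).det := by
    intro x
    rw [Matrix.inv_def, Matrix.smul_apply, Matrix.adjugate_apply, Ring.inverse_eq_inv', smul_eq_mul]
  simp only [e]
  refine ContDiffOn.mul ((contDiffOn_det h).inv h0) (contDiffOn_det fun a b => ?_)
  by_cases hab : a = j
  · subst hab
    simp only [Matrix.updateRow_self]
    exact contDiffOn_const
  · simp only [Matrix.updateRow_ne hab]
    exact h a b

namespace IsControlledMetric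

lemma symm (h : IsControlledMetric s θ G g) (hx : x ∈ s) (i j : ι) : g x i j = g x j i := by
  have := (h.posDef x hx).isHermitian
  rw [Matrix.IsHermitian, Matrix.conjTranspose_eq_transpose_of_trivial] at this
  conv_lhs => rw [← this]
  rfl

lemma isSymm (h : IsControlledMetric s θ G g) (hx : x ∈ s) : (g x).IsSymm := by
  have := (h.posDef x hx).isHermitian
  rwa [Matrix.IsHermitian, Matrix.conjTranspose_eq_transpose_of_trivial] at this

lemma det_ne_zero (h : IsControlledMetric s θ G g) (hx : x ∈ s) : (g x).det ≠ 0 :=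
  (h.posDef x hx).det_pos.ne'

lemma mul_inv (h : IsControlledMetric s θ G g) (hx : x ∈ s) : g x * (g x)⁻¹ = 1 :=
  Matrix.mul_nonsing_inv _ (isUnit_iff_ne_zero.2 (h.det_ne_zero hx))

lemma inv_mul (h : IsControlledMetric s θ G g) (hx : x ∈ s) : (g x)⁻¹ * g x = 1 :=
  Matrix.nonsing_inv_mul _ (isUnit_iff_ne_zero.2 (h.det_ne_zero hx))

lemma inv_contDiffOn (h : IsControlledMetric s θ G g) (i j : ι) :
    ContDiffOn ℝ 3 (fun x => (g x)⁻¹ i j) s :=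
  contDiffOn_inv_apply h.contDiffOn (fun _ hx => h.det_ne_zero hx) i j

lemma exists_frame (h : IsControlledMetric s θ G g) (hx : x ∈ s) : ∃ E, IsFrame (g x) E := by
  obtain ⟨E, d, hE, -⟩ := exists_frame_diagonal (h.posDef x hx) (h.isSymm hx)
  exact ⟨E, hE⟩

/-- The inverse metric is EEᵀ for an orthonormal frame E, whose entries are at most θ^{−1/2}. -/
lemma abs_inv_le (h : IsControlledMetric s θ G g) (hθ : 0 < θ) (hx : x ∈ s) (i j : ι) :
    |(g x)⁻¹ i j| ≤ Fintype.card ι * θ⁻¹ := by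
  obtain ⟨E, hE⟩ := h.exists_frame hx
  rw [hE.inv_eq, Matrix.mul_apply]
  refine (Finset.abs_sum_le_sum_abs _ _).trans ?_
  refine (Finset.sum_le_card_nsmul _ _ θ⁻¹ fun a _ => ?_).trans (by simp)
  rw [abs_mul, Matrix.transpose_apply]
  have e : (√θ)⁻¹ * (√θ)⁻¹ = θ⁻¹ := by rw [← _root_.mul_inv, Real.mul_self_sqrt hθ.le]
  rw [← e]
  exact mul_le_mul (hE.abs_le hθ (h.lower x hx) i a) (hE.abs_le hθ (h.lower x hx) j a)
    (abs_nonneg _) (by positivity)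

/-- Differentiate g g⁻¹ = 1 and multiply by g⁻¹ from the left. -/
lemma pd_inv (h : IsControlledMetric s θ G g) (hx : x ∈ s) (i a b : ι) :
    pd s i (fun y => (g y)⁻¹ a b) x
      = -1 * ∑ c, ∑ d, (g x)⁻¹ a c * pd s i (fun y => g y c d) x * (g x)⁻¹ d b := by
  have hd : ∀ a b, DifferentiableWithinAt ℝ (fun y => (g y)⁻¹ a b) s x := fun a b =>
    (h.inv_contDiffOn a b).differentiableOn (by norm_num) x hx
  have hg : ∀ a b, DifferentiableWithinAt ℝ (fun y => g y a b) s x := fun a b =>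
    (h.contDiffOn a b).differentiableOn (by norm_num) x hx
  have key : ∀ c, ∑ d, (pd s i (fun y => g y c d) x * (g x)⁻¹ d b
      + g x c d * pd s i (fun y => (g y)⁻¹ d b) x) = 0 := by
    intro c
    have e : ∀ y ∈ s, ∑ d, g y c d * (g y)⁻¹ d b = (1 : Matrix ι ι ℝ) c b := fun y hy => by
      rw [← Matrix.mul_apply, h.mul_inv hy]
    have := pd_eq_zero_of_eqOn_const e hx i
    rw [pd_sum h.good hx _ (fun d _ => (hg c d).fun_mul (hd d b))] at this
    rw [← this]
    exact Finset.sum_congr rfl fun d _ => (pd_mul h.good hx (hg c d) (hd d b) i).symm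
  have h2 : ∑ c, (g x)⁻¹ a c * (∑ d, (pd s i (fun y => g y c d) x * (g x)⁻¹ d b
      + g x c d * pd s i (fun y => (g y)⁻¹ d b) x)) = 0 := by simp [key]
  simp only [Finset.sum_add_distrib, mul_add, Finset.mul_sum] at h2
  have h3 : ∑ c, ∑ d, (g x)⁻¹ a c * (g x c d * pd s i (fun y => (g y)⁻¹ d b) x)
      = pd s i (fun y => (g y)⁻¹ a b) x := by
    rw [Finset.sum_comm]
    have : ∀ d, ∑ c, (g x)⁻¹ a c * (g x c d * pd s i (fun y => (g y)⁻¹ d b) x)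
        = (1 : Matrix ι ι ℝ) a d * pd s i (fun y => (g y)⁻¹ d b) x := fun d => by
      rw [← h.inv_mul hx, Matrix.mul_apply, Finset.sum_mul]
      exact Finset.sum_congr rfl fun c _ => by ring
    simp only [this, Matrix.one_apply, ite_mul, one_mul, zero_mul, Finset.sum_ite_eq,
      Finset.mem_univ, if_true]
  rw [h3] at h2
  simp only [mul_assoc, neg_mul, one_mul]
  linarith

end IsControlledMetric

/-- Induction on the order: ∂(g⁻¹) = −g⁻¹(∂g)g⁻¹ expresses k + 1 derivatives of g⁻¹ by at most k
derivatives of g⁻¹ and k + 1 of g. The constant does not depend on the domain or on the metric in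
the class. -/
lemma exists_inv_pdBound (ι : Type*) [Fintype ι] [DecidableEq ι] {θ G : ℝ} (hθ : 0 < θ) (k : ℕ)
    (hk : k ≤ 3) : ∃ M : ℝ, 0 ≤ M ∧ ∀ (s : Set (EuclideanSpace ℝ ι))
      (g : EuclideanSpace ℝ ι → Matrix ι ι ℝ), IsControlledMetric s θ G g →
        ∀ i j, PdBound s k M (fun x => (g x)⁻¹ i j) := by
  induction k with
  | zero =>
    exact ⟨Fintype.card ι * θ⁻¹, by positivity, fun s g h i j x hx => h.abs_inv_le hθ hx i j⟩
  | succ k ih =>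
    obtain ⟨M, hM0, hM⟩ := ih (by omega)
    set c : ℝ := (Fintype.card ι : ℝ) with hc
    set M1 : ℝ := 2 ^ k * (2 ^ k * (M * |G|) * M) with hM1
    set M2 : ℝ := 2 ^ k * (|(-1 : ℝ)| * (c * (c * M1))) with hM2
    refine ⟨max M M2, le_max_of_le_left hM0, fun s g h i j => ⟨fun x hx =>
      ((hM s g h i j).abs_le x hx).trans (le_max_left _ _), fun l => ?_⟩⟩
    have hk3 : (k : WithTop ℕ∞) ≤ 3 := by exact_mod_cast (by omega : k ≤ 3)
    have ci : ∀ a b, ContDiffOn ℝ k (fun x => (g x)⁻¹ a b) s := fun a b =>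
      (h.inv_contDiffOn a b).of_le hk3
    have cg : ∀ a b, ContDiffOn ℝ k (pd s l (fun x => g x a b)) s := fun a b =>
      contDiffOn_pd h.good (k := 3) (by exact_mod_cast h.contDiffOn a b) hk l
    have bg : ∀ a b, PdBound s k |G| (pd s l (fun x => g x a b)) := fun a b => by
      have := ((h.bound a b).mono (le_abs_self G)).2 l
      rcases Nat.lt_or_ge k 1 with h0 | h0
      · obtain rfl : k = 0 := by omega
        exact this.of_succ.of_succ
      · rcases Nat.lt_or_ge k 2 with h1 | h1
        · obtain rfl : k = 1 := by omega
          exact this.of_succ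
        · obtain rfl : k = 2 := by omega
          exact this
    have hcM1 : 0 ≤ c * M1 := by positivity
    have c3 : ∀ a b, ContDiffOn ℝ k
        (fun x => (g x)⁻¹ i a * pd s l (fun y => g y a b) x * (g x)⁻¹ b j) s := fun a b =>
      ((ci i a).mul (cg a b)).mul (ci b j)
    have b3 : ∀ a b, PdBound s k M1
        (fun x => (g x)⁻¹ i a * pd s l (fun y => g y a b) x * (g x)⁻¹ b j) := fun a b =>
      PdBound.mul h.good (PdBound.mul h.good (hM s g h i a) (bg a b) (ci i a) (cg a b) hM0
        (abs_nonneg _)) (hM s g h b j) ((ci i a).mul (cg a b)) (ci b j) (by positivity) hM0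
    have b4 : ∀ a, PdBound s k (c * M1)
        (fun x => ∑ b, (g x)⁻¹ i a * pd s l (fun y => g y a b) x * (g x)⁻¹ b j) := fun a =>
      PdBound.sum h.good Finset.univ (fun b _ => b3 a b) (fun b _ => c3 a b)
    have c4 : ∀ a, ContDiffOn ℝ k
        (fun x => ∑ b, (g x)⁻¹ i a * pd s l (fun y => g y a b) x * (g x)⁻¹ b j) s := fun a =>
      ContDiffOn.sum fun b _ => c3 a b
    have b5 := PdBound.sum h.good Finset.univ (fun a _ => b4 a) (fun a _ => c4 a)
    have c5 := ContDiffOn.sum (s := Finset.univ) fun a _ => c4 a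
    have b6 := PdBound.mul h.good (pdBound_const s k (-1)) b5 contDiffOn_const c5 (abs_nonneg _)
      (by positivity)
    exact (b6.mono (le_max_right _ _)).congr fun x hx => (h.pd_inv hx l i j).symm

namespace IsControlledMetric

lemma pd_contDiffOn (h : IsControlledMetric s θ G g) (k i j : ι) :
    ContDiffOn ℝ 2 (pd s k (fun x => g x i j)) s := by
  exact_mod_cast contDiffOn_pd h.good (k := 3) (l := 2) (by exact_mod_cast h.contDiffOn i j)
    le_rfl k

lemma christoffel_contDiffOn (h : IsControlledMetric s θ G g) (k i j : ι) :
    ContDiffOn ℝ 2 (christoffel s g k i j) s := by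
  refine contDiffOn_const.mul (ContDiffOn.sum fun l _ => ?_)
  exact ((h.inv_contDiffOn k l).of_le (by norm_num)).mul
    (((h.pd_contDiffOn i j l).add (h.pd_contDiffOn j i l)).sub (h.pd_contDiffOn l i j))

lemma pd_symm (h : IsControlledMetric s θ G g) (hx : x ∈ s) (k i j : ι) :
    pd s k (fun y => g y i j) x = pd s k (fun y => g y j i) x :=
  pd_congr (fun _ hy => h.symm hy i j) hx k

lemma christoffel_symm (h : IsControlledMetric s θ G g) (hx : x ∈ s) (k i j : ι) :
    christoffel s g k i j x = christoffel s g k j i x := by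
  simp only [christoffel]
  congr 1
  refine Finset.sum_congr rfl fun l _ => ?_
  rw [h.pd_symm hx l i j]; ring

/-- The Christoffel symbols of the first kind. -/
lemma sum_mul_christoffel (h : IsControlledMetric s θ G g) (hx : x ∈ s) (l i j : ι) :
    ∑ k, g x l k * christoffel s g k i j x = 1 / 2 * (pd s i (fun y => g y j l) x
      + pd s j (fun y => g y i l) x - pd s l (fun y => g y i j) x) := by
  simp only [christoffel, Finset.mul_sum]
  rw [Finset.sum_comm]
  have : ∀ p, ∑ k, g x l k * (1 / 2 * ((g x)⁻¹ k p * (pd s i (fun y => g y j p) x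
      + pd s j (fun y => g y i p) x - pd s p (fun y => g y i j) x)))
      = (1 : Matrix ι ι ℝ) l p * (1 / 2 * (pd s i (fun y => g y j p) x
      + pd s j (fun y => g y i p) x - pd s p (fun y => g y i j) x)) := fun p => by
    rw [← h.mul_inv hx, Matrix.mul_apply, Finset.sum_mul]
    exact Finset.sum_congr rfl fun c _ => by ring
  simp only [this, Matrix.one_apply, ite_mul, one_mul, zero_mul, Finset.sum_ite_eq,
      Finset.mem_univ, if_true]

/-- The metric is parallel. -/
lemma pd_eq_sum_christoffel (h : IsControlledMetric s θ G g) (hx : x ∈ s) (k i j : ι) :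
    pd s k (fun y => g y i j) x = ∑ l, g x j l * christoffel s g l k i x
      + ∑ l, g x i l * christoffel s g l k j x := by
  rw [h.sum_mul_christoffel hx, h.sum_mul_christoffel hx, h.pd_symm hx k i j]
  ring

end IsControlledMetric

lemma exists_christoffel_pdBound (ι : Type*) [Fintype ι] [DecidableEq ι] {θ G : ℝ} (hθ : 0 < θ) :
    ∃ M : ℝ, 0 ≤ M ∧ ∀ (s : Set (EuclideanSpace ℝ ι))
      (g : EuclideanSpace ℝ ι → Matrix ι ι ℝ), IsControlledMetric s θ G g →
        ∀ k i j, PdBound s 2 M (christoffel s g k i j) := by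
  obtain ⟨M, hM0, hM⟩ := exists_inv_pdBound ι hθ (G := G) 2 (by norm_num)
  refine ⟨2 ^ 2 * (|1 / 2| * ((Fintype.card ι : ℝ) * (2 ^ 2 * (M * (|G| + |G| + |G|))))),
    by positivity, fun s g h k i j => ?_⟩
  have c1 : ∀ k i j, ContDiffOn ℝ ((2 : ℕ) : WithTop ℕ∞) (pd s k (fun x => g x i j)) s := fun k i j =>
    by exact_mod_cast h.pd_contDiffOn k i j
  have b1 : ∀ k i j, PdBound s 2 |G| (pd s k (fun x => g x i j)) := fun k i j =>
    -- Two derivatives of a Christoffel symbol use three of g; the C³ bound on the metric is spent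
    -- here.
    ((h.bound i j).mono (le_abs_self G)).2 k
  have ci : ∀ a b, ContDiffOn ℝ ((2 : ℕ) : WithTop ℕ∞) (fun x => (g x)⁻¹ a b) s := fun a b =>
    (h.inv_contDiffOn a b).of_le (by norm_num)
  have c2 : ∀ l, ContDiffOn ℝ ((2 : ℕ) : WithTop ℕ∞) (fun x => pd s i (fun y => g y j l) x
      + pd s j (fun y => g y i l) x + -1 * pd s l (fun y => g y i j) x) s := fun l =>
    ((c1 i j l).add (c1 j i l)).add (contDiffOn_const.mul (c1 l i j))
  have bneg : ∀ l, PdBound s 2 |G| (fun x => -1 * pd s l (fun y => g y i j) x) := fun l => by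
    have aux : ∀ (k : ℕ) (φ : EuclideanSpace ℝ ι → ℝ), ContDiffOn ℝ k φ s → PdBound s k |G| φ →
        PdBound s k |G| (fun x => -1 * φ x) := by
      intro k
      induction k with
      | zero => intro φ _ hb x hx; simpa using hb x hx
      | succ k ih =>
        intro φ hφ hb
        refine ⟨fun x hx => by simpa using hb.1 x hx, fun m => ?_⟩
        exact (ih _ (contDiffOn_pd h.good hφ le_rfl m) (hb.2 m)).congr fun x hx =>
          (pd_const_mul h.good hx _ (hφ.differentiableOn (by simp) x hx) m).symm
    exact aux 2 _ (c1 l i j) (b1 l i j)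
  have b2 : ∀ l, PdBound s 2 (|G| + |G| + |G|) (fun x => pd s i (fun y => g y j l) x
      + pd s j (fun y => g y i l) x + -1 * pd s l (fun y => g y i j) x) := fun l =>
    ((b1 i j l).add h.good (b1 j i l) (c1 i j l) (c1 j i l)).add h.good (bneg l)
      ((c1 i j l).add (c1 j i l)) (contDiffOn_const.mul (c1 l i j))
  have b3 := fun l => (hM s g h k l).mul h.good (b2 l) (ci k l) (c2 l) hM0 (by positivity)
  have b4 := PdBound.sum h.good Finset.univ (fun l _ => b3 l) (fun l _ => (ci k l).mul (c2 l))
  have c4 := ContDiffOn.sum (s := Finset.univ) (fun l _ => (ci k l).mul (c2 l))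
  have b5 := PdBound.mul h.good (pdBound_const s 2 (1 / 2)) b4 contDiffOn_const c4 (abs_nonneg _)
    (by positivity)
  refine b5.congr fun x _ => ?_
  simp only [christoffel]
  congr 1
  exact Finset.sum_congr rfl fun l _ => by ring

end Metrics

end BoundaryEstimate

end

noncomputable section

namespace BoundaryEstimate

open Finset

/-! ### The algebra of the maximum principle at an interior point -/

section InteriorAlgebra

variable {ι : Type*} [Fintype ι]

lemma abs_sum_le_card_mul {x : ι → ℝ} {B : ℝ} (h : ∀ i, |x i| ≤ B) :
    |∑ i, x i| ≤ Fintype.card ι * B := by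
  refine (Finset.abs_sum_le_sum_abs _ _).trans ?_
  simpa using Finset.sum_le_card_nsmul Finset.univ _ B fun i _ => h i

lemma abs_mul_le_mul {x y a b : ℝ} (hx : |x| ≤ a) (hy : |y| ≤ b) : |x * y| ≤ a * b := by
  rw [abs_mul]
  exact mul_le_mul hx hy (abs_nonneg _) ((abs_nonneg _).trans hx)

/-- The commutation of the linearized operator with two differentiations. The `v₃ a i` and `v₄ a i`
stand for `∂ᵢ∂ₐ∂ₐv` and `∂ᵢ∂ᵢ∂ₐ∂ₐv`; all terms of third and fourth order cancel. -/
lemma hessian_sum_le {F w v₁ q₁ q₂ f₁ f₂ e₃ : ι → ℝ} {v₂ v₃ v₄ e₁ e₂ : ι → ι → ℝ} {q₀ k : ℝ}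
    (hq₀ : 0 < q₀) (hF : ∀ i, 0 ≤ F i) (hw : ∀ i, 0 ≤ w i)
    (h₂ : ∀ i j, v₂ i j = v₂ j i) (h₄ : ∀ i j, v₄ i j = v₄ j i)
    (max₁ : ∀ i, q₀ * (∑ a, w a * (v₃ a i + 2 * v₁ a * v₂ a i + e₁ a i)) + q₁ i * k = 0)
    (max₂ : ∀ i, q₀ * (∑ a, w a * (1 / 2 * v₄ a i + v₂ a i ^ 2 + v₁ a * v₃ i a + e₂ a i))
      + q₁ i * (∑ a, w a * (v₃ a i + 2 * v₁ a * v₂ a i + e₁ a i)) + q₂ i * k ≤ 0)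
    (eqn₁ : ∀ i, ∑ a, F a * (v₃ a i + 2 * v₁ a * v₂ a i + e₁ a i - ∑ c, v₁ c * v₂ c i) = f₁ i)
    (eqn₂ : ∀ i, f₂ i ≤ ∑ a, F a * (1 / 2 * v₄ a i + v₂ a i ^ 2 + v₁ a * v₃ i a + e₂ a i
      - 1 / 2 * (∑ c, (v₂ c i ^ 2 + v₁ c * v₃ i c) + e₃ i))) :
    1 / 2 * (∑ i, F i) * ∑ i, w i * ∑ c, v₂ c i ^ 2 ≤
      ∑ i, F i * ((q₁ i / q₀) ^ 2 * k - q₂ i / q₀ * k) - ∑ i, w i * f₂ i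
        - 1 / 2 * (∑ i, F i) * ∑ i, w i * e₃ i
        - ∑ i, ∑ a, F i * w a * (e₂ a i - e₂ i a)
        + 1 / 2 * (∑ i, F i) * (k / q₀ * ∑ c, v₁ c * q₁ c + ∑ c, ∑ a, v₁ c * (w a * e₁ a c))
        - ∑ a, w a * v₁ a * f₁ a + ∑ a, ∑ i, w a * v₁ a * (F i * e₁ i a)
        - k / q₀ * ∑ i, F i * v₁ i * q₁ i - ∑ i, ∑ a, F i * v₁ i * (w a * e₁ a i) := by
  set Φ := ∑ i, F i with hΦ
  -- S₁ and S₂ are the two expressions of type du·du·∇²v that appear when the third derivatives are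
  -- eliminated. They cancel in the last step.
  set S₁ := ∑ c, ∑ a, v₁ c * (w a * (v₁ a * v₂ a c)) with hS₁
  set S₂ := ∑ i, ∑ a, F i * v₁ i * (w a * (v₁ a * v₂ a i)) with hS₂
  -- The first-order condition at the maximum removes the w-weighted third derivatives.
  have hY : ∀ c, ∑ a, w a * v₃ a c = -(k / q₀ * q₁ c) - 2 * (∑ a, w a * (v₁ a * v₂ a c))
      - ∑ a, w a * e₁ a c := by
    intro c
    have h1 : ∑ a, w a * (v₃ a c + 2 * v₁ a * v₂ a c + e₁ a c) = -(k / q₀ * q₁ c) := by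
      have := max₁ c
      field_simp
      linarith
    rw [← h1, Finset.mul_sum, ← Finset.sum_sub_distrib, ← Finset.sum_sub_distrib]
    exact Finset.sum_congr rfl fun a _ => by ring
  -- The differentiated equation removes the F-weighted third derivatives.
  have hZ : ∀ i, ∑ a, F a * v₃ a i = f₁ i - 2 * (∑ a, F a * (v₁ a * v₂ a i))
      - (∑ a, F a * e₁ a i) + Φ * ∑ c, v₁ c * v₂ c i := by
    intro i
    rw [← eqn₁ i, Finset.mul_sum, hΦ, Finset.sum_mul, ← Finset.sum_sub_distrib,
      ← Finset.sum_sub_distrib, ← Finset.sum_add_distrib]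
    exact Finset.sum_congr rfl fun a _ => by ring
  have hT₁ : ∑ c, v₁ c * ∑ a, w a * v₃ a c = -(k / q₀ * ∑ c, v₁ c * q₁ c) - 2 * S₁
      - ∑ c, ∑ a, v₁ c * (w a * e₁ a c) := by
    rw [hS₁, Finset.mul_sum, Finset.mul_sum, ← Finset.sum_neg_distrib, ← Finset.sum_sub_distrib,
      ← Finset.sum_sub_distrib]
    refine Finset.sum_congr rfl fun c _ => ?_
    rw [hY c, ← Finset.mul_sum, ← Finset.mul_sum]; ring
  have hT₂ : ∑ a, w a * v₁ a * ∑ i, F i * v₃ i a = ∑ a, w a * v₁ a * f₁ a - 2 * S₂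
      - (∑ a, ∑ i, w a * v₁ a * (F i * e₁ i a)) + Φ * S₁ := by
    have e1 : S₂ = ∑ a, ∑ i, w a * v₁ a * (F i * (v₁ i * v₂ i a)) := by
      rw [hS₂, Finset.sum_comm]
      refine Finset.sum_congr rfl fun a _ => Finset.sum_congr rfl fun i _ => ?_
      rw [h₂ a i]; ring
    have e2 : S₁ = ∑ a, ∑ c, w a * v₁ a * (v₁ c * v₂ c a) := by
      rw [hS₁, Finset.sum_comm]
      refine Finset.sum_congr rfl fun a _ => Finset.sum_congr rfl fun i _ => ?_
      rw [h₂ a i]; ring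
    rw [e1, e2, Finset.mul_sum, Finset.mul_sum, ← Finset.sum_sub_distrib,
      ← Finset.sum_sub_distrib, ← Finset.sum_add_distrib]
    refine Finset.sum_congr rfl fun a _ => ?_
    rw [hZ a, ← Finset.mul_sum, ← Finset.mul_sum, ← Finset.mul_sum]; ring
  have hT₃ : ∑ i, F i * v₁ i * ∑ a, w a * v₃ a i = -(k / q₀ * ∑ i, F i * v₁ i * q₁ i) - 2 * S₂
      - ∑ i, ∑ a, F i * v₁ i * (w a * e₁ a i) := by
    rw [hS₂, Finset.mul_sum, Finset.mul_sum, ← Finset.sum_neg_distrib, ← Finset.sum_sub_distrib,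
      ← Finset.sum_sub_distrib]
    refine Finset.sum_congr rfl fun c _ => ?_
    rw [hY c, ← Finset.mul_sum, ← Finset.mul_sum]; ring
  -- The second-order condition at the maximum, with the first-order condition inserted into the
  -- term that contains q₁.
  have hA : ∑ i, F i * ∑ a, w a * (1 / 2 * v₄ a i + v₂ a i ^ 2 + v₁ a * v₃ i a + e₂ a i)
      ≤ ∑ i, F i * ((q₁ i / q₀) ^ 2 * k - q₂ i / q₀ * k) := by
    refine Finset.sum_le_sum fun i _ => mul_le_mul_of_nonneg_left ?_ (hF i)
    have h1 := max₁ i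
    have h2 := max₂ i
    set X := ∑ a, w a * (v₃ a i + 2 * v₁ a * v₂ a i + e₁ a i)
    have hX : X = -(q₁ i * k / q₀) := by field_simp; linarith
    rw [hX] at h2
    have : (q₁ i / q₀) ^ 2 * k - q₂ i / q₀ * k = (q₁ i * (q₁ i * k / q₀) - q₂ i * k) / q₀ := by
      field_simp
    rw [this, le_div_iff₀ hq₀]
    linarith
  have hB : ∑ i, w i * f₂ i ≤ ∑ i, w i * ∑ a, F a * (1 / 2 * v₄ a i + v₂ a i ^ 2 + v₁ a * v₃ i a
      + e₂ a i - 1 / 2 * (∑ c, (v₂ c i ^ 2 + v₁ c * v₃ i c) + e₃ i)) :=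
    Finset.sum_le_sum fun i _ => mul_le_mul_of_nonneg_left (eqn₂ i) (hw i)
  -- Exchanging the roles of i and a leaves the fourth-order and squared second-order terms of the
  -- double sum unchanged, because v₄ and v₂ are symmetric. Only the v₁v₃ terms, the errors e₂, and
  -- the contribution of −½|∇u|² distinguish the two sides.
  have hB' : ∑ i, w i * ∑ a, F a * (1 / 2 * v₄ a i + v₂ a i ^ 2 + v₁ a * v₃ i a
      + e₂ a i - 1 / 2 * (∑ c, (v₂ c i ^ 2 + v₁ c * v₃ i c) + e₃ i))
      = ∑ i, F i * ∑ a, w a * (1 / 2 * v₄ a i + v₂ a i ^ 2 + v₁ a * v₃ i a + e₂ a i)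
        - ∑ i, ∑ a, F i * w a * (e₂ a i - e₂ i a)
        - (∑ a, w a * v₁ a * ∑ i, F i * v₃ i a) + (∑ i, F i * v₁ i * ∑ a, w a * v₃ a i)
        - 1 / 2 * Φ * (∑ i, w i * ∑ c, v₂ c i ^ 2 + (∑ c, v₁ c * ∑ a, w a * v₃ a c)
          + ∑ i, w i * e₃ i) := by
    have e1 : ∑ c, v₁ c * ∑ a, w a * v₃ a c = ∑ i, w i * ∑ c, v₁ c * v₃ i c := by
      simp only [Finset.mul_sum]
      rw [Finset.sum_comm]
      exact Finset.sum_congr rfl fun a _ => Finset.sum_congr rfl fun i _ => by ring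
    have e2 : ∑ i, w i * ∑ c, v₂ c i ^ 2 + (∑ i, w i * ∑ c, v₁ c * v₃ i c) + ∑ i, w i * e₃ i
        = ∑ i, w i * (∑ c, (v₂ c i ^ 2 + v₁ c * v₃ i c) + e₃ i) := by
      rw [← Finset.sum_add_distrib, ← Finset.sum_add_distrib]
      refine Finset.sum_congr rfl fun i _ => ?_
      rw [Finset.sum_add_distrib]; ring
    have e3 : ∑ i, w i * ∑ a, F a * (1 / 2 * v₄ a i + v₂ a i ^ 2 + v₁ a * v₃ i a
        + e₂ a i - 1 / 2 * (∑ c, (v₂ c i ^ 2 + v₁ c * v₃ i c) + e₃ i))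
        = ∑ i, w i * (∑ a, F a * (1 / 2 * v₄ a i + v₂ a i ^ 2 + v₁ a * v₃ i a
        + e₂ a i)) - 1 / 2 * Φ * ∑ i, w i * (∑ c, (v₂ c i ^ 2 + v₁ c * v₃ i c) + e₃ i) := by
      rw [Finset.mul_sum, ← Finset.sum_sub_distrib]
      refine Finset.sum_congr rfl fun i _ => ?_
      rw [hΦ, show 1 / 2 * (∑ i, F i) * (w i * (∑ c, (v₂ c i ^ 2 + v₁ c * v₃ i c) + e₃ i))
        = w i * ((∑ i, F i) * (1 / 2 * (∑ c, (v₂ c i ^ 2 + v₁ c * v₃ i c) + e₃ i))) by ring,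
        Finset.sum_mul, ← mul_sub, ← Finset.sum_sub_distrib]
      congr 1
      exact Finset.sum_congr rfl fun a _ => by ring
    have e4 : ∑ i, w i * (∑ a, F a * (1 / 2 * v₄ a i + v₂ a i ^ 2 + v₁ a * v₃ i a + e₂ a i))
        = ∑ i, F i * ∑ a, w a * (1 / 2 * v₄ a i + v₂ a i ^ 2 + v₁ a * v₃ i a + e₂ a i)
        - ∑ i, ∑ a, F i * w a * (e₂ a i - e₂ i a)
        - (∑ a, w a * v₁ a * ∑ i, F i * v₃ i a) + (∑ i, F i * v₁ i * ∑ a, w a * v₃ a i) := by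
      simp only [Finset.mul_sum]
      rw [Finset.sum_comm]
      have : ∑ a, ∑ i, w a * v₁ a * (F i * v₃ i a) = ∑ i, ∑ a, w a * v₁ a * (F i * v₃ i a) :=
        Finset.sum_comm
      rw [this]
      simp only [← Finset.sum_sub_distrib, ← Finset.sum_add_distrib]
      refine Finset.sum_congr rfl fun i _ => Finset.sum_congr rfl fun a _ => ?_
      rw [h₂ i a, h₄ i a]; ring
    rw [e1, e2, e3, e4]
  -- The coefficients of S₁ add up to −Φ + Φ and those of S₂ to 2 − 2.
  rw [hB', hT₁, hT₂, hT₃] at hB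
  linarith

/-- Bookkeeping with X = κ²/q and Y = κ³/√q. Every term is at most Φ(n + 1)²M⁴ times a multiple of
κ², X or Y; terms lacking the factor Φ receive it from 1 ≤ Φ. The factor 100 is generous. -/
lemma error_sum_le {n M Φ κ X Y : ℝ} (hn : 0 ≤ n) (hM : 1 ≤ M) (hΦ : 1 ≤ Φ) (hX : 0 ≤ X)
    (hY : 0 ≤ Y) :
    Φ * ((M ^ 2 + M) * X) + n * (2 * (M * κ ^ 2))
        + 1 / 2 * Φ * (n * (2 * (M * κ ^ 2))) + n * (n * (Φ * 2 * (2 * (M * κ ^ 2))))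
        + 1 / 2 * Φ * (n * M ^ 2 * Y + n * (n * (M * κ * (2 * (M * κ)))))
        + n * (2 * (M * κ) * (M * κ)) + n * (n * (2 * (M * κ) * (Φ * (M * κ))))
        + Φ * (n * M ^ 2 * Y) + n * (n * (Φ * (M * κ) * (2 * (M * κ))))
      ≤ 1 / 2 * Φ * (100 * (n + 1) ^ 2 * M ^ 4 * (κ ^ 2 + X + Y)) := by
  have hM0 : 0 ≤ M := by linarith
  have hκ : 0 ≤ κ ^ 2 := sq_nonneg _
  have m1 : M ≤ M ^ 2 := by nlinarith
  have m2 : M ^ 2 ≤ M ^ 4 := pow_le_pow_right₀ hM (by norm_num)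
  have n1 : n ≤ (n + 1) ^ 2 := by nlinarith
  have n2 : n * n ≤ (n + 1) ^ 2 := by nlinarith
  have n3 : 1 ≤ (n + 1) ^ 2 := by nlinarith
  have p1 : n * (2 * (M * κ ^ 2)) ≤ Φ * (n * (2 * (M * κ ^ 2))) :=
    le_mul_of_one_le_left (by positivity) hΦ
  have p2 : n * (2 * (M * κ) * (M * κ)) ≤ Φ * (n * (2 * (M * κ) * (M * κ))) :=
    le_mul_of_one_le_left (by
      rw [show n * (2 * (M * κ) * (M * κ)) = n * (2 * (M ^ 2 * κ ^ 2)) by ring]; positivity) hΦ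
  set P := (n + 1) ^ 2 * M ^ 4 with hP
  have b1 : M ^ 2 + M ≤ 2 * P := by
    have : 1 * M ^ 4 ≤ (n + 1) ^ 2 * M ^ 4 := mul_le_mul_of_nonneg_right n3 (by positivity)
    rw [hP]; linarith
  have b2 : n * M ≤ P := by
    rw [hP]; exact mul_le_mul n1 (m1.trans m2) hM0 (by positivity)
  have b3 : n * n * M ≤ P := by
    rw [hP]; exact mul_le_mul n2 (m1.trans m2) hM0 (by positivity)
  have b4 : n * M ^ 2 ≤ P := by
    rw [hP]; exact mul_le_mul n1 m2 (by positivity) (by positivity)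
  have b5 : n * n * M ^ 2 ≤ P := by
    rw [hP]; exact mul_le_mul n2 m2 (by positivity) (by positivity)
  have q1 := mul_le_mul_of_nonneg_right b1 hX
  have q2 := mul_le_mul_of_nonneg_right b2 hκ
  have q3 := mul_le_mul_of_nonneg_right b3 hκ
  have q4 := mul_le_mul_of_nonneg_right b4 hκ
  have q5 := mul_le_mul_of_nonneg_right b5 hκ
  have q6 := mul_le_mul_of_nonneg_right b4 hY
  have hP0 : 0 ≤ P := by positivity
  have hPX : 0 ≤ P * X := by positivity
  have hPY : 0 ≤ P * Y := by positivity
  have hPκ : 0 ≤ P * κ ^ 2 := by positivity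
  have inner : (M ^ 2 + M) * X + n * (2 * (M * κ ^ 2)) + 1 / 2 * (n * (2 * (M * κ ^ 2)))
      + n * (n * (2 * (2 * (M * κ ^ 2))))
      + 1 / 2 * (n * M ^ 2 * Y + n * (n * (M * κ * (2 * (M * κ)))))
      + n * (2 * (M * κ) * (M * κ)) + n * (n * (2 * (M * κ) * (M * κ)))
      + n * M ^ 2 * Y + n * (n * ((M * κ) * (2 * (M * κ))))
      ≤ 1 / 2 * (100 * P * (κ ^ 2 + X + Y)) := by
    have e : (M ^ 2 + M) * X + n * (2 * (M * κ ^ 2)) + 1 / 2 * (n * (2 * (M * κ ^ 2)))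
      + n * (n * (2 * (2 * (M * κ ^ 2))))
      + 1 / 2 * (n * M ^ 2 * Y + n * (n * (M * κ * (2 * (M * κ)))))
      + n * (2 * (M * κ) * (M * κ)) + n * (n * (2 * (M * κ) * (M * κ)))
      + n * M ^ 2 * Y + n * (n * ((M * κ) * (2 * (M * κ))))
      = (M ^ 2 + M) * X + 3 * (n * M * κ ^ 2) + 4 * (n * n * M * κ ^ 2)
        + 3 / 2 * (n * M ^ 2 * Y) + 5 * (n * n * M ^ 2 * κ ^ 2) + 2 * (n * M ^ 2 * κ ^ 2) := by ring
    rw [e]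
    have e' : 1 / 2 * (100 * P * (κ ^ 2 + X + Y)) = 50 * (P * κ ^ 2) + 50 * (P * X) + 50 * (P * Y) := by
      ring
    rw [e']
    linarith
  have h := mul_le_mul_of_nonneg_left inner (zero_le_one.trans hΦ)
  have e : 100 * (n + 1) ^ 2 * M ^ 4 = 100 * P := by rw [hP]; ring
  rw [e]
  calc _ ≤ _ := add_le_add_left (add_le_add_left (add_le_add_left (add_le_add
        (add_le_add_left (add_le_add_left (add_le_add_left (add_le_add_right p1 _) _) _) _) p2) _) _) _
    _ = _ := by ring
    _ ≤ _ := h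
    _ = _ := by ring

set_option maxHeartbeats 800000 in
/-- The maximum principle estimate at an interior maximum. -/
lemma exists_interior_bound (ι : Type*) [Fintype ι] {M : ℝ} (hM : 1 ≤ M) :
    ∃ C : ℝ, 0 ≤ C ∧ ∀ (F w v₁ q₁ q₂ f₁ f₂ e₃ : ι → ℝ) (v₂ v₃ v₄ e₁ e₂ : ι → ι → ℝ)
      (q₀ k κ : ℝ), 0 < q₀ → q₀ ≤ M → (∀ i, 0 ≤ F i) → 1 ≤ ∑ i, F i →
      (∀ i, 1 ≤ w i) → (∀ i, w i ≤ 2) →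
      (∀ i j, v₂ i j = v₂ j i) → (∀ i j, v₄ i j = v₄ j i) →
      (∀ i, q₀ * (∑ a, w a * (v₃ a i + 2 * v₁ a * v₂ a i + e₁ a i)) + q₁ i * k = 0) →
      (∀ i, q₀ * (∑ a, w a * (1 / 2 * v₄ a i + v₂ a i ^ 2 + v₁ a * v₃ i a + e₂ a i))
        + q₁ i * (∑ a, w a * (v₃ a i + 2 * v₁ a * v₂ a i + e₁ a i)) + q₂ i * k ≤ 0) →
      (∀ i, ∑ a, F a * (v₃ a i + 2 * v₁ a * v₂ a i + e₁ a i - ∑ c, v₁ c * v₂ c i) = f₁ i) →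
      (∀ i, f₂ i ≤ ∑ a, F a * (1 / 2 * v₄ a i + v₂ a i ^ 2 + v₁ a * v₃ i a + e₂ a i
        - 1 / 2 * (∑ c, (v₂ c i ^ 2 + v₁ c * v₃ i c) + e₃ i))) →
      0 ≤ k → 1 ≤ κ → κ ^ 2 = 1 + k →
      (∀ i, |v₁ i| ≤ M * κ) → (∀ i j, |e₁ i j| ≤ M * κ) → (∀ i j, |e₂ i j| ≤ M * κ ^ 2) →
      (∀ i, |e₃ i| ≤ M * κ ^ 2) → (∀ i, |f₁ i| ≤ M * κ) → (∀ i, |f₂ i| ≤ M * κ ^ 2) →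
      (∀ i, |q₁ i| ≤ M * √q₀) → (∀ i, |q₂ i| ≤ M) →
      κ ^ 4 ≤ M * (1 + ∑ i, ∑ c, v₂ c i ^ 2) → q₀ * (1 + k) ≤ C := by
  set n : ℝ := (Fintype.card ι : ℝ) with hn
  have hn0 : 0 ≤ n := Nat.cast_nonneg _
  set C₁ : ℝ := 100 * (n + 1) ^ 2 * M ^ 4 with hC₁
  set B : ℝ := 2 * M * C₁ with hB
  have hC₁0 : 0 ≤ C₁ := by positivity
  have hB0 : 0 ≤ B := by positivity
  refine ⟨2 * B * (M + 1) + B ^ 2, by positivity, ?_⟩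
  intro F w v₁ q₁ q₂ f₁ f₂ e₃ v₂ v₃ v₄ e₁ e₂ q₀ k κ hq₀ hq₀M hF hFs hw1 hw2 h₂ h₄ max₁ max₂ eqn₁ eqn₂
    hk hκ hκk hv₁ he₁ he₂ he₃ hf₁ hf₂ hq₁ hq₂ hkey
  have main := hessian_sum_le hq₀ hF (fun i => zero_le_one.trans (hw1 i)) h₂ h₄ max₁ max₂ eqn₁ eqn₂
  set Φ := ∑ i, F i with hΦ
  have hM0 : 0 ≤ M := by linarith
  have hκ0 : 0 ≤ κ := by linarith
  have hΦ0 : 0 ≤ Φ := by linarith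
  have hFa : ∀ i, |F i| ≤ Φ := fun i => by
    rw [abs_of_nonneg (hF i)]
    exact Finset.single_le_sum (fun j _ => hF j) (Finset.mem_univ i)
  have hwa : ∀ i, |w i| ≤ 2 := fun i => by
    rw [abs_of_nonneg (zero_le_one.trans (hw1 i))]; exact hw2 i
  set ρ : ℝ := √q₀ with hρ
  have hρ0 : 0 < ρ := Real.sqrt_pos.2 hq₀
  have hρ2 : ρ ^ 2 = q₀ := Real.sq_sqrt hq₀.le
  have hkκ : k ≤ κ ^ 2 := by linarith
  -- each term of the right-hand side
  have t₁ : ∑ i, F i * ((q₁ i / q₀) ^ 2 * k - q₂ i / q₀ * k)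
      ≤ Φ * ((M ^ 2 + M) * κ ^ 2 / q₀) := by
    rw [hΦ, Finset.sum_mul]
    refine Finset.sum_le_sum fun i _ => mul_le_mul_of_nonneg_left ?_ (hF i)
    -- The bound |∇q| ≤ M√q, valid for a weight that is a square, turns (q₁/q)²k into a term of
    -- order k/q.
    have a1 : q₁ i ^ 2 ≤ M ^ 2 * q₀ := by
      rw [← hρ2, ← mul_pow, ← sq_abs (q₁ i)]
      exact pow_le_pow_left₀ (abs_nonneg _) (hq₁ i) 2
    have a2 : -q₂ i ≤ M := (neg_le_abs _).trans (hq₂ i)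
    have e : (q₁ i / q₀) ^ 2 * k - q₂ i / q₀ * k = (q₁ i ^ 2 / q₀ + -q₂ i) * k / q₀ := by
      field_simp; ring
    rw [e]
    gcongr
    · rw [div_le_iff₀ hq₀]; exact a1
  have t₂ : |∑ i, w i * f₂ i| ≤ n * (2 * (M * κ ^ 2)) :=
    abs_sum_le_card_mul fun i => abs_mul_le_mul (hwa i) (hf₂ i)
  have t₃ : |∑ i, w i * e₃ i| ≤ n * (2 * (M * κ ^ 2)) :=
    abs_sum_le_card_mul fun i => abs_mul_le_mul (hwa i) (he₃ i)
  have t₄ : |∑ i, ∑ a, F i * w a * (e₂ a i - e₂ i a)| ≤ n * (n * (Φ * 2 * (2 * (M * κ ^ 2)))) :=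
    abs_sum_le_card_mul fun i => abs_sum_le_card_mul fun a =>
      abs_mul_le_mul (abs_mul_le_mul (hFa i) (hwa a))
        ((abs_sub _ _).trans (by linarith [he₂ a i, he₂ i a]))
  have t₅ : |∑ c, v₁ c * q₁ c| ≤ n * (M * κ * (M * ρ)) :=
    abs_sum_le_card_mul fun i => abs_mul_le_mul (hv₁ i) (hq₁ i)
  have t₆ : |∑ c, ∑ a, v₁ c * (w a * e₁ a c)| ≤ n * (n * (M * κ * (2 * (M * κ)))) :=
    abs_sum_le_card_mul fun i => abs_sum_le_card_mul fun a =>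
      abs_mul_le_mul (hv₁ i) (abs_mul_le_mul (hwa a) (he₁ a i))
  have t₇ : |∑ a, w a * v₁ a * f₁ a| ≤ n * (2 * (M * κ) * (M * κ)) :=
    abs_sum_le_card_mul fun i => abs_mul_le_mul (abs_mul_le_mul (hwa i) (hv₁ i)) (hf₁ i)
  have t₈ : |∑ a, ∑ i, w a * v₁ a * (F i * e₁ i a)| ≤ n * (n * (2 * (M * κ) * (Φ * (M * κ)))) :=
    abs_sum_le_card_mul fun a => abs_sum_le_card_mul fun i =>
      abs_mul_le_mul (abs_mul_le_mul (hwa a) (hv₁ a)) (abs_mul_le_mul (hFa i) (he₁ i a))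
  have t₉ : |∑ i, F i * v₁ i * q₁ i| ≤ n * (Φ * (M * κ) * (M * ρ)) :=
    abs_sum_le_card_mul fun i => abs_mul_le_mul (abs_mul_le_mul (hFa i) (hv₁ i)) (hq₁ i)
  have t₁₀ : |∑ i, ∑ a, F i * v₁ i * (w a * e₁ a i)| ≤ n * (n * (Φ * (M * κ) * (2 * (M * κ)))) :=
    abs_sum_le_card_mul fun i => abs_sum_le_card_mul fun a =>
      abs_mul_le_mul (abs_mul_le_mul (hFa i) (hv₁ i)) (abs_mul_le_mul (hwa a) (he₁ a i))
  have hkq : |k / q₀| ≤ κ ^ 2 / q₀ := by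
    rw [abs_of_nonneg (by positivity)]; gcongr
  have t₅' : |k / q₀ * ∑ c, v₁ c * q₁ c| ≤ κ ^ 2 / q₀ * (n * (M * κ * (M * ρ))) :=
    abs_mul_le_mul hkq t₅
  have t₉' : |k / q₀ * ∑ i, F i * v₁ i * q₁ i| ≤ κ ^ 2 / q₀ * (n * (Φ * (M * κ) * (M * ρ))) :=
    abs_mul_le_mul hkq t₉
  set V := ∑ i, ∑ c, v₂ c i ^ 2 with hV
  -- All weights are at least 1, so the good term controls the whole Hessian; this is one reason for
  -- including the trace in the test quantity.
  have hVw : V ≤ ∑ i, w i * ∑ c, v₂ c i ^ 2 := by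
    refine Finset.sum_le_sum fun i _ => ?_
    exact le_mul_of_one_le_left (Finset.sum_nonneg fun c _ => sq_nonneg _) (hw1 i)
  have hκ2 : κ ^ 2 / q₀ = κ ^ 2 / ρ ^ 2 := by rw [hρ2]
  -- the sum of the terms
  have hVb : V ≤ C₁ * (κ ^ 2 + κ ^ 2 / q₀ + κ ^ 3 / ρ) := by
    have hΦV : 1 / 2 * Φ * V ≤ Φ * ((M ^ 2 + M) * κ ^ 2 / q₀) + n * (2 * (M * κ ^ 2))
        + 1 / 2 * Φ * (n * (2 * (M * κ ^ 2))) + n * (n * (Φ * 2 * (2 * (M * κ ^ 2))))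
        + 1 / 2 * Φ * (κ ^ 2 / q₀ * (n * (M * κ * (M * ρ))) + n * (n * (M * κ * (2 * (M * κ)))))
        + n * (2 * (M * κ) * (M * κ)) + n * (n * (2 * (M * κ) * (Φ * (M * κ))))
        + κ ^ 2 / q₀ * (n * (Φ * (M * κ) * (M * ρ)))
        + n * (n * (Φ * (M * κ) * (2 * (M * κ)))) := by
      have s1 : 1 / 2 * Φ * V ≤ 1 / 2 * Φ * ∑ i, w i * ∑ c, v₂ c i ^ 2 :=
        mul_le_mul_of_nonneg_left hVw (by positivity)
      have s3 : -(1 / 2 * Φ * ∑ i, w i * e₃ i) ≤ 1 / 2 * Φ * (n * (2 * (M * κ ^ 2))) := by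
        rw [← mul_neg]
        exact mul_le_mul_of_nonneg_left ((neg_le_abs _).trans t₃) (by positivity)
      have s5 : 1 / 2 * Φ * (k / q₀ * ∑ c, v₁ c * q₁ c + ∑ c, ∑ a, v₁ c * (w a * e₁ a c))
          ≤ 1 / 2 * Φ * (κ ^ 2 / q₀ * (n * (M * κ * (M * ρ)))
            + n * (n * (M * κ * (2 * (M * κ))))) :=
        mul_le_mul_of_nonneg_left (add_le_add ((le_abs_self _).trans t₅')
          ((le_abs_self _).trans t₆)) (by positivity)
      linarith [neg_le_abs (∑ i, w i * f₂ i), neg_le_abs (∑ i, ∑ a, F i * w a * (e₂ a i - e₂ i a)),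
        neg_le_abs (∑ a, w a * v₁ a * f₁ a), le_abs_self (∑ a, ∑ i, w a * v₁ a * (F i * e₁ i a)),
        neg_le_abs (k / q₀ * ∑ i, F i * v₁ i * q₁ i),
        neg_le_abs (∑ i, ∑ a, F i * v₁ i * (w a * e₁ a i))]
    have hcube : κ ^ 2 / q₀ * (κ * ρ) = κ ^ 3 / ρ := by
      rw [hκ2]; field_simp
    set X := κ ^ 2 / q₀ with hX
    set Y := κ ^ 3 / ρ with hY
    have hX0 : 0 ≤ X := by positivity
    have hY0 : 0 ≤ Y := by positivity
    have hκ20 : 0 ≤ κ ^ 2 := by positivity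
    have hle : 1 / 2 * Φ * V ≤ 1 / 2 * Φ * (C₁ * (κ ^ 2 + X + Y)) := by
      refine hΦV.trans ?_
      have e1 : (M ^ 2 + M) * κ ^ 2 / q₀ = (M ^ 2 + M) * X := by rw [hX]; ring
      have e2 : X * (n * (M * κ * (M * ρ))) = n * M ^ 2 * Y := by rw [← hcube]; ring
      have e3 : X * (n * (Φ * (M * κ) * (M * ρ))) = Φ * (n * M ^ 2 * Y) := by
        rw [← hcube]; ring
      rw [e1, e2, e3]
      exact error_sum_le hn0 hM hFs hX0 hY0
    exact le_of_mul_le_mul_left hle (by positivity)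
  -- conclusion
  have h4 : κ ^ 4 ≤ B * (κ ^ 2 + κ ^ 2 / q₀ + κ ^ 3 / ρ) := by
    have h1κ : 1 ≤ κ ^ 2 := one_le_pow₀ hκ
    have : 1 + V ≤ 2 * C₁ * (κ ^ 2 + κ ^ 2 / q₀ + κ ^ 3 / ρ) := by
      have hC1 : 1 ≤ C₁ := by
        rw [hC₁]
        have := one_le_mul_of_one_le_of_one_le (one_le_pow₀ (show 1 ≤ n + 1 by linarith) (n := 2))
          (one_le_pow₀ hM (n := 4))
        linarith
      have : 1 ≤ C₁ * (κ ^ 2 + κ ^ 2 / q₀ + κ ^ 3 / ρ) := by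
        have s : 1 ≤ κ ^ 2 + κ ^ 2 / q₀ + κ ^ 3 / ρ := by
          have : 0 ≤ κ ^ 2 / q₀ := by positivity
          have : 0 ≤ κ ^ 3 / ρ := by positivity
          linarith
        exact one_le_mul_of_one_le_of_one_le hC1 s
      linarith
    calc κ ^ 4 ≤ M * (1 + V) := hkey
      _ ≤ M * (2 * C₁ * (κ ^ 2 + κ ^ 2 / q₀ + κ ^ 3 / ρ)) := mul_le_mul_of_nonneg_left this hM0
      _ = B * (κ ^ 2 + κ ^ 2 / q₀ + κ ^ 3 / ρ) := by rw [hB]; ring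
  -- In y = √(q(1 + k)) the inequality for κ⁴ reads y² ≤ B(q + 1 + y), after multiplication by q/κ².
  -- Completing the square then bounds y².
  have hy : (ρ * κ) ^ 2 = q₀ * (1 + k) := by rw [mul_pow, hρ2, hκk]
  set y := ρ * κ with hyd
  have hy0 : 0 < y := mul_pos hρ0 (by linarith)
  have h5 : y ^ 2 ≤ B * (q₀ + 1 + y) := by
    have e : B * (κ ^ 2 + κ ^ 2 / q₀ + κ ^ 3 / ρ) * (ρ ^ 2 / κ ^ 2) = B * (q₀ + 1 + y) := by
      rw [hκ2, ← hρ2, hyd]; field_simp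
    have e' : κ ^ 4 * (ρ ^ 2 / κ ^ 2) = y ^ 2 := by rw [hyd]; field_simp
    rw [← e, ← e']
    exact mul_le_mul_of_nonneg_right h4 (by positivity)
  rw [← hy]
  have h6 : B * q₀ ≤ B * M := mul_le_mul_of_nonneg_left hq₀M hB0
  linarith [sq_nonneg (y - B), sub_sq y B]

end InteriorAlgebra

end BoundaryEstimate

end

noncomputable section

namespace BoundaryEstimate

open Finset Filter Topology Asymptotics

/-! ### Quadratic coordinates centred at a point -/

section AdaptedCoordinates

set_option linter.unusedSectionVars false

variable {ι : Type*} [Fintype ι] [DecidableEq ι]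

/-- The quadratic map `y ↦ x₀ + E y - ½ A(y, y)`. -/
def quadMap (x₀ : EuclideanSpace ℝ ι) (E : Matrix ι ι ℝ) (A : ι → ι → ι → ℝ)
    (y : EuclideanSpace ℝ ι) : EuclideanSpace ℝ ι :=
  WithLp.toLp 2 fun k => x₀ k + ∑ a, E k a * y a - 1 / 2 * ∑ a, ∑ b, A k a b * y a * y b

/-- The Jacobian matrix of `quadMap`. -/
def quadJac (E : Matrix ι ι ℝ) (A : ι → ι → ι → ℝ) (y : EuclideanSpace ℝ ι) : Matrix ι ι ℝ :=
  Matrix.of fun k a => E k a - ∑ b, A k a b * y b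

/-- The Christoffel symbols at `x₀` in the frame `E`. -/
def frameChristoffel (s : Set (EuclideanSpace ℝ ι)) (g : EuclideanSpace ℝ ι → Matrix ι ι ℝ)
    (x₀ : EuclideanSpace ℝ ι) (E : Matrix ι ι ℝ) (k a b : ι) : ℝ :=
  ∑ i, ∑ j, christoffel s g k i j x₀ * E i a * E j b

variable {x₀ : EuclideanSpace ℝ ι} {E : Matrix ι ι ℝ} {A : ι → ι → ι → ℝ}

lemma quadMap_zero : quadMap x₀ E A 0 = x₀ := by
  ext k; simp [quadMap]

lemma quadMap_line (i : ι) (t : ℝ) : quadMap x₀ E A (t • EuclideanSpace.single i 1)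
    = x₀ + t • WithLp.toLp 2 (fun k => E k i) + t ^ 2 • WithLp.toLp 2 (fun k => -1 / 2 * A k i i) := by
  ext k
  simp [quadMap]
  ring

lemma quadJac_line (i : ι) (t : ℝ) (k a : ι) :
    quadJac E A (t • EuclideanSpace.single i 1) k a = E k a + -A k a i * t := by
  simp [quadJac]; ring

lemma contDiff_coord (k : WithTop ℕ∞) (i : ι) : ContDiff ℝ k fun y : EuclideanSpace ℝ ι => y i :=
  contDiff_euclidean.1 contDiff_id i

lemma contDiff_quadMap (k : WithTop ℕ∞) (x₀ : EuclideanSpace ℝ ι) (E : Matrix ι ι ℝ)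
    (A : ι → ι → ι → ℝ) : ContDiff ℝ k (quadMap x₀ E A) := by
  rw [contDiff_euclidean]
  intro l
  have h := contDiff_coord (ι := ι) k
  have e : (fun y : EuclideanSpace ℝ ι => quadMap x₀ E A y l)
      = fun y => x₀ l + ∑ a, E l a * y a - 1 / 2 * ∑ a, ∑ b, A l a b * y a * y b := rfl
  rw [e]
  exact (contDiff_const.add (ContDiff.sum fun a _ => contDiff_const.mul (h a))).sub
    (contDiff_const.mul (ContDiff.sum fun a _ => ContDiff.sum fun b _ =>
      (contDiff_const.mul (h a)).mul (h b)))

lemma pd_coord {U : Set (EuclideanSpace ℝ ι)} (hU : GoodDomain U) {y : EuclideanSpace ℝ ι}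
    (hy : y ∈ U) (a b : ι) :
    pd U a (fun y : EuclideanSpace ℝ ι => y b) y = if b = a then 1 else 0 := by
  have h : HasFDerivWithinAt (fun y : EuclideanSpace ℝ ι => y b)
      (EuclideanSpace.proj b : EuclideanSpace ℝ ι →L[ℝ] ℝ) U y :=
    (EuclideanSpace.proj b : EuclideanSpace ℝ ι →L[ℝ] ℝ).hasFDerivWithinAt
  rw [pd_eq_of_hasFDerivWithinAt hU hy h]
  simp

lemma pd_quadMap {U : Set (EuclideanSpace ℝ ι)} (hU : GoodDomain U) {y : EuclideanSpace ℝ ι}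
    (hy : y ∈ U) (hA : ∀ k a b, A k a b = A k b a) (a k : ι) :
    pd U a (fun y => quadMap x₀ E A y k) y = quadJac E A y k a := by
  have hc : ∀ b : ι, DifferentiableWithinAt ℝ (fun y : EuclideanSpace ℝ ι => y b) U y := fun b =>
    ((contDiff_coord 1 b).differentiable one_ne_zero).differentiableAt.differentiableWithinAt
  have hcst : ∀ c : ℝ, DifferentiableWithinAt ℝ (fun _ : EuclideanSpace ℝ ι => c) U y := fun c =>
    differentiableWithinAt_const c
  have d1 : ∀ b, DifferentiableWithinAt ℝ (fun y : EuclideanSpace ℝ ι => E k b * y b) U y :=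
    fun b => (hcst _).fun_mul (hc b)
  have d2 : ∀ b c, DifferentiableWithinAt ℝ (fun y : EuclideanSpace ℝ ι => A k b c * y b) U y :=
    fun b c => (hcst _).fun_mul (hc b)
  have d3 : ∀ b c, DifferentiableWithinAt ℝ (fun y : EuclideanSpace ℝ ι => A k b c * y b * y c) U y :=
    fun b c => (d2 b c).fun_mul (hc c)
  have d4 : ∀ b, DifferentiableWithinAt ℝ
      (fun y : EuclideanSpace ℝ ι => ∑ c, A k b c * y b * y c) U y :=
    fun b => DifferentiableWithinAt.fun_sum fun c _ => d3 b c
  have d5 : DifferentiableWithinAt ℝ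
      (fun y : EuclideanSpace ℝ ι => ∑ b, ∑ c, A k b c * y b * y c) U y :=
    DifferentiableWithinAt.fun_sum fun b _ => d4 b
  have d6 : DifferentiableWithinAt ℝ (fun y : EuclideanSpace ℝ ι => ∑ b, E k b * y b) U y :=
    DifferentiableWithinAt.fun_sum fun b _ => d1 b
  have e : (fun y : EuclideanSpace ℝ ι => quadMap x₀ E A y k)
      = fun y => x₀ k + ∑ a, E k a * y a - 1 / 2 * ∑ a, ∑ b, A k a b * y a * y b := rfl
  rw [e, pd_sub hU hy ((hcst _).fun_add d6) ((hcst _).fun_mul d5), pd_add hU hy (hcst _) d6,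
    pd_const, pd_sum hU hy _ (fun b _ => d1 b), pd_const_mul hU hy _ d5,
    pd_sum hU hy _ (fun b _ => d4 b)]
  have e1 : ∀ b, pd U a (fun y : EuclideanSpace ℝ ι => E k b * y b) y
      = E k b * (if b = a then 1 else 0) := fun b => by
    rw [pd_const_mul hU hy _ (hc b), pd_coord hU hy]
  have e2 : ∀ b, pd U a (fun y : EuclideanSpace ℝ ι => ∑ c, A k b c * y b * y c) y
      = ∑ c, (A k b c * (if b = a then 1 else 0) * y c
        + A k b c * y b * (if c = a then 1 else 0)) := fun b => by
    rw [pd_sum hU hy _ (fun c _ => d3 b c)]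
    refine Finset.sum_congr rfl fun c _ => ?_
    rw [pd_mul hU hy (d2 b c) (hc c), pd_const_mul hU hy _ (hc b), pd_coord hU hy, pd_coord hU hy]
  simp only [e1, e2, quadJac, Matrix.of_apply, Finset.sum_add_distrib, mul_ite, mul_one, mul_zero,
    ite_mul, zero_mul, Finset.sum_ite_eq', Finset.mem_univ, if_true]
  have e3 : ∑ b, ∑ c, (if b = a then A k b c * y c else 0) = ∑ c, A k a c * y c := by
    rw [Finset.sum_comm]
    simp
  rw [e3]
  have e4 : ∑ b, A k b a * y b = ∑ c, A k a c * y c :=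
    Finset.sum_congr rfl fun b _ => by rw [hA]
  rw [e4]; ring

lemma contDiff_quadJac (n : WithTop ℕ∞) (E : Matrix ι ι ℝ) (A : ι → ι → ι → ℝ) (k a : ι) :
    ContDiff ℝ n (fun y => quadJac E A y k a) :=
  contDiff_const.sub (ContDiff.sum fun b _ => contDiff_const.mul (contDiff_coord n b))

lemma pd_quadJac {U : Set (EuclideanSpace ℝ ι)} (hU : GoodDomain U) {y : EuclideanSpace ℝ ι}
    (hy : y ∈ U) (k a b : ι) : pd U b (fun y => quadJac E A y k a) y = -A k a b := by
  have hc : ∀ b : ι, DifferentiableWithinAt ℝ (fun y : EuclideanSpace ℝ ι => y b) U y := fun b =>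
    ((contDiff_coord 1 b).differentiable one_ne_zero).differentiableAt.differentiableWithinAt
  have hcst : ∀ c : ℝ, DifferentiableWithinAt ℝ (fun _ : EuclideanSpace ℝ ι => c) U y := fun c =>
    differentiableWithinAt_const c
  have d1 : ∀ c, DifferentiableWithinAt ℝ (fun y : EuclideanSpace ℝ ι => A k a c * y c) U y :=
    fun c => (hcst _).fun_mul (hc c)
  have e : (fun y : EuclideanSpace ℝ ι => quadJac E A y k a)
      = fun y => E k a - ∑ b, A k a b * y b := rfl
  rw [e, pd_sub hU hy (hcst _) (DifferentiableWithinAt.fun_sum fun c _ => d1 c), pd_const,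
    pd_sum hU hy _ (fun c _ => d1 c)]
  have e1 : ∀ c, pd U b (fun y : EuclideanSpace ℝ ι => A k a c * y c) y
      = A k a c * (if c = b then 1 else 0) := fun c => by
    rw [pd_const_mul hU hy _ (hc c), pd_coord hU hy]
  simp [e1]

section Pullback

variable {s U : Set (EuclideanSpace ℝ ι)} {u : EuclideanSpace ℝ ι → ℝ}

lemma pd_pullback (hU : GoodDomain U) (hm : Set.MapsTo (quadMap x₀ E A) U s)
    (hA : ∀ k a b, A k a b = A k b a) {χ : EuclideanSpace ℝ ι → ℝ} (hχ : ContDiffOn ℝ 1 χ s)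
    {y : EuclideanSpace ℝ ι} (hy : y ∈ U) (a : ι) :
    pd U a (fun y => χ (quadMap x₀ E A y)) y
      = ∑ k, pd s k χ (quadMap x₀ E A y) * quadJac E A y k a := by
  rw [pd_comp hU hy hm (hχ.differentiableOn one_ne_zero _ (hm hy)) (fun k =>
    ((contDiff_euclidean.1 (contDiff_quadMap 1 x₀ E A) k).differentiable
      one_ne_zero).differentiableAt.differentiableWithinAt)]
  exact Finset.sum_congr rfl fun k _ => by rw [pd_quadMap hU hy hA]

/-- The coordinate map has constant second derivative −A, which accounts for the first-order term.
With A the Christoffel symbols in the frame, this term supplies the connection correction of the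
covariant Hessian at the centre. -/
lemma pd_pd_pullback (hs : GoodDomain s) (hU : GoodDomain U)
    (hm : Set.MapsTo (quadMap x₀ E A) U s)
    (hA : ∀ k a b, A k a b = A k b a) (hu : ContDiffOn ℝ 2 u s)
    {y : EuclideanSpace ℝ ι} (hy : y ∈ U) (a b : ι) :
    pd U b (pd U a (fun y => u (quadMap x₀ E A y))) y
      = ∑ k, ∑ l, pd s l (pd s k u) (quadMap x₀ E A y) * quadJac E A y l b * quadJac E A y k a
        - ∑ k, pd s k u (quadMap x₀ E A y) * A k a b := by
  have h1 : Set.EqOn (pd U a (fun y => u (quadMap x₀ E A y)))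
      (fun y => ∑ k, pd s k u (quadMap x₀ E A y) * quadJac E A y k a) U := fun z hz =>
    pd_pullback hU hm hA (hu.of_le (by norm_num)) hz a
  have hc : ∀ k, ContDiffOn ℝ 1 (pd s k u) s := fun k => by
    exact_mod_cast contDiffOn_pd hs (k := 2) (l := 1) (by exact_mod_cast hu) le_rfl k
  have d1 : ∀ k, DifferentiableWithinAt ℝ (fun y => pd s k u (quadMap x₀ E A y)) U y := fun k =>
    ((hc k).comp (contDiff_quadMap 1 x₀ E A).contDiffOn hm).differentiableOn one_ne_zero y hy
  have d2 : ∀ k, DifferentiableWithinAt ℝ (fun y => quadJac E A y k a) U y := fun k =>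
    ((contDiff_quadJac 1 E A k a).differentiable one_ne_zero).differentiableAt.differentiableWithinAt
  rw [pd_congr h1 hy, pd_sum hU hy _ (fun k _ => (d1 k).fun_mul (d2 k)), ← Finset.sum_sub_distrib]
  refine Finset.sum_congr rfl fun k _ => ?_
  rw [pd_mul hU hy (d1 k) (d2 k), pd_pullback hU hm hA (hc k) hy, pd_quadJac hU hy,
    Finset.sum_mul]
  ring

end Pullback

end AdaptedCoordinates

end BoundaryEstimate

end

noncomputable section

namespace BoundaryEstimate

open Finset Filter Topology Asymptotics

/-! ### Orthonormal frames along coordinate lines, to second order -/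

section FrameJets

set_option linter.unusedSectionVars false

/-- `BJet` only asserts that some bounded coefficients exist; uniqueness identifies the linear one
with an explicitly computed coefficient. -/
lemma Jet.linear_unique {φ : ℝ → ℝ} {a b c b' c' : ℝ} (h : Jet φ a b c) (h' : Jet φ a b' c') :
    b = b' := by
  have h1 := h.sub h'
  simp only [sub_self] at h1
  have := (h1.coeff_of_nonneg (Eventually.of_forall fun t => by simp)).1
  linarith

lemma Jet.eventually_abs_le {φ : ℝ → ℝ} {c M : ℝ} (h : Jet φ 0 0 c) (hM : |c| ≤ M) :
    ∀ᶠ t in 𝓝 0, |φ t| ≤ (M + 1) * t ^ 2 := by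
  filter_upwards [IsLittleO.def h one_pos] with t ht
  simp only [zero_mul, zero_add, Real.norm_eq_abs, one_mul, abs_pow, sq_abs] at ht
  have h1 : |φ t| ≤ |φ t - c * t ^ 2| + |c * t ^ 2| := by
    have := abs_add_le (φ t - c * t ^ 2) (c * t ^ 2)
    simpa using this
  have h2 : |c * t ^ 2| ≤ M * t ^ 2 := by
    rw [abs_mul, abs_of_nonneg (sq_nonneg t)]
    exact mul_le_mul_of_nonneg_right hM (sq_nonneg t)
  linarith

variable {ι : Type*} [Fintype ι] [DecidableEq ι]

lemma bjet_of_pdBound {s : Set (EuclideanSpace ℝ ι)} (hs : GoodDomain s)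
    {φ : EuclideanSpace ℝ ι → ℝ} (hφ : ContDiffOn ℝ 2 φ s) {x₀ : EuclideanSpace ℝ ι}
    (hx : s ∈ 𝓝 x₀) {M m₁ m₂ : ℝ} (hM : PdBound s 2 M φ) {a b : EuclideanSpace ℝ ι}
    (ha : ∀ k, |a k| ≤ m₁) (hb : ∀ k, |b k| ≤ m₂) :
    BJet (Fintype.card ι * (M * m₁) + (Fintype.card ι * (M * m₂)
      + 1 / 2 * (Fintype.card ι * (Fintype.card ι * (M * m₁ * m₁)))))
      (fun t => φ (x₀ + t • a + t ^ 2 • b)) (φ x₀) := by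
  have hx0 := mem_of_mem_nhds hx
  have p1 : ∀ k, |pd s k φ x₀| ≤ M := fun k => (hM.2 k).abs_le x₀ hx0
  have p2 : ∀ k l, |pd s l (pd s k φ) x₀| ≤ M := fun k l => ((hM.2 k).2 l).abs_le x₀ hx0
  have h1 : |∑ k, pd s k φ x₀ * a k| ≤ Fintype.card ι * (M * m₁) :=
    abs_sum_le_card_mul fun k => abs_mul_le_mul (p1 k) (ha k)
  have h2 : |∑ k, pd s k φ x₀ * b k| ≤ Fintype.card ι * (M * m₂) :=
    abs_sum_le_card_mul fun k => abs_mul_le_mul (p1 k) (hb k)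
  have h3 : |1 / 2 * ∑ k, ∑ l, pd s l (pd s k φ) x₀ * a k * a l|
      ≤ 1 / 2 * (Fintype.card ι * (Fintype.card ι * (M * m₁ * m₁))) := by
    rw [abs_mul, abs_of_pos (by norm_num : (0 : ℝ) < 1 / 2)]
    refine mul_le_mul_of_nonneg_left ?_ (by norm_num)
    exact abs_sum_le_card_mul fun k => abs_sum_le_card_mul fun l =>
      abs_mul_le_mul (abs_mul_le_mul (p2 k l) (ha k)) (ha l)
  have q1 := (abs_nonneg _).trans h1
  have q2 := (abs_nonneg _).trans h2
  have q3 := (abs_nonneg _).trans h3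
  refine ⟨_, _, ?_, ?_, jet_along_parabola hs hφ hx a b⟩
  · linarith
  · refine (abs_add_le _ _).trans ?_
    linarith

/-- The constant bounding the Christoffel symbols in an orthonormal frame. -/
lemma abs_frameChristoffel_le {s : Set (EuclideanSpace ℝ ι)}
    {g : EuclideanSpace ℝ ι → Matrix ι ι ℝ} {x₀ : EuclideanSpace ℝ ι} (hx : x₀ ∈ s)
    {E : Matrix ι ι ℝ} {M m : ℝ} (hM : ∀ k i j, PdBound s 2 M (christoffel s g k i j))
    (hE : ∀ i a, |E i a| ≤ m) (k a b : ι) :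
    |frameChristoffel s g x₀ E k a b| ≤ Fintype.card ι * (Fintype.card ι * (M * m * m)) :=
  abs_sum_le_card_mul fun i => abs_sum_le_card_mul fun j =>
    abs_mul_le_mul (abs_mul_le_mul ((hM k i j).abs_le x₀ hx) (hE i a)) (hE j b)

lemma frameChristoffel_symm {s : Set (EuclideanSpace ℝ ι)} {θ G : ℝ}
    {g : EuclideanSpace ℝ ι → Matrix ι ι ℝ} (h : IsControlledMetric s θ G g)
    {x₀ : EuclideanSpace ℝ ι} (hx : x₀ ∈ s) (E : Matrix ι ι ℝ) (k a b : ι) :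
    frameChristoffel s g x₀ E k a b = frameChristoffel s g x₀ E k b a := by
  rw [frameChristoffel, Finset.sum_comm, frameChristoffel]
  refine Finset.sum_congr rfl fun i _ => Finset.sum_congr rfl fun j _ => ?_
  rw [h.christoffel_symm hx k j i]; ring

lemma isFrame_apply {h E : Matrix ι ι ℝ} (hE : IsFrame h E) (a b : ι) :
    ∑ i, ∑ j, h i j * E i a * E j b = (1 : Matrix ι ι ℝ) a b := by
  rw [← conj_apply, hE]

/-- The pulled back metric is Euclidean up to terms of second order. -/
lemma gram_linear_eq_zero {s : Set (EuclideanSpace ℝ ι)} {θ G : ℝ}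
    {g : EuclideanSpace ℝ ι → Matrix ι ι ℝ} (h : IsControlledMetric s θ G g)
    {x₀ : EuclideanSpace ℝ ι} (hx : x₀ ∈ s) (E : Matrix ι ι ℝ) (i a b : ι) :
    ∑ k, ∑ l, ((g x₀ k l * E k a) * -frameChristoffel s g x₀ E l b i
      + (g x₀ k l * -frameChristoffel s g x₀ E k a i
        + (∑ p, pd s p (fun y => g y k l) x₀ * E p i) * E k a) * E l b) = 0 := by
  set A := frameChristoffel s g x₀ E with hA
  -- Metric compatibility: the derivative of g along the i-th frame vector is compensated exactly by
  -- the two terms in which the Jacobian E − A·y varies.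
  have key : ∑ k, ∑ l, (∑ p, pd s p (fun y => g y k l) x₀ * E p i) * E k a * E l b
      = ∑ k, ∑ l, g x₀ k l * E k a * A l b i + ∑ k, ∑ l, g x₀ k l * A k a i * E l b := by
    have e1 : ∀ k b, ∑ l, ∑ p, (∑ q, g x₀ k q * christoffel s g q p l x₀) * E p i * E l b
        = ∑ q, g x₀ k q * A q b i := by
      intro k b
      rw [Finset.sum_comm]
      simp only [hA, frameChristoffel, Finset.mul_sum, Finset.sum_mul]
      have : ∀ q, ∑ i_1, ∑ i_2, g x₀ k q * (christoffel s g q i_1 i_2 x₀ * E i_1 b * E i_2 i)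
          = ∑ p, ∑ l, g x₀ k q * christoffel s g q p l x₀ * E p i * E l b := by
        intro q
        rw [Finset.sum_comm]
        refine Finset.sum_congr rfl fun p _ => Finset.sum_congr rfl fun l _ => ?_
        rw [h.christoffel_symm hx q l p]; ring
      simp only [this]
      rw [Finset.sum_comm' (t' := Finset.univ) (s' := fun _ => Finset.univ) (by simp)]
      have : ∀ l, ∑ p, ∑ q, g x₀ k q * christoffel s g q p l x₀ * E p i * E l b
        = ∑ q, ∑ p, g x₀ k q * christoffel s g q p l x₀ * E p i * E l b :=
          fun l => Finset.sum_comm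
      simp only [this]
      rw [Finset.sum_comm]
      exact Finset.sum_congr rfl fun q _ => Finset.sum_comm
    have e2 : ∀ k l, (∑ p, pd s p (fun y => g y k l) x₀ * E p i) * E k a * E l b
        = (∑ p, (∑ q, g x₀ l q * christoffel s g q p k x₀) * E p i * E k a) * E l b
          + E k a * (∑ p, (∑ q, g x₀ k q * christoffel s g q p l x₀) * E p i * E l b) := by
      intro k l
      rw [Finset.sum_mul, Finset.sum_mul, Finset.sum_mul, Finset.mul_sum, ← Finset.sum_add_distrib]
      refine Finset.sum_congr rfl fun p _ => ?_
      rw [h.pd_eq_sum_christoffel hx p k l]; ring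
    simp only [e2, Finset.sum_add_distrib]
    rw [add_comm]
    congr 1
    · refine Finset.sum_congr rfl fun k _ => ?_
      rw [← Finset.mul_sum, e1, Finset.mul_sum]
      exact Finset.sum_congr rfl fun q _ => by ring
    · rw [Finset.sum_comm]
      have : ∀ l, ∑ k, (∑ p, (∑ q, g x₀ l q * christoffel s g q p k x₀) * E p i * E k a) * E l b
          = ∑ k, g x₀ l k * A k a i * E l b := by
        intro l
        rw [← Finset.sum_mul, e1, Finset.sum_mul]
      simp only [this]
      rw [Finset.sum_comm]
      refine Finset.sum_congr rfl fun k _ => Finset.sum_congr rfl fun l _ => ?_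
      rw [h.symm hx l k]
  have e : ∀ k l, (g x₀ k l * E k a) * -A l b i
      + (g x₀ k l * -A k a i + (∑ p, pd s p (fun y => g y k l) x₀ * E p i) * E k a) * E l b
      = (∑ p, pd s p (fun y => g y k l) x₀ * E p i) * E k a * E l b
        - (g x₀ k l * E k a * A l b i + g x₀ k l * A k a i * E l b) := fun k l => by ring
  simp only [e, Finset.sum_sub_distrib, Finset.sum_add_distrib]
  rw [key]; ring

/-- Along a coordinate line of the adapted coordinates, the coordinate frame can be corrected to
an orthonormal frame by a matrix that is the identity up to terms of second order. -/
lemma exists_frame_along (ι : Type*) [Fintype ι] [DecidableEq ι] {θ G : ℝ} (hθ : 0 < θ) :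
    ∃ M : ℝ, 0 ≤ M ∧ ∀ (s : Set (EuclideanSpace ℝ ι)) (g : EuclideanSpace ℝ ι → Matrix ι ι ℝ),
      IsControlledMetric s θ G g → ∀ (x₀ : EuclideanSpace ℝ ι) (E : Matrix ι ι ℝ), s ∈ 𝓝 x₀ →
      IsFrame (g x₀) E → ∀ i, ∃ (N : ℝ → Matrix ι ι ℝ) (ν : Matrix ι ι ℝ),
        (∀ a b, |ν a b| ≤ M) ∧ (∀ a b, Jet (fun t => N t a b) ((1 : Matrix ι ι ℝ) a b) 0 (ν a b)) ∧
        (∀ t, (N t).IsSymm) ∧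
        ∀ᶠ t in 𝓝 (0 : ℝ), IsFrame (g (quadMap x₀ E (frameChristoffel s g x₀ E)
            (t • EuclideanSpace.single i 1)))
          (quadJac E (frameChristoffel s g x₀ E) (t • EuclideanSpace.single i 1) * N t) := by
  obtain ⟨MΓ, hMΓ0, hMΓ⟩ := exists_christoffel_pdBound ι hθ (G := G)
  obtain ⟨δ, hδ, C, hC0, hinv⟩ := exists_invSqrt ι
  set n : ℝ := (Fintype.card ι : ℝ) with hn
  have hn0 : 0 ≤ n := Nat.cast_nonneg _
  set m : ℝ := (√θ)⁻¹ with hm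
  have hm0 : 0 ≤ m := by positivity
  set mA : ℝ := n * (n * (MΓ * m * m)) with hmA
  set Mg : ℝ := n * (|G| * m) + (n * (|G| * mA) + 1 / 2 * (n * (n * (|G| * m * m)))) + |G| with hMg
  set Mp : ℝ := m + mA with hMp
  set MR : ℝ := n * (n * (3 * (3 * (Mg * Mp) * Mp))) with hMR
  have hMR0 : 0 ≤ MR := by positivity
  refine ⟨MR, hMR0, fun s g h x₀ E hs hE i => ?_⟩
  have hx := mem_of_mem_nhds hs
  set A := frameChristoffel s g x₀ E with hA
  have hEb : ∀ k a, |E k a| ≤ m := fun k a => hE.abs_le hθ (h.lower x₀ hx) k a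
  have hAb : ∀ k a b, |A k a b| ≤ mA := fun k a b =>
    abs_frameChristoffel_le hx (hMΓ s g h) hEb k a b
  set x : ℝ → EuclideanSpace ℝ ι := fun t => quadMap x₀ E A (t • EuclideanSpace.single i 1) with hxdef
  set P : ℝ → Matrix ι ι ℝ := fun t => quadJac E A (t • EuclideanSpace.single i 1) with hPdef
  -- jets of the metric and of the coordinate frame
  have jg : ∀ k l, BJet Mg (fun t => g (x t) k l) (g x₀ k l) := by
    intro k l
    have := bjet_of_pdBound h.good ((h.contDiffOn k l).of_le (by norm_num)) hs (M := |G|)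
      (((h.bound k l).mono (le_abs_self G)).of_succ) (m₁ := m) (m₂ := mA)
      (a := WithLp.toLp 2 fun k => E k i) (b := WithLp.toLp 2 fun k => -1 / 2 * A k i i)
      (fun k => hEb k i) (fun k => by
        simp only [abs_mul]
        have := hAb k i i
        have h2 : |(-1 / 2 : ℝ)| = 1 / 2 := by norm_num [abs_div]
        rw [h2]; linarith [abs_nonneg (A k i i)])
    refine (this.mono ?_).imp fun b hb => hb.imp fun c hc => ⟨hc.1, hc.2.1, ?_⟩
    · rw [hMg]; linarith [abs_nonneg G]
    · refine hc.2.2.congr' (Eventually.of_forall fun t => ?_)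
      simp only [hxdef, quadMap_line]
  have jg' : ∀ k l, ∃ c, Jet (fun t => g (x t) k l) (g x₀ k l)
      (∑ p, pd s p (fun y => g y k l) x₀ * E p i) c := by
    intro k l
    have := jet_along_parabola h.good ((h.contDiffOn k l).of_le (by norm_num)) hs
      (WithLp.toLp 2 fun k => E k i) (WithLp.toLp 2 fun k => -1 / 2 * A k i i)
    refine ⟨_, this.congr' (Eventually.of_forall fun t => ?_)⟩
    simp only [hxdef, quadMap_line]
  have jp' : ∀ k a, Jet (fun t => P t k a) (E k a) (-A k a i) 0 := by
    intro k a
    refine (jet_affine _ _).congr' (Eventually.of_forall fun t => ?_)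
    simp only [hPdef, quadJac_line]
  have jp : ∀ k a, BJet Mp (fun t => P t k a) (E k a) := by
    intro k a
    refine ⟨_, _, ?_, ?_, jp' k a⟩
    · rw [abs_neg]; exact (hAb k a i).trans (by rw [hMp]; linarith)
    · rw [abs_zero]; positivity
  have hG : ∀ k l, |g x₀ k l| ≤ Mg := fun k l =>
    ((h.bound k l).abs_le x₀ hx).trans ((le_abs_self G).trans (by
      rw [hMg]; have : 0 ≤ n * (|G| * m) + (n * (|G| * mA) + 1 / 2 * (n * (n * (|G| * m * m)))) := by
        positivity
      linarith))
  have hEp : ∀ k a, |E k a| ≤ Mp := fun k a => (hEb k a).trans (by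
    rw [hMp]; have : 0 ≤ mA := by positivity
    linarith)
  -- jets of the Gram matrix
  set R : ℝ → Matrix ι ι ℝ := fun t => (P t).transpose * g (x t) * P t - 1 with hR
  have hRapp : ∀ t a b, R t a b
      = ∑ k, ∑ l, g (x t) k l * P t k a * P t l b - (1 : Matrix ι ι ℝ) a b := fun t a b => by
    change ((P t).transpose * g (x t) * P t - 1) a b = _
    rw [Matrix.sub_apply, conj_apply]
  have jR : ∀ a b, ∃ c, |c| ≤ MR ∧ Jet (fun t => R t a b) 0 0 c := by
    intro a b
    have j1 : BJet MR (fun t => ∑ k, ∑ l, g (x t) k l * P t k a * P t l b)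
        (∑ k, ∑ l, g x₀ k l * E k a * E l b) := by
      have h1 : ∀ k l, BJet (3 * (3 * (Mg * Mp) * Mp)) (fun t => g (x t) k l * P t k a * P t l b)
          (g x₀ k l * E k a * E l b) := fun k l => by
        have h2 := (jg k l).mul (jp k a) (hG k l) (hEp k a)
        refine BJet.mul h2 (jp l b) ?_ (hEp l b)
        have := abs_mul_le_mul (hG k l) (hEp k a)
        have := (abs_nonneg _).trans this
        linarith
      have h3 := BJet.sum (s := Finset.univ) fun k (_ : k ∈ Finset.univ) =>
        BJet.sum (s := Finset.univ) fun l (_ : l ∈ Finset.univ) => h1 k l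
      simpa [hMR, hn] using h3
    obtain ⟨β, c, hβ, hc, hj⟩ := j1
    rw [isFrame_apply hE] at hj
    choose c' hc' using jg'
    have j2 := Jet.sum Finset.univ fun k (_ : k ∈ Finset.univ) =>
      Jet.sum Finset.univ fun l (_ : l ∈ Finset.univ) => ((hc' k l).mul (jp' k a)).mul (jp' l b)
    rw [isFrame_apply hE] at j2
    -- The Gram entry has two expansions: one with controlled quadratic coefficient but unspecified
    -- linear one, and an explicit one whose linear coefficient vanishes.
    have hβ0 : β = 0 := by
      rw [hj.linear_unique j2]
      exact gram_linear_eq_zero h hx E i a b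
    subst hβ0
    refine ⟨c, hc, ?_⟩
    have := hj.sub (jet_const ((1 : Matrix ι ι ℝ) a b))
    simp only [sub_self, sub_zero] at this
    exact this.congr' (Eventually.of_forall fun t => (hRapp t a b).symm)
  choose cR hcR hjR using jR
  have hxs : ∀ᶠ t in 𝓝 (0 : ℝ), x t ∈ s := by
    have hcont : Continuous x := by
      have := (contDiff_quadMap 0 x₀ E A).continuous
      fun_prop
    have h0 : x 0 = x₀ := by simp only [hxdef, zero_smul, quadMap_zero]
    exact hcont.continuousAt.eventually_mem (by rw [h0]; exact hs)
  have hRs : ∀ᶠ t in 𝓝 (0 : ℝ), (R t).IsSymm := by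
    filter_upwards [hxs] with t ht
    exact (conj_isSymm (P t) (h.isSymm ht)).sub Matrix.isSymm_one
  have hsmall : ∀ᶠ t in 𝓝 (0 : ℝ), (MR + 1) * t ^ 2 ≤ δ := by
    have hcont : Continuous fun t : ℝ => (MR + 1) * t ^ 2 := by fun_prop
    have := hcont.tendsto 0
    simp only [ne_eq, OfNat.ofNat_ne_zero, not_false_eq_true, zero_pow, mul_zero] at this
    exact this.eventually_le_const hδ
  have hRb : ∀ᶠ t in 𝓝 (0 : ℝ), ∀ a b, |R t a b| ≤ (MR + 1) * t ^ 2 := by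
    rw [eventually_all]
    intro a
    rw [eventually_all]
    intro b
    exact (hjR a b).eventually_abs_le (hcR a b)
  -- Away from t = 0, where R may be large, the identity is a default value; only the behaviour near
  -- 0 matters.
  have hN : ∀ t, ∃ N : Matrix ι ι ℝ, N.IsSymm ∧ ((R t).IsSymm ∧ (MR + 1) * t ^ 2 ≤ δ ∧
      (∀ a b, |R t a b| ≤ (MR + 1) * t ^ 2) → N * (1 + R t) * N = 1 ∧
        ∀ i j, |N i j - ((1 : Matrix ι ι ℝ) i j - R t i j / 2)| ≤ C * ((MR + 1) * t ^ 2) ^ 2) := by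
    intro t
    by_cases hc : (R t).IsSymm ∧ (MR + 1) * t ^ 2 ≤ δ ∧ ∀ a b, |R t a b| ≤ (MR + 1) * t ^ 2
    · obtain ⟨N, h1, h2, h3⟩ := hinv (R t) _ hc.1 (by positivity) hc.2.1 hc.2.2
      exact ⟨N, h1, fun _ => ⟨h2, h3⟩⟩
    · exact ⟨1, Matrix.isSymm_one, fun h => absurd h hc⟩
  choose N hNs hN using hN
  -- From (1 + R)^{−1/2} = 1 − R/2 + O(R²), with R = O(t²), so that the error is O(t⁴).
  refine ⟨N, fun a b => -1 / 2 * cR a b, fun a b => ?_, fun a b => ?_, hNs, ?_⟩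
  · rw [abs_mul]
    have h2 : |(-1 / 2 : ℝ)| = 1 / 2 := by norm_num [abs_div]
    rw [h2]; linarith [hcR a b, abs_nonneg (cR a b)]
  · have h1 := (jet_const ((1 : Matrix ι ι ℝ) a b)).add ((hjR a b).const_mul (-1 / 2))
    simp only [mul_zero, add_zero, zero_add] at h1
    refine h1.add_littleO ?_
    have h2 : (fun t => N t a b - ((1 : Matrix ι ι ℝ) a b + -1 / 2 * R t a b))
        =O[𝓝 0] fun t : ℝ => t ^ 2 * t ^ 2 := by
      refine IsBigO.of_bound (C * (MR + 1) ^ 2) ?_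
      filter_upwards [hRs, hsmall, hRb] with t ht1 ht2 ht3
      have := (hN t ⟨ht1, ht2, ht3⟩).2 a b
      rw [Real.norm_eq_abs, Real.norm_eq_abs,
        show (1 : Matrix ι ι ℝ) a b + -1 / 2 * R t a b = (1 : Matrix ι ι ℝ) a b - R t a b / 2 by ring]
      refine this.trans (le_of_eq ?_)
      rw [abs_of_nonneg (by positivity)]; ring
    refine h2.trans_isLittleO ?_
    have h3 : (fun t : ℝ => t ^ 2 * t ^ 2) =o[𝓝 0] fun t : ℝ => 1 * t ^ 2 := by
      refine IsLittleO.mul_isBigO ?_ (isBigO_refl _ _)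
      rw [isLittleO_one_iff]
      have hcont : Continuous fun t : ℝ => t ^ 2 := by fun_prop
      simpa using hcont.tendsto 0
    simpa using h3
  · filter_upwards [hRs, hsmall, hRb] with t ht1 ht2 ht3
    have h1 := (hN t ⟨ht1, ht2, ht3⟩).1
    have h2 : 1 + R t = (P t).transpose * g (x t) * P t := by simp [hR]
    rw [h2] at h1
    rw [IsFrame, Matrix.transpose_mul, (hNs t).eq]
    rw [← h1]
    simp only [Matrix.mul_assoc]
    rfl

end FrameJets

end BoundaryEstimate

end

noncomputable section

namespace BoundaryEstimate

open Finset Filter Topology Asymptotics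

/-! ### The tensor T and its components in a frame -/

section TensorT

set_option linter.unusedSectionVars false

variable {ι : Type*} [Fintype ι] [DecidableEq ι]

/-- The tensor `T = ∇²u + du ⊗ du + S`. -/
def tensorT (D : Set (EuclideanSpace ℝ ι)) (g S : EuclideanSpace ℝ ι → Matrix ι ι ℝ)
    (u : EuclideanSpace ℝ ι → ℝ) (x : EuclideanSpace ℝ ι) : Matrix ι ι ℝ :=
  Matrix.of fun i j => covHess D g u x i j + pd D i u x * pd D j u x + S x i j

/-- The component of `du` in the direction of the `a`-th vector of the frame `E`. -/
def gradComp (D : Set (EuclideanSpace ℝ ι)) (u : EuclideanSpace ℝ ι → ℝ) (E : Matrix ι ι ℝ)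
    (x : EuclideanSpace ℝ ι) (a : ι) : ℝ :=
  ∑ i, E i a * pd D i u x

variable {s : Set (EuclideanSpace ℝ ι)} {θ G : ℝ} {g S : EuclideanSpace ℝ ι → Matrix ι ι ℝ}
  {u : EuclideanSpace ℝ ι → ℝ} {x : EuclideanSpace ℝ ι} {E : Matrix ι ι ℝ}

lemma conj_tensorT (E : Matrix ι ι ℝ) (a b : ι) :
    (E.transpose * tensorT s g S u x * E) a b = (E.transpose * covHess s g u x * E) a b
      + gradComp s u E x a * gradComp s u E x b + (E.transpose * S x * E) a b := by
  simp only [conj_apply, tensorT, Matrix.of_apply, gradComp, Finset.sum_mul_sum,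
    ← Finset.sum_add_distrib]
  exact Finset.sum_congr rfl fun i _ => Finset.sum_congr rfl fun j _ => by ring

lemma conj_tensorW (hE : IsFrame (g x) E) (a b : ι) :
    (E.transpose * tensorW s g S u x * E) a b = (E.transpose * tensorT s g S u x * E) a b
      - 1 / 2 * (∑ c, gradComp s u E x c ^ 2) * (1 : Matrix ι ι ℝ) a b := by
  have h1 : covectorNormSq (g x) (fun k => pd s k u x) = ∑ c, gradComp s u E x c ^ 2 :=
    hE.covectorNormSq_eq _
  rw [← isFrame_apply hE a b, conj_apply, conj_apply, ← h1, Finset.mul_sum,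
    ← Finset.sum_sub_distrib]
  refine Finset.sum_congr rfl fun i _ => ?_
  rw [Finset.mul_sum, ← Finset.sum_sub_distrib]
  refine Finset.sum_congr rfl fun j _ => ?_
  simp only [tensorW, tensorT, Matrix.of_apply]; ring

lemma covHess_symm (h : IsControlledMetric s θ G g) {φ : EuclideanSpace ℝ ι → ℝ}
    (hφ : ContDiffOn ℝ 2 φ s) (hx : x ∈ s) (i j : ι) :
    covHess s g φ x i j = covHess s g φ x j i := by
  simp only [covHess, Matrix.of_apply]
  rw [pd_comm h.good hφ hx]
  congr 1
  exact Finset.sum_congr rfl fun k _ => by rw [h.christoffel_symm hx]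

lemma tensorT_isSymm (h : IsControlledMetric s θ G g) (hu : ContDiffOn ℝ 2 u s)
    (hS : (S x).IsSymm) (hx : x ∈ s) : (tensorT s g S u x).IsSymm := by
  refine Matrix.IsSymm.ext fun i j => ?_
  simp only [tensorT, Matrix.of_apply]
  rw [covHess_symm h hu hx, hS.apply i j]; ring

lemma tensorW_isSymm (h : IsControlledMetric s θ G g) (hu : ContDiffOn ℝ 2 u s)
    (hS : (S x).IsSymm) (hx : x ∈ s) : (tensorW s g S u x).IsSymm := by
  refine Matrix.IsSymm.ext fun i j => ?_
  simp only [tensorW, Matrix.of_apply]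
  rw [covHess_symm h hu hx, hS.apply i j, h.symm hx i j]; ring

end TensorT

/-! ### Pointwise consequences of the equation -/

section Equation

variable {n : ℕ} {Γ : Set (Fin n → ℝ)} {F : (Fin n → ℝ) → ℝ} {ε θ G : ℝ}
  {s : Set (EuclideanSpace ℝ (Fin n))} {g S : EuclideanSpace ℝ (Fin n) → Matrix (Fin n) (Fin n) ℝ}
  {u φ : EuclideanSpace ℝ (Fin n) → ℝ} {x : EuclideanSpace ℝ (Fin n)}
  {E : Matrix (Fin n) (Fin n) ℝ}

/-- The equation `F(W) = φ` on `s`. -/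
def SolvesOn (s : Set (EuclideanSpace ℝ (Fin n)))
    (g S : EuclideanSpace ℝ (Fin n) → Matrix (Fin n) (Fin n) ℝ) (u : EuclideanSpace ℝ (Fin n) → ℝ)
    (Γ : Set (Fin n → ℝ)) (F : (Fin n → ℝ) → ℝ) (φ : EuclideanSpace ℝ (Fin n) → ℝ) : Prop :=
  ∀ x ∈ s, ∃ lam ∈ Γ, IsEigenvaluesOf (g x) (tensorW s g S u x) lam ∧ F lam = φ x

/-- In any orthonormal frame, the right-hand side is below the linearization of `F`. -/
lemma SolvesOn.le_sum (hΓ : IsAdmissibleCone Γ) (hF : IsStructured Γ F ε)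
    (h : IsControlledMetric s θ G g) (hu : ContDiffOn ℝ 2 u s) (hS : (S x).IsSymm)
    (hsol : SolvesOn s g S u Γ F φ) (hx : x ∈ s) (hE : IsFrame (g x) E) {lam₀ : Fin n → ℝ}
    (h₀ : lam₀ ∈ Γ) : φ x ≤ ∑ a, dF F a lam₀ * ((E.transpose * tensorT s g S u x * E) a a
      - 1 / 2 * ∑ c, gradComp s u E x c ^ 2) := by
  obtain ⟨lam, hl, heig, hFl⟩ := hsol x hx
  rw [IsEigenvaluesOf, hE.charpoly_eq] at heig
  -- Schur–Horn passes from the eigenvalues of W to its diagonal, and the tangent hyperplane at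
  -- `lam₀` replaces F by a linear function. No diagonalization of W at x is needed.
  obtain ⟨h1, h2⟩ := diag_mem_and_le hΓ hF (conj_isSymm E (tensorW_isSymm h hu hS hx)) hl heig
  have h3 := hF.le_sum_dF_mul hΓ h₀ h1
  rw [← hFl]
  refine (h2.trans h3).trans (le_of_eq ?_)
  refine Finset.sum_congr rfl fun a _ => ?_
  rw [Matrix.diag_apply, conj_tensorW hE, Matrix.one_apply_eq, mul_one]

/-- T and W differ by a multiple of the metric, so a frame that diagonalizes one diagonalizes the
other. The resulting list is a permutation of the one provided by the equation. -/
lemma SolvesOn.eigenvalues (hΓ : IsAdmissibleCone Γ) (hF : IsStructured Γ F ε)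
    (hsol : SolvesOn s g S u Γ F φ) (hx : x ∈ s) (hE : IsFrame (g x) E) {τ : Fin n → ℝ}
    (hτ : E.transpose * tensorT s g S u x * E = Matrix.diagonal τ) :
    (fun a => τ a - 1 / 2 * ∑ c, gradComp s u E x c ^ 2) ∈ Γ ∧
      F (fun a => τ a - 1 / 2 * ∑ c, gradComp s u E x c ^ 2) = φ x := by
  obtain ⟨lam, hl, heig, hFl⟩ := hsol x hx
  rw [IsEigenvaluesOf, hE.charpoly_eq] at heig
  have e : E.transpose * tensorW s g S u x * E
      = Matrix.diagonal (fun a => τ a - 1 / 2 * ∑ c, gradComp s u E x c ^ 2) := by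
    ext a b
    rw [conj_tensorW hE, hτ]
    by_cases hab : a = b
    · subst hab; simp
    · simp [hab]
  rw [e, Matrix.charpoly_diagonal] at heig
  obtain ⟨π, hπ⟩ := exists_perm_of_prod_eq heig
  rw [hπ]
  exact ⟨hΓ.symm lam hl π, (hF.symm lam hl π).trans hFl⟩

/-- The size of the eigenvalues of `T` and of the gradient in terms of the top eigenvalue and the
trace. -/
lemma eigenvalue_bounds (hΓ : IsAdmissibleCone Γ) {τ : Fin n → ℝ} {p k : ℝ} {o : Fin n}
    (hp : 0 ≤ p) (hmem : (fun a => τ a - 1 / 2 * p) ∈ Γ) (ho : ∀ a, τ a ≤ τ o)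
    (hk : k = τ o + ∑ a, τ a) :
    0 < k ∧ p ≤ 2 * k ∧ (∀ a, |τ a| ≤ n * k) ∧ n / 2 * p < ∑ a, τ a ∧ τ o ≤ k := by
  have h1 := sum_pos_of_mem_cone hΓ hmem
  have hn : (1 : ℝ) ≤ n := by
    have : 0 < n := Fin.pos o
    exact_mod_cast this
  rw [Finset.sum_sub_distrib] at h1
  simp only [Finset.sum_const, Finset.card_univ, Fintype.card_fin, nsmul_eq_mul] at h1
  have h2 : ∑ a, τ a ≤ n * τ o := by
    have := Finset.sum_le_card_nsmul Finset.univ τ (τ o) fun a _ => ho a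
    simpa using this
  have hnp : 0 ≤ (n : ℝ) * p := by positivity
  have h3 : 0 < ∑ a, τ a := by linarith
  have h4 : 0 < τ o := by
    by_contra hc
    push Not at hc
    have : (n : ℝ) * τ o ≤ 0 := mul_nonpos_of_nonneg_of_nonpos (by linarith) hc
    linarith
  have hτk : τ o ≤ k := by linarith
  refine ⟨by linarith, ?_, fun a => ?_, by linarith, hτk⟩
  · have : p ≤ n * p := le_mul_of_one_le_left hp hn
    linarith
  · rw [abs_le]
    constructor
    · have h5 : ∑ b ∈ Finset.univ.erase a, τ b ≤ (n - 1) * τ o := by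
        have := Finset.sum_le_card_nsmul (Finset.univ.erase a) τ (τ o) fun a _ => ho a
        rw [Finset.card_erase_of_mem (Finset.mem_univ a), Finset.card_univ, Fintype.card_fin,
          nsmul_eq_mul, Nat.cast_sub (Fin.pos o)] at this
        simpa using this
      have h6 := Finset.add_sum_erase Finset.univ τ (Finset.mem_univ a)
      have h7 : ((n : ℝ) - 1) * τ o ≤ (n - 1) * k := mul_le_mul_of_nonneg_left hτk (by linarith)
      linarith
    · have : k ≤ n * k := le_mul_of_one_le_left (by linarith) hn
      linarith [ho a]

end Equation

/-! ### Second-order expansion of f(x, u(x)) -/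

section RightHandSide

variable {ι : Type*} [Fintype ι] [DecidableEq ι]

/-- The derivatives of `(x, z) ↦ f(x, z)` in terms of the joint derivative. -/
lemma joint_derivatives {s : Set (EuclideanSpace ℝ ι)} {f : EuclideanSpace ℝ ι → ℝ → ℝ}
    (hs : GoodDomain s)
    (hf : ContDiffOn ℝ 2 (fun p : EuclideanSpace ℝ ι × ℝ => f p.1 p.2) (s ×ˢ Set.univ))
    {x₀ : EuclideanSpace ℝ ι} (hx : s ∈ 𝓝 x₀) (z : ℝ) :
    let f' : EuclideanSpace ℝ ι × ℝ → ℝ := fun p => f p.1 p.2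
    let L := fderiv ℝ f' (x₀, z)
    let B := fderiv ℝ (fderiv ℝ f') (x₀, z)
    (∀ k, pd s k (fun y => f y z) x₀ = L (EuclideanSpace.single k 1, 0)) ∧
    deriv (f x₀) z = L (0, 1) ∧
    (∀ k l, pd s l (pd s k (fun y => f y z)) x₀
      = B (EuclideanSpace.single l 1, 0) (EuclideanSpace.single k 1, 0)) ∧
    (∀ k, pd s k (fun y => deriv (f y) z) x₀ = B (EuclideanSpace.single k 1, 0) (0, 1)) ∧
    deriv (deriv (f x₀)) z = B (0, 1) (0, 1) ∧ (∀ a b, B a b = B b a) := by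
  intro f' L B
  have hnh : ∀ y, s ∈ 𝓝 y → ∀ z : ℝ, ContDiffAt ℝ 2 f' (y, z) := fun y hy z =>
    hf.contDiffAt (prod_mem_nhds hy univ_mem)
  have hd : ∀ y, s ∈ 𝓝 y → ∀ z : ℝ, HasFDerivAt f' (fderiv ℝ f' (y, z)) (y, z) := fun y hy z =>
    ((hnh y hy z).differentiableAt (by norm_num)).hasFDerivAt
  have hx' : ∀ᶠ y in 𝓝 x₀, s ∈ 𝓝 y := eventually_mem_nhds_iff.2 hx
  have incl : ∀ (y : EuclideanSpace ℝ ι) (z : ℝ), HasFDerivAt (fun y : EuclideanSpace ℝ ι => (y, z))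
      (ContinuousLinearMap.inl ℝ (EuclideanSpace ℝ ι) ℝ) y := fun y z =>
    (hasFDerivAt_id y).prodMk (hasFDerivAt_const z y)
  have incr : ∀ (y : EuclideanSpace ℝ ι) (z : ℝ), HasDerivAt (fun z : ℝ => (y, z))
      ((0, 1) : EuclideanSpace ℝ ι × ℝ) z := fun y z =>
    (hasDerivAt_const z y).prodMk (hasDerivAt_id z)
  have p1 : ∀ y, s ∈ 𝓝 y → ∀ k, pd s k (fun y => f y z) y
      = fderiv ℝ f' (y, z) (EuclideanSpace.single k 1, 0) := by
    intro y hy k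
    have h1 : HasFDerivAt (fun y => f y z) ((fderiv ℝ f' (y, z)).comp
      (ContinuousLinearMap.inl ℝ (EuclideanSpace ℝ ι) ℝ)) y :=
      HasFDerivAt.comp (g := f') (f := fun y => (y, z)) y (hd y hy z) (incl y z)
    rw [pd_eq_of_hasFDerivWithinAt hs (mem_of_mem_nhds hy) h1.hasFDerivWithinAt]
    simp
  have p2 : ∀ y, s ∈ 𝓝 y → ∀ z, HasDerivAt (f y) (fderiv ℝ f' (y, z) (0, 1)) z := by
    intro y hy z
    exact (hd y hy z).comp_hasDerivAt z (incr y z)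
  have hB : HasFDerivAt (fderiv ℝ f') B (x₀, z) := by
    have : ContDiffAt ℝ 1 (fderiv ℝ f') (x₀, z) := (hnh x₀ hx z).fderiv_right (by norm_num)
    exact (this.differentiableAt one_ne_zero).hasFDerivAt
  have hBx : ∀ w : EuclideanSpace ℝ ι × ℝ, HasFDerivAt (fun y => fderiv ℝ f' (y, z) w)
      ((B.comp (ContinuousLinearMap.inl ℝ (EuclideanSpace ℝ ι) ℝ)).flip w) x₀ := by
    intro w
    have h1 : HasFDerivAt (fun y => fderiv ℝ f' (y, z))
      (B.comp (ContinuousLinearMap.inl ℝ (EuclideanSpace ℝ ι) ℝ)) x₀ := hB.comp x₀ (incl x₀ z)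
    have h2 := h1.clm_apply (hasFDerivAt_const w x₀)
    simpa using h2
  refine ⟨p1 x₀ hx, (p2 x₀ hx z).deriv, fun k l => ?_, fun k => ?_, ?_, fun a b => ?_⟩
  · have e : pd s k (fun y => f y z) =ᶠ[𝓝 x₀]
        fun y => fderiv ℝ f' (y, z) (EuclideanSpace.single k 1, 0) := by
      filter_upwards [hx'] with y hy
      exact p1 y hy k
    have h1 := (hBx (EuclideanSpace.single k 1, 0)).congr_of_eventuallyEq e
    rw [pd_eq_of_hasFDerivWithinAt hs (mem_of_mem_nhds hx) h1.hasFDerivWithinAt]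
    simp
  · have e : (fun y => deriv (f y) z) =ᶠ[𝓝 x₀] fun y => fderiv ℝ f' (y, z) (0, 1) := by
      filter_upwards [hx'] with y hy
      exact (p2 y hy z).deriv
    have h1 := (hBx (0, 1)).congr_of_eventuallyEq e
    rw [pd_eq_of_hasFDerivWithinAt hs (mem_of_mem_nhds hx) h1.hasFDerivWithinAt]
    simp
  · have e : deriv (f x₀) = fun z => fderiv ℝ f' (x₀, z) (0, 1) := by
      ext z
      exact (p2 x₀ hx z).deriv
    rw [e]
    have h1 : HasDerivAt (fun z => fderiv ℝ f' (x₀, z)) (B (0, 1)) z :=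
      hB.comp_hasDerivAt z (incr x₀ z)
    have h2 := h1.clm_apply (hasDerivAt_const z ((0, 1) : EuclideanSpace ℝ ι × ℝ))
    simpa using h2.deriv
  · exact ((hnh x₀ hx z).isSymmSndFDerivAt (by simp)).eq a b

lemma linear_single_sum (L : EuclideanSpace ℝ ι × ℝ →L[ℝ] ℝ) (w : EuclideanSpace ℝ ι) (z : ℝ) :
    L (w, z) = ∑ k, L (EuclideanSpace.single k 1, 0) * w k + z * L (0, 1) := by
  have h1 : ((w, z) : EuclideanSpace ℝ ι × ℝ) = (w, 0) + z • (0, 1) := by simp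
  rw [h1, map_add, map_smul, smul_eq_mul]
  congr 1
  have := clm_apply_eq_sum (L.comp (ContinuousLinearMap.inl ℝ (EuclideanSpace ℝ ι) ℝ)) w
  simpa using this

/-- The second order expansion of `f(x, ζ)` along a parabola. -/
lemma jet_rhs {s : Set (EuclideanSpace ℝ ι)} {f : EuclideanSpace ℝ ι → ℝ → ℝ}
    (hs : GoodDomain s)
    (hf : ContDiffOn ℝ 2 (fun p : EuclideanSpace ℝ ι × ℝ => f p.1 p.2) (s ×ˢ Set.univ))
    {x₀ : EuclideanSpace ℝ ι} (hx : s ∈ 𝓝 x₀) (a b : EuclideanSpace ℝ ι) {ζ ζ' : ℝ → ℝ} {ζ₂ : ℝ}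
    (hζ : ∀ᶠ t in 𝓝 0, HasDerivAt ζ (ζ' t) t) (hζ' : HasDerivAt ζ' ζ₂ 0) :
    Jet (fun t => f (x₀ + t • a + t ^ 2 • b) (ζ t)) (f x₀ (ζ 0))
      (∑ k, pd s k (fun y => f y (ζ 0)) x₀ * a k + ζ' 0 * deriv (f x₀) (ζ 0))
      (1 / 2 * (∑ k, ∑ l, pd s l (pd s k (fun y => f y (ζ 0))) x₀ * a k * a l
        + 2 * ∑ k, pd s k (fun y => f y (ζ 0)) x₀ * b k
        + 2 * ζ' 0 * ∑ k, pd s k (fun y => deriv (f y) (ζ 0)) x₀ * a k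
        + ζ' 0 ^ 2 * deriv (deriv (f x₀)) (ζ 0) + ζ₂ * deriv (f x₀) (ζ 0))) := by
  obtain ⟨j1, j2, j3, j4, j5, j6⟩ := joint_derivatives hs hf hx (ζ 0)
  set f' : EuclideanSpace ℝ ι × ℝ → ℝ := fun p => f p.1 p.2 with hf'
  set L := fderiv ℝ f' (x₀, ζ 0) with hL
  set B := fderiv ℝ (fderiv ℝ f') (x₀, ζ 0) with hB
  set γ : ℝ → EuclideanSpace ℝ ι × ℝ := fun t => (x₀ + t • a + t ^ 2 • b, ζ t) with hγ
  have hγ0 : γ 0 = (x₀, ζ 0) := by simp [hγ]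
  have hxd : ∀ t : ℝ, HasDerivAt (fun t : ℝ => x₀ + t • a + t ^ 2 • b) (a + (2 * t) • b) t := by
    intro t
    have h1 := ((hasDerivAt_id t).smul_const a).const_add x₀
    have h2 := ((hasDerivAt_id t).pow 2).smul_const b
    have := h1.add h2
    simp only [id_eq, one_smul, Nat.cast_ofNat, Nat.add_one_sub_one, pow_one, mul_one] at this
    exact this
  have hc : ContDiffAt ℝ 2 f' (x₀, ζ 0) := hf.contDiffAt (prod_mem_nhds hx univ_mem)
  have hγc : ContinuousAt γ 0 :=
    (hxd 0).continuousAt.prodMk (hζ.self_of_nhds).continuousAt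
  have hev : ∀ᶠ t in 𝓝 (0 : ℝ), ContDiffAt ℝ 2 f' (γ t) := by
    have h1 : ∀ᶠ p in 𝓝 (γ 0), ContDiffAt ℝ 2 f' p := by
      rw [hγ0]; exact hc.eventually (by simp)
    exact hγc.eventually h1
  have hD : ∀ᶠ t in 𝓝 (0 : ℝ), HasDerivAt (fun t => f' (γ t))
      (fderiv ℝ f' (γ t) (a + (2 * t) • b, ζ' t)) t := by
    filter_upwards [hev, hζ] with t h1 h2
    exact (h1.differentiableAt (by norm_num)).hasFDerivAt.comp_hasDerivAt t ((hxd t).prodMk h2)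
  have hD2 : HasDerivAt (fun t => fderiv ℝ f' (γ t) (a + (2 * t) • b, ζ' t))
      (B (a, ζ' 0) (a, ζ' 0) + L ((2 : ℝ) • b, ζ₂)) 0 := by
    have h1 : HasFDerivAt (fderiv ℝ f') B (γ 0) := by
      rw [hγ0]
      have : ContDiffAt ℝ 1 (fderiv ℝ f') (x₀, ζ 0) := hc.fderiv_right (by norm_num)
      exact (this.differentiableAt one_ne_zero).hasFDerivAt
    have h2 : HasDerivAt γ (a, ζ' 0) 0 := by
      have := (hxd 0).prodMk (hζ.self_of_nhds)
      simpa using this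
    have h3 := h1.comp_hasDerivAt (0 : ℝ) h2
    have h4 : HasDerivAt (fun t : ℝ => (a + (2 * t) • b, ζ' t)) ((2 : ℝ) • b, ζ₂) 0 := by
      have h5 : HasDerivAt (fun t : ℝ => a + (2 * t) • b) ((2 : ℝ) • b) 0 := by
        have := (((hasDerivAt_id (0 : ℝ)).const_mul 2).smul_const b).const_add a
        simpa using this
      exact h5.prodMk hζ'
    have h6 := h3.clm_apply h4
    simp only [Function.comp_def, hγ0, mul_zero, zero_smul, add_zero] at h6
    exact h6
  have hval : B (a, ζ' 0) (a, ζ' 0) + L ((2 : ℝ) • b, ζ₂) = 2 * (1 / 2 *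
      (∑ k, ∑ l, pd s l (pd s k (fun y => f y (ζ 0))) x₀ * a k * a l
        + 2 * ∑ k, pd s k (fun y => f y (ζ 0)) x₀ * b k
        + 2 * ζ' 0 * ∑ k, pd s k (fun y => deriv (f y) (ζ 0)) x₀ * a k
        + ζ' 0 ^ 2 * deriv (deriv (f x₀)) (ζ 0) + ζ₂ * deriv (f x₀) (ζ 0))) := by
    rw [linear_single_sum L]
    simp only [← j1, ← j2]
    have e1 : B (a, ζ' 0) (a, ζ' 0) = ∑ k, ∑ l, pd s l (pd s k (fun y => f y (ζ 0))) x₀ * a k * a l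
        + 2 * ζ' 0 * ∑ k, pd s k (fun y => deriv (f y) (ζ 0)) x₀ * a k
        + ζ' 0 ^ 2 * deriv (deriv (f x₀)) (ζ 0) := by
      rw [linear_single_sum (B (a, ζ' 0))]
      have e2 : ∀ w, B (a, ζ' 0) w = ∑ k, B (EuclideanSpace.single k 1, 0) w * a k
          + ζ' 0 * B (0, 1) w := fun w => by
        have := linear_single_sum (B.flip w) a (ζ' 0)
        simpa using this
      simp only [e2]
      have e3 : ∀ k, B (0, 1) (EuclideanSpace.single k 1, 0)
        = pd s k (fun y => deriv (f y) (ζ 0)) x₀ := fun k => by rw [j6, j4]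
      simp only [← j3, ← j4, e3, ← j5]
      simp only [add_mul, Finset.sum_add_distrib, Finset.sum_mul, mul_add, Finset.mul_sum]
      have e4 : ∑ k, ∑ l, pd s l (pd s k (fun y => f y (ζ 0))) x₀ * a l * a k
          = ∑ k, ∑ l, pd s l (pd s k (fun y => f y (ζ 0))) x₀ * a k * a l :=
        Finset.sum_congr rfl fun k _ => Finset.sum_congr rfl fun l _ => by ring
      have e5 : ∑ k, 2 * ζ' 0 * (pd s k (fun y => deriv (f y) (ζ 0)) x₀ * a k)
          = ∑ k, ζ' 0 * pd s k (fun y => deriv (f y) (ζ 0)) x₀ * a k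
            + ∑ k, ζ' 0 * (pd s k (fun y => deriv (f y) (ζ 0)) x₀ * a k) := by
        rw [← Finset.sum_add_distrib]
        exact Finset.sum_congr rfl fun k _ => by ring
      rw [e4, e5]; ring
    rw [e1]
    have e6 : ∑ k, pd s k (fun y => f y (ζ 0)) x₀ * ((2 : ℝ) • b) k
        = 2 * ∑ k, pd s k (fun y => f y (ζ 0)) x₀ * b k := by
      rw [Finset.mul_sum]
      exact Finset.sum_congr rfl fun k _ => by simp; ring
    rw [e6]; ring
  rw [hval] at hD2
  have := jet_of_hasDerivAt hD hD2
  refine this.congr_coeff (by simp [hγ0, hf']) ?_ rfl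
  rw [hγ0]
  simp only [mul_zero, zero_smul, add_zero]
  rw [linear_single_sum, ← j2]
  simp only [hL, j1]

end RightHandSide

end BoundaryEstimate

end

noncomputable section

namespace BoundaryEstimate

open Finset Filter Topology Asymptotics

/-! ### Second-order expansion of T in corrected frames -/

section TensorJets

set_option linter.unusedSectionVars false

variable {ι : Type*} [Fintype ι] [DecidableEq ι]

/-- Conjugation by a matrix that is the identity up to second order. -/
lemma jet_conj_diag {N B : ℝ → Matrix ι ι ℝ} {ν B₀ B₁ B₂ : Matrix ι ι ℝ}
    (hN : ∀ a b, Jet (fun t => N t a b) ((1 : Matrix ι ι ℝ) a b) 0 (ν a b))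
    (hB : ∀ a b, Jet (fun t => B t a b) (B₀ a b) (B₁ a b) (B₂ a b)) (a : ι) :
    Jet (fun t => ((N t).transpose * B t * N t) a a) (B₀ a a) (B₁ a a)
      (B₂ a a + (∑ j, B₀ a j * ν j a + ∑ i, B₀ i a * ν i a)) := by
  have h := Jet.sum Finset.univ fun i (_ : i ∈ Finset.univ) =>
    Jet.sum Finset.univ fun j (_ : j ∈ Finset.univ) => ((hB i j).mul (hN i a)).mul (hN j a)
  refine (h.congr' (Eventually.of_forall fun t => (conj_apply (N t) (B t) a a).symm)).congr_coeff
    ?_ ?_ ?_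
  · simp [Matrix.one_apply]
  · simp [Matrix.one_apply]
  · simp only [mul_zero, zero_add, add_zero, Matrix.one_apply, mul_ite, mul_one, ite_mul, zero_mul,
      Finset.sum_add_distrib, Finset.sum_ite_eq', Finset.mem_univ, if_true]
    have : ∑ i, ∑ j, (if i = a then B₀ i j * ν j a else 0) = ∑ j, B₀ a j * ν j a := by
      rw [Finset.sum_comm]; simp
    rw [this]; ring

lemma jet_mulVec {N : ℝ → Matrix ι ι ℝ} {w : ι → ℝ → ℝ} {ν : Matrix ι ι ℝ} {w₀ w₁ w₂ : ι → ℝ}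
    (hN : ∀ a b, Jet (fun t => N t a b) ((1 : Matrix ι ι ℝ) a b) 0 (ν a b))
    (hw : ∀ a, Jet (w a) (w₀ a) (w₁ a) (w₂ a)) (c : ι) :
    Jet (fun t => ∑ b, N t b c * w b t) (w₀ c) (w₁ c) (w₂ c + ∑ b, ν b c * w₀ b) := by
  have h := Jet.sum Finset.univ fun b (_ : b ∈ Finset.univ) => (hN b c).mul (hw b)
  refine h.congr_coeff ?_ ?_ ?_
  · simp [Matrix.one_apply]
  · simp [Matrix.one_apply]
  · simp [Matrix.one_apply, Finset.sum_add_distrib]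

variable {s : Set (EuclideanSpace ℝ ι)} {x₀ : EuclideanSpace ℝ ι} {E : Matrix ι ι ℝ}
  {A : ι → ι → ι → ℝ}

/-- Expansion of a tensor pulled back by the quadratic map, with constants depending only on bounds
for its components, the frame and A. It is applied to the Christoffel symbols and to S. -/
lemma bjet_contract (hs : GoodDomain s) (hx : s ∈ 𝓝 x₀) {M m mA : ℝ}
    (hE : ∀ k a, |E k a| ≤ m) (hA : ∀ k a b, |A k a b| ≤ mA)
    {φ : ι → ι → EuclideanSpace ℝ ι → ℝ} (hφ : ∀ p q, ContDiffOn ℝ 2 (φ p q) s)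
    (hM : ∀ p q, PdBound s 2 M (φ p q)) (hM0 : 0 ≤ M) (hm : 0 ≤ m) (hmA : 0 ≤ mA) (i a b : ι) :
    BJet (Fintype.card ι * (Fintype.card ι * (3 * (3 * ((Fintype.card ι * (M * m)
      + (Fintype.card ι * (M * mA)
        + 1 / 2 * (Fintype.card ι * (Fintype.card ι * (M * m * m)))) + M) * (m + mA)) * (m + mA)))))
      (fun t => ∑ p, ∑ q, φ p q (quadMap x₀ E A (t • EuclideanSpace.single i 1))
        * quadJac E A (t • EuclideanSpace.single i 1) p a
        * quadJac E A (t • EuclideanSpace.single i 1) q b)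
      (∑ p, ∑ q, φ p q x₀ * E p a * E q b) := by
  set n : ℝ := (Fintype.card ι : ℝ) with hn
  have hn0 : 0 ≤ n := Nat.cast_nonneg _
  have h0 : 0 ≤ n * (M * m) + (n * (M * mA) + 1 / 2 * (n * (n * (M * m * m)))) := by positivity
  set Mg : ℝ := n * (M * m) + (n * (M * mA) + 1 / 2 * (n * (n * (M * m * m)))) + M with hMg
  have jφ : ∀ p q, BJet Mg
      (fun t => φ p q (quadMap x₀ E A (t • EuclideanSpace.single i 1))) (φ p q x₀) := by
    intro p q
    have := bjet_of_pdBound hs (hφ p q) hx (hM p q) (m₁ := m) (m₂ := mA)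
      (a := WithLp.toLp 2 fun k => E k i) (b := WithLp.toLp 2 fun k => -1 / 2 * A k i i)
      (fun k => hE k i) (fun k => by
        simp only [abs_mul]
        have := hA k i i
        have h2 : |(-1 / 2 : ℝ)| = 1 / 2 := by norm_num [abs_div]
        rw [h2]; linarith [abs_nonneg (A k i i)])
    refine (this.mono ?_).imp fun b hb => hb.imp fun c hc => ⟨hc.1, hc.2.1, ?_⟩
    · rw [hMg]; linarith
    · refine hc.2.2.congr' (Eventually.of_forall fun t => ?_)
      simp only [quadMap_line]
  have jp : ∀ k a, BJet (m + mA) (fun t => quadJac E A (t • EuclideanSpace.single i 1) k a)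
      (E k a) := by
    intro k a
    refine ⟨-A k a i, 0, ?_, ?_, (jet_affine _ _).congr' (Eventually.of_forall fun t => ?_)⟩
    · rw [abs_neg]; exact (hA k a i).trans (by linarith)
    · rw [abs_zero]; positivity
    · simp only [quadJac_line]
  have hφb : ∀ p q, |φ p q x₀| ≤ Mg := fun p q =>
    ((hM p q).abs_le x₀ (mem_of_mem_nhds hx)).trans (by rw [hMg]; linarith)
  have hEp : ∀ k a, |E k a| ≤ m + mA := fun k a => (hE k a).trans (by linarith)
  have h1 : ∀ p q, BJet (3 * (3 * (Mg * (m + mA)) * (m + mA)))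
      (fun t => φ p q (quadMap x₀ E A (t • EuclideanSpace.single i 1))
        * quadJac E A (t • EuclideanSpace.single i 1) p a
        * quadJac E A (t • EuclideanSpace.single i 1) q b)
      (φ p q x₀ * E p a * E q b) := fun p q => by
    have h2 := (jφ p q).mul (jp p a) (hφb p q) (hEp p a)
    refine BJet.mul h2 (jp q b) ?_ (hEp q b)
    have := abs_mul_le_mul (hφb p q) (hEp p a)
    have := (abs_nonneg _).trans this
    linarith
  have h3 := BJet.sum (s := Finset.univ) fun p (_ : p ∈ Finset.univ) =>
    BJet.sum (s := Finset.univ) fun q (_ : q ∈ Finset.univ) => h1 p q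
  simpa [hn] using h3

variable {g S : EuclideanSpace ℝ ι → Matrix ι ι ℝ} {u : EuclideanSpace ℝ ι → ℝ}
  {U : Set (EuclideanSpace ℝ ι)}

lemma gradComp_quadJac (hU : GoodDomain U)
    (hm : Set.MapsTo (quadMap x₀ E A) U s) (hA : ∀ k a b, A k a b = A k b a)
    (hu : ContDiffOn ℝ 1 u s) {y : EuclideanSpace ℝ ι} (hy : y ∈ U) (a : ι) :
    gradComp s u (quadJac E A y) (quadMap x₀ E A y) a
      = pd U a (fun y => u (quadMap x₀ E A y)) y := by
  rw [pd_pullback hU hm hA hu hy, gradComp]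
  exact Finset.sum_congr rfl fun k _ => mul_comm _ _

/-- The tensor `T` in adapted coordinates. -/
lemma tensorT_quadJac (hs : GoodDomain s) (hU : GoodDomain U)
    (hm : Set.MapsTo (quadMap x₀ E A) U s) (hA : ∀ k a b, A k a b = A k b a)
    (hu : ContDiffOn ℝ 2 u s) {y : EuclideanSpace ℝ ι} (hy : y ∈ U) (a b : ι) :
    ((quadJac E A y).transpose * tensorT s g S u (quadMap x₀ E A y) * quadJac E A y) a b
      = pd U a (pd U b (fun y => u (quadMap x₀ E A y))) y
        - ∑ k, (∑ p, ∑ q, christoffel s g k p q (quadMap x₀ E A y) * quadJac E A y p a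
            * quadJac E A y q b - A k a b) * pd s k u (quadMap x₀ E A y)
        + pd U a (fun y => u (quadMap x₀ E A y)) y * pd U b (fun y => u (quadMap x₀ E A y)) y
        + ∑ p, ∑ q, S (quadMap x₀ E A y) p q * quadJac E A y p a * quadJac E A y q b := by
  rw [conj_tensorT, gradComp_quadJac hU hm hA (hu.of_le (by norm_num)) hy,
    gradComp_quadJac hU hm hA (hu.of_le (by norm_num)) hy, conj_apply _ (S _)]
  congr 2
  rw [pd_pd_pullback hs hU hm hA hu hy, conj_apply]
  simp only [covHess, Matrix.of_apply, sub_mul, Finset.sum_sub_distrib]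
  have e1 : ∑ k, ∑ l, pd s l (pd s k u) (quadMap x₀ E A y) * quadJac E A y l a * quadJac E A y k b
      = ∑ p, ∑ q, pd s p (pd s q u) (quadMap x₀ E A y) * quadJac E A y p a * quadJac E A y q b :=
    Finset.sum_comm
  have e2 : ∑ k, (∑ p, ∑ q, christoffel s g k p q (quadMap x₀ E A y) * quadJac E A y p a
      * quadJac E A y q b) * pd s k u (quadMap x₀ E A y)
      = ∑ p, ∑ q, (∑ k, christoffel s g k p q (quadMap x₀ E A y) * pd s k u (quadMap x₀ E A y))
        * quadJac E A y p a * quadJac E A y q b := by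
    simp only [Finset.sum_mul]
    rw [Finset.sum_comm]
    refine Finset.sum_congr rfl fun p _ => ?_
    rw [Finset.sum_comm]
    exact Finset.sum_congr rfl fun q _ => Finset.sum_congr rfl fun k _ => by ring
  have e3 : ∑ k, A k a b * pd s k u (quadMap x₀ E A y)
      = ∑ k, pd s k u (quadMap x₀ E A y) * A k b a :=
    Finset.sum_congr rfl fun k _ => by rw [hA k a b, mul_comm]
  rw [e1, e2, e3]; ring

set_option maxHeartbeats 800000 in
/-- The second order expansion of `T` and of `|∇u|²` in an orthonormal frame along a coordinate
line of the adapted coordinates. -/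
lemma exists_tensor_jets (ι : Type*) [Fintype ι] [DecidableEq ι] {θ G : ℝ} (hθ : 0 < θ) (σ : ℝ) :
    ∃ M : ℝ, 1 ≤ M ∧ ∀ (s : Set (EuclideanSpace ℝ ι)) (g S : EuclideanSpace ℝ ι → Matrix ι ι ℝ)
      (u : EuclideanSpace ℝ ι → ℝ) (x₀ : EuclideanSpace ℝ ι) (E : Matrix ι ι ℝ)
      (U : Set (EuclideanSpace ℝ ι)) (B₁ B₂ B₃ : ℝ),
      IsControlledMetric s θ G g → (∀ i j, ContDiffOn ℝ 2 (fun x => S x i j) s) →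
      (∀ i j, PdBound s 2 σ (fun x => S x i j)) → ContDiffOn ℝ 4 u s → s ∈ 𝓝 x₀ →
      IsFrame (g x₀) E → GoodDomain U → U ∈ 𝓝 0 →
      Set.MapsTo (quadMap x₀ E (frameChristoffel s g x₀ E)) U s →
      let A := frameChristoffel s g x₀ E
      let v : EuclideanSpace ℝ ι → ℝ := fun y => u (quadMap x₀ E A y)
      (∀ k, |pd s k u x₀| ≤ B₁) → (∀ k l, |pd s l (pd s k u) x₀| ≤ B₂) →
      (∀ a b, |(E.transpose * tensorT s g S u x₀ * E) a b| ≤ B₃) →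
      (∀ c, |pd U c v 0| ≤ B₁) → ∀ i, ∃ (E' : ℝ → Matrix ι ι ℝ) (e₁ e₂ : ι → ℝ) (e₃ : ℝ),
        (∀ᶠ t in 𝓝 (0 : ℝ), IsFrame (g (quadMap x₀ E A (t • EuclideanSpace.single i 1))) (E' t)) ∧
        (∀ a, |e₁ a| ≤ M * (1 + B₁)) ∧ (∀ a, |e₂ a| ≤ M * (1 + B₁ + B₂ + B₃)) ∧
        |e₃| ≤ M * B₁ ^ 2 ∧
        (∀ a, Jet (fun t => ((E' t).transpose * tensorT s g S u
            (quadMap x₀ E A (t • EuclideanSpace.single i 1)) * E' t) a a)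
          ((E.transpose * tensorT s g S u x₀ * E) a a)
          (pd U i (pd U a (pd U a v)) 0 + 2 * pd U a v 0 * pd U i (pd U a v) 0 + e₁ a)
          (1 / 2 * pd U i (pd U i (pd U a (pd U a v))) 0 + pd U i (pd U a v) 0 ^ 2
            + pd U a v 0 * pd U i (pd U i (pd U a v)) 0 + e₂ a)) ∧
        Jet (fun t => ∑ c, gradComp s u (E' t)
            (quadMap x₀ E A (t • EuclideanSpace.single i 1)) c ^ 2)
          (∑ c, pd U c v 0 ^ 2) (2 * ∑ c, pd U c v 0 * pd U i (pd U c v) 0)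
          (∑ c, (pd U i (pd U c v) 0 ^ 2 + pd U c v 0 * pd U i (pd U i (pd U c v)) 0) + e₃) := by
  obtain ⟨MΓ, hMΓ0, hMΓ⟩ := exists_christoffel_pdBound ι hθ (G := G)
  obtain ⟨Mν, hMν0, hframe⟩ := exists_frame_along ι hθ (G := G)
  set n : ℝ := (Fintype.card ι : ℝ) with hn
  have hn0 : 0 ≤ n := Nat.cast_nonneg _
  set m : ℝ := (√θ)⁻¹ with hm
  have hm0 : 0 ≤ m := by positivity
  set mA : ℝ := n * (n * (MΓ * m * m)) with hmA
  have hmA0 : 0 ≤ mA := by positivity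
  set MG : ℝ := n * (n * (3 * (3 * ((n * (MΓ * m) + (n * (MΓ * mA)
      + 1 / 2 * (n * (n * (MΓ * m * m)))) + MΓ) * (m + mA)) * (m + mA)))) with hMG
  set MS : ℝ := n * (n * (3 * (3 * ((n * (|σ| * m) + (n * (|σ| * mA)
      + 1 / 2 * (n * (n * (|σ| * m * m)))) + |σ|) * (m + mA)) * (m + mA)))) with hMS
  have hMG0 : 0 ≤ MG := by positivity
  have hMS0 : 0 ≤ MS := by positivity
  set M : ℝ := 1 + MS + n * MG * (1 + n * m) + 2 * n * Mν + 2 * n * (n * Mν) with hM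
  have hM1 : 1 ≤ M := by
    have : 0 ≤ MS + n * MG * (1 + n * m) + 2 * n * Mν + 2 * n * (n * Mν) := by positivity
    linarith
  have hMe₁ : MS + n * MG ≤ M := by
    have e : n * MG * (1 + n * m) = n * MG + n * MG * (n * m) := by ring
    have : 0 ≤ n * MG * (n * m) + 2 * n * Mν + 2 * n * (n * Mν) := by positivity
    linarith
  have hMe₂ : ∀ B₁ B₂ B₃ : ℝ, 0 ≤ B₁ → 0 ≤ B₂ → 0 ≤ B₃ →
      MS + n * (MG * (n * (B₂ * m)) + MG * B₁) + 2 * (n * (B₃ * Mν))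
        ≤ M * (1 + B₁ + B₂ + B₃) := by
    clear_value MS MG
    intro B₁ B₂ B₃ h₁ h₂ h₃
    have e : M * (1 + B₁ + B₂ + B₃) - (MS + n * (MG * (n * (B₂ * m)) + MG * B₁)
        + 2 * (n * (B₃ * Mν)))
        = (1 + 2 * n * (n * Mν)) * (1 + B₁ + B₂ + B₃) + MS * (B₁ + B₂ + B₃)
          + n * MG * (1 + B₂ + B₃) + n * MG * (n * m) * (1 + B₁ + B₃)
          + 2 * n * Mν * (1 + B₁ + B₂) := by rw [hM]; ring
    have : 0 ≤ (1 + 2 * n * (n * Mν)) * (1 + B₁ + B₂ + B₃) + MS * (B₁ + B₂ + B₃)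
          + n * MG * (1 + B₂ + B₃) + n * MG * (n * m) * (1 + B₁ + B₃)
          + 2 * n * Mν * (1 + B₁ + B₂) := by positivity
    linarith
  have hMe₃ : 2 * n * (n * Mν) ≤ M := by
    have : 0 ≤ MS + n * MG * (1 + n * m) + 2 * n * Mν := by positivity
    linarith
  clear_value M
  refine ⟨M, hM1, ?_⟩
  intro s g S u x₀ E U B₁ B₂ B₃ h hS hσ hu hs hE hU hU0 hmaps A v hB₁ hB₂ hB₃ hv i
  have hx := mem_of_mem_nhds hs
  have hU00 : (0 : EuclideanSpace ℝ ι) ∈ U := mem_of_mem_nhds hU0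
  have hEb : ∀ k a, |E k a| ≤ m := fun k a => hE.abs_le hθ (h.lower x₀ hx) k a
  have hAb : ∀ k a b, |A k a b| ≤ mA := fun k a b =>
    abs_frameChristoffel_le hx (hMΓ s g h) hEb k a b
  have hAs : ∀ k a b, A k a b = A k b a := fun k a b => frameChristoffel_symm h hx E k a b
  obtain ⟨N, ν, hν, hNj, hNs, hNf⟩ := hframe s g h x₀ E hs hE i
  have hB₁0 : 0 ≤ B₁ := (abs_nonneg _).trans (hv i)
  have hB₂0 : 0 ≤ B₂ := (abs_nonneg _).trans (hB₂ i i)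
  have hB₃0 : 0 ≤ B₃ := (abs_nonneg _).trans (hB₃ i i)
  have hvC : ContDiffOn ℝ 4 v U := hu.comp (contDiff_quadMap 4 x₀ E A).contDiffOn hmaps
  have hv1 : ∀ a, ContDiffOn ℝ 3 (pd U a v) U := fun a => by
    exact_mod_cast contDiffOn_pd hU (k := 4) (l := 3) (by exact_mod_cast hvC) le_rfl a
  have hv2 : ∀ a b, ContDiffOn ℝ 2 (pd U a (pd U b v)) U := fun a b => by
    exact_mod_cast contDiffOn_pd hU (k := 3) (l := 2) (by exact_mod_cast hv1 b) le_rfl a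
  have hline : ∀ᶠ t : ℝ in 𝓝 0, t • EuclideanSpace.single i (1 : ℝ) ∈ U := by
    have hc : Continuous fun t : ℝ => t • (EuclideanSpace.single i (1 : ℝ) : EuclideanSpace ℝ ι) := by
      fun_prop
    exact hc.continuousAt.eventually_mem (by simpa using hU0)
  -- jets of the coefficients
  have jG : ∀ k a b, BJet MG (fun t => ∑ p, ∑ q, christoffel s g k p q
      (quadMap x₀ E A (t • EuclideanSpace.single i 1))
        * quadJac E A (t • EuclideanSpace.single i 1) p a
        * quadJac E A (t • EuclideanSpace.single i 1) q b - A k a b) 0 := by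
    intro k a b
    obtain ⟨β, γ, hβ, hγ, hj⟩ := bjet_contract h.good hs hEb hAb
      (φ := fun p q => christoffel s g k p q) (fun p q => h.christoffel_contDiffOn k p q)
      (fun p q => hMΓ s g h k p q) hMΓ0 hm0 hmA0 i a b
    refine ⟨β, γ, hβ, hγ, ?_⟩
    refine (hj.sub (jet_const (A k a b))).congr_coeff ?_ (sub_zero _) (sub_zero _)
    exact sub_self _
  have jS : ∀ a b, BJet MS (fun t => ∑ p, ∑ q, S (quadMap x₀ E A (t • EuclideanSpace.single i 1)) p q
        * quadJac E A (t • EuclideanSpace.single i 1) p a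
        * quadJac E A (t • EuclideanSpace.single i 1) q b) (∑ p, ∑ q, S x₀ p q * E p a * E q b) :=
    fun a b => bjet_contract h.good hs hEb hAb (φ := fun p q x => S x p q) hS
      (fun p q => (hσ p q).mono (le_abs_self σ)) (abs_nonneg σ) hm0 hmA0 i a b
  -- No bound is asked for the quadratic coefficient: it contains third derivatives of u, and it
  -- will be multiplied by zero.
  have ju : ∀ k, ∃ c, Jet (fun t => pd s k u (quadMap x₀ E A (t • EuclideanSpace.single i 1)))
      (pd s k u x₀) (∑ l, pd s l (pd s k u) x₀ * E l i) c := by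
    intro k
    have hc : ContDiffOn ℝ 2 (pd s k u) s := by
      exact_mod_cast contDiffOn_pd h.good (k := 4) (l := 2) (by exact_mod_cast hu) (by norm_num) k
    refine ⟨_, (jet_along_parabola h.good hc hs (WithLp.toLp 2 fun k => E k i)
      (WithLp.toLp 2 fun k => -1 / 2 * A k i i)).congr' (Eventually.of_forall fun t => ?_)⟩
    simp only [quadMap_line]
  choose βG γG hβG hγG hjG using jG
  choose βS γS hβS hγS hjS using jS
  choose γu hju using ju
  have jv : ∀ a, Jet (fun t => pd U a v (t • EuclideanSpace.single i 1)) (pd U a v 0)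
      (pd U i (pd U a v) 0) (1 / 2 * pd U i (pd U i (pd U a v)) 0) := fun a =>
    jet_along_line hU ((hv1 a).of_le (by norm_num)) hU0 i
  have jvv : ∀ a b, Jet (fun t => pd U a (pd U b v) (t • EuclideanSpace.single i 1))
      (pd U a (pd U b v) 0) (pd U i (pd U a (pd U b v)) 0)
      (1 / 2 * pd U i (pd U i (pd U a (pd U b v))) 0) := fun a b =>
    jet_along_line hU (hv2 a b) hU0 i
  -- jets of `T` in the coordinate frame
  have jGu : ∀ a b, Jet (fun t => ∑ k, (∑ p, ∑ q, christoffel s g k p q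
      (quadMap x₀ E A (t • EuclideanSpace.single i 1))
        * quadJac E A (t • EuclideanSpace.single i 1) p a
        * quadJac E A (t • EuclideanSpace.single i 1) q b - A k a b)
        * pd s k u (quadMap x₀ E A (t • EuclideanSpace.single i 1))) 0
        (∑ k, βG k a b * pd s k u x₀)
        (∑ k, (βG k a b * (∑ l, pd s l (pd s k u) x₀ * E l i) + γG k a b * pd s k u x₀)) := by
    intro a b
    -- The bracket vanishes at t = 0 because A consists of the Christoffel symbols there. This keeps
    -- third derivatives of u out of the error terms.
    refine (Jet.sum Finset.univ fun k (_ : k ∈ Finset.univ) =>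
      (hjG k a b).mul (hju k)).congr_coeff ?_ ?_ ?_
    · simp
    · simp
    · simp
  have hT0 : ∀ a b, (E.transpose * tensorT s g S u x₀ * E) a b
      = pd U a (pd U b v) 0 - 0 + pd U a v 0 * pd U b v 0 + ∑ p, ∑ q, S x₀ p q * E p a * E q b := by
    intro a b
    have := tensorT_quadJac (g := g) (S := S) h.good hU hmaps hAs (hu.of_le (by norm_num)) hU00 a b
    rw [quadMap_zero] at this
    have e : quadJac E (frameChristoffel s g x₀ E) 0 = E := by
      ext k a; simp [quadJac]
    rw [e] at this
    rw [this]
    congr 3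
    refine Finset.sum_eq_zero fun k _ => ?_
    rw [show (∑ p, ∑ q, christoffel s g k p q x₀ * E p a * E q b)
      = frameChristoffel s g x₀ E k a b from rfl, sub_self, zero_mul]
  have jT := fun a b => (((jvv a b).sub (jGu a b)).add ((jv a).mul (jv b))).add (hjS a b)
  have jT' : ∀ a b, Jet (fun t => ((quadJac E A (t • EuclideanSpace.single i 1)).transpose
      * tensorT s g S u (quadMap x₀ E A (t • EuclideanSpace.single i 1))
      * quadJac E A (t • EuclideanSpace.single i 1)) a b) _ _ _ := fun a b =>
    ((jT a b).congr' (hline.mono fun t ht =>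
      (tensorT_quadJac (g := g) (S := S) h.good hU hmaps hAs (hu.of_le (by norm_num)) ht a b).symm))
  -- N is the identity up to order two, so the frame correction affects only the quadratic
  -- coefficient, by products of ν with T at x₀.
  have jN := jet_conj_diag (B₀ := E.transpose * tensorT s g S u x₀ * E)
    (B₁ := Matrix.of fun a b => pd U i (pd U a (pd U b v)) 0 - ∑ k, βG k a b * pd s k u x₀ +
          (pd U a v 0 * pd U i (pd U b v) 0 + pd U i (pd U a v) 0 * pd U b v 0) + βS a b)
    (B₂ := Matrix.of fun a b => 1 / 2 * pd U i (pd U i (pd U a (pd U b v))) 0 -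
            ∑ k, (βG k a b * ∑ l, pd s l (pd s k u) x₀ * E l i + γG k a b * pd s k u x₀) +
          (pd U a v 0 * (1 / 2 * pd U i (pd U i (pd U b v)) 0)
            + pd U i (pd U a v) 0 * pd U i (pd U b v) 0 +
            1 / 2 * pd U i (pd U i (pd U a v)) 0 * pd U b v 0) + γS a b)
    hNj fun a b => (jT' a b).congr_coeff (hT0 a b).symm rfl rfl
  have jw := jet_mulVec hNj jv
  refine ⟨fun t => quadJac E A (t • EuclideanSpace.single i 1) * N t,
    fun a => βS a a - ∑ k, βG k a a * pd s k u x₀,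
    fun a => γS a a - (∑ k, (βG k a a * (∑ l, pd s l (pd s k u) x₀ * E l i)
      + γG k a a * pd s k u x₀))
      + (∑ j, (E.transpose * tensorT s g S u x₀ * E) a j * ν j a
        + ∑ j, (E.transpose * tensorT s g S u x₀ * E) j a * ν j a),
    ∑ c, 2 * (pd U c v 0 * ∑ b, ν b c * pd U b v 0), hNf, fun a => ?_, fun a => ?_, ?_,
    fun a => ?_, ?_⟩
  · have h1 : |∑ k, βG k a a * pd s k u x₀| ≤ n * (MG * B₁) :=
      abs_sum_le_card_mul fun k => abs_mul_le_mul (hβG k a a) (hB₁ k)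
    refine (abs_sub _ _).trans ?_
    have h3 : MS + n * (MG * B₁) ≤ (MS + n * MG) * (1 + B₁) := by
      have : 0 ≤ MS * B₁ + n * MG := by positivity
      linarith
    calc _ ≤ MS + n * (MG * B₁) := add_le_add (hβS a a) h1
      _ ≤ (MS + n * MG) * (1 + B₁) := h3
      _ ≤ M * (1 + B₁) := mul_le_mul_of_nonneg_right hMe₁ (by linarith)
  · have h1 : |∑ k, (βG k a a * (∑ l, pd s l (pd s k u) x₀ * E l i) + γG k a a * pd s k u x₀)|
        ≤ n * (MG * (n * (B₂ * m)) + MG * B₁) :=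
      abs_sum_le_card_mul fun k => (abs_add_le _ _).trans (add_le_add
        (abs_mul_le_mul (hβG k a a) (abs_sum_le_card_mul fun l =>
          abs_mul_le_mul (hB₂ k l) (hEb l i))) (abs_mul_le_mul (hγG k a a) (hB₁ k)))
    have h2 : |∑ j, (E.transpose * tensorT s g S u x₀ * E) a j * ν j a| ≤ n * (B₃ * Mν) :=
      abs_sum_le_card_mul fun j => abs_mul_le_mul (hB₃ a j) (hν j a)
    have h3 : |∑ j, (E.transpose * tensorT s g S u x₀ * E) j a * ν j a| ≤ n * (B₃ * Mν) :=
      abs_sum_le_card_mul fun j => abs_mul_le_mul (hB₃ j a) (hν j a)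
    have h4 := abs_add_le (γS a a - ∑ k, (βG k a a * (∑ l, pd s l (pd s k u) x₀ * E l i)
      + γG k a a * pd s k u x₀)) (∑ j, (E.transpose * tensorT s g S u x₀ * E) a j * ν j a
        + ∑ j, (E.transpose * tensorT s g S u x₀ * E) j a * ν j a)
    have h5 := abs_sub (γS a a) (∑ k, (βG k a a * (∑ l, pd s l (pd s k u) x₀ * E l i)
      + γG k a a * pd s k u x₀))
    have h6 := abs_add_le (∑ j, (E.transpose * tensorT s g S u x₀ * E) a j * ν j a)
        (∑ j, (E.transpose * tensorT s g S u x₀ * E) j a * ν j a)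
    have h7 := hγS a a
    have h8 := hMe₂ B₁ B₂ B₃ hB₁0 hB₂0 hB₃0
    linarith
  · have h1 : |∑ c, 2 * (pd U c v 0 * ∑ b, ν b c * pd U b v 0)|
        ≤ n * (2 * (B₁ * (n * (Mν * B₁)))) :=
      abs_sum_le_card_mul fun c => abs_mul_le_mul (by norm_num) (abs_mul_le_mul (hv c)
        (abs_sum_le_card_mul fun b => abs_mul_le_mul (hν b c) (hv b)))
    refine h1.trans ?_
    calc n * (2 * (B₁ * (n * (Mν * B₁)))) = 2 * n * (n * Mν) * B₁ ^ 2 := by ring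
      _ ≤ M * B₁ ^ 2 := mul_le_mul_of_nonneg_right hMe₃ (sq_nonneg _)
  · refine ((jN a).congr' (Eventually.of_forall fun t => ?_)).congr_coeff rfl ?_ ?_
    · simp only [Matrix.transpose_mul, Matrix.mul_assoc]
    · simp only [Matrix.of_apply]; ring
    · simp only [Matrix.of_apply]; ring
  · have e : ∀ᶠ t in 𝓝 (0 : ℝ), ∀ c, gradComp s u (quadJac E A (t • EuclideanSpace.single i 1) * N t)
        (quadMap x₀ E A (t • EuclideanSpace.single i 1)) c
        = ∑ b, N t b c * pd U b v (t • EuclideanSpace.single i 1) := by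
      filter_upwards [hline] with t ht c
      rw [gradComp]
      simp only [Matrix.mul_apply, Finset.sum_mul]
      rw [Finset.sum_comm]
      refine Finset.sum_congr rfl fun b _ => ?_
      rw [← gradComp_quadJac hU hmaps hAs (hu.of_le (by norm_num)) ht, gradComp, Finset.mul_sum]
      exact Finset.sum_congr rfl fun k _ => by ring
    have j := Jet.sum Finset.univ fun c (_ : c ∈ Finset.univ) => (jw c).mul (jw c)
    refine (j.congr' (e.mono fun t ht => ?_)).congr_coeff ?_ ?_ ?_
    · exact Finset.sum_congr rfl fun c _ => by rw [ht c]; ring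
    · exact Finset.sum_congr rfl fun c _ => by ring
    · rw [Finset.mul_sum]; exact Finset.sum_congr rfl fun c _ => by ring
    · rw [← Finset.sum_add_distrib]; exact Finset.sum_congr rfl fun c _ => by ring

end TensorJets

end BoundaryEstimate

end

noncomputable section

namespace BoundaryEstimate

open Finset Filter Topology Asymptotics

/-! ### Control of du and ∇²u by T, and of the test quantity by the Hessian -/

section PointwiseBounds

set_option linter.unusedSectionVars false

variable {ι : Type*} [Fintype ι] [DecidableEq ι]

lemma IsFrame.abs_le_covectorNorm {h E : Matrix ι ι ℝ} (hE : IsFrame h E) (w : ι → ℝ) (a : ι) :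
    |∑ i, w i * E i a| ≤ covectorNorm h w := by
  rw [covectorNorm, hE.covectorNormSq_eq]
  refine Real.abs_le_sqrt ?_
  have : ∑ i, w i * E i a = ∑ i, E i a * w i := Finset.sum_congr rfl fun i _ => mul_comm _ _
  rw [this]
  exact Finset.single_le_sum (f := fun c => (∑ i, E i c * w i) ^ 2) (fun c _ => sq_nonneg _)
    (Finset.mem_univ a)

lemma abs_le_sqrt_sum_sq (B : ι → ι → ℝ) (a b : ι) : |B a b| ≤ √(∑ a, ∑ b, B a b ^ 2) := by
  refine Real.abs_le_sqrt ?_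
  calc B a b ^ 2 ≤ ∑ b, B a b ^ 2 :=
        Finset.single_le_sum (f := fun b => B a b ^ 2) (fun c _ => sq_nonneg _) (Finset.mem_univ b)
    _ ≤ ∑ a, ∑ b, B a b ^ 2 := Finset.single_le_sum (f := fun a => ∑ b, B a b ^ 2)
        (fun c _ => Finset.sum_nonneg fun _ _ => sq_nonneg _) (Finset.mem_univ a)

lemma IsFrame.abs_le_tensorNorm {h E : Matrix ι ι ℝ} (hE : IsFrame h E) (T : Matrix ι ι ℝ)
    (a b : ι) : |(E.transpose * T * E) a b| ≤ tensorNorm h T := by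
  rw [hE.tensorNorm_eq]
  exact abs_le_sqrt_sum_sq (fun a b => (E.transpose * T * E) a b) a b

lemma IsFrame.mul_transpose_right {h E : Matrix ι ι ℝ} (hE : IsFrame h E) (hs : h.IsSymm) :
    h * E * E.transpose = 1 := by
  have := congrArg Matrix.transpose hE.mul_transpose
  rwa [Matrix.transpose_mul, Matrix.transpose_mul, Matrix.transpose_transpose, hs.eq,
    Matrix.transpose_one] at this

lemma IsFrame.covector_eq {h E : Matrix ι ι ℝ} (hE : IsFrame h E) (hs : h.IsSymm) (w : ι → ℝ)
    (k : ι) : w k = ∑ a, (h * E) k a * ∑ i, E i a * w i := by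
  have h1 := congrArg (fun A => A.mulVec w k) (hE.mul_transpose_right hs)
  simp only [Matrix.one_mulVec] at h1
  rw [← Matrix.mulVec_mulVec] at h1
  exact h1.symm

lemma IsFrame.tensor_eq {h E : Matrix ι ι ℝ} (hE : IsFrame h E) (hs : h.IsSymm) (T : Matrix ι ι ℝ)
    (k l : ι) : T k l = ∑ a, ∑ b, (E.transpose * T * E) a b * (h * E) k a * (h * E) l b := by
  have h1 := hE.mul_transpose_right hs
  have h2 : T = (h * E) * (E.transpose * T * E) * (h * E).transpose := by
    have h3 := congrArg Matrix.transpose h1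
    rw [Matrix.transpose_mul, Matrix.transpose_transpose, Matrix.transpose_one] at h3
    calc T = (h * E * E.transpose) * T * (E * (h * E).transpose) := by
            rw [h1, h3, Matrix.one_mul, Matrix.mul_one]
      _ = _ := by simp only [Matrix.mul_assoc]
  have h4 := conj_apply (h * E).transpose (E.transpose * T * E) k l
  rw [Matrix.transpose_transpose, ← h2] at h4
  exact h4

variable {s : Set (EuclideanSpace ℝ ι)} {x : EuclideanSpace ℝ ι} {θ G σ : ℝ}
  {g S : EuclideanSpace ℝ ι → Matrix ι ι ℝ} {u : EuclideanSpace ℝ ι → ℝ} {E : Matrix ι ι ℝ}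

lemma abs_mul_apply_le {A B : Matrix ι ι ℝ} {α β : ℝ} (hA : ∀ i j, |A i j| ≤ α)
    (hB : ∀ i j, |B i j| ≤ β) (i j : ι) : |(A * B) i j| ≤ Fintype.card ι * (α * β) := by
  rw [Matrix.mul_apply]
  exact abs_sum_le_card_mul fun k => abs_mul_le_mul (hA i k) (hB k j)

/-- The coordinate derivatives of `u` up to second order are controlled by the frame components of
`du` and of `T`. -/
lemma exists_derivative_bound (ι : Type*) [Fintype ι] [DecidableEq ι] {θ G : ℝ} (hθ : 0 < θ)
    (σ : ℝ) : ∃ M : ℝ, 1 ≤ M ∧ ∀ (s : Set (EuclideanSpace ℝ ι))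
      (g S : EuclideanSpace ℝ ι → Matrix ι ι ℝ) (u : EuclideanSpace ℝ ι → ℝ)
      (x : EuclideanSpace ℝ ι) (E : Matrix ι ι ℝ) (κ B : ℝ), IsControlledMetric s θ G g →
      (∀ i j, |S x i j| ≤ σ) → x ∈ s → IsFrame (g x) E → 1 ≤ κ → 1 ≤ B →
      (∀ a, |gradComp s u E x a| ≤ B * κ) →
      (∀ a b, |(E.transpose * tensorT s g S u x * E) a b| ≤ B * κ ^ 2) →
      (∀ k, |pd s k u x| ≤ M * B ^ 2 * κ) ∧
      (∀ k l, |pd s l (pd s k u) x| ≤ M * B ^ 2 * κ ^ 2) ∧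
      (∀ a b, |(E.transpose * covHess s g u x * E) a b| ≤ M * B ^ 2 * κ ^ 2) ∧
      (∀ a b, |(E.transpose * S x * E) a b| ≤ M) := by
  obtain ⟨MΓ, hMΓ0, hMΓ⟩ := exists_christoffel_pdBound ι hθ (G := G)
  set n : ℝ := (Fintype.card ι : ℝ) with hn
  have hn0 : 0 ≤ n := Nat.cast_nonneg _
  set m : ℝ := (√θ)⁻¹ with hm
  have hm0 : 0 ≤ m := by positivity
  set MS : ℝ := n * (n * (|σ| * m * m)) with hMS
  have hMS0 : 0 ≤ MS := by positivity
  set b : ℝ := n * (|G| * m) with hb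
  have hb0 : 0 ≤ b := by positivity
  set MC : ℝ := n * (n * ((2 + MS) * b * b)) with hMC
  have hMC0 : 0 ≤ MC := by positivity
  set M : ℝ := 3 + MS + n * b + MC + n * (MΓ * (n * b)) with hM
  clear_value n m MS b MC
  have hM1 : 3 ≤ M := by
    have : 0 ≤ MS + n * b + MC + n * (MΓ * (n * b)) := by positivity
    linarith
  have hMb : n * b ≤ M := by
    have : 0 ≤ 3 + MS + MC + n * (MΓ * (n * b)) := by positivity
    linarith
  have hMS' : 2 + MS ≤ M := by
    have : 0 ≤ 1 + n * b + MC + n * (MΓ * (n * b)) := by positivity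
    linarith
  have hMC' : MC + n * (MΓ * (n * b)) ≤ M := by
    have : 0 ≤ 3 + MS + n * b := by positivity
    linarith
  clear_value M
  refine ⟨M, by linarith, ?_⟩
  intro s g S u x E κ B h hS hx hE hκ hB hv hT
  have hB2 : B ≤ B ^ 2 := by nlinarith
  have hB1 : 1 ≤ B ^ 2 := hB.trans hB2
  have hκ1 : κ ≤ κ ^ 2 := by nlinarith
  have hκ2 : 1 ≤ κ ^ 2 := hκ.trans hκ1
  have hEb : ∀ k a, |E k a| ≤ m := fun k a => by rw [hm]; exact hE.abs_le hθ (h.lower x hx) k a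
  have hgb : ∀ i j, |g x i j| ≤ |G| := fun i j => ((h.bound i j).abs_le x hx).trans (le_abs_self G)
  have hgE : ∀ k a, |(g x * E) k a| ≤ b := fun k a => by
    rw [hb, hn]; exact abs_mul_apply_le hgb hEb k a
  have hSE : ∀ a b, |(E.transpose * S x * E) a b| ≤ MS := fun a b => by
    rw [conj_apply, hMS, hn]
    exact abs_sum_le_card_mul fun i => abs_sum_le_card_mul fun j => abs_mul_le_mul
      (abs_mul_le_mul ((hS i j).trans (le_abs_self σ)) (hEb i a)) (hEb j b)
  have hu1 : ∀ k, |pd s k u x| ≤ n * b * (B * κ) := fun k => by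
    rw [hE.covector_eq (h.isSymm hx) (fun k => pd s k u x) k]
    refine (abs_sum_le_card_mul (B := b * (B * κ)) fun a => abs_mul_le_mul (hgE k a) (hv a)).trans ?_
    rw [← hn]; exact le_of_eq (by ring)
  have hC : ∀ a b, |(E.transpose * covHess s g u x * E) a b| ≤ (2 + MS) * (B ^ 2 * κ ^ 2) := by
    intro a b
    have e := conj_tensorT (g := g) (S := S) (u := u) (s := s) (x := x) E a b
    have h1 := hT a b
    have h2 := abs_mul_le_mul (hv a) (hv b)
    have h3 := hSE a b
    have h4 : B * κ ^ 2 ≤ B ^ 2 * κ ^ 2 := mul_le_mul_of_nonneg_right hB2 (by positivity)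
    have h5 : MS ≤ MS * (B ^ 2 * κ ^ 2) := le_mul_of_one_le_right hMS0 (one_le_mul_of_one_le_of_one_le hB1 hκ2)
    have h6 : B * κ * (B * κ) = B ^ 2 * κ ^ 2 := by ring
    rw [abs_le] at h1 h2 h3 ⊢
    constructor <;> linarith [h1.1, h1.2, h2.1, h2.2, h3.1, h3.2]
  have hBκ : 0 ≤ B ^ 2 * κ ^ 2 := by positivity
  refine ⟨fun k => (hu1 k).trans ?_, fun k l => ?_, fun a b => (hC a b).trans ?_,
    fun a b => (hSE a b).trans (by linarith)⟩
  · have h1 : B * κ ≤ B ^ 2 * κ := mul_le_mul_of_nonneg_right hB2 (by linarith)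
    calc n * b * (B * κ) ≤ M * (B ^ 2 * κ) := mul_le_mul hMb h1 (by positivity) (by linarith)
      _ = M * B ^ 2 * κ := by ring
  · have e : pd s l (pd s k u) x = covHess s g u x l k
        + ∑ p, christoffel s g p l k x * pd s p u x := by simp [covHess]
    have h1 : |covHess s g u x l k| ≤ MC * (B ^ 2 * κ ^ 2) := by
      rw [hE.tensor_eq (h.isSymm hx) (covHess s g u x) l k]
      refine (abs_sum_le_card_mul fun a => abs_sum_le_card_mul fun b => abs_mul_le_mul
        (abs_mul_le_mul (hC a b) (hgE l a)) (hgE k b)).trans ?_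
      rw [← hn, hMC]; exact le_of_eq (by ring)
    have h2 : |∑ p, christoffel s g p l k x * pd s p u x| ≤ n * (MΓ * (n * b)) * (B ^ 2 * κ ^ 2) := by
      refine (abs_sum_le_card_mul fun p => abs_mul_le_mul ((hMΓ s g h p l k).abs_le x hx)
        (hu1 p)).trans ?_
      rw [← hn]
      have h3 : B * κ ≤ B ^ 2 * κ ^ 2 := mul_le_mul hB2 hκ1 (by linarith) (by positivity)
      calc n * (MΓ * (n * b * (B * κ))) = n * (MΓ * (n * b)) * (B * κ) := by ring
        _ ≤ _ := mul_le_mul_of_nonneg_left h3 (by positivity)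
    rw [e]
    have h4 := mul_le_mul_of_nonneg_right hMC' hBκ
    have h5 := abs_add_le (covHess s g u x l k) (∑ p, christoffel s g p l k x * pd s p u x)
    have h6 : M * B ^ 2 * κ ^ 2 = M * (B ^ 2 * κ ^ 2) := by ring
    rw [h6]; linarith
  · have := mul_le_mul_of_nonneg_right hMS' hBκ
    linarith

/-- Presents T_oo + tr T as a trace with weights in {1, 2}, the form required by the interior
inequality. -/
lemma sum_double_weight {n : ℕ} (o : Fin n) (X : Fin n → ℝ) :
    ∑ a, (if a = o then 2 else 1) * X a = X o + ∑ a, X a := by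
  have : ∀ a, (if a = o then (2 : ℝ) else 1) * X a = (if a = o then X a else 0) + X a := fun a => by
    split_ifs <;> ring
  simp only [this, Finset.sum_add_distrib]
  simp

/-- In dimension at least three the test quantity is controlled by the Hessian. -/
lemma sq_trace_le {n : ℕ} (hn : 3 ≤ n) {τ v : Fin n → ℝ} {c : Fin n → Fin n → ℝ} {b : Fin n → ℝ}
    {o : Fin n} {M : ℝ} (hτ : ∀ a, τ a = c a a + v a * v a + b a) (hb : ∀ a, |b a| ≤ M)
    (hM : 0 ≤ M) (hp : n / 2 * ∑ a, v a ^ 2 < ∑ a, τ a) (hk : 0 ≤ τ o + ∑ a, τ a) :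
    (1 + (τ o + ∑ a, τ a)) ^ 2
      ≤ (2 * (6 * n + 1) ^ 2 + 2 * (1 + (6 * n + 1) * M) ^ 2) * (1 + ∑ i, ∑ j, c i j ^ 2) := by
  set N : ℝ := √(∑ i, ∑ j, c i j ^ 2) with hN
  have hN2 : N ^ 2 = ∑ i, ∑ j, c i j ^ 2 :=
    Real.sq_sqrt (Finset.sum_nonneg fun _ _ => Finset.sum_nonneg fun _ _ => sq_nonneg _)
  have hN0 : 0 ≤ N := Real.sqrt_nonneg _
  have hc : ∀ a, c a a ≤ N := fun a => (le_abs_self _).trans (abs_le_sqrt_sum_sq c a a)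
  set p := ∑ a, v a ^ 2 with hpd
  set t := ∑ a, τ a with ht
  have hn3 : (3 : ℝ) ≤ n := by exact_mod_cast hn
  have hp0 : 0 ≤ p := Finset.sum_nonneg fun _ _ => sq_nonneg _
  have hs : t ≤ n * (N + M) + p := by
    have e : t = ∑ a, (c a a + b a) + p := by
      rw [ht, hpd, ← Finset.sum_add_distrib]
      exact Finset.sum_congr rfl fun a _ => by rw [hτ]; ring
    have : ∑ a, (c a a + b a) ≤ n * (N + M) := by
      have := Finset.sum_le_card_nsmul Finset.univ (fun a => c a a + b a) (N + M)
        fun a _ => add_le_add (hc a) ((le_abs_self _).trans (hb a))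
      rw [Finset.card_univ, Fintype.card_fin, nsmul_eq_mul] at this
      exact this
    linarith
  -- The use of n ≥ 3: from (3/2)p < tr T ≤ n(N + M) + p it follows that p ≤ 2n(N + M). For n = 2
  -- the term p would cancel and leave no information.
  have hp2 : 3 / 2 * p ≤ n / 2 * p := mul_le_mul_of_nonneg_right (by linarith) hp0
  have hto : τ o ≤ N + M + p := by
    have h1 : v o ^ 2 ≤ p := Finset.single_le_sum (f := fun a => v a ^ 2)
      (fun _ _ => sq_nonneg _) (Finset.mem_univ o)
    have h2 := hc o
    have h3 := (le_abs_self _).trans (hb o)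
    rw [hτ o]; nlinarith
  have hNM : 0 ≤ n * (N + M) := by positivity
  have hk2 : 1 + (τ o + t) ≤ (6 * n + 1) * N + (1 + (6 * n + 1) * M) := by
    have : p ≤ 2 * (n * (N + M)) := by linarith
    have h3 : t ≤ 3 * (n * (N + M)) := by linarith
    nlinarith
  have h1 : (1 + (τ o + t)) ^ 2 ≤ ((6 * n + 1) * N + (1 + (6 * n + 1) * M)) ^ 2 :=
    pow_le_pow_left₀ (by linarith) hk2 2
  refine h1.trans ?_
  rw [← hN2]
  have h2 : ((6 * n + 1) * N + (1 + (6 * n + 1) * M)) ^ 2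
      ≤ 2 * ((6 * n + 1) * N) ^ 2 + 2 * (1 + (6 * n + 1) * M) ^ 2 := add_sq_le.trans (by ring_nf; rfl)
  refine h2.trans ?_
  have h3 : 0 ≤ (1 + (6 * n + 1) * M) ^ 2 * N ^ 2 + (6 * (n : ℝ) + 1) ^ 2 := by positivity
  nlinarith

end PointwiseBounds

/-! ### Derivatives along coordinate lines -/

section CoordinateLines

set_option linter.unusedSectionVars false

variable {ι : Type*} [Fintype ι] [DecidableEq ι] {U : Set (EuclideanSpace ℝ ι)}
  {φ : EuclideanSpace ℝ ι → ℝ}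

lemma hasDerivAt_along_line (hU : IsOpen U) (hφ : ContDiffOn ℝ 1 φ U) (i : ι) {t : ℝ}
    (ht : t • EuclideanSpace.single i (1 : ℝ) ∈ U) :
    HasDerivAt (fun t : ℝ => φ (t • EuclideanSpace.single i 1))
      (pd U i φ (t • EuclideanSpace.single i 1)) t := by
  have hc : Continuous fun t : ℝ => t • (EuclideanSpace.single i (1 : ℝ) : EuclideanSpace ℝ ι) := by
    fun_prop
  have h := hasDerivWithinAt_comp_curve (t := U)
    (I := (fun t : ℝ => t • (EuclideanSpace.single i (1 : ℝ) : EuclideanSpace ℝ ι)) ⁻¹' U) (τ := t)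
    (γ := fun t => t • EuclideanSpace.single i 1) (γ' := fun k => EuclideanSpace.single i (1 : ℝ) k)
    (χ := φ) (fun _ h => h) (hφ.differentiableOn one_ne_zero _ ht) fun k => by
      have := ((hasDerivAt_id t).mul_const ((EuclideanSpace.single i (1 : ℝ) : EuclideanSpace ℝ ι) k))
      simpa using this.hasDerivWithinAt
  have h2 := h.hasDerivAt ((hU.preimage hc).mem_nhds ht)
  simpa using h2

lemma pd_pd_comm (hU : IsOpen U) (hφ : ContDiffOn ℝ 3 φ U) {y : EuclideanSpace ℝ ι} (hy : y ∈ U)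
    (i a : ι) : pd U i (pd U a (pd U a φ)) y = pd U a (pd U a (pd U i φ)) y := by
  have hG := GoodDomain.of_isOpen hU
  have h1 : ContDiffOn ℝ 2 (pd U a φ) U := by
    exact_mod_cast contDiffOn_pd hG (k := 3) (l := 2) (by exact_mod_cast hφ) le_rfl a
  rw [pd_comm hG h1 hy]
  exact pd_congr (fun z hz => pd_comm hG (hφ.of_le (by norm_num)) hz i a) hy a

end CoordinateLines

/-! ### The estimate at an interior maximum -/

section Interior

/-- The derivatives of `f` up to second order at `(x, z)` are bounded by `c`. -/
structure RhsBound {ι : Type*} [Fintype ι] [DecidableEq ι] (s : Set (EuclideanSpace ℝ ι))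
    (g : EuclideanSpace ℝ ι → Matrix ι ι ℝ) (f : EuclideanSpace ℝ ι → ℝ → ℝ) (c : ℝ)
    (x : EuclideanSpace ℝ ι) (z : ℝ) : Prop where
  dx : covectorNorm (g x) (fun i => pd s i (fun y => f y z) x) ≤ c
  dz : |deriv (f x) z| ≤ c
  dxx : tensorNorm (g x) (covHess s g (fun y => f y z) x) ≤ c
  dxz : covectorNorm (g x) (fun i => pd s i (fun y => deriv (f y) z) x) ≤ c
  dzz : |deriv (deriv (f x)) z| ≤ c

set_option maxHeartbeats 1600000 in
/-- The estimate at an interior maximum point of `q (λ_max(T) + tr T)`. -/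
lemma exists_interior_estimate {n : ℕ} (hn : 3 ≤ n) {θ G : ℝ} (hθ : 0 < θ) (σ c Q : ℝ) :
    ∃ C : ℝ, ∀ (s : Set (EuclideanSpace ℝ (Fin n)))
      (g S : EuclideanSpace ℝ (Fin n) → Matrix (Fin n) (Fin n) ℝ)
      (u q : EuclideanSpace ℝ (Fin n) → ℝ) (Γ : Set (Fin n → ℝ)) (F : (Fin n → ℝ) → ℝ) (ε : ℝ)
      (f : EuclideanSpace ℝ (Fin n) → ℝ → ℝ) (x₀ : EuclideanSpace ℝ (Fin n))
      (E : Matrix (Fin n) (Fin n) ℝ) (τ : Fin n → ℝ) (o : Fin n),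
      IsControlledMetric s θ G g → (∀ i j, ContDiffOn ℝ 2 (fun x => S x i j) s) →
      (∀ i j, PdBound s 2 σ (fun x => S x i j)) → (∀ x ∈ s, (S x).IsSymm) → ContDiffOn ℝ 4 u s →
      IsAdmissibleCone Γ → IsStructured Γ F ε →
      ContDiffOn ℝ 2 (fun p : EuclideanSpace ℝ (Fin n) × ℝ => f p.1 p.2) (s ×ˢ Set.univ) →
      SolvesOn s g S u Γ F (fun x => f x (u x)) → s ∈ 𝓝 x₀ → RhsBound s g f c x₀ (u x₀) →
      ContDiffOn ℝ 2 q s → 0 < q x₀ → q x₀ ≤ Q → (∀ k, |pd s k q x₀| ≤ Q * √(q x₀)) →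
      (∀ k l, |pd s l (pd s k q) x₀| ≤ Q) → IsFrame (g x₀) E →
      E.transpose * tensorT s g S u x₀ * E = Matrix.diagonal τ → (∀ a, τ a ≤ τ o) →
      (∀ x ∈ s, ∀ E', IsFrame (g x) E' → q x * ((E'.transpose * tensorT s g S u x * E') o o
        + ∑ a, (E'.transpose * tensorT s g S u x * E') a a) ≤ q x₀ * (τ o + ∑ a, τ a)) →
      q x₀ * (1 + (τ o + ∑ a, τ a)) ≤ C := by
  obtain ⟨MΓ, hMΓ0, hMΓ⟩ := exists_christoffel_pdBound (Fin n) hθ (G := G)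
  obtain ⟨M₁, hM₁, hderiv⟩ := exists_derivative_bound (Fin n) hθ (G := G) σ
  obtain ⟨M₂, hM₂, hjets⟩ := exists_tensor_jets (Fin n) hθ (G := G) σ
  set m : ℝ := (√θ)⁻¹ with hm
  have hm0 : 0 ≤ m := by positivity
  set mA : ℝ := n * (n * (MΓ * m * m)) with hmA
  have hmA0 : 0 ≤ mA := by positivity
  -- At the maximum |du| ≤ 2κ and |T| ≤ nκ² in the frame, by `eigenvalue_bounds`; this number serves
  -- for both.
  set B : ℝ := 2 + n with hB
  have hB1 : 1 ≤ B := by have : (0:ℝ) ≤ n := Nat.cast_nonneg _; linarith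
  set MB : ℝ := M₁ * B ^ 2 + B with hMB
  have hMB1 : 1 ≤ MB := by
    have : 0 ≤ M₁ * B ^ 2 := by positivity
    linarith
  set M : ℝ := MB + |Q| + 4 * M₂ * MB ^ 2 + |c| * (1 + 5 * MB ^ 2) + n * (|Q| * m)
    + n * (|Q| * (1 + |Q|) * mA) + n * (n * (|Q| * m * m))
    + (2 * (6 * n + 1) ^ 2 + 2 * (1 + (6 * n + 1) * M₁) ^ 2) with hM
  have hM' : 1 ≤ M ∧ MB ≤ M ∧ Q ≤ M ∧ 4 * M₂ * MB ^ 2 ≤ M ∧ |c| * (1 + 5 * MB ^ 2) ≤ M ∧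
      n * (|Q| * m) ≤ M ∧ n * (|Q| * (1 + |Q|) * mA) + n * (n * (|Q| * m * m)) ≤ M ∧
      2 * (6 * n + 1) ^ 2 + 2 * (1 + (6 * n + 1) * M₁) ^ 2 ≤ M := by
    have h1 : 0 ≤ |Q| := abs_nonneg Q
    have h2 : 0 ≤ 4 * M₂ * MB ^ 2 := by positivity
    have h3 : 0 ≤ |c| * (1 + 5 * MB ^ 2) := by positivity
    have h4 : 0 ≤ n * (|Q| * m) := by positivity
    have h5 : 0 ≤ n * (|Q| * (1 + |Q|) * mA) := by positivity
    have h6 : 0 ≤ n * (n * (|Q| * m * m)) := by positivity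
    have h7 : 0 ≤ 2 * (6 * (n : ℝ) + 1) ^ 2 + 2 * (1 + (6 * n + 1) * M₁) ^ 2 := by positivity
    have h8 := le_abs_self Q
    refine ⟨?_, ?_, ?_, ?_, ?_, ?_, ?_, ?_⟩ <;> linarith
  clear_value M MB B
  obtain ⟨hM1, hM2, hM3, hM4, hM5, hM6, hM7, hM8⟩ := hM'
  obtain ⟨C, -, hC⟩ := exists_interior_bound (Fin n) hM1
  refine ⟨C, ?_⟩
  intro s g S u q Γ F ε f x₀ E τ o h hS hσ hSs hu hΓ hF hf hsol hs hfb hq hq0 hqQ hq1 hq2 hE hτ ho hmax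
  have hx := mem_of_mem_nhds hs
  set A := frameChristoffel s g x₀ E with hA
  -- The adapted coordinates are used on an open neighbourhood of the origin that is mapped into s;
  -- it need not be mapped diffeomorphically.
  set U : Set (EuclideanSpace ℝ (Fin n)) := quadMap x₀ E A ⁻¹' interior s with hUd
  have hUo : IsOpen U := isOpen_interior.preimage (contDiff_quadMap 0 x₀ E A).continuous
  have hU00 : (0 : EuclideanSpace ℝ (Fin n)) ∈ U := by
    rw [hUd, Set.mem_preimage, quadMap_zero]; exact mem_interior_iff_mem_nhds.2 hs
  have hU := GoodDomain.of_isOpen hUo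
  have hU0 : U ∈ 𝓝 0 := hUo.mem_nhds hU00
  have hmaps : Set.MapsTo (quadMap x₀ E A) U s := fun y hy => interior_subset hy
  set v : EuclideanSpace ℝ (Fin n) → ℝ := fun y => u (quadMap x₀ E A y) with hv
  have hAs : ∀ k a b, A k a b = A k b a := fun k a b => frameChristoffel_symm h hx E k a b
  have hvC : ContDiffOn ℝ 4 v U := hu.comp (contDiff_quadMap 4 x₀ E A).contDiffOn hmaps
  have hv1 : ∀ a, ContDiffOn ℝ 3 (pd U a v) U := fun a => by
    exact_mod_cast contDiffOn_pd hU (k := 4) (l := 3) (by exact_mod_cast hvC) le_rfl a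
  have hu2 : ContDiffOn ℝ 2 u s := hu.of_le (by norm_num)
  have hEb : ∀ k a, |E k a| ≤ m := fun k a => hE.abs_le hθ (h.lower x₀ hx) k a
  have hAb : ∀ k a b, |A k a b| ≤ mA := fun k a b => by
    have := abs_frameChristoffel_le hx (hMΓ s g h) hEb k a b
    rwa [Fintype.card_fin] at this
  have hJ0 : quadJac E A 0 = E := by ext k a; simp [quadJac]
  -- size of the quantities at `x₀`
  have hgrad : ∀ a, gradComp s u E x₀ a = pd U a v 0 := fun a => by
    have := gradComp_quadJac hU hmaps hAs (hu.of_le (by norm_num)) hU00 a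
    rwa [quadMap_zero, hJ0] at this
  have hTd : ∀ a, (E.transpose * tensorT s g S u x₀ * E) a a = τ a := fun a => by
    rw [hτ, Matrix.diagonal_apply_eq]
  obtain ⟨hmem, hFval⟩ := hsol.eigenvalues hΓ hF hx hE hτ
  have hp0 : 0 ≤ ∑ c, gradComp s u E x₀ c ^ 2 := Finset.sum_nonneg fun _ _ => sq_nonneg _
  obtain ⟨hk0, hp2, hτb, hpτ, -⟩ := eigenvalue_bounds hΓ hp0 hmem ho rfl
  set k : ℝ := τ o + ∑ a, τ a with hk
  -- The scale of the gradient; T and the Hessian have scale κ². The added 1 lets bounded quantities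
  -- be absorbed into powers of κ.
  set κ : ℝ := √(1 + k) with hκ
  have hκ2 : κ ^ 2 = 1 + k := Real.sq_sqrt (by linarith)
  have hκ1 : 1 ≤ κ := by rw [hκ, Real.one_le_sqrt]; linarith
  have hκκ : κ ≤ κ ^ 2 := le_self_pow₀ hκ1 two_ne_zero
  have hgb : ∀ a, |gradComp s u E x₀ a| ≤ B * κ := fun a => by
    have h1 : gradComp s u E x₀ a ^ 2 ≤ (2 * κ) ^ 2 := by
      have : gradComp s u E x₀ a ^ 2 ≤ ∑ c, gradComp s u E x₀ c ^ 2 :=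
        Finset.single_le_sum (f := fun c => gradComp s u E x₀ c ^ 2) (fun _ _ => sq_nonneg _)
          (Finset.mem_univ a)
      rw [mul_pow, hκ2]; linarith
    have h2 := abs_le_of_sq_le_sq h1 (by linarith)
    have h3 : 2 * κ ≤ B * κ := mul_le_mul_of_nonneg_right (by rw [hB]; simp) (by linarith)
    exact h2.trans h3
  have hTb : ∀ a b, |(E.transpose * tensorT s g S u x₀ * E) a b| ≤ B * κ ^ 2 := fun a b => by
    rw [hτ, Matrix.diagonal_apply]
    split_ifs
    · refine (hτb a).trans ?_
      rw [hκ2, hB]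
      have : (0 : ℝ) ≤ n := Nat.cast_nonneg _
      linarith
    · rw [abs_zero]; positivity
  obtain ⟨hb1, hb2, hb3, hb4⟩ := hderiv s g S u x₀ E κ B h (fun i j => (hσ i j).abs_le x₀ hx) hx hE
    hκ1 hB1 hgb hTb
  have hMBle : M₁ * B ^ 2 ≤ MB := by rw [hMB]; linarith
  have hBle : B ≤ MB := by
    have : 0 ≤ M₁ * B ^ 2 := by positivity
    rw [hMB]; linarith
  have hκ0 : 0 ≤ κ := by linarith
  have hκ20 : 0 ≤ κ ^ 2 := sq_nonneg κ
  have hvb : ∀ a, |pd U a v 0| ≤ MB * κ := fun a => by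
    rw [← hgrad]; exact (hgb a).trans (mul_le_mul_of_nonneg_right hBle hκ0)
  -- At the centre, A cancels the connection, so coordinate second derivatives of v are frame
  -- components of the covariant Hessian of u.
  have hvv : ∀ a b, pd U a (pd U b v) 0 = (E.transpose * covHess s g u x₀ * E) a b := by
    intro a b
    have h1 := tensorT_quadJac (g := g) (S := S) h.good hU hmaps hAs hu2 hU00 a b
    have h2 := conj_tensorT (g := g) (S := S) (u := u) (s := s) (x := x₀) E a b
    rw [quadMap_zero, hJ0] at h1
    have h3 : ∑ k, (∑ p, ∑ q, christoffel s g k p q x₀ * E p a * E q b - A k a b) * pd s k u x₀ = 0 :=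
      Finset.sum_eq_zero fun k _ => by
        rw [show (∑ p, ∑ q, christoffel s g k p q x₀ * E p a * E q b) = A k a b from rfl, sub_self,
          zero_mul]
    rw [h3, ← conj_apply] at h1
    rw [hgrad, hgrad] at h2
    linarith
  have hvvb : ∀ a b, |pd U a (pd U b v) 0| ≤ MB * κ ^ 2 := fun a b => by
    rw [hvv]; exact (hb3 a b).trans (mul_le_mul_of_nonneg_right hMBle hκ20)
  choose E' e₁ e₂ e₃ hE' he₁ he₂ he₃ hjT hjp using hjets s g S u x₀ E U (MB * κ) (MB * κ ^ 2)
    (MB * κ ^ 2) h hS hσ hu hs hE hU hU0 hmaps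
    (fun k => (hb1 k).trans (mul_le_mul_of_nonneg_right hMBle hκ0))
    (fun k l => (hb2 k l).trans (mul_le_mul_of_nonneg_right hMBle hκ20))
    (fun a b => (hTb a b).trans (mul_le_mul_of_nonneg_right hBle hκ20)) hvb
  simp only [← hA, ← hv] at hE' hjT hjp
  have hline : ∀ i : Fin n, ∀ᶠ t : ℝ in 𝓝 0, t • EuclideanSpace.single i (1 : ℝ) ∈ U := fun i => by
    have hc : Continuous fun t : ℝ =>
      t • (EuclideanSpace.single i (1 : ℝ) : EuclideanSpace ℝ (Fin n)) := by fun_prop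
    exact hc.continuousAt.eventually_mem (by simpa using hU0)
  have hv₃ : ∀ i a, pd U i (pd U i (pd U a v)) 0 = pd U a (pd U i (pd U i v)) 0 := fun i a =>
    (pd_pd_comm hUo (hvC.of_le (by norm_num)) hU00 a i).symm
  have hv₄ : ∀ i a, pd U i (pd U i (pd U a (pd U a v))) 0 = pd U a (pd U a (pd U i (pd U i v))) 0 :=
    fun i a => by
      rw [pd_congr (fun z hz => pd_pd_comm hUo (hvC.of_le (by norm_num)) hz i a) hU00 i]
      exact pd_pd_comm hUo (hv1 i) hU00 i a
  have jq : ∀ i, Jet (fun t => q (quadMap x₀ E A (t • EuclideanSpace.single i 1))) (q x₀)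
      (∑ k, pd s k q x₀ * E k i) (∑ k, pd s k q x₀ * (-1 / 2 * A k i i)
        + 1 / 2 * ∑ k, ∑ l, pd s l (pd s k q) x₀ * E k i * E l i) := fun i =>
    (jet_along_parabola h.good hq hs (WithLp.toLp 2 fun k => E k i)
      (WithLp.toLp 2 fun k => -1 / 2 * A k i i)).congr'
      (Eventually.of_forall fun t => by simp only [quadMap_line])
  set f₁ : Fin n → ℝ := fun i => ∑ k, pd s k (fun y => f y (u x₀)) x₀ * E k i
    + pd U i v 0 * deriv (f x₀) (u x₀) with hf₁
  set f₂ : Fin n → ℝ := fun i => 1 / 2 * ((E.transpose * covHess s g (fun y => f y (u x₀)) x₀ * E) i i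
    + 2 * pd U i v 0 * ∑ k, pd s k (fun y => deriv (f y) (u x₀)) x₀ * E k i
    + pd U i v 0 ^ 2 * deriv (deriv (f x₀)) (u x₀)
    + pd U i (pd U i v) 0 * deriv (f x₀) (u x₀)) with hf₂
  have hv0 : v 0 = u x₀ := by simp only [hv, quadMap_zero]
  have jf : ∀ i, Jet (fun t => f (quadMap x₀ E A (t • EuclideanSpace.single i 1))
      (u (quadMap x₀ E A (t • EuclideanSpace.single i 1)))) (f x₀ (u x₀)) (f₁ i) (f₂ i) := by
    intro i
    have hz : (0 : ℝ) • (EuclideanSpace.single i (1 : ℝ) : EuclideanSpace ℝ (Fin n)) = 0 := zero_smul _ _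
    have h1 := jet_rhs h.good hf hs (WithLp.toLp 2 fun k => E k i)
      (WithLp.toLp 2 fun k => -1 / 2 * A k i i)
      (ζ := fun t => v (t • EuclideanSpace.single i 1))
      (ζ' := fun t => pd U i v (t • EuclideanSpace.single i 1)) (ζ₂ := pd U i (pd U i v) 0)
      ((hline i).mono fun t ht => hasDerivAt_along_line hUo (hvC.of_le (by norm_num)) i ht)
      (by
        have := hasDerivAt_along_line hUo ((hv1 i).of_le (by norm_num)) i (t := 0) (by rwa [hz])
        rwa [hz] at this)
    simp only [hz, hv0] at h1
    refine (h1.congr' (Eventually.of_forall fun t => ?_)).congr_coeff rfl rfl ?_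
    · simp only [hv, quadMap_line]
    · simp only [hf₂]
      -- The quadratic term −½A of the parabola turns the coordinate Hessian of f into the covariant
      -- one, which is the quantity bounded by c.
      have e : ∑ k, ∑ l, pd s l (pd s k fun y => f y (u x₀)) x₀ * E k i * E l i
          + 2 * ∑ k, pd s k (fun y => f y (u x₀)) x₀ * (-1 / 2 * A k i i)
          = (E.transpose * covHess s g (fun y => f y (u x₀)) x₀ * E) i i := by
        rw [conj_apply]
        simp only [covHess, Matrix.of_apply, sub_mul, Finset.sum_sub_distrib]
        rw [sub_eq_add_neg]
        congr 1
        · rw [Finset.sum_comm]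
          exact Finset.sum_congr rfl fun l _ => Finset.sum_congr rfl fun k _ => by ring
        · rw [Finset.mul_sum]
          have e2 : ∀ k, 2 * (pd s k (fun y => f y (u x₀)) x₀ * (-1 / 2 * A k i i))
              = -∑ p, ∑ r, christoffel s g k p r x₀ * pd s k (fun y => f y (u x₀)) x₀ * E p i * E r i := by
            intro k
            have e3 : A k i i = ∑ p, ∑ r, christoffel s g k p r x₀ * E p i * E r i := rfl
            have e4 : ∑ p, ∑ r, christoffel s g k p r x₀ * pd s k (fun y => f y (u x₀)) x₀ * E p i
                * E r i = pd s k (fun y => f y (u x₀)) x₀ * A k i i := by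
              rw [e3, Finset.mul_sum]
              refine Finset.sum_congr rfl fun p _ => ?_
              rw [Finset.mul_sum]
              exact Finset.sum_congr rfl fun r _ => by ring
            rw [e4]; ring
          simp only [e2, Finset.sum_neg_distrib, Finset.sum_mul]
          rw [Finset.sum_comm]
          congr 1
          exact Finset.sum_congr rfl fun p _ => Finset.sum_comm
      rw [← e]
  set lam : Fin n → ℝ := fun a => τ a - 1 / 2 * ∑ c, gradComp s u E x₀ c ^ 2 with hlam
  have hlam' : ∀ a, lam a = τ a - 1 / 2 * ∑ c, pd U c v 0 ^ 2 := fun a => by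
    simp only [hlam, hgrad]
  -- the maximum property and the equation along the coordinate lines
  have hmaxJ : ∀ i, _ ∧ _ := fun i =>
    ((jet_const (q x₀ * k)).sub ((jq i).mul (Jet.sum Finset.univ fun a (_ : a ∈ Finset.univ) =>
      (hjT i a).const_mul (if a = o then 2 else 1)))).congr_coeff (by
        simp only [hTd, sum_double_weight, ← hk, sub_self]) rfl rfl |>.coeff_of_nonneg (by
        filter_upwards [hline i, hE' i] with t ht hEt
        have := hmax _ (hmaps ht) _ hEt
        rw [sum_double_weight]
        exact sub_nonneg.2 this)
  -- F is linearized at the eigenvalues of W(x₀). By Euler's relation the difference with f vanishes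
  -- at t = 0, and it is nonnegative nearby by `SolvesOn.le_sum`.
  have heqJ : ∀ i, _ ∧ _ := fun i =>
    ((Jet.sum Finset.univ fun a (_ : a ∈ Finset.univ) =>
      (((hjT i a).sub ((hjp i).const_mul (1 / 2))).const_mul (dF F a lam))).sub (jf i)).congr_coeff (by
        simp only [hTd]
        have := hF.euler hΓ hmem
        rw [hFval] at this
        simp only [hlam'] at this
        exact sub_eq_zero.2 this) rfl rfl |>.coeff_of_nonneg (by
        filter_upwards [hline i, hE' i] with t ht hEt
        exact sub_nonneg.2 (hsol.le_sum hΓ hF h hu2 (hSs _ (hmaps ht)) (hmaps ht) hEt hmem))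
  have hQ0 : 0 ≤ |Q| := abs_nonneg Q
  have hqQ' : √(q x₀) ≤ 1 + |Q| := by
    rw [Real.sqrt_le_left (by linarith)]
    have h1 := le_abs_self Q
    have h2 : (1 + |Q|) ^ 2 = 1 + 2 * |Q| + |Q| ^ 2 := by ring
    have h3 := sq_nonneg |Q|
    linarith
  have hκ1' : 1 ≤ κ ^ 2 := hκ1.trans hκκ
  have hMB2 : MB ≤ MB ^ 2 := le_self_pow₀ hMB1 two_ne_zero
  have hc0 : 0 ≤ |c| := abs_nonneg c
  have hcc := le_abs_self c
  have hq1' : ∀ k, |pd s k q x₀| ≤ |Q| * √(q x₀) := fun k =>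
    (hq1 k).trans (mul_le_mul_of_nonneg_right (le_abs_self Q) (Real.sqrt_nonneg _))
  refine hC (fun a => dF F a lam) (fun a => if a = o then 2 else 1) (fun a => pd U a v 0)
    (fun i => ∑ k, pd s k q x₀ * E k i) (fun i => ∑ k, pd s k q x₀ * (-1 / 2 * A k i i)
        + 1 / 2 * ∑ k, ∑ l, pd s l (pd s k q) x₀ * E k i * E l i) f₁ f₂ e₃
    (fun a i => pd U i (pd U a v) 0) (fun a i => pd U i (pd U a (pd U a v)) 0)
    (fun a i => pd U i (pd U i (pd U a (pd U a v))) 0) (fun a i => e₁ i a) (fun a i => e₂ i a)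
    (q x₀) k κ hq0 (hqQ.trans hM3) (fun i => (hF.s2 lam hmem i).le) (hF.one_le_sum_dF hΓ hmem)
    (fun i => by split_ifs <;> norm_num) (fun i => by split_ifs <;> norm_num)
    (fun i j => pd_comm hU (hvC.of_le (by norm_num)) hU00 j i) (fun i j => hv₄ j i)
    (fun i => ?_) (fun i => ?_) (fun i => ?_) (fun i => ?_) hk0.le hκ1 hκ2
    (fun i => ?_) (fun i j => ?_) (fun i j => ?_) (fun i => ?_) (fun i => ?_) (fun i => ?_)
    (fun i => ?_) (fun i => ?_) ?_
  · have := (hmaxJ i).1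
    simp only [hTd, sum_double_weight, ← hk] at this ⊢
    linarith
  · have := (hmaxJ i).2
    simp only [hTd, sum_double_weight, ← hk, hv₃ i] at this ⊢
    linarith
  · have := (heqJ i).1
    rw [sub_eq_zero] at this
    rw [← this]
    exact Finset.sum_congr rfl fun a _ => by ring
  · have := (heqJ i).2
    rw [sub_nonneg] at this
    refine this.trans (le_of_eq (Finset.sum_congr rfl fun a _ => ?_))
    simp only [hv₃ i]
  · exact (hvb i).trans (mul_le_mul_of_nonneg_right hM2 hκ0)
  · refine (he₁ j i).trans ?_
    have h1 : 1 + MB * κ ≤ 4 * MB ^ 2 * κ := by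
      have h3 : 1 ≤ MB * κ := one_le_mul_of_one_le_of_one_le hMB1 hκ1
      have h4 : MB * κ ≤ MB ^ 2 * κ := mul_le_mul_of_nonneg_right hMB2 hκ0
      linarith
    calc M₂ * (1 + MB * κ) ≤ M₂ * (4 * MB ^ 2 * κ) := mul_le_mul_of_nonneg_left h1 (by linarith)
      _ = 4 * M₂ * MB ^ 2 * κ := by ring
      _ ≤ M * κ := mul_le_mul_of_nonneg_right hM4 hκ0
  · refine (he₂ j i).trans ?_
    have h1 : 1 + MB * κ + MB * κ ^ 2 + MB * κ ^ 2 ≤ 4 * MB ^ 2 * κ ^ 2 := by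
      have h2 : MB * κ ≤ MB * κ ^ 2 := mul_le_mul_of_nonneg_left hκκ (by linarith)
      have h3 : 1 ≤ MB * κ ^ 2 := one_le_mul_of_one_le_of_one_le hMB1 hκ1'
      have h4 : MB * κ ^ 2 ≤ MB ^ 2 * κ ^ 2 := mul_le_mul_of_nonneg_right hMB2 hκ20
      linarith
    calc M₂ * (1 + MB * κ + MB * κ ^ 2 + MB * κ ^ 2) ≤ M₂ * (4 * MB ^ 2 * κ ^ 2) :=
          mul_le_mul_of_nonneg_left h1 (by linarith)
      _ = 4 * M₂ * MB ^ 2 * κ ^ 2 := by ring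
      _ ≤ M * κ ^ 2 := mul_le_mul_of_nonneg_right hM4 hκ20
  · refine (he₃ i).trans ?_
    have h1 : 0 ≤ M₂ * (MB ^ 2 * κ ^ 2) := by positivity
    calc M₂ * (MB * κ) ^ 2 = M₂ * (MB ^ 2 * κ ^ 2) := by ring
      _ ≤ 4 * M₂ * MB ^ 2 * κ ^ 2 := by linarith
      _ ≤ M * κ ^ 2 := mul_le_mul_of_nonneg_right hM4 hκ20
  · have h1 : |∑ k, pd s k (fun y => f y (u x₀)) x₀ * E k i| ≤ |c| :=
      (hE.abs_le_covectorNorm _ i).trans (hfb.dx.trans hcc)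
    have h2 : |pd U i v 0 * deriv (f x₀) (u x₀)| ≤ MB * κ * |c| :=
      abs_mul_le_mul (hvb i) (hfb.dz.trans hcc)
    have h3 : |c| + MB * κ * |c| ≤ |c| * (1 + 5 * MB ^ 2) * κ := by
      have h4 : 0 ≤ |c| * (κ - 1) := mul_nonneg hc0 (by linarith)
      have h5 : 0 ≤ |c| * κ * (MB ^ 2 - MB) := mul_nonneg (mul_nonneg hc0 hκ0) (by linarith)
      have h6 : 0 ≤ |c| * MB ^ 2 * κ := by positivity
      linarith
    exact ((abs_add_le _ _).trans (add_le_add h1 h2)).trans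
      (h3.trans (mul_le_mul_of_nonneg_right hM5 hκ0))
  · have h1 : |(E.transpose * covHess s g (fun y => f y (u x₀)) x₀ * E) i i| ≤ |c| :=
      (hE.abs_le_tensorNorm _ i i).trans (hfb.dxx.trans hcc)
    have h2 : |2 * pd U i v 0 * ∑ k, pd s k (fun y => deriv (f y) (u x₀)) x₀ * E k i|
        ≤ 2 * (MB * κ) * |c| :=
      abs_mul_le_mul (abs_mul_le_mul (by norm_num) (hvb i))
        ((hE.abs_le_covectorNorm _ i).trans (hfb.dxz.trans hcc))
    have h3 : |pd U i v 0 ^ 2 * deriv (deriv (f x₀)) (u x₀)| ≤ (MB * κ) ^ 2 * |c| :=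
      abs_mul_le_mul (by rw [abs_pow]; exact pow_le_pow_left₀ (abs_nonneg _) (hvb i) 2)
        (hfb.dzz.trans hcc)
    have h4 : |pd U i (pd U i v) 0 * deriv (f x₀) (u x₀)| ≤ MB * κ ^ 2 * |c| :=
      abs_mul_le_mul (hvvb i i) (hfb.dz.trans hcc)
    have h5 : |c| + 2 * (MB * κ) * |c| + (MB * κ) ^ 2 * |c| + MB * κ ^ 2 * |c|
        ≤ |c| * (1 + 5 * MB ^ 2) * κ ^ 2 := by
      have h6 : 0 ≤ |c| * (κ ^ 2 - 1) := mul_nonneg hc0 (by linarith)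
      have h7 : 0 ≤ |c| * κ ^ 2 * (MB ^ 2 - MB) := mul_nonneg (mul_nonneg hc0 hκ20) (by linarith)
      have h8 : 0 ≤ |c| * MB * (κ ^ 2 - κ) := mul_nonneg (mul_nonneg hc0 (by linarith)) (by linarith)
      have h9 : 0 ≤ |c| * MB ^ 2 * κ ^ 2 := by positivity
      linarith
    refine le_trans ?_ (mul_le_mul_of_nonneg_right hM5 hκ20)
    refine le_trans ?_ h5
    have h10 : |f₂ i| = 1 / 2 * |(E.transpose * covHess s g (fun y => f y (u x₀)) x₀ * E) i i
        + 2 * pd U i v 0 * ∑ k, pd s k (fun y => deriv (f y) (u x₀)) x₀ * E k i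
        + pd U i v 0 ^ 2 * deriv (deriv (f x₀)) (u x₀)
        + pd U i (pd U i v) 0 * deriv (f x₀) (u x₀)| := by
      rw [hf₂, abs_mul]; norm_num
    have h11 := (abs_add_le _ _).trans (add_le_add ((abs_add_le _ _).trans (add_le_add
      ((abs_add_le _ _).trans (add_le_add h1 h2)) h3)) h4)
    rw [h10]
    have := (abs_nonneg _).trans h11
    linarith
  · have h1 := abs_sum_le_card_mul (x := fun k => pd s k q x₀ * E k i) (B := |Q| * √(q x₀) * m)
      fun k => abs_mul_le_mul (hq1' k) (hEb k i)
    rw [Fintype.card_fin] at h1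
    refine h1.trans ?_
    calc n * (|Q| * √(q x₀) * m) = n * (|Q| * m) * √(q x₀) := by ring
      _ ≤ M * √(q x₀) := mul_le_mul_of_nonneg_right hM6 (Real.sqrt_nonneg _)
  · have h1 := abs_sum_le_card_mul (x := fun k => pd s k q x₀ * (-1 / 2 * A k i i))
      (B := |Q| * (1 + |Q|) * mA) fun k => abs_mul_le_mul
        ((hq1' k).trans (mul_le_mul_of_nonneg_left hqQ' hQ0)) (by
          rw [abs_mul]
          have h2 : |(-1 / 2 : ℝ)| = 1 / 2 := by norm_num [abs_div]
          rw [h2]; linarith [hAb k i i, abs_nonneg (A k i i)])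
    have h2 := abs_sum_le_card_mul (x := fun k => ∑ l, pd s l (pd s k q) x₀ * E k i * E l i)
      (B := n * (|Q| * m * m)) fun k => by
        have := abs_sum_le_card_mul (x := fun l => pd s l (pd s k q) x₀ * E k i * E l i)
          (B := |Q| * m * m) fun l => abs_mul_le_mul (abs_mul_le_mul
            ((hq2 k l).trans (le_abs_self Q)) (hEb k i)) (hEb l i)
        rwa [Fintype.card_fin] at this
    rw [Fintype.card_fin] at h1 h2
    refine (abs_add_le _ _).trans ?_
    rw [abs_mul]
    have h3 : |(1 / 2 : ℝ)| = 1 / 2 := by norm_num [abs_div]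
    rw [h3]
    linarith [abs_nonneg (∑ k, ∑ l, pd s l (pd s k q) x₀ * E k i * E l i)]
  · have h1 := sq_trace_le hn (τ := τ) (v := fun a => pd U a v 0)
      (c := fun a b => (E.transpose * covHess s g u x₀ * E) a b)
      (b := fun a => (E.transpose * S x₀ * E) a a) (o := o) (M := M₁)
      (fun a => by
        have := conj_tensorT (g := g) (S := S) (u := u) (s := s) (x := x₀) E a a
        rw [hTd, hgrad] at this
        exact this) (fun a => hb4 a a) (by linarith) (by simpa only [hgrad] using hpτ) hk0.le
    rw [← hk] at h1
    have e : κ ^ 4 = (1 + k) ^ 2 := by rw [← hκ2]; ring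
    rw [e]
    refine h1.trans (mul_le_mul hM8 (le_of_eq ?_) (by positivity) (by linarith))
    congr 1
    refine Finset.sum_congr rfl fun i _ => Finset.sum_congr rfl fun j _ => ?_
    rw [hvv]

end Interior

end BoundaryEstimate

end

noncomputable section

namespace BoundaryEstimate

open Finset Filter Topology Asymptotics

/-! ### The half ball, Fermi coordinates and umbilicity -/

section HalfBallGeometry

variable {m : ℕ} {r : ℝ}

lemma isOpen_sum_sq_lt (n : ℕ) (r : ℝ) : IsOpen {x : EuclideanSpace ℝ (Fin n) | ∑ i, x i ^ 2 < r} :=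
  isOpen_lt (by fun_prop) continuous_const

lemma convex_sum_sq_le (n : ℕ) (hr : 0 ≤ r) :
    Convex ℝ {x : EuclideanSpace ℝ (Fin n) | ∑ i, x i ^ 2 ≤ r ^ 2} := by
  have : {x : EuclideanSpace ℝ (Fin n) | ∑ i, x i ^ 2 ≤ r ^ 2} = Metric.closedBall 0 r := by
    ext x
    rw [Set.mem_ofPred_eq, ← EuclideanSpace.real_norm_sq_eq, mem_closedBall_zero_iff,
      sq_le_sq₀ (norm_nonneg x) hr]
  rw [this]
  exact convex_closedBall 0 r

lemma isOpen_interiorHalfBall (m : ℕ) (r : ℝ) :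
    IsOpen {x : EuclideanSpace ℝ (Fin (m + 1)) | 0 < x (Fin.last m) ∧ ∑ i, x i ^ 2 < r ^ 2} :=
  IsOpen.inter (s := {x : EuclideanSpace ℝ (Fin (m + 1)) | 0 < x (Fin.last m)})
    (isOpen_lt continuous_const (by fun_prop)) (isOpen_sum_sq_lt (m + 1) (r ^ 2))

lemma halfBall_mem_nhds {x : EuclideanSpace ℝ (Fin (m + 1))} (h1 : 0 < x (Fin.last m))
    (h2 : ∑ i, x i ^ 2 < r ^ 2) : halfBall m r ∈ 𝓝 x :=
  Filter.mem_of_superset ((isOpen_interiorHalfBall m r).mem_nhds ⟨h1, h2⟩)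
    fun _ h => ⟨h.1.le, h.2.le⟩

lemma goodDomain_halfBall (m : ℕ) (hr : 0 < r) : GoodDomain (halfBall m r) := by
  refine GoodDomain.of_convex ?_ ?_
  · have h1 : Convex ℝ {x : EuclideanSpace ℝ (Fin (m + 1)) | 0 ≤ x (Fin.last m)} :=
      convex_halfSpace_ge ⟨fun x y => rfl, fun c x => rfl⟩ 0
    exact h1.inter (convex_sum_sq_le (m + 1) hr.le)
  · refine ⟨EuclideanSpace.single (Fin.last m) (r / 2), mem_interior_iff_mem_nhds.2
      (halfBall_mem_nhds ?_ ?_)⟩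
    · simp [hr]
    · have : ∑ i, (EuclideanSpace.single (Fin.last m) (r / 2) : EuclideanSpace ℝ (Fin (m + 1))) i ^ 2
          = (r / 2) ^ 2 := by
        rw [← EuclideanSpace.real_norm_sq_eq]; simp [div_pow]
      rw [this]; nlinarith

lemma mem_bdryDisc {y : EuclideanSpace ℝ (Fin m)} : y ∈ bdryDisc m r ↔ ∑ α, y α ^ 2 ≤ r ^ 2 :=
  Iff.rfl

lemma goodDomain_bdryDisc (m : ℕ) (hr : 0 < r) : GoodDomain (bdryDisc m r) := by
  refine GoodDomain.of_convex (convex_sum_sq_le m hr.le) ⟨0, mem_interior_iff_mem_nhds.2 ?_⟩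
  refine Filter.mem_of_superset ((isOpen_sum_sq_lt m (r ^ 2)).mem_nhds ?_) fun _ h =>
    mem_bdryDisc.2 (le_of_lt h)
  simpa using pow_pos hr 2

@[simp] lemma bdryPt_castSucc (y : EuclideanSpace ℝ (Fin m)) (α : Fin m) :
    bdryPt y α.castSucc = y α := by
  simp [bdryPt]

@[simp] lemma bdryPt_last (y : EuclideanSpace ℝ (Fin m)) : bdryPt y (Fin.last m) = 0 := by
  simp [bdryPt]

lemma mapsTo_bdryPt (m : ℕ) (r : ℝ) : Set.MapsTo bdryPt (bdryDisc m r) (halfBall m r) := by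
  intro y hy
  refine ⟨by simp, ?_⟩
  rw [Fin.sum_univ_castSucc]
  simpa using mem_bdryDisc.1 hy

lemma contDiff_bdryPt (k : WithTop ℕ∞) : ContDiff ℝ k (bdryPt (m := m)) := by
  rw [contDiff_euclidean]
  intro i
  refine Fin.lastCases ?_ (fun α => ?_) i
  · simpa using contDiff_const
  · simpa using contDiff_coord k α

/-- Tangential derivatives can be computed on the boundary piece. -/
lemma pd_bdryPt (hr : 0 < r) {φ : EuclideanSpace ℝ (Fin (m + 1)) → ℝ}
    {y : EuclideanSpace ℝ (Fin m)} (hy : y ∈ bdryDisc m r)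
    (hφ : DifferentiableWithinAt ℝ φ (halfBall m r) (bdryPt y)) (α : Fin m) :
    pd (bdryDisc m r) α (fun y => φ (bdryPt y)) y = pd (halfBall m r) α.castSucc φ (bdryPt y) := by
  have hg := goodDomain_bdryDisc m hr
  rw [pd_comp hg hy (mapsTo_bdryPt m r) hφ fun k =>
    ((contDiff_euclidean.1 (contDiff_bdryPt 1) k).differentiable
      one_ne_zero).differentiableAt.differentiableWithinAt]
  rw [Fin.sum_univ_castSucc]
  simp only [bdryPt_castSucc, bdryPt_last, pd_const, mul_zero, add_zero]
  simp only [pd_coord hg hy]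
  simp

lemma contDiffOn_comp_bdryPt {k : WithTop ℕ∞} {φ : EuclideanSpace ℝ (Fin (m + 1)) → ℝ}
    (hφ : ContDiffOn ℝ k φ (halfBall m r)) :
    ContDiffOn ℝ k (fun y => φ (bdryPt y)) (bdryDisc m r) :=
  hφ.comp (contDiff_bdryPt k).contDiffOn (mapsTo_bdryPt m r)

lemma PdBound.comp_bdryPt (hr : 0 < r) {k : ℕ} {M : ℝ} {φ : EuclideanSpace ℝ (Fin (m + 1)) → ℝ}
    (hφ : ContDiffOn ℝ k φ (halfBall m r)) (h : PdBound (halfBall m r) k M φ) :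
    PdBound (bdryDisc m r) k M (fun y => φ (bdryPt y)) := by
  induction k generalizing φ with
  | zero => exact fun y hy => h _ (mapsTo_bdryPt m r hy)
  | succ k ih =>
    refine ⟨fun y hy => h.1 _ (mapsTo_bdryPt m r hy), fun α => ?_⟩
    have h1 : ContDiffOn ℝ k (pd (halfBall m r) α.castSucc φ) (halfBall m r) :=
      contDiffOn_pd (goodDomain_halfBall m hr) hφ le_rfl _
    refine (ih h1 (h.2 α.castSucc)).congr fun y hy => ?_
    refine (pd_bdryPt hr hy ?_ α).symm
    exact hφ.differentiableOn (by simp) _ (mapsTo_bdryPt m r hy)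

/-- A metric in Fermi coordinates with umbilic boundary piece. -/
structure IsUmbilicFermi (r θ G : ℝ)
    (g : EuclideanSpace ℝ (Fin (m + 1)) → Matrix (Fin (m + 1)) (Fin (m + 1)) ℝ)
    (μ : EuclideanSpace ℝ (Fin m) → ℝ) : Prop where
  pos : 0 < r
  controlled : IsControlledMetric (halfBall m r) θ G g
  normal : ∀ x ∈ halfBall m r, g x (Fin.last m) (Fin.last m) = 1
  mixed : ∀ x ∈ halfBall m r, ∀ α : Fin m, g x α.castSucc (Fin.last m) = 0
  umbilic : IsUmbilic r g μ
  smooth : ContDiffOn ℝ 2 μ (bdryDisc m r)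

namespace IsUmbilicFermi

variable {θ G : ℝ} {g : EuclideanSpace ℝ (Fin (m + 1)) → Matrix (Fin (m + 1)) (Fin (m + 1)) ℝ}
  {μ : EuclideanSpace ℝ (Fin m) → ℝ} {x : EuclideanSpace ℝ (Fin (m + 1))}
  {y : EuclideanSpace ℝ (Fin m)}

lemma mixed' (h : IsUmbilicFermi r θ G g μ) (hx : x ∈ halfBall m r) (α : Fin m) :
    g x (Fin.last m) α.castSucc = 0 := by
  rw [h.controlled.symm hx, h.mixed x hx]

lemma pd_normal (h : IsUmbilicFermi r θ G g μ) (hx : x ∈ halfBall m r) (k : Fin (m + 1)) :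
    pd (halfBall m r) k (fun y => g y (Fin.last m) (Fin.last m)) x = 0 :=
  pd_eq_zero_of_eqOn_const h.normal hx k

lemma pd_mixed (h : IsUmbilicFermi r θ G g μ) (hx : x ∈ halfBall m r) (k : Fin (m + 1))
    (α : Fin m) : pd (halfBall m r) k (fun y => g y α.castSucc (Fin.last m)) x = 0 :=
  pd_eq_zero_of_eqOn_const (fun y hy => h.mixed y hy α) hx k

lemma pd_mixed' (h : IsUmbilicFermi r θ G g μ) (hx : x ∈ halfBall m r) (k : Fin (m + 1))
    (α : Fin m) : pd (halfBall m r) k (fun y => g y (Fin.last m) α.castSucc) x = 0 :=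
  pd_eq_zero_of_eqOn_const (fun _ hy => h.mixed' hy α) hx k

lemma christoffel_last (h : IsUmbilicFermi r θ G g μ) (hx : x ∈ halfBall m r) (i j : Fin (m + 1)) :
    christoffel (halfBall m r) g (Fin.last m) i j x
      = 1 / 2 * (pd (halfBall m r) i (fun y => g y j (Fin.last m)) x
        + pd (halfBall m r) j (fun y => g y i (Fin.last m)) x
        - pd (halfBall m r) (Fin.last m) (fun y => g y i j) x) := by
  rw [← h.controlled.sum_mul_christoffel hx, Fin.sum_univ_castSucc]
  simp [h.mixed' hx, h.normal x hx]

lemma sum_mul_christoffel_castSucc (h : IsUmbilicFermi r θ G g μ) (hx : x ∈ halfBall m r)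
    (ε : Fin m) (i j : Fin (m + 1)) :
    ∑ γ : Fin m, g x ε.castSucc γ.castSucc * christoffel (halfBall m r) g γ.castSucc i j x
      = 1 / 2 * (pd (halfBall m r) i (fun y => g y j ε.castSucc) x
        + pd (halfBall m r) j (fun y => g y i ε.castSucc) x
        - pd (halfBall m r) ε.castSucc (fun y => g y i j) x) := by
  rw [← h.controlled.sum_mul_christoffel hx, Fin.sum_univ_castSucc]
  simp [h.mixed x hx]

lemma christoffel_last_tangent (h : IsUmbilicFermi r θ G g μ) (hx : x ∈ halfBall m r)
    (α β : Fin m) : christoffel (halfBall m r) g (Fin.last m) α.castSucc β.castSucc x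
      = -1 / 2 * pd (halfBall m r) (Fin.last m) (fun y => g y α.castSucc β.castSucc) x := by
  rw [h.christoffel_last hx, h.pd_mixed hx, h.pd_mixed hx]; ring

lemma christoffel_last_mixed (h : IsUmbilicFermi r θ G g μ) (hx : x ∈ halfBall m r)
    (i : Fin (m + 1)) : christoffel (halfBall m r) g (Fin.last m) i (Fin.last m) x = 0 := by
  rw [h.christoffel_last hx]
  refine Fin.lastCases ?_ (fun α => ?_) i
  · rw [h.pd_normal hx]; ring
  · rw [h.pd_normal hx, h.pd_mixed hx]; ring

/-- The metric block of the tangential directions is nondegenerate. -/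
lemma posDef_inducedMetric (h : IsUmbilicFermi r θ G g μ) (hx : x ∈ halfBall m r) :
    ((g x).submatrix (Fin.castSucc (n := m)) Fin.castSucc).PosDef :=
  (h.controlled.posDef x hx).submatrix (Fin.castSucc_injective m)

/-- The tangential block of g is invertible, so identities between Christoffel symbols may be
checked after lowering an index. -/
lemma eq_of_sum_mul_eq (h : IsUmbilicFermi r θ G g μ) (hx : x ∈ halfBall m r) {a b : Fin m → ℝ}
    (hab : ∀ ε : Fin m, ∑ γ : Fin m, g x ε.castSucc γ.castSucc * a γ
      = ∑ γ : Fin m, g x ε.castSucc γ.castSucc * b γ) : a = b := by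
  have hu : IsUnit ((g x).submatrix (Fin.castSucc (n := m)) Fin.castSucc) :=
    (h.posDef_inducedMetric hx).isUnit
  exact Matrix.mulVec_injective_of_isUnit hu (funext fun ε => hab ε)

lemma christoffel_normal_normal (h : IsUmbilicFermi r θ G g μ) (hx : x ∈ halfBall m r)
    (k : Fin (m + 1)) : christoffel (halfBall m r) g k (Fin.last m) (Fin.last m) x = 0 := by
  refine Fin.lastCases (h.christoffel_last_mixed hx _) (fun γ => ?_) k
  have := h.eq_of_sum_mul_eq hx (a := fun γ : Fin m =>
    christoffel (halfBall m r) g γ.castSucc (Fin.last m) (Fin.last m) x) (b := 0) fun ε => by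
      rw [h.sum_mul_christoffel_castSucc hx, h.pd_mixed' hx, h.pd_normal hx]; simp
  exact congrFun this γ

lemma pd_last_eq (h : IsUmbilicFermi r θ G g μ) (hy : y ∈ bdryDisc m r) (α β : Fin m) :
    pd (halfBall m r) (Fin.last m) (fun x => g x α.castSucc β.castSucc) (bdryPt y)
      = -2 * μ y * g (bdryPt y) α.castSucc β.castSucc := by
  have h1 := h.umbilic y hy α β
  rw [secondFF, h.christoffel_last_tangent (mapsTo_bdryPt m r hy), inducedMetric,
    Matrix.of_apply] at h1
  linarith

lemma christoffel_last_boundary (h : IsUmbilicFermi r θ G g μ) (hy : y ∈ bdryDisc m r)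
    (α β : Fin m) : christoffel (halfBall m r) g (Fin.last m) α.castSucc β.castSucc (bdryPt y)
      = μ y * g (bdryPt y) α.castSucc β.castSucc :=
  h.umbilic y hy α β

lemma sum_mul_christoffel_normal (h : IsUmbilicFermi r θ G g μ) (hx : x ∈ halfBall m r)
    (ε β : Fin m) : ∑ γ : Fin m, g x ε.castSucc γ.castSucc
        * christoffel (halfBall m r) g γ.castSucc β.castSucc (Fin.last m) x
      = 1 / 2 * pd (halfBall m r) (Fin.last m) (fun y => g y ε.castSucc β.castSucc) x := by
  rw [h.sum_mul_christoffel_castSucc hx, h.pd_mixed hx, h.pd_mixed' hx,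
    h.controlled.pd_symm hx _ β.castSucc]
  ring

/-- The tangential components of ∇_α ∂_n: umbilicity makes the shape operator μ times the identity,
and the minus sign belongs to the inner normal. -/
lemma christoffel_mixed_boundary (h : IsUmbilicFermi r θ G g μ) (hy : y ∈ bdryDisc m r)
    (γ α : Fin m) : christoffel (halfBall m r) g γ.castSucc α.castSucc (Fin.last m) (bdryPt y)
      = -μ y * (1 : Matrix (Fin m) (Fin m) ℝ) γ α := by
  have hx := mapsTo_bdryPt m r hy
  have := h.eq_of_sum_mul_eq hx (a := fun γ : Fin m =>
    christoffel (halfBall m r) g γ.castSucc α.castSucc (Fin.last m) (bdryPt y))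
    (b := fun γ => -μ y * (1 : Matrix (Fin m) (Fin m) ℝ) γ α) fun ε => by
      rw [h.sum_mul_christoffel_normal hx, h.pd_last_eq hy]
      simp [Matrix.one_apply]; ring
  exact congrFun this γ

lemma induced_controlled (h : IsUmbilicFermi r θ G g μ) :
    IsControlledMetric (bdryDisc m r) θ G (inducedMetric g) where
  good := goodDomain_bdryDisc m h.pos
  contDiffOn α β := contDiffOn_comp_bdryPt (h.controlled.contDiffOn α.castSucc β.castSucc)
  posDef y hy := h.posDef_inducedMetric (mapsTo_bdryPt m r hy)
  lower y hy ξ := by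
    have := h.controlled.lower _ (mapsTo_bdryPt m r hy) (Fin.snoc ξ 0)
    simpa [Fin.sum_univ_castSucc, inducedMetric] using this
  bound α β := PdBound.comp_bdryPt h.pos
    (by exact_mod_cast h.controlled.contDiffOn α.castSucc β.castSucc)
    (h.controlled.bound α.castSucc β.castSucc)

/-- Lower the index: since g_{αn} = 0, both sides become the same combination of tangential
derivatives of the tangential metric. It allows the intrinsic Hessian of μ to be compared with terms
of the ambient connection. -/
lemma christoffel_tangent (h : IsUmbilicFermi r θ G g μ) (hy : y ∈ bdryDisc m r) (γ α β : Fin m) :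
    christoffel (bdryDisc m r) (inducedMetric g) γ α β y
      = christoffel (halfBall m r) g γ.castSucc α.castSucc β.castSucc (bdryPt y) := by
  have hx := mapsTo_bdryPt m r hy
  have hd : ∀ i j, DifferentiableWithinAt ℝ (fun x => g x i j) (halfBall m r) (bdryPt y) :=
    fun i j => (h.controlled.contDiffOn i j).differentiableOn (by norm_num) _ hx
  have := h.eq_of_sum_mul_eq hx (a := fun γ : Fin m =>
    christoffel (bdryDisc m r) (inducedMetric g) γ α β y)
    (b := fun γ => christoffel (halfBall m r) g γ.castSucc α.castSucc β.castSucc (bdryPt y))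
    fun ε => by
      rw [h.sum_mul_christoffel_castSucc hx]
      have h1 := h.induced_controlled.sum_mul_christoffel hy ε α β
      refine h1.trans ?_
      simp only [inducedMetric, Matrix.of_apply]
      rw [pd_bdryPt h.pos hy (hd _ _), pd_bdryPt h.pos hy (hd _ _), pd_bdryPt h.pos hy (hd _ _)]
  exact congrFun this γ

/-- The normal derivative of `Γⁿ_{αβ}`. -/
lemma pd_christoffel_last (h : IsUmbilicFermi r θ G g μ) (hy : y ∈ bdryDisc m r) (α β : Fin m) :
    pd (halfBall m r) (Fin.last m)
        (christoffel (halfBall m r) g (Fin.last m) α.castSucc β.castSucc) (bdryPt y)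
      = riemann (halfBall m r) g α.castSucc (Fin.last m) β.castSucc (Fin.last m) (bdryPt y)
        - μ y ^ 2 * g (bdryPt y) α.castSucc β.castSucc := by
  have hx := mapsTo_bdryPt m r hy
  have hG := h.controlled.good
  have hd : ∀ i j, DifferentiableWithinAt ℝ (fun x => g x i j) (halfBall m r) (bdryPt y) :=
    fun i j => (h.controlled.contDiffOn i j).differentiableOn (by norm_num) _ hx
  have hpd : ∀ k i j, DifferentiableWithinAt ℝ (pd (halfBall m r) k fun x => g x i j)
      (halfBall m r) (bdryPt y) :=
    fun k i j => (h.controlled.pd_contDiffOn k i j).differentiableOn (by norm_num) _ hx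
  have hΓ : ∀ k i j, DifferentiableWithinAt ℝ (christoffel (halfBall m r) g k i j)
      (halfBall m r) (bdryPt y) :=
    fun k i j => (h.controlled.christoffel_contDiffOn k i j).differentiableOn (by norm_num) _ hx
  set g₂ := pd (halfBall m r) (Fin.last m) (pd (halfBall m r) (Fin.last m)
    fun x => g x α.castSucc β.castSucc) (bdryPt y) with hg₂
  have h1 : pd (halfBall m r) (Fin.last m)
        (christoffel (halfBall m r) g (Fin.last m) α.castSucc β.castSucc) (bdryPt y)
      = -1 / 2 * g₂ := by
    rw [pd_congr (fun x hx => h.christoffel_last_tangent hx α β) hx,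
      pd_const_mul hG hx _ (hpd _ _ _)]
  -- The normal derivative of g_{αγ}Γ^γ_{βn} = ½∂_n g_{αβ} relates ∂_n² g to ∂_n Γ^γ_{βn}, which is
  -- the derivative that enters the curvature.
  have h2 := pd_congr (fun x hx => h.sum_mul_christoffel_normal hx α β) hx (Fin.last m)
  rw [pd_const_mul hG hx _ (hpd _ _ _), pd_sum hG hx _ fun γ _ => (hd _ _).fun_mul (hΓ _ _ _)] at h2
  simp only [pd_mul hG hx (hd _ _) (hΓ _ _ _), h.pd_last_eq hy, h.christoffel_mixed_boundary hy,
    Finset.sum_add_distrib] at h2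
  have h3 : ∑ γ : Fin m, -2 * μ y * g (bdryPt y) α.castSucc γ.castSucc
      * (-μ y * (1 : Matrix (Fin m) (Fin m) ℝ) γ β)
      = 2 * μ y ^ 2 * g (bdryPt y) α.castSucc β.castSucc := by
    simp [Matrix.one_apply]; ring
  -- Because Γ^k_{nn} = 0, only ∂_n Γ^γ_{βn} and one product of mixed symbols contribute; by
  -- umbilicity that product gives μ²g.
  have h4 : riemann (halfBall m r) g α.castSucc (Fin.last m) β.castSucc (Fin.last m) (bdryPt y)
      = -(∑ γ : Fin m, g (bdryPt y) α.castSucc γ.castSucc * pd (halfBall m r) (Fin.last m)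
          (christoffel (halfBall m r) g γ.castSucc β.castSucc (Fin.last m)) (bdryPt y))
        - μ y ^ 2 * g (bdryPt y) α.castSucc β.castSucc := by
    have e0 : ∀ a, pd (halfBall m r) β.castSucc
        (christoffel (halfBall m r) g a (Fin.last m) (Fin.last m)) (bdryPt y) = 0 := fun a =>
      pd_eq_zero_of_eqOn_const (fun x hx => h.christoffel_normal_normal hx a) hx _
    have e1 : ∀ γ p : Fin m, christoffel (halfBall m r) g γ.castSucc (Fin.last m) p.castSucc (bdryPt y)
        = -μ y * (1 : Matrix (Fin m) (Fin m) ℝ) γ p := fun γ p => by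
      rw [h.controlled.christoffel_symm hx, h.christoffel_mixed_boundary hy]
    rw [riemann, Fin.sum_univ_castSucc, h.mixed _ hx, zero_mul, add_zero]
    simp only [e0, h.christoffel_normal_normal hx, mul_zero, Finset.sum_const_zero, zero_sub,
      add_zero, Fin.sum_univ_castSucc (n := m), h.christoffel_last_mixed hx, e1,
      h.christoffel_mixed_boundary hy]
    rw [← Finset.sum_neg_distrib]
    have e2 : ∀ γ : Fin m, ∑ p : Fin m, -μ y * (1 : Matrix (Fin m) (Fin m) ℝ) γ p
        * (-μ y * (1 : Matrix (Fin m) (Fin m) ℝ) p β)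
        = μ y ^ 2 * (1 : Matrix (Fin m) (Fin m) ℝ) γ β := fun γ => by
      simp only [Matrix.one_apply, mul_ite, mul_one, mul_zero, Finset.sum_ite_eq', Finset.mem_univ,
        if_true]
      split_ifs <;> ring
    simp only [e2, mul_sub, Finset.sum_sub_distrib]
    congr 1
    · exact Finset.sum_congr rfl fun γ _ => by ring
    · simp [Matrix.one_apply]; ring
  rw [h1, h4]
  rw [h3] at h2
  linarith

/-- The normal derivative of the tangential Christoffel symbols. -/
lemma sum_mul_pd_christoffel (h : IsUmbilicFermi r θ G g μ) (hy : y ∈ bdryDisc m r)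
    (ε α β : Fin m) : ∑ γ : Fin m, g (bdryPt y) ε.castSucc γ.castSucc
      * pd (halfBall m r) (Fin.last m)
        (christoffel (halfBall m r) g γ.castSucc α.castSucc β.castSucc) (bdryPt y)
      = -(pd (bdryDisc m r) α μ y * g (bdryPt y) β.castSucc ε.castSucc
        + pd (bdryDisc m r) β μ y * g (bdryPt y) α.castSucc ε.castSucc
        - pd (bdryDisc m r) ε μ y * g (bdryPt y) α.castSucc β.castSucc) := by
  have hx := mapsTo_bdryPt m r hy
  have hG := h.controlled.good
  have hd : ∀ i j, DifferentiableWithinAt ℝ (fun x => g x i j) (halfBall m r) (bdryPt y) :=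
    fun i j => (h.controlled.contDiffOn i j).differentiableOn (by norm_num) _ hx
  have hpd : ∀ k i j, DifferentiableWithinAt ℝ (pd (halfBall m r) k fun x => g x i j)
      (halfBall m r) (bdryPt y) :=
    fun k i j => (h.controlled.pd_contDiffOn k i j).differentiableOn (by norm_num) _ hx
  have hΓ : ∀ k i j, DifferentiableWithinAt ℝ (christoffel (halfBall m r) g k i j)
      (halfBall m r) (bdryPt y) :=
    fun k i j => (h.controlled.christoffel_contDiffOn k i j).differentiableOn (by norm_num) _ hx
  have hμd : DifferentiableWithinAt ℝ μ (bdryDisc m r) y :=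
    h.smooth.differentiableOn (by norm_num) y hy
  -- Interchange the derivatives and then differentiate ∂_n g = −2μg tangentially, which is
  -- legitimate because it holds along the whole boundary piece.
  have key : ∀ a b c : Fin m, pd (halfBall m r) (Fin.last m) (pd (halfBall m r) a.castSucc
      fun x => g x b.castSucc c.castSucc) (bdryPt y)
      = -2 * (pd (bdryDisc m r) a μ y * g (bdryPt y) b.castSucc c.castSucc
        + μ y * pd (halfBall m r) a.castSucc (fun x => g x b.castSucc c.castSucc) (bdryPt y)) := by
    intro a b c
    rw [pd_comm hG ((h.controlled.contDiffOn _ _).of_le (by norm_num)) hx,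
      ← pd_bdryPt h.pos hy (hpd _ _ _), pd_congr (fun z hz => h.pd_last_eq hz b c) hy]
    have hgb : DifferentiableWithinAt ℝ (fun z => g (bdryPt z) b.castSucc c.castSucc)
        (bdryDisc m r) y :=
      (contDiffOn_comp_bdryPt (h.controlled.contDiffOn b.castSucc c.castSucc)).differentiableOn
        (by norm_num) y hy
    have e : ∀ z, -2 * μ z * g (bdryPt z) b.castSucc c.castSucc
        = -2 * (μ z * g (bdryPt z) b.castSucc c.castSucc) := fun z => by ring
    simp only [e]
    rw [pd_const_mul (goodDomain_bdryDisc m h.pos) hy _ (hμd.fun_mul hgb),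
      pd_mul (goodDomain_bdryDisc m h.pos) hy hμd hgb, pd_bdryPt h.pos hy (hd _ _)]
  have h2 := pd_congr (fun x hx => h.sum_mul_christoffel_castSucc hx ε α.castSucc β.castSucc) hx
    (Fin.last m)
  rw [pd_const_mul hG hx _ (((hpd _ _ _).fun_add (hpd _ _ _)).fun_sub (hpd _ _ _)),
    pd_sub hG hx ((hpd _ _ _).fun_add (hpd _ _ _)) (hpd _ _ _), pd_add hG hx (hpd _ _ _) (hpd _ _ _),
    pd_sum hG hx _ fun γ _ => (hd _ _).fun_mul (hΓ _ _ _), key, key, key] at h2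
  simp only [pd_mul hG hx (hd _ _) (hΓ _ _ _), h.pd_last_eq hy, Finset.sum_add_distrib] at h2
  have h3 : ∑ γ : Fin m, -2 * μ y * g (bdryPt y) ε.castSucc γ.castSucc
      * christoffel (halfBall m r) g γ.castSucc α.castSucc β.castSucc (bdryPt y)
      = -2 * μ y * ∑ γ : Fin m, g (bdryPt y) ε.castSucc γ.castSucc
      * christoffel (halfBall m r) g γ.castSucc α.castSucc β.castSucc (bdryPt y) := by
    rw [Finset.mul_sum]; exact Finset.sum_congr rfl fun γ _ => by ring
  rw [h3, h.sum_mul_christoffel_castSucc hx] at h2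
  linarith

end IsUmbilicFermi

end HalfBallGeometry

end BoundaryEstimate

end

noncomputable section

namespace BoundaryEstimate

open Finset Filter Topology Asymptotics

/-! ### Derivatives of u and of T on the flat boundary piece -/

section NormalDerivatives

lemma pd_exp {ι : Type*} [Fintype ι] [DecidableEq ι] {s : Set (EuclideanSpace ℝ ι)}
    (hs : GoodDomain s) {x : EuclideanSpace ℝ ι} (hx : x ∈ s) {φ : EuclideanSpace ℝ ι → ℝ}
    (hφ : DifferentiableWithinAt ℝ φ s x) (i : ι) :
    pd s i (fun y => Real.exp (φ y)) x = Real.exp (φ x) * pd s i φ x := by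
  rw [pd, fderivWithin_exp hφ (hs.uniqueDiffOn x hx)]; simp [pd]

variable {m : ℕ} {r θ G muHat : ℝ}
  {g S : EuclideanSpace ℝ (Fin (m + 1)) → Matrix (Fin (m + 1)) (Fin (m + 1)) ℝ}
  {μ : EuclideanSpace ℝ (Fin m) → ℝ} {u : EuclideanSpace ℝ (Fin (m + 1)) → ℝ}
  {y : EuclideanSpace ℝ (Fin m)}

/-- A function that satisfies the boundary condition, and the tensor `S` with condition (T0). -/
structure IsBoundaryData (r θ G muHat : ℝ)
    (g S : EuclideanSpace ℝ (Fin (m + 1)) → Matrix (Fin (m + 1)) (Fin (m + 1)) ℝ)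
    (μ : EuclideanSpace ℝ (Fin m) → ℝ) (u : EuclideanSpace ℝ (Fin (m + 1)) → ℝ) : Prop where
  fermi : IsUmbilicFermi r θ G g μ
  contDiffOn : ContDiffOn ℝ 4 u (halfBall m r)
  tensor : ∀ i j, ContDiffOn ℝ 2 (fun x => S x i j) (halfBall m r)
  tensor_symm : ∀ x ∈ halfBall m r, (S x).IsSymm
  neumann : ∀ y ∈ bdryDisc m r,
    pd (halfBall m r) (Fin.last m) u (bdryPt y) + μ y = muHat * Real.exp (-u (bdryPt y))
  t0 : ∀ y ∈ bdryDisc m r, ∀ α : Fin m,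
    S (bdryPt y) α.castSucc (Fin.last m) = pd (bdryDisc m r) α μ y

namespace IsBoundaryData

lemma pd_contDiffOn (h : IsBoundaryData r θ G muHat g S μ u) (i : Fin (m + 1)) :
    ContDiffOn ℝ 3 (pd (halfBall m r) i u) (halfBall m r) := by
  exact_mod_cast contDiffOn_pd h.fermi.controlled.good (k := 4) (l := 3)
    (by exact_mod_cast h.contDiffOn) le_rfl i

lemma pd_pd_contDiffOn (h : IsBoundaryData r θ G muHat g S μ u) (i j : Fin (m + 1)) :
    ContDiffOn ℝ 2 (pd (halfBall m r) i (pd (halfBall m r) j u)) (halfBall m r) := by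
  exact_mod_cast contDiffOn_pd h.fermi.controlled.good (k := 3) (l := 2)
    (by exact_mod_cast h.pd_contDiffOn j) le_rfl i

lemma normal_eq (h : IsBoundaryData r θ G muHat g S μ u) (hy : y ∈ bdryDisc m r) :
    pd (halfBall m r) (Fin.last m) u (bdryPt y) = muHat * Real.exp (-u (bdryPt y)) - μ y := by
  linarith [h.neumann y hy]

lemma pd_exp_bdry (h : IsBoundaryData r θ G muHat g S μ u) (hy : y ∈ bdryDisc m r) (α : Fin m) :
    pd (bdryDisc m r) α (fun y => muHat * Real.exp (-u (bdryPt y))) y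
      = -(muHat * Real.exp (-u (bdryPt y))) * pd (halfBall m r) α.castSucc u (bdryPt y) := by
  have hG := goodDomain_bdryDisc m h.fermi.pos
  have hd : DifferentiableWithinAt ℝ (fun y => u (bdryPt y)) (bdryDisc m r) y :=
    (contDiffOn_comp_bdryPt h.contDiffOn).differentiableOn (by norm_num) y hy
  have e : ∀ z, -u (bdryPt z) = -1 * u (bdryPt z) := fun z => by ring
  rw [pd_const_mul hG hy _ hd.fun_neg.exp, pd_exp hG hy hd.fun_neg]
  simp only [e]
  rw [pd_const_mul hG hy _ hd, pd_bdryPt h.fermi.pos hy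
    (h.contDiffOn.differentiableOn (by norm_num) _ (mapsTo_bdryPt m r hy))]
  ring

lemma differentiable_exp (h : IsBoundaryData r θ G muHat g S μ u) (hy : y ∈ bdryDisc m r) :
    DifferentiableWithinAt ℝ (fun y => muHat * Real.exp (-u (bdryPt y))) (bdryDisc m r) y := by
  have hd : DifferentiableWithinAt ℝ (fun y => u (bdryPt y)) (bdryDisc m r) y :=
    (contDiffOn_comp_bdryPt h.contDiffOn).differentiableOn (by norm_num) y hy
  exact hd.fun_neg.exp.const_mul _

/-- The mixed second derivatives on the boundary piece. -/
lemma pd_tangent_normal (h : IsBoundaryData r θ G muHat g S μ u) (hy : y ∈ bdryDisc m r)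
    (α : Fin m) : pd (halfBall m r) α.castSucc (pd (halfBall m r) (Fin.last m) u) (bdryPt y)
      = -(muHat * Real.exp (-u (bdryPt y))) * pd (halfBall m r) α.castSucc u (bdryPt y)
        - pd (bdryDisc m r) α μ y := by
  rw [← pd_bdryPt h.fermi.pos hy ((h.pd_contDiffOn _).differentiableOn (by norm_num) _
    (mapsTo_bdryPt m r hy)), pd_congr (fun z hz => h.normal_eq hz) hy,
    pd_sub (goodDomain_bdryDisc m h.fermi.pos) hy (h.differentiable_exp hy)
      (h.fermi.smooth.differentiableOn (by norm_num) y hy), h.pd_exp_bdry hy]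

lemma pd_normal_tangent (h : IsBoundaryData r θ G muHat g S μ u) (hy : y ∈ bdryDisc m r)
    (α : Fin m) : pd (halfBall m r) (Fin.last m) (pd (halfBall m r) α.castSucc u) (bdryPt y)
      = -(muHat * Real.exp (-u (bdryPt y))) * pd (halfBall m r) α.castSucc u (bdryPt y)
        - pd (bdryDisc m r) α μ y := by
  rw [pd_comm h.fermi.controlled.good (h.contDiffOn.of_le (by norm_num)) (mapsTo_bdryPt m r hy),
    h.pd_tangent_normal hy]

/-- The normal derivative of the tangential second derivatives. -/
lemma pd_normal_tangent_tangent (h : IsBoundaryData r θ G muHat g S μ u) (hy : y ∈ bdryDisc m r)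
    (α β : Fin m) : pd (halfBall m r) (Fin.last m)
        (pd (halfBall m r) α.castSucc (pd (halfBall m r) β.castSucc u)) (bdryPt y)
      = (muHat * Real.exp (-u (bdryPt y))) * (pd (halfBall m r) α.castSucc u (bdryPt y)
          * pd (halfBall m r) β.castSucc u (bdryPt y)
          - pd (halfBall m r) α.castSucc (pd (halfBall m r) β.castSucc u) (bdryPt y))
        - pd (bdryDisc m r) α (pd (bdryDisc m r) β μ) y := by
  have hG := h.fermi.controlled.good
  have hx := mapsTo_bdryPt m r hy
  have hGb := goodDomain_bdryDisc m h.fermi.pos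
  have hβ : DifferentiableWithinAt ℝ (pd (halfBall m r) β.castSucc u) (halfBall m r) (bdryPt y) :=
    (h.pd_contDiffOn _).differentiableOn (by norm_num) _ hx
  have hβ' : DifferentiableWithinAt ℝ (fun y => pd (halfBall m r) β.castSucc u (bdryPt y))
      (bdryDisc m r) y :=
    (contDiffOn_comp_bdryPt (h.pd_contDiffOn β.castSucc)).differentiableOn (by norm_num) y hy
  have hμβ : DifferentiableWithinAt ℝ (pd (bdryDisc m r) β μ) (bdryDisc m r) y := by
    have : ContDiffOn ℝ (1 : ℕ) (pd (bdryDisc m r) β μ) (bdryDisc m r) :=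
      contDiffOn_pd hGb (k := 2) (by exact_mod_cast h.fermi.smooth) (by norm_num) β
    exact this.differentiableOn (by norm_num) y hy
  -- The normal derivative is moved to the innermost place; there the Neumann condition replaces it,
  -- and two tangential derivatives of that condition are taken along the boundary.
  rw [pd_comm hG ((h.pd_contDiffOn _).of_le (by norm_num)) hx,
    pd_congr (fun z hz => pd_comm hG (h.contDiffOn.of_le (by norm_num)) hz _ _) hx,
    ← pd_bdryPt h.fermi.pos hy ((h.pd_pd_contDiffOn _ _).differentiableOn (by norm_num) _ hx),
    pd_congr (fun z hz => h.pd_tangent_normal hz β) hy]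
  have e : ∀ z, -(muHat * Real.exp (-u (bdryPt z))) * pd (halfBall m r) β.castSucc u (bdryPt z)
      = -1 * (muHat * Real.exp (-u (bdryPt z)) * pd (halfBall m r) β.castSucc u (bdryPt z)) :=
    fun z => by ring
  simp only [e]
  rw [pd_sub hGb hy (((h.differentiable_exp hy).fun_mul hβ').const_mul _) hμβ,
    pd_const_mul hGb hy _ ((h.differentiable_exp hy).fun_mul hβ'),
    pd_mul hGb hy (h.differentiable_exp hy) hβ', h.pd_exp_bdry hy, pd_bdryPt h.fermi.pos hy hβ]
  ring

lemma covHess_normal_normal (h : IsBoundaryData r θ G muHat g S μ u) (hy : y ∈ bdryDisc m r) :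
    covHess (halfBall m r) g u (bdryPt y) (Fin.last m) (Fin.last m)
      = pd (halfBall m r) (Fin.last m) (pd (halfBall m r) (Fin.last m) u) (bdryPt y) := by
  simp [covHess, h.fermi.christoffel_normal_normal (mapsTo_bdryPt m r hy)]

/-- The mixed components of `T` vanish on the boundary piece. -/
lemma tensorT_mixed (h : IsBoundaryData r θ G muHat g S μ u) (hy : y ∈ bdryDisc m r) (α : Fin m) :
    tensorT (halfBall m r) g S u (bdryPt y) α.castSucc (Fin.last m) = 0 := by
  have hx := mapsTo_bdryPt m r hy
  simp only [tensorT, covHess, Matrix.of_apply]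
  -- With v = μ̂e^{−u} the four contributions are −vu_α − μ_α from ∂_α u_n, +μu_α from the
  -- connection, u_α(v − μ) from du⊗du and μ_α from (T0); their sum is zero.
  rw [Fin.sum_univ_castSucc, h.fermi.christoffel_last_mixed hx, h.pd_tangent_normal hy, h.t0 y hy,
    h.normal_eq hy]
  simp only [h.fermi.christoffel_mixed_boundary hy, Matrix.one_apply, mul_ite, mul_one, mul_zero,
    ite_mul, zero_mul, Finset.sum_ite_eq', Finset.mem_univ, if_true]
  ring

/-- The normal derivative of the tangential components of `T`; the vector `U` is the tangential
gradient of `u`. -/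
lemma pd_tensorT (h : IsBoundaryData r θ G muHat g S μ u) (hy : y ∈ bdryDisc m r) (α β : Fin m)
    {U : Fin m → ℝ} (hU : ∀ γ : Fin m, ∑ ε : Fin m, g (bdryPt y) γ.castSucc ε.castSucc * U ε
      = pd (halfBall m r) γ.castSucc u (bdryPt y)) :
    pd (halfBall m r) (Fin.last m)
        (fun x => tensorT (halfBall m r) g S u x α.castSucc β.castSucc) (bdryPt y)
      = -(muHat * Real.exp (-u (bdryPt y)))
          * (tensorT (halfBall m r) g S u (bdryPt y) α.castSucc β.castSucc
            - S (bdryPt y) α.castSucc β.castSucc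
            + riemann (halfBall m r) g α.castSucc (Fin.last m) β.castSucc (Fin.last m) (bdryPt y))
        - (covHess (bdryDisc m r) (inducedMetric g) μ y α β
          - riemann (halfBall m r) g α.castSucc (Fin.last m) β.castSucc (Fin.last m) (bdryPt y)
            * μ y - pd (halfBall m r) (Fin.last m) (fun x => S x α.castSucc β.castSucc) (bdryPt y))
        - g (bdryPt y) α.castSucc β.castSucc * (∑ ε, pd (bdryDisc m r) ε μ y * U ε
          + μ y * pd (halfBall m r) (Fin.last m) u (bdryPt y) ^ 2
          + μ y * pd (halfBall m r) (Fin.last m) (pd (halfBall m r) (Fin.last m) u) (bdryPt y)) := by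
  have hG := h.fermi.controlled.good
  have hx := mapsTo_bdryPt m r hy
  set x := bdryPt y with hxd
  set D := halfBall m r with hD
  have d1 : ∀ i, DifferentiableWithinAt ℝ (pd D i u) D x := fun i =>
    (h.pd_contDiffOn i).differentiableOn (by norm_num) _ hx
  have d2 : ∀ i j, DifferentiableWithinAt ℝ (pd D i (pd D j u)) D x := fun i j =>
    (h.pd_pd_contDiffOn i j).differentiableOn (by norm_num) _ hx
  have d3 : ∀ k i j, DifferentiableWithinAt ℝ (christoffel D g k i j) D x := fun k i j =>
    (h.fermi.controlled.christoffel_contDiffOn k i j).differentiableOn (by norm_num) _ hx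
  have d4 : ∀ i j, DifferentiableWithinAt ℝ (fun x => S x i j) D x := fun i j =>
    (h.tensor i j).differentiableOn (by norm_num) _ hx
  have d5 : ∀ i j, DifferentiableWithinAt ℝ
      (fun x => ∑ k, christoffel D g k i j x * pd D k u x) D x := fun i j =>
    DifferentiableWithinAt.fun_sum fun k _ => (d3 k i j).fun_mul (d1 k)
  have e1 : pd D (Fin.last m) (fun x => tensorT D g S u x α.castSucc β.castSucc) x
      = pd D (Fin.last m) (pd D α.castSucc (pd D β.castSucc u)) x
        - ∑ k, (pd D (Fin.last m) (christoffel D g k α.castSucc β.castSucc) x * pd D k u x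
          + christoffel D g k α.castSucc β.castSucc x * pd D (Fin.last m) (pd D k u) x)
        + (pd D (Fin.last m) (pd D α.castSucc u) x * pd D β.castSucc u x
          + pd D α.castSucc u x * pd D (Fin.last m) (pd D β.castSucc u) x)
        + pd D (Fin.last m) (fun x => S x α.castSucc β.castSucc) x := by
    simp only [tensorT, covHess, Matrix.of_apply]
    rw [pd_add hG hx (((d2 _ _).fun_sub (d5 _ _)).fun_add ((d1 _).fun_mul (d1 _))) (d4 _ _),
      pd_add hG hx ((d2 _ _).fun_sub (d5 _ _)) ((d1 _).fun_mul (d1 _)),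
      pd_sub hG hx (d2 _ _) (d5 _ _), pd_mul hG hx (d1 _) (d1 _),
      pd_sum hG hx _ fun k _ => (d3 k _ _).fun_mul (d1 k)]
    simp only [pd_mul hG hx (d3 _ _ _) (d1 _)]
  -- The terms μ_α u_β + μ_β u_α cancel against those from the normal derivative of u_α u_β, and
  -- ⟨∇μ, ∇u⟩g remains.
  have e2 : ∑ γ : Fin m, pd D (Fin.last m) (christoffel D g γ.castSucc α.castSucc β.castSucc) x
      * pd D γ.castSucc u x = -(pd (bdryDisc m r) α μ y * pd D β.castSucc u x
        + pd (bdryDisc m r) β μ y * pd D α.castSucc u x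
        - (∑ ε, pd (bdryDisc m r) ε μ y * U ε) * g x α.castSucc β.castSucc) := by
    simp only [← hU, Finset.mul_sum, Finset.sum_mul]
    rw [Finset.sum_comm]
    have e3 : ∀ ε : Fin m, ∑ γ : Fin m,
        pd D (Fin.last m) (christoffel D g γ.castSucc α.castSucc β.castSucc) x
          * (g x γ.castSucc ε.castSucc * U ε) = -(pd (bdryDisc m r) α μ y * g x β.castSucc ε.castSucc
        + pd (bdryDisc m r) β μ y * g x α.castSucc ε.castSucc
        - pd (bdryDisc m r) ε μ y * g x α.castSucc β.castSucc) * U ε := fun ε => by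
      rw [← h.fermi.sum_mul_pd_christoffel hy ε α β, Finset.sum_mul]
      exact Finset.sum_congr rfl fun γ _ => by
        rw [h.fermi.controlled.symm hx γ.castSucc ε.castSucc]; ring
    simp only [e3, ← Finset.sum_add_distrib, ← Finset.sum_sub_distrib, ← Finset.sum_neg_distrib]
    exact Finset.sum_congr rfl fun ε _ => by ring
  have e4 : covHess (bdryDisc m r) (inducedMetric g) μ y α β
      = pd (bdryDisc m r) α (pd (bdryDisc m r) β μ) y
        - ∑ γ : Fin m, christoffel D g γ.castSucc α.castSucc β.castSucc x * pd (bdryDisc m r) γ μ y := by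
    simp only [covHess, Matrix.of_apply, h.fermi.christoffel_tangent hy]
    rfl
  have e5 : tensorT D g S u x α.castSucc β.castSucc
      = pd D α.castSucc (pd D β.castSucc u) x
        - (∑ γ : Fin m, christoffel D g γ.castSucc α.castSucc β.castSucc x * pd D γ.castSucc u x
          + μ y * g x α.castSucc β.castSucc * pd D (Fin.last m) u x)
        + pd D α.castSucc u x * pd D β.castSucc u x + S x α.castSucc β.castSucc := by
    simp only [tensorT, covHess, Matrix.of_apply]
    rw [Fin.sum_univ_castSucc, h.fermi.christoffel_last_boundary hy]
  have e6 : ∑ γ : Fin m, christoffel D g γ.castSucc α.castSucc β.castSucc x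
        * pd D (Fin.last m) (pd D γ.castSucc u) x
      = -(muHat * Real.exp (-u x)) * ∑ γ : Fin m,
          christoffel D g γ.castSucc α.castSucc β.castSucc x * pd D γ.castSucc u x
        - ∑ γ : Fin m, christoffel D g γ.castSucc α.castSucc β.castSucc x
          * pd (bdryDisc m r) γ μ y := by
    rw [Finset.mul_sum, ← Finset.sum_sub_distrib]
    exact Finset.sum_congr rfl fun γ _ => by rw [h.pd_normal_tangent hy]; ring
  have e7 := h.fermi.pd_christoffel_last hy α β
  have e8 := h.fermi.christoffel_last_boundary hy α β
  rw [← hxd, ← hD] at e7 e8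
  rw [e1, Fin.sum_univ_castSucc, Finset.sum_add_distrib, e2, e6, e7, e8, e4, e5,
    h.pd_normal_tangent_tangent hy, h.pd_normal_tangent hy, h.pd_normal_tangent hy, h.normal_eq hy]
  ring

end IsBoundaryData

end NormalDerivatives

end BoundaryEstimate

end

noncomputable section

namespace BoundaryEstimate

open Finset Filter Topology Asymptotics

/-! ### One-sided first-order expansions at the boundary -/

section OneSided

set_option linter.unusedSectionVars false

variable {ι : Type*} [Fintype ι] [DecidableEq ι] {I : Set ℝ}

lemma nonneg_of_hasDerivWithinAt {φ : ℝ → ℝ} {φ' δ : ℝ} (hδ : 0 < δ)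
    (h : HasDerivWithinAt φ φ' (Set.Icc 0 δ) 0) (h0 : φ 0 = 0)
    (hp : ∀ᶠ t in 𝓝[Set.Icc 0 δ] 0, 0 ≤ φ t) : 0 ≤ φ' := by
  rw [hasDerivWithinAt_iff_tendsto_slope] at h
  have e : Set.Icc (0 : ℝ) δ \ {0} = Set.Ioc 0 δ := by
    ext t; simp only [Set.mem_sdiff, Set.mem_Icc, Set.mem_singleton_iff, Set.mem_Ioc]
    constructor
    · rintro ⟨⟨h1, h2⟩, h3⟩; exact ⟨lt_of_le_of_ne h1 (Ne.symm h3), h2⟩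
    · rintro ⟨h1, h2⟩; exact ⟨⟨h1.le, h2⟩, h1.ne'⟩
  rw [e] at h
  have hne : (𝓝[Set.Ioc 0 δ] (0 : ℝ)).NeBot := by
    rw [nhdsWithin_Ioc_eq_nhdsGT hδ]; infer_instance
  refine ge_of_tendsto h ?_
  have h1 : ∀ᶠ t in 𝓝[Set.Ioc 0 δ] (0 : ℝ), 0 ≤ φ t :=
    hp.filter_mono (nhdsWithin_mono 0 Set.Ioc_subset_Icc_self)
  filter_upwards [h1, self_mem_nhdsWithin] with t ht htI
  rw [slope_def_field, h0]
  exact div_nonneg (by linarith) (by linarith [htI.1])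

/-- A frame that is orthonormal up to first order can be corrected to an orthonormal one. -/
lemma exists_frame_within {g P : ℝ → Matrix ι ι ℝ}
    (hg : ∀ᶠ t in 𝓝[I] 0, (g t).IsSymm) (hP : IsFrame (g 0) (P 0))
    (hd : ∀ a b, HasDerivWithinAt (fun t => ((P t).transpose * g t * P t) a b) 0 I 0) :
    ∃ N : ℝ → Matrix ι ι ℝ, N 0 = 1 ∧ (∀ a b, HasDerivWithinAt (fun t => N t a b) 0 I 0) ∧
      ∀ᶠ t in 𝓝[I] 0, IsFrame (g t) (P t * N t) := by
  classical
  obtain ⟨δ, hδ, C, hC0, hinv⟩ := exists_invSqrt ι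
  set R : ℝ → Matrix ι ι ℝ := fun t => (P t).transpose * g t * P t - 1 with hR
  have hR0 : R 0 = 0 := by simp only [hR]; rw [IsFrame] at hP; rw [hP, sub_self]
  -- The Gram matrix is constant to first order, so its defect is o(t), and the correction 1 − R/2 +
  -- O(R²) has zero derivative at 0.
  have hRo : ∀ a b, (fun t => R t a b) =o[𝓝[I] 0] fun t : ℝ => t := fun a b => by
    have h1 := hasDerivWithinAt_iff_isLittleO.1 (hd a b)
    refine h1.congr (fun t => ?_) fun t => sub_zero t
    have h2 : ((P 0).transpose * g 0 * P 0) a b = (1 : Matrix ι ι ℝ) a b := by rw [← hP]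
    simp only [smul_zero, sub_zero, h2, hR, Matrix.sub_apply]
  set s : ℝ → ℝ := fun t => ∑ a, ∑ b, |R t a b| with hs
  have hso : s =o[𝓝[I] 0] fun t : ℝ => t :=
    IsLittleO.fun_sum fun a _ => IsLittleO.fun_sum fun b _ => (hRo a b).abs_left
  have hs0 : ∀ t, 0 ≤ s t := fun t => Finset.sum_nonneg fun _ _ => Finset.sum_nonneg fun _ _ =>
    abs_nonneg _
  have hsR : ∀ t a b, |R t a b| ≤ s t := fun t a b =>
    (Finset.single_le_sum (f := fun b => |R t a b|) (fun _ _ => abs_nonneg _)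
      (Finset.mem_univ b)).trans (Finset.single_le_sum (f := fun a => ∑ b, |R t a b|)
        (fun _ _ => Finset.sum_nonneg fun _ _ => abs_nonneg _) (Finset.mem_univ a))
  have hid : Tendsto (fun t : ℝ => t) (𝓝[I] 0) (𝓝 0) := tendsto_id.mono_left nhdsWithin_le_nhds
  have hst : Tendsto s (𝓝[I] 0) (𝓝 0) := hso.trans_tendsto hid
  have hex : ∀ t, ∃ N : Matrix ι ι ℝ, ((R t).IsSymm → s t ≤ δ → N.IsSymm ∧ N * (1 + R t) * N = 1 ∧
      ∀ i j, |N i j - ((1 : Matrix ι ι ℝ) i j - R t i j / 2)| ≤ C * s t ^ 2) := fun t => by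
    by_cases h : (R t).IsSymm ∧ s t ≤ δ
    · obtain ⟨N, hN⟩ := hinv (R t) (s t) h.1 (hs0 t) h.2 (hsR t)
      exact ⟨N, fun _ _ => hN⟩
    · exact ⟨1, fun h1 h2 => absurd ⟨h1, h2⟩ h⟩
  choose N hN using hex
  have hsym : ∀ᶠ t in 𝓝[I] 0, (R t).IsSymm := hg.mono fun t ht =>
    (conj_isSymm (P t) ht).sub Matrix.isSymm_one
  have hsmall : ∀ᶠ t in 𝓝[I] 0, s t ≤ δ := hst.eventually_le_const hδ
  have hs00 : s 0 = 0 := by simp [hs, hR0]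
  have hN0 : N 0 = 1 := by
    obtain ⟨-, -, h3⟩ := hN 0 (by rw [hR0]; exact Matrix.isSymm_zero) (by rw [hs00]; exact hδ.le)
    ext i j
    have := h3 i j
    rw [hs00, hR0] at this
    simp only [Matrix.zero_apply, zero_div, sub_zero, ne_eq, OfNat.ofNat_ne_zero, not_false_eq_true,
      zero_pow, mul_zero] at this
    linarith [abs_nonpos_iff.1 this]
  refine ⟨N, hN0, fun a b => ?_, ?_⟩
  · rw [hasDerivWithinAt_iff_isLittleO]
    have h1 : (fun t => N t a b - ((1 : Matrix ι ι ℝ) a b - R t a b / 2)) =O[𝓝[I] 0]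
        fun t => s t ^ 2 := by
      refine IsBigO.of_bound C ?_
      filter_upwards [hsym, hsmall] with t h1 h2
      rw [Real.norm_eq_abs, Real.norm_eq_abs, abs_of_nonneg (sq_nonneg (s t))]
      exact (hN t h1 h2).2.2 a b
    have h2 : (fun t => s t ^ 2) =o[𝓝[I] 0] fun t : ℝ => t := by
      have h3 : (fun t => s t * s t) =o[𝓝[I] 0] fun t : ℝ => t * 1 :=
        hso.mul_isBigO (hst.isBigO_one ℝ)
      simpa [sq] using h3
    have h4 := (h1.trans_isLittleO h2).sub ((hRo a b).const_mul_left (1 / 2))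
    refine h4.congr (fun t => ?_) fun t => (sub_zero t).symm
    rw [hN0]; simp only [smul_zero]; ring
  · filter_upwards [hsym, hsmall] with t h1 h2
    obtain ⟨h3, h4, -⟩ := hN t h1 h2
    rw [IsFrame, Matrix.transpose_mul, h3.eq]
    have h5 : 1 + R t = (P t).transpose * g t * P t := by simp [hR]
    rw [h5] at h4
    simpa only [Matrix.mul_assoc] using h4

lemma hasDerivWithinAt_conj {N B : ℝ → Matrix ι ι ℝ} {B' : Matrix ι ι ℝ} (hN0 : N 0 = 1)
    (hN : ∀ a b, HasDerivWithinAt (fun t => N t a b) 0 I 0)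
    (hB : ∀ a b, HasDerivWithinAt (fun t => B t a b) (B' a b) I 0) (a : ι) :
    HasDerivWithinAt (fun t => ((N t).transpose * B t * N t) a a) (B' a a) I 0 := by
  have h := HasDerivWithinAt.fun_sum fun i (_ : i ∈ Finset.univ) =>
    HasDerivWithinAt.fun_sum fun j (_ : j ∈ Finset.univ) =>
      ((hB i j).fun_mul (hN i a)).fun_mul (hN j a)
  simp only [conj_apply]
  refine h.congr_deriv ?_
  simp [hN0, Matrix.one_apply]

lemma hasDerivWithinAt_mulVec {N : ℝ → Matrix ι ι ℝ} {w : ι → ℝ → ℝ} {w' : ι → ℝ} (hN0 : N 0 = 1)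
    (hN : ∀ a b, HasDerivWithinAt (fun t => N t a b) 0 I 0)
    (hw : ∀ a, HasDerivWithinAt (w a) (w' a) I 0) (c : ι) :
    HasDerivWithinAt (fun t => ∑ b, N t b c * w b t) (w' c) I 0 := by
  have h := HasDerivWithinAt.fun_sum fun b (_ : b ∈ Finset.univ) => (hN b c).fun_mul (hw b)
  refine h.congr_deriv ?_
  simp [hN0, Matrix.one_apply]

end OneSided

/-! ### The normal coordinate line -/

section NormalCurve

variable {m : ℕ} {r : ℝ} {y : EuclideanSpace ℝ (Fin m)}

/-- The coordinate line in the normal direction. -/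
def normalCurve (y : EuclideanSpace ℝ (Fin m)) (t : ℝ) : EuclideanSpace ℝ (Fin (m + 1)) :=
  bdryPt y + t • EuclideanSpace.single (Fin.last m) 1

@[simp] lemma normalCurve_zero : normalCurve y 0 = bdryPt y := by simp [normalCurve]

lemma exists_mapsTo_normalCurve (hy : ∑ α, y α ^ 2 < r ^ 2) :
    ∃ δ > 0, Set.MapsTo (normalCurve y) (Set.Icc 0 δ) (halfBall m r) := by
  refine ⟨√(r ^ 2 - ∑ α, y α ^ 2), Real.sqrt_pos.2 (by linarith), fun t ht => ⟨?_, ?_⟩⟩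
  · simpa [normalCurve] using ht.1
  · rw [Fin.sum_univ_castSucc]
    have h1 : t ^ 2 ≤ r ^ 2 - ∑ α, y α ^ 2 := by
      have := pow_le_pow_left₀ ht.1 ht.2 2
      rwa [Real.sq_sqrt (by linarith)] at this
    simp [normalCurve]
    linarith

lemma hasDerivWithinAt_normalCurve {δ : ℝ}
    (hm : Set.MapsTo (normalCurve y) (Set.Icc 0 δ) (halfBall m r))
    {φ : EuclideanSpace ℝ (Fin (m + 1)) → ℝ}
    (hφ : DifferentiableWithinAt ℝ φ (halfBall m r) (bdryPt y)) :
    HasDerivWithinAt (fun t => φ (normalCurve y t))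
      (pd (halfBall m r) (Fin.last m) φ (bdryPt y)) (Set.Icc 0 δ) 0 := by
  have h := hasDerivWithinAt_comp_curve (τ := 0) (χ := φ)
    (γ' := fun k => (EuclideanSpace.single (Fin.last m) (1 : ℝ) : EuclideanSpace ℝ (Fin (m + 1))) k)
    hm (by simpa using hφ) fun k => by
      have := ((hasDerivAt_id (0 : ℝ)).mul_const
        ((EuclideanSpace.single (Fin.last m) (1 : ℝ) : EuclideanSpace ℝ (Fin (m + 1))) k)).const_add
          (bdryPt y k)
      simpa [normalCurve] using this.hasDerivWithinAt
  simpa using h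

/-- The derivative of `f(x, u(x))` along the normal curve. -/
lemma hasDerivWithinAt_rhs (hr : 0 < r) (hy : y ∈ bdryDisc m r) {δ : ℝ}
    (hm : Set.MapsTo (normalCurve y) (Set.Icc 0 δ) (halfBall m r))
    {f : EuclideanSpace ℝ (Fin (m + 1)) → ℝ → ℝ} {u : EuclideanSpace ℝ (Fin (m + 1)) → ℝ}
    (hf : ContDiffOn ℝ 2 (fun p : EuclideanSpace ℝ (Fin (m + 1)) × ℝ => f p.1 p.2)
      (halfBall m r ×ˢ Set.univ))
    (hu : DifferentiableWithinAt ℝ u (halfBall m r) (bdryPt y)) :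
    HasDerivWithinAt (fun t => f (normalCurve y t) (u (normalCurve y t)))
      (pd (halfBall m r) (Fin.last m) (fun x => f x (u (bdryPt y))) (bdryPt y)
        + pd (halfBall m r) (Fin.last m) u (bdryPt y) * deriv (f (bdryPt y)) (u (bdryPt y)))
      (Set.Icc 0 δ) 0 := by
  have hx := mapsTo_bdryPt m r hy
  set D := halfBall m r with hD
  set x := bdryPt y with hxd
  set z := u x with hz
  set f' : EuclideanSpace ℝ (Fin (m + 1)) × ℝ → ℝ := fun p => f p.1 p.2 with hf'
  obtain ⟨L, hL⟩ : ∃ L, HasFDerivWithinAt f' L (D ×ˢ Set.univ) (x, z) :=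
    ⟨_, (hf.differentiableOn (by norm_num) (x, z) ⟨hx, Set.mem_univ _⟩).hasFDerivWithinAt⟩
  have h1 : pd D (Fin.last m) (fun x => f x z) x = L (EuclideanSpace.single (Fin.last m) 1, 0) := by
    have hincl : HasFDerivWithinAt (fun y : EuclideanSpace ℝ (Fin (m + 1)) => (y, z))
        (ContinuousLinearMap.inl ℝ (EuclideanSpace ℝ (Fin (m + 1))) ℝ) D x :=
      ((hasFDerivAt_id x).prodMk (hasFDerivAt_const z x)).hasFDerivWithinAt
    have h2 : HasFDerivWithinAt (fun x => f x z) (L.comp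
        (ContinuousLinearMap.inl ℝ (EuclideanSpace ℝ (Fin (m + 1))) ℝ)) D x :=
      HasFDerivWithinAt.comp (g := f') (f := fun y => (y, z)) x hL hincl
        fun y hy => ⟨hy, Set.mem_univ _⟩
    rw [pd_eq_of_hasFDerivWithinAt (goodDomain_halfBall m hr) hx h2]
    simp
  have h2 : deriv (f x) z = L (0, 1) := by
    have h3 : HasDerivWithinAt (fun z : ℝ => (x, z))
        ((0, 1) : EuclideanSpace ℝ (Fin (m + 1)) × ℝ) Set.univ z :=
      ((hasDerivAt_const z x).prodMk (hasDerivAt_id z)).hasDerivWithinAt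
    have h4 := hL.comp_hasDerivWithinAt (f := fun z : ℝ => (x, z)) z h3
      fun w _ => ⟨hx, Set.mem_univ _⟩
    exact (h4.hasDerivAt Filter.univ_mem).deriv
  have h3 : HasDerivWithinAt (normalCurve y) (EuclideanSpace.single (Fin.last m) 1)
      (Set.Icc 0 δ) 0 := by
    have := ((hasDerivAt_id (0 : ℝ)).smul_const
      (EuclideanSpace.single (Fin.last m) (1 : ℝ) : EuclideanSpace ℝ (Fin (m + 1)))).const_add
        (bdryPt y)
    rw [one_smul] at this
    exact this.hasDerivWithinAt
  have h4 : HasDerivWithinAt (fun t => (normalCurve y t, u (normalCurve y t)))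
      (EuclideanSpace.single (Fin.last m) 1, pd D (Fin.last m) u x) (Set.Icc 0 δ) 0 :=
    h3.prodMk (hasDerivWithinAt_normalCurve hm hu)
  have hL' : HasFDerivWithinAt f' L (D ×ˢ Set.univ) (normalCurve y 0, u (normalCurve y 0)) := by
    simpa [hz] using hL
  have h5 := hL'.comp_hasDerivWithinAt (f := fun t => (normalCurve y t, u (normalCurve y t))) 0 h4
    fun t ht => ⟨hm ht, Set.mem_univ _⟩
  refine h5.congr_deriv ?_
  rw [linear_single_sum, h1, h2]
  simp

end NormalCurve

end BoundaryEstimate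

end

noncomputable section

namespace BoundaryEstimate

open Finset Filter Topology Asymptotics

/-! ### Frames that split into tangential and normal directions -/

section BlockFrame

variable {m : ℕ}

/-- The frame that consists of a tangential frame and the normal coordinate vector. -/
def blockFrame (e : Matrix (Fin m) (Fin m) ℝ) : Matrix (Fin (m + 1)) (Fin (m + 1)) ℝ :=
  Matrix.of fun i a => Fin.snoc (α := fun _ => ℝ) (fun γ => Fin.snoc (α := fun _ => ℝ) (fun α => e γ α) 0 a)
    (Fin.snoc (α := fun _ => ℝ) (fun _ => 0) 1 a) i

variable (e : Matrix (Fin m) (Fin m) ℝ)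

@[simp] lemma blockFrame_tangent (γ α : Fin m) : blockFrame e γ.castSucc α.castSucc = e γ α := by
  simp [blockFrame]

@[simp] lemma blockFrame_tangent_last (γ : Fin m) : blockFrame e γ.castSucc (Fin.last m) = 0 := by
  simp [blockFrame]

@[simp] lemma blockFrame_last_tangent (α : Fin m) : blockFrame e (Fin.last m) α.castSucc = 0 := by
  simp [blockFrame]

@[simp] lemma blockFrame_last : blockFrame e (Fin.last m) (Fin.last m) = 1 := by
  simp [blockFrame]

variable {e}

lemma sum_blockFrame_tangent (T : Fin (m + 1) → Fin (m + 1) → ℝ) (α β : Fin m) :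
    ∑ i, ∑ j, T i j * blockFrame e i α.castSucc * blockFrame e j β.castSucc
      = ∑ γ : Fin m, ∑ δ : Fin m, T γ.castSucc δ.castSucc * e γ α * e δ β := by
  simp [Fin.sum_univ_castSucc]

lemma sum_blockFrame_last (T : Fin (m + 1) → Fin (m + 1) → ℝ) :
    ∑ i, ∑ j, T i j * blockFrame e i (Fin.last m) * blockFrame e j (Fin.last m)
      = T (Fin.last m) (Fin.last m) := by
  simp [Fin.sum_univ_castSucc]

lemma sum_blockFrame_mixed {T : Fin (m + 1) → Fin (m + 1) → ℝ}
    (hT : ∀ γ : Fin m, T γ.castSucc (Fin.last m) = 0) (α : Fin m) :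
    ∑ i, ∑ j, T i j * blockFrame e i α.castSucc * blockFrame e j (Fin.last m) = 0 := by
  simp [Fin.sum_univ_castSucc, hT]

lemma sum_blockFrame_mixed' {T : Fin (m + 1) → Fin (m + 1) → ℝ}
    (hT : ∀ γ : Fin m, T (Fin.last m) γ.castSucc = 0) (α : Fin m) :
    ∑ i, ∑ j, T i j * blockFrame e i (Fin.last m) * blockFrame e j α.castSucc = 0 := by
  simp [Fin.sum_univ_castSucc, hT]

lemma conj_blockFrame {T : Matrix (Fin (m + 1)) (Fin (m + 1)) ℝ}
    (h1 : ∀ γ : Fin m, T γ.castSucc (Fin.last m) = 0)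
    (h2 : ∀ γ : Fin m, T (Fin.last m) γ.castSucc = 0) {d : Fin m → ℝ}
    (hd : e.transpose * T.submatrix Fin.castSucc Fin.castSucc * e = Matrix.diagonal d) :
    (blockFrame e).transpose * T * blockFrame e
      = Matrix.diagonal (Fin.snoc (α := fun _ => ℝ) d (T (Fin.last m) (Fin.last m))) := by
  ext a b
  rw [conj_apply]
  refine Fin.lastCases ?_ (fun α => ?_) a
  · refine Fin.lastCases ?_ (fun β => ?_) b
    · refine (sum_blockFrame_last (e := e) fun i j => T i j).trans ?_; simp
    · rw [sum_blockFrame_mixed' h2, Matrix.diagonal_apply_ne _ (Fin.castSucc_lt_last β).ne']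
  · refine Fin.lastCases ?_ (fun β => ?_) b
    · rw [sum_blockFrame_mixed h1, Matrix.diagonal_apply_ne _ (Fin.castSucc_lt_last α).ne]
    · refine (sum_blockFrame_tangent (e := e) (fun i j => T i j) α β).trans ?_
      have := congrFun (congrFun hd α) β
      rw [conj_apply] at this
      simp only [Matrix.submatrix_apply] at this
      rw [this, Matrix.diagonal_apply, Matrix.diagonal_apply]
      simp [Fin.castSucc_inj]

end BlockFrame

/-! ### First-order expansion of T along the normal line -/

section Expansion

variable {m : ℕ} {r θ G muHat : ℝ}
  {g S : EuclideanSpace ℝ (Fin (m + 1)) → Matrix (Fin (m + 1)) (Fin (m + 1)) ℝ}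
  {μ : EuclideanSpace ℝ (Fin m) → ℝ} {u : EuclideanSpace ℝ (Fin (m + 1)) → ℝ}
  {y : EuclideanSpace ℝ (Fin m)} {e : Matrix (Fin m) (Fin m) ℝ}

lemma IsUmbilicFermi.isFrame_blockFrame (h : IsUmbilicFermi r θ G g μ) (hy : y ∈ bdryDisc m r)
    (he : IsFrame (inducedMetric g y) e) : IsFrame (g (bdryPt y)) (blockFrame e) := by
  have hx := mapsTo_bdryPt m r hy
  rw [IsFrame, conj_blockFrame (d := fun _ => 1) (h.mixed _ hx) (h.mixed' hx) (by
    rw [Matrix.diagonal_one]; exact he), h.normal _ hx]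
  rw [← Matrix.diagonal_one]
  congr 1
  ext a
  refine Fin.lastCases ?_ (fun α => ?_) a <;> simp

lemma IsBoundaryData.differentiable_tensorT (h : IsBoundaryData r θ G muHat g S μ u)
    {x : EuclideanSpace ℝ (Fin (m + 1))} (hx : x ∈ halfBall m r) (i j : Fin (m + 1)) :
    DifferentiableWithinAt ℝ (fun x => tensorT (halfBall m r) g S u x i j) (halfBall m r) x := by
  have d1 : ∀ i, DifferentiableWithinAt ℝ (pd (halfBall m r) i u) (halfBall m r) x := fun i =>
    (h.pd_contDiffOn i).differentiableOn (by norm_num) _ hx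
  have d2 : ∀ i j, DifferentiableWithinAt ℝ (pd (halfBall m r) i (pd (halfBall m r) j u))
      (halfBall m r) x := fun i j =>
    (h.pd_pd_contDiffOn i j).differentiableOn (by norm_num) _ hx
  have d3 : ∀ k i j, DifferentiableWithinAt ℝ (christoffel (halfBall m r) g k i j)
      (halfBall m r) x := fun k i j =>
    (h.fermi.controlled.christoffel_contDiffOn k i j).differentiableOn (by norm_num) _ hx
  have d4 : ∀ i j, DifferentiableWithinAt ℝ (fun x => S x i j) (halfBall m r) x := fun i j =>
    (h.tensor i j).differentiableOn (by norm_num) _ hx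
  have d5 : DifferentiableWithinAt ℝ (fun x => ∑ k, christoffel (halfBall m r) g k i j x
      * pd (halfBall m r) k u x) (halfBall m r) x :=
    DifferentiableWithinAt.fun_sum fun k _ => (d3 k i j).fun_mul (d1 k)
  simp only [tensorT, covHess, Matrix.of_apply]
  exact (((d2 i j).fun_sub d5).fun_add ((d1 i).fun_mul (d1 j))).fun_add (d4 i j)

/-- The first order expansion of `T` and `|∇u|²` in an orthonormal frame along the normal curve. -/
lemma IsBoundaryData.exists_normal_expansion (h : IsBoundaryData r θ G muHat g S μ u)
    (hy : y ∈ bdryDisc m r) (he : IsFrame (inducedMetric g y) e) {δ : ℝ}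
    (hm : Set.MapsTo (normalCurve y) (Set.Icc 0 δ) (halfBall m r)) :
    ∃ E' : ℝ → Matrix (Fin (m + 1)) (Fin (m + 1)) ℝ, E' 0 = blockFrame e ∧
      (∀ᶠ t in 𝓝[Set.Icc 0 δ] 0, IsFrame (g (normalCurve y t)) (E' t)) ∧
      (∀ a, HasDerivWithinAt (fun t => ((E' t).transpose
          * tensorT (halfBall m r) g S u (normalCurve y t) * E' t) a a)
        (∑ i, ∑ j, pd (halfBall m r) (Fin.last m) (fun x => tensorT (halfBall m r) g S u x i j)
            (bdryPt y) * blockFrame e i a * blockFrame e j a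
          + 2 * Fin.snoc (α := fun _ => ℝ) (fun _ : Fin m => μ y) 0 a
            * ((blockFrame e).transpose * tensorT (halfBall m r) g S u (bdryPt y)
              * blockFrame e) a a) (Set.Icc 0 δ) 0) ∧
      HasDerivWithinAt (fun t => ∑ c, gradComp (halfBall m r) u (E' t) (normalCurve y t) c ^ 2)
        (∑ c, 2 * gradComp (halfBall m r) u (blockFrame e) (bdryPt y) c
          * (∑ i, blockFrame e i c * pd (halfBall m r) (Fin.last m) (pd (halfBall m r) i u) (bdryPt y)
            + Fin.snoc (α := fun _ => ℝ) (fun _ : Fin m => μ y) 0 c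
              * gradComp (halfBall m r) u (blockFrame e) (bdryPt y) c)) (Set.Icc 0 δ) 0 := by
  have hx := mapsTo_bdryPt m r hy
  have hF := h.fermi
  set D := halfBall m r with hD
  set x := bdryPt y with hxd
  set E := blockFrame e with hE
  have hEf : IsFrame (g x) E := hF.isFrame_blockFrame hy he
  set ν : Fin (m + 1) → ℝ := Fin.snoc (α := fun _ => ℝ) (fun _ : Fin m => μ y) 0 with hν
  set I := Set.Icc 0 δ with hI
  -- Stretching the tangential vectors by 1 + μt compensates ∂_n g = −2μg; the normal vector stays
  -- fixed. The frame is then orthonormal to first order, and the stretching accounts for the terms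
  -- with 2μ and μ in the derivatives.
  set P : ℝ → Matrix (Fin (m + 1)) (Fin (m + 1)) ℝ :=
    fun t => Matrix.of fun i a => E i a * (1 + ν a * t) with hP
  have hP0 : P 0 = E := by ext i a; simp [hP]
  have hPd : ∀ i a, HasDerivWithinAt (fun t => P t i a) (E i a * ν a) I 0 := fun i a => by
    have := ((((hasDerivAt_id (0 : ℝ)).const_mul (ν a)).const_add 1).const_mul (E i a))
    simp only [id, mul_one] at this
    exact this.hasDerivWithinAt
  have hconj : ∀ (A : EuclideanSpace ℝ (Fin (m + 1)) → Matrix (Fin (m + 1)) (Fin (m + 1)) ℝ),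
      (∀ i j, DifferentiableWithinAt ℝ (fun x => A x i j) D x) → ∀ a b,
      HasDerivWithinAt (fun t => ((P t).transpose * A (normalCurve y t) * P t) a b)
        (∑ i, ∑ j, pd D (Fin.last m) (fun x => A x i j) x * E i a * E j b
          + (ν a + ν b) * (E.transpose * A x * E) a b) I 0 := by
    intro A hA a b
    have h1 := HasDerivWithinAt.fun_sum fun i (_ : i ∈ Finset.univ) =>
      HasDerivWithinAt.fun_sum fun j (_ : j ∈ Finset.univ) =>
        ((hasDerivWithinAt_normalCurve hm (hA i j)).fun_mul (hPd i a)).fun_mul (hPd j b)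
    simp only [conj_apply]
    refine h1.congr_deriv ?_
    rw [hP0, normalCurve_zero, Finset.mul_sum, ← Finset.sum_add_distrib]
    refine Finset.sum_congr rfl fun i _ => ?_
    rw [Finset.mul_sum, ← Finset.sum_add_distrib]
    exact Finset.sum_congr rfl fun j _ => by ring
  have hgram : ∀ a b, HasDerivWithinAt
      (fun t => ((P t).transpose * g (normalCurve y t) * P t) a b) 0 I 0 := by
    intro a b
    refine (hconj g (fun i j => (hF.controlled.contDiffOn i j).differentiableOn (by norm_num) _ hx)
      a b).congr_deriv ?_
    rw [hEf]
    refine Fin.lastCases ?_ (fun α => ?_) a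
    · refine Fin.lastCases ?_ (fun β => ?_) b
      · rw [sum_blockFrame_last, hF.pd_normal hx]; simp [hν]
      · rw [sum_blockFrame_mixed' fun γ => hF.pd_mixed' hx _ γ,
          Matrix.one_apply_ne (Fin.castSucc_lt_last β).ne']; simp
    · refine Fin.lastCases ?_ (fun β => ?_) b
      · rw [sum_blockFrame_mixed fun γ => hF.pd_mixed hx _ γ,
          Matrix.one_apply_ne (Fin.castSucc_lt_last α).ne]; simp
      · rw [sum_blockFrame_tangent]
        have h1 := isFrame_apply he α β
        have h2 : ∑ γ : Fin m, ∑ δ : Fin m, -2 * μ y * g (bdryPt y) γ.castSucc δ.castSucc * e γ α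
            * e δ β = -2 * μ y * (1 : Matrix (Fin m) (Fin m) ℝ) α β := by
          rw [← h1, Finset.mul_sum]
          refine Finset.sum_congr rfl fun γ _ => ?_
          rw [Finset.mul_sum]
          exact Finset.sum_congr rfl fun δ _ => by simp only [inducedMetric, Matrix.of_apply]; ring
        have h3 : ∑ γ : Fin m, ∑ δ : Fin m, pd D (Fin.last m)
            (fun x => g x γ.castSucc δ.castSucc) x * e γ α * e δ β
            = -2 * μ y * (1 : Matrix (Fin m) (Fin m) ℝ) α β := by
          rw [← h2]
          exact Finset.sum_congr rfl fun γ _ => Finset.sum_congr rfl fun δ _ => by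
            rw [hF.pd_last_eq hy]
        refine (congrArg₂ (· + ·) h3 rfl).trans ?_
        simp only [hν, Fin.snoc_castSucc, Matrix.one_apply, Fin.castSucc_inj]
        ring
  have hev : ∀ᶠ t in 𝓝[I] 0, (g (normalCurve y t)).IsSymm := by
    filter_upwards [self_mem_nhdsWithin] with t ht
    exact hF.controlled.isSymm (hm ht)
  obtain ⟨N, hN0, hN, hfr⟩ := exists_frame_within (g := fun t => g (normalCurve y t)) (P := P) hev
    (by rw [hP0, normalCurve_zero]; exact hEf) hgram
  refine ⟨fun t => P t * N t, by show P 0 * N 0 = E; rw [hP0, hN0, Matrix.mul_one], hfr, fun a => ?_, ?_⟩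
  · have h1 := hasDerivWithinAt_conj hN0 hN (B' := Matrix.of fun a b =>
      ∑ i, ∑ j, pd D (Fin.last m) (fun x => tensorT D g S u x i j) x * E i a * E j b
          + (ν a + ν b) * (E.transpose * tensorT D g S u x * E) a b)
      (hconj (tensorT D g S u) fun i j => h.differentiable_tensorT hx i j) a
    have e1 : (fun t => ((P t * N t).transpose * tensorT D g S u (normalCurve y t) * (P t * N t)) a a)
        = fun t => ((N t).transpose * ((P t).transpose * tensorT D g S u (normalCurve y t) * P t)
          * N t) a a := by
      funext t; simp only [Matrix.transpose_mul, Matrix.mul_assoc]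
    rw [e1]
    refine h1.congr_deriv ?_
    simp only [Matrix.of_apply]; ring
  · have hw : ∀ b, HasDerivWithinAt (fun t => gradComp D u (P t) (normalCurve y t) b)
        (∑ i, E i b * pd D (Fin.last m) (pd D i u) x + ν b * gradComp D u E x b) I 0 := by
      intro b
      have h1 := HasDerivWithinAt.fun_sum fun i (_ : i ∈ Finset.univ) => (hPd i b).fun_mul
        (hasDerivWithinAt_normalCurve hm (φ := pd D i u)
          ((h.pd_contDiffOn i).differentiableOn (by norm_num) _ hx))
      refine h1.congr_deriv ?_
      rw [hP0, normalCurve_zero, gradComp, Finset.mul_sum, ← Finset.sum_add_distrib]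
      exact Finset.sum_congr rfl fun i _ => by ring
    have h2 := fun c => hasDerivWithinAt_mulVec hN0 hN hw c
    have e2 : ∀ t c, gradComp D u (P t * N t) (normalCurve y t) c
        = ∑ b, N t b c * gradComp D u (P t) (normalCurve y t) b := by
      intro t c
      simp only [gradComp, Matrix.mul_apply, Finset.sum_mul, Finset.mul_sum]
      rw [Finset.sum_comm]
      exact Finset.sum_congr rfl fun b _ => Finset.sum_congr rfl fun k _ => by ring
    have h3 := HasDerivWithinAt.fun_sum fun c (_ : c ∈ Finset.univ) => (h2 c).fun_pow 2
    simp only [e2]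
    refine h3.congr_deriv ?_
    refine Finset.sum_congr rfl fun c _ => ?_
    rw [← e2, hP0, hN0, Matrix.mul_one, normalCurve_zero]
    rw [← hxd]
    norm_num

end Expansion

end BoundaryEstimate

end

noncomputable section

namespace BoundaryEstimate

open Finset Filter Topology Asymptotics

/-! ### Lower bound for the normal derivative of the normal eigenvalue -/

section NormalComponent

/-- The linearized equation gives a lower bound for the normal derivative of the normal
eigenvalue. -/
lemma normal_derivative_lower {m : ℕ} {Fd η η' : Fin (m + 1) → ℝ} {E₁ E₂ : Fin m → ℝ}
    {f f' v b c₁ c₂ c₃ c₄ V ρ : ℝ} (hFd : ∀ a, 0 < Fd a) (heul : ∑ a, Fd a * η a = f)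
    (hlin : f' ≤ ∑ a, Fd a * η' a) (h1 : -(c₁ * f) ≤ f') (hf : 0 ≤ f) (hc₁ : 0 ≤ c₁)
    (h2 : f ≤ c₂ * Fd (Fin.last m)) (h3 : |η (Fin.last m)| ≤ c₃) (h4 : |b| ≤ c₄) (hv : 0 ≤ v)
    (hV : v ≤ V) (hρ : 0 ≤ ρ)
    (hA : v = 0 ∨ (η (Fin.last m) ≤ 0 → ∑ α : Fin m, Fd α.castSucc ≤ ρ * Fd (Fin.last m)))
    (hE₁ : ∀ α, 0 ≤ E₁ α) (hE₂ : ∀ α, 0 ≤ E₂ α)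
    (hη' : ∀ α : Fin m, η' α.castSucc
      = b * η α.castSucc - v * η (Fin.last m) - v * E₁ α - E₂ α) :
    -(c₁ * c₂ + c₄ * c₂ + c₄ * c₃ + V * ρ * c₃) ≤ η' (Fin.last m) := by
  set Φ := Fd (Fin.last m) with hΦ
  set w := η (Fin.last m) with hw
  have hΦ0 : 0 < Φ := hFd _
  rw [Fin.sum_univ_castSucc] at heul hlin
  -- The nonnegative terms supplied by (T1) and (T2) are dropped, and Euler's relation evaluates the
  -- tangential part of ΣF_a η_a as f − F_n η_n.
  have hs : ∑ α : Fin m, Fd α.castSucc * η' α.castSucc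
      ≤ b * (f - Φ * w) - v * w * ∑ α : Fin m, Fd α.castSucc := by
    rw [← heul, add_sub_cancel_right, Finset.mul_sum, Finset.mul_sum, ← Finset.sum_sub_distrib]
    refine Finset.sum_le_sum fun α _ => ?_
    have p1 : 0 ≤ Fd α.castSucc * (v * E₁ α + E₂ α) :=
      mul_nonneg (hFd _).le (add_nonneg (mul_nonneg hv (hE₁ α)) (hE₂ α))
    rw [hη']
    linarith
  have hc₃ : 0 ≤ c₃ := (abs_nonneg _).trans h3
  have hc₄ : 0 ≤ c₄ := (abs_nonneg _).trans h4
  have hV0 : 0 ≤ V := hv.trans hV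
  have t1 : b * f ≤ c₄ * (c₂ * Φ) :=
    (mul_le_mul_of_nonneg_right ((le_abs_self b).trans h4) hf).trans
      (mul_le_mul_of_nonneg_left h2 hc₄)
  have t2 : -(b * w) ≤ c₄ * c₃ := (neg_le_abs _).trans (abs_mul_le_mul h4 h3)
  have t2' : -(b * w) * Φ ≤ c₄ * c₃ * Φ := mul_le_mul_of_nonneg_right t2 hΦ0.le
  have t3 : c₁ * f ≤ c₁ * (c₂ * Φ) := mul_le_mul_of_nonneg_left h2 hc₁
  have hsum : 0 ≤ ∑ α : Fin m, Fd α.castSucc := Finset.sum_nonneg fun α _ => (hFd _).le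
  -- This term has a bad sign only if v > 0 and the normal eigenvalue w is negative; condition (A)
  -- then bounds the tangential sum by ρF_n.
  have t4 : -(v * w * ∑ α : Fin m, Fd α.castSucc) ≤ V * ρ * c₃ * Φ := by
    have hpos : 0 ≤ V * ρ * c₃ * Φ := by positivity
    rcases hA with h0 | hA
    · rw [h0]; simpa using hpos
    · rcases le_total w 0 with hw0 | hw0
      · have q1 := hA hw0
        have q2 : -w ≤ c₃ := (neg_le_abs w).trans h3
        have q3 : v * (-w) ≤ V * c₃ := mul_le_mul hV q2 (by linarith) hV0
        have q4 : v * (-w) * ∑ α : Fin m, Fd α.castSucc ≤ V * c₃ * (ρ * Φ) :=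
          mul_le_mul q3 q1 hsum (by positivity)
        linarith
      · have : 0 ≤ v * w * ∑ α : Fin m, Fd α.castSucc := by positivity
        linarith
  -- Every term has been compared with a multiple of Φ = F_n, which can be divided out.
  have key : -(c₁ * c₂ + c₄ * c₂ + c₄ * c₃ + V * ρ * c₃) * Φ ≤ η' (Fin.last m) * Φ := by
    linarith
  exact le_of_mul_le_mul_right key hΦ0

end NormalComponent

/-! ### Bilinear forms evaluated on a tangential frame -/

section TangentForm

variable {m : ℕ} {e : Matrix (Fin m) (Fin m) ℝ}

/-- The value of a bilinear form on the `α`-th vector of a frame. -/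
def frameForm (e : Matrix (Fin m) (Fin m) ℝ) (B : Fin m → Fin m → ℝ) (α : Fin m) : ℝ :=
  ∑ γ, ∑ δ, B γ δ * e γ α * e δ α

lemma abs_frameForm_le {B : Fin m → Fin m → ℝ} {b c : ℝ} (hB : ∀ γ δ, |B γ δ| ≤ b)
    (he : ∀ γ α, |e γ α| ≤ c) (α : Fin m) : |frameForm e B α| ≤ m * (m * (b * c * c)) := by
  have := abs_sum_le_card_mul (x := fun γ => ∑ δ, B γ δ * e γ α * e δ α) fun γ =>
    abs_sum_le_card_mul (x := fun δ => B γ δ * e γ α * e δ α) fun δ =>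
      abs_mul_le_mul (abs_mul_le_mul (hB γ δ) (he γ α)) (he δ α)
  simpa [frameForm] using this

lemma frameForm_add (B C : Fin m → Fin m → ℝ) (α : Fin m) :
    frameForm e (fun γ δ => B γ δ + C γ δ) α = frameForm e B α + frameForm e C α := by
  simp only [frameForm, add_mul, Finset.sum_add_distrib]

lemma frameForm_sub (B C : Fin m → Fin m → ℝ) (α : Fin m) :
    frameForm e (fun γ δ => B γ δ - C γ δ) α = frameForm e B α - frameForm e C α := by
  simp only [frameForm, sub_mul, Finset.sum_sub_distrib]

lemma frameForm_mul (c : ℝ) (B : Fin m → Fin m → ℝ) (α : Fin m) :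
    frameForm e (fun γ δ => c * B γ δ) α = c * frameForm e B α := by
  simp only [frameForm, Finset.mul_sum, mul_assoc]

end TangentForm

/-! ### Normal derivatives of T and |∇u|² in a diagonalizing frame -/

section NormalDerivative

variable {m : ℕ} {r θ G muHat : ℝ}
  {g S : EuclideanSpace ℝ (Fin (m + 1)) → Matrix (Fin (m + 1)) (Fin (m + 1)) ℝ}
  {μ : EuclideanSpace ℝ (Fin m) → ℝ} {u : EuclideanSpace ℝ (Fin (m + 1)) → ℝ}
  {y : EuclideanSpace ℝ (Fin m)} {e : Matrix (Fin m) (Fin m) ℝ}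

lemma gradComp_blockFrame_tangent (x : EuclideanSpace ℝ (Fin (m + 1))) (α : Fin m) :
    gradComp (halfBall m r) u (blockFrame e) x α.castSucc
      = ∑ γ, e γ α * pd (halfBall m r) γ.castSucc u x := by
  simp [gradComp, Fin.sum_univ_castSucc]

lemma gradComp_blockFrame_last (x : EuclideanSpace ℝ (Fin (m + 1))) :
    gradComp (halfBall m r) u (blockFrame e) x (Fin.last m) = pd (halfBall m r) (Fin.last m) u x := by
  simp [gradComp, Fin.sum_univ_castSucc]

/-- The defect in condition (T2). -/
def defectTwo (r : ℝ)
    (g S : EuclideanSpace ℝ (Fin (m + 1)) → Matrix (Fin (m + 1)) (Fin (m + 1)) ℝ)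
    (μ : EuclideanSpace ℝ (Fin m) → ℝ) (y : EuclideanSpace ℝ (Fin m)) (α β : Fin m) : ℝ :=
  covHess (bdryDisc m r) (inducedMetric g) μ y α β
    - riemann (halfBall m r) g α.castSucc (Fin.last m) β.castSucc (Fin.last m) (bdryPt y) * μ y
    - pd (halfBall m r) (Fin.last m) (fun x => S x α.castSucc β.castSucc) (bdryPt y)

/-- The tangential part of `T` on the boundary piece. -/
def tangentT (r : ℝ)
    (g S : EuclideanSpace ℝ (Fin (m + 1)) → Matrix (Fin (m + 1)) (Fin (m + 1)) ℝ)
    (u : EuclideanSpace ℝ (Fin (m + 1)) → ℝ) (y : EuclideanSpace ℝ (Fin m)) :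
    Matrix (Fin m) (Fin m) ℝ :=
  (tensorT (halfBall m r) g S u (bdryPt y)).submatrix Fin.castSucc Fin.castSucc

/-- Contraction of `IsBoundaryData.pd_tensorT` with a frame that diagonalizes the tangential block,
so that T enters only through the eigenvalue d α. The tangential gradient is rebuilt from its frame
components. -/
lemma IsBoundaryData.frame_pd_tensorT (h : IsBoundaryData r θ G muHat g S μ u)
    (hy : y ∈ bdryDisc m r) (he : IsFrame (inducedMetric g y) e) {d : Fin m → ℝ}
    (hd : e.transpose * tangentT r g S u y * e = Matrix.diagonal d) (α : Fin m) :
    ∑ i, ∑ j, pd (halfBall m r) (Fin.last m) (fun x => tensorT (halfBall m r) g S u x i j)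
        (bdryPt y) * blockFrame e i α.castSucc * blockFrame e j α.castSucc
      = -(muHat * Real.exp (-u (bdryPt y)))
          * (d α - frameForm e (fun γ δ => S (bdryPt y) γ.castSucc δ.castSucc) α
            + frameForm e (fun γ δ => riemann (halfBall m r) g γ.castSucc (Fin.last m) δ.castSucc
              (Fin.last m) (bdryPt y)) α)
        - frameForm e (defectTwo r g S μ y) α
        - (∑ β, gradComp (halfBall m r) u (blockFrame e) (bdryPt y) β.castSucc
            * ∑ γ, e γ β * pd (bdryDisc m r) γ μ y
          + μ y * pd (halfBall m r) (Fin.last m) u (bdryPt y) ^ 2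
          + μ y * pd (halfBall m r) (Fin.last m) (pd (halfBall m r) (Fin.last m) u) (bdryPt y)) := by
  have hx := mapsTo_bdryPt m r hy
  set D := halfBall m r with hD
  set x := bdryPt y with hxd
  have hsymm : (inducedMetric g y).IsSymm := h.fermi.induced_controlled.isSymm hy
  set U : Fin m → ℝ := fun ε => ∑ β, e ε β * gradComp D u (blockFrame e) x β.castSucc with hUd
  have hU : ∀ γ : Fin m, ∑ ε : Fin m, g x γ.castSucc ε.castSucc * U ε = pd D γ.castSucc u x := by
    intro γ
    have h1 := he.covector_eq hsymm (fun γ => pd D γ.castSucc u x) γ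
    rw [h1]
    simp only [hUd, gradComp_blockFrame_tangent, hD, Matrix.mul_apply, Finset.mul_sum,
      Finset.sum_mul]
    rw [Finset.sum_comm]
    refine Finset.sum_congr rfl fun β _ => ?_
    rw [Finset.sum_comm]
    refine Finset.sum_congr rfl fun k _ => Finset.sum_congr rfl fun j _ => ?_
    simp only [inducedMetric, Matrix.of_apply]; ring
  have hX : ∑ ε, pd (bdryDisc m r) ε μ y * U ε
      = ∑ β, gradComp D u (blockFrame e) x β.castSucc * ∑ γ, e γ β * pd (bdryDisc m r) γ μ y := by
    simp only [hUd, Finset.mul_sum]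
    rw [Finset.sum_comm]
    exact Finset.sum_congr rfl fun β _ => Finset.sum_congr rfl fun k _ => by ring
  rw [← hX]
  set Z := ∑ ε, pd (bdryDisc m r) ε μ y * U ε + μ y * pd D (Fin.last m) u x ^ 2
    + μ y * pd D (Fin.last m) (pd D (Fin.last m) u) x with hZ
  set v := muHat * Real.exp (-u x) with hv
  have h2 : frameForm e (fun γ δ => tensorT D g S u x γ.castSucc δ.castSucc) α = d α := by
    have := congrFun (congrFun hd α) α
    rw [conj_apply, Matrix.diagonal_apply_eq] at this
    exact this
  have h3 : frameForm e (fun γ δ => g x γ.castSucc δ.castSucc) α = 1 := by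
    have := isFrame_apply he α α
    rw [Matrix.one_apply_eq] at this
    exact this
  rw [sum_blockFrame_tangent (T := fun i j => pd D (Fin.last m)
    (fun x => tensorT D g S u x i j) x)]
  have h4 : ∀ γ δ : Fin m, pd D (Fin.last m) (fun x => tensorT D g S u x γ.castSucc δ.castSucc) x
      = (-v) * ((tensorT D g S u x γ.castSucc δ.castSucc - S x γ.castSucc δ.castSucc)
        + riemann D g γ.castSucc (Fin.last m) δ.castSucc (Fin.last m) x)
        - defectTwo r g S μ y γ δ - Z * g x γ.castSucc δ.castSucc := fun γ δ => by
    rw [h.pd_tensorT hy γ δ hU, defectTwo, hZ]; ring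
  simp only [h4]
  have h5 := frameForm_sub (e := e) (fun γ δ =>
    (-v) * ((tensorT D g S u x γ.castSucc δ.castSucc - S x γ.castSucc δ.castSucc)
        + riemann D g γ.castSucc (Fin.last m) δ.castSucc (Fin.last m) x)
        - defectTwo r g S μ y γ δ) (fun γ δ => Z * g x γ.castSucc δ.castSucc) α
  refine h5.trans ?_
  rw [frameForm_sub, frameForm_mul, frameForm_mul, frameForm_add, frameForm_sub, h2, h3]
  ring

/-- All mixed second derivatives are replaced through the Neumann condition. Half of the result is
subtracted from the derivative of T to obtain that of W; the common term with ∇μ then cancels. -/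
lemma IsBoundaryData.frame_pd_gradient (h : IsBoundaryData r θ G muHat g S μ u)
    (hy : y ∈ bdryDisc m r) :
    ∑ c, 2 * gradComp (halfBall m r) u (blockFrame e) (bdryPt y) c
        * (∑ i, blockFrame e i c * pd (halfBall m r) (Fin.last m) (pd (halfBall m r) i u) (bdryPt y)
          + Fin.snoc (α := fun _ => ℝ) (fun _ : Fin m => μ y) 0 c
            * gradComp (halfBall m r) u (blockFrame e) (bdryPt y) c)
      = 2 * ((μ y - muHat * Real.exp (-u (bdryPt y)))
          * ∑ β : Fin m, gradComp (halfBall m r) u (blockFrame e) (bdryPt y) β.castSucc ^ 2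
        - ∑ β : Fin m, gradComp (halfBall m r) u (blockFrame e) (bdryPt y) β.castSucc
            * ∑ γ, e γ β * pd (bdryDisc m r) γ μ y
        + pd (halfBall m r) (Fin.last m) u (bdryPt y)
          * pd (halfBall m r) (Fin.last m) (pd (halfBall m r) (Fin.last m) u) (bdryPt y)) := by
  have h1 : ∀ β : Fin m, ∑ i, blockFrame e i β.castSucc
      * pd (halfBall m r) (Fin.last m) (pd (halfBall m r) i u) (bdryPt y)
      = -(muHat * Real.exp (-u (bdryPt y)))
        * gradComp (halfBall m r) u (blockFrame e) (bdryPt y) β.castSucc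
        - ∑ γ, e γ β * pd (bdryDisc m r) γ μ y := by
    intro β
    rw [gradComp_blockFrame_tangent, Fin.sum_univ_castSucc, Finset.mul_sum,
      ← Finset.sum_sub_distrib]
    simp only [blockFrame_tangent, blockFrame_last_tangent, zero_mul, add_zero,
      h.pd_normal_tangent hy]
    exact Finset.sum_congr rfl fun γ _ => by ring
  have h2 : ∑ i, blockFrame e i (Fin.last m)
      * pd (halfBall m r) (Fin.last m) (pd (halfBall m r) i u) (bdryPt y)
      = pd (halfBall m r) (Fin.last m) (pd (halfBall m r) (Fin.last m) u) (bdryPt y) := by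
    simp [Fin.sum_univ_castSucc]
  rw [Fin.sum_univ_castSucc, h2, gradComp_blockFrame_last]
  simp only [h1, Fin.snoc_castSucc, Fin.snoc_last, zero_mul, add_zero]
  have h3 : ∑ β : Fin m, 2 * gradComp (halfBall m r) u (blockFrame e) (bdryPt y) β.castSucc
        * (-(muHat * Real.exp (-u (bdryPt y)))
        * gradComp (halfBall m r) u (blockFrame e) (bdryPt y) β.castSucc
        - ∑ γ, e γ β * pd (bdryDisc m r) γ μ y
        + μ y * gradComp (halfBall m r) u (blockFrame e) (bdryPt y) β.castSucc)
      = 2 * ((μ y - muHat * Real.exp (-u (bdryPt y)))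
          * ∑ β : Fin m, gradComp (halfBall m r) u (blockFrame e) (bdryPt y) β.castSucc ^ 2
        - ∑ β : Fin m, gradComp (halfBall m r) u (blockFrame e) (bdryPt y) β.castSucc
            * ∑ γ, e γ β * pd (bdryDisc m r) γ μ y) := by
    rw [Finset.mul_sum, ← Finset.sum_sub_distrib, Finset.mul_sum]
    exact Finset.sum_congr rfl fun β _ => by ring
  rw [h3]
  ring

end NormalDerivative

end BoundaryEstimate

end

noncomputable section

namespace BoundaryEstimate

open Finset Filter Topology Asymptotics

/-! ### Lower bounds for all normal derivatives of the diagonal of T -/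

section BoundaryAlgebra

/-- Lower bounds for the normal derivatives `τ'` of the diagonal entries of `T` at a boundary point,
from the structure of these derivatives and the linearized equation. -/
lemma exists_normal_lower_bound (m : ℕ) {M V ρ Λ ε : ℝ} (hM : 0 ≤ M) (hV : 0 ≤ V) (hρ : 0 ≤ ρ)
    (hΛ : 0 ≤ Λ) (hε : 0 < ε) :
    ∃ C, 0 ≤ C ∧ ∀ (τ τ' Fd : Fin (m + 1) → ℝ) (S R D₂ w N : Fin m → ℝ)
      (μ v un unn Snn p p' f f' k : ℝ),
      0 < k → p ≤ 2 * k → (∀ a, |τ a| ≤ (m + 1) * k) →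
      |μ| ≤ M → 0 ≤ v → v ≤ V → |Snn| ≤ M → (∀ α, |S α| ≤ M) → (∀ α, |R α| ≤ M) →
      (∀ α, |D₂ α| ≤ M) → (∀ α, |N α| ≤ M) → (∀ α, 0 ≤ D₂ α) → (∀ α, 0 ≤ R α - S α - Snn) →
      un = v - μ → unn = τ (Fin.last m) - un ^ 2 - Snn → p = ∑ α, w α ^ 2 + un ^ 2 →
      p' = 2 * ((μ - v) * ∑ α, w α ^ 2 - ∑ α, w α * N α + un * unn) →
      (∀ α : Fin m, τ' α.castSucc = -v * (τ α.castSucc - S α + R α) - D₂ α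
        - (∑ α, w α * N α + μ * un ^ 2 + μ * unn) + 2 * μ * τ α.castSucc) →
      (∀ a, 0 < Fd a) → ∑ a, Fd a * (τ a - 1 / 2 * p) = f → 0 ≤ f →
      ε * f ≤ Fd (Fin.last m) * ∑ a, (τ a - 1 / 2 * p) →
      |f'| ≤ Λ * f + |un| * (Λ * f) → f' ≤ ∑ a, Fd a * (τ' a - 1 / 2 * p') →
      (v = 0 ∨ (τ (Fin.last m) - 1 / 2 * p ≤ 0 →
        ∑ α : Fin m, Fd α.castSucc ≤ ρ * Fd (Fin.last m))) →
      ∀ a, -(C * (1 + k)) ≤ τ' a := by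
  obtain ⟨n, hn⟩ : ∃ n : ℝ, n = (m : ℝ) + 1 := ⟨_, rfl⟩
  have hn0 : 0 ≤ n := by rw [hn]; positivity
  have hm0 : (0 : ℝ) ≤ m := m.cast_nonneg
  -- Roles of the constants: L bounds |u_n|, Ca(1 + k) bounds |u_nn|, B₁(1 + k) the tangential τ',
  -- B₂(1 + k) the derivative ½p'. Moreover −f' ≤ c₁f, f ≤ c₂kF_n, |η| ≤ c₃k, |2μ − v| ≤ c₄, and
  -- B₃(1 + k) controls the normal derivative of η from below.
  obtain ⟨L, hL⟩ : ∃ L : ℝ, L = V + M := ⟨_, rfl⟩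
  obtain ⟨Ca, hCa⟩ : ∃ Ca : ℝ, Ca = n + L ^ 2 + M := ⟨_, rfl⟩
  obtain ⟨B₁, hB₁⟩ : ∃ B₁ : ℝ, B₁ = V * (n + 2 * M) + M + 2 * (m * M) + M * L ^ 2 + M * Ca + 2 * M * n := ⟨_, rfl⟩
  obtain ⟨B₂, hB₂⟩ : ∃ B₂ : ℝ, B₂ = 2 * L + 2 * (m * M) + L * Ca := ⟨_, rfl⟩
  obtain ⟨c₁, hc₁⟩ : ∃ c₁ : ℝ, c₁ = Λ * (1 + L) := ⟨_, rfl⟩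
  obtain ⟨c₂, hc₂⟩ : ∃ c₂ : ℝ, c₂ = n * (n + 1) / ε := ⟨_, rfl⟩
  obtain ⟨c₃, hc₃⟩ : ∃ c₃ : ℝ, c₃ = n + 1 := ⟨_, rfl⟩
  obtain ⟨c₄, hc₄⟩ : ∃ c₄ : ℝ, c₄ = 2 * M + V := ⟨_, rfl⟩
  obtain ⟨B₃, hB₃⟩ : ∃ B₃ : ℝ, B₃ = c₁ * c₂ + c₄ * c₂ + c₄ * c₃ + V * ρ * c₃ := ⟨_, rfl⟩
  have hL0 : 0 ≤ L := by rw [hL]; positivity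
  have hCa0 : 0 ≤ Ca := by rw [hCa]; positivity
  have hc₁0 : 0 ≤ c₁ := by rw [hc₁]; positivity
  have hc₂0 : 0 ≤ c₂ := by rw [hc₂]; positivity
  have hc₃0 : 0 ≤ c₃ := by rw [hc₃]; positivity
  have hc₄0 : 0 ≤ c₄ := by rw [hc₄]; positivity
  have hB₁0 : 0 ≤ B₁ := by rw [hB₁]; positivity
  have hB₂0 : 0 ≤ B₂ := by rw [hB₂]; positivity
  have hB₃0 : 0 ≤ B₃ := by rw [hB₃]; positivity
  refine ⟨B₁ + B₂ + B₃, by positivity, ?_⟩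
  intro τ τ' Fd S R D₂ w N μ v un unn Snn p p' f f' k hk hp hτ hμ hv hvV hSnn hS hR hD hN hD0 hE0
    hun hunn hpd hp' hτ' hFd heul hf hs3 hf' hlin hA
  simp only [← hn] at hτ
  have hk1 : 1 ≤ 1 + k := by linarith
  have hk2 : k ≤ 1 + k := by linarith
  have hvabs : |v| ≤ V := by rwa [abs_of_nonneg hv]
  have hunL : |un| ≤ L := by
    rw [hun, hL]
    exact (abs_sub v μ).trans (add_le_add hvabs hμ)
  have hun2 : un ^ 2 ≤ L ^ 2 := by
    rw [← sq_abs]; exact pow_le_pow_left₀ (abs_nonneg _) hunL 2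
  have hunnC : |unn| ≤ Ca * (1 + k) := by
    have h1 : |unn| ≤ |τ (Fin.last m)| + un ^ 2 + |Snn| := by
      rw [hunn]
      refine (abs_sub _ _).trans (add_le_add_left ((abs_sub _ _).trans ?_) _)
      rw [abs_of_nonneg (sq_nonneg un)]
    have h2 := hτ (Fin.last m)
    have h3 : 0 ≤ (L ^ 2 + M) * k := by positivity
    rw [hCa]
    linarith
  have hP0 : 0 ≤ ∑ α, w α ^ 2 := Finset.sum_nonneg fun _ _ => sq_nonneg _
  have hP : ∑ α, w α ^ 2 ≤ 2 * k := by linarith [sq_nonneg un]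
  have hX : |∑ α, w α * N α| ≤ 2 * (m * M) * (1 + k) := by
    have h1 : ∀ α, |w α * N α| ≤ (2 * (1 + k)) * M := fun α => by
      refine abs_mul_le_mul ?_ (hN α)
      have h2 : w α ^ 2 ≤ ∑ α, w α ^ 2 :=
        Finset.single_le_sum (f := fun α => w α ^ 2) (fun _ _ => sq_nonneg _) (Finset.mem_univ α)
      have h3 := two_mul_le_add_sq |w α| 1
      rw [sq_abs] at h3
      linarith
    have := abs_sum_le_card_mul h1
    rw [Fintype.card_fin] at this
    linarith
  have hp0 : 0 ≤ p := by rw [hpd]; positivity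
  have hhalf : |1 / 2 * p'| ≤ B₂ * (1 + k) := by
    have e : 1 / 2 * p' = (μ - v) * ∑ α, w α ^ 2 - ∑ α, w α * N α + un * unn := by rw [hp']; ring
    have h1 : |(μ - v) * ∑ α, w α ^ 2| ≤ L * (2 * k) :=
      abs_mul_le_mul ((abs_sub μ v).trans (by linarith)) (by rwa [abs_of_nonneg hP0])
    have h2 : |un * unn| ≤ L * (Ca * (1 + k)) := abs_mul_le_mul hunL hunnC
    rw [e]
    refine (abs_add_le _ _).trans ?_
    have h4 := abs_sub ((μ - v) * ∑ α, w α ^ 2) (∑ α, w α * N α)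
    rw [hB₂]
    linarith
  have htan : ∀ α : Fin m, |τ' α.castSucc| ≤ B₁ * (1 + k) := by
    intro α
    have h1 : |v * (τ α.castSucc - S α + R α)| ≤ V * (n * k + M + M) := by
      refine abs_mul_le_mul hvabs ((abs_add_le _ _).trans ?_)
      exact add_le_add ((abs_sub _ _).trans (add_le_add (hτ _) (hS α))) (hR α)
    have h2 : |μ * un ^ 2| ≤ M * L ^ 2 :=
      abs_mul_le_mul hμ (by rwa [abs_of_nonneg (sq_nonneg un)])
    have h3 : |μ * unn| ≤ M * (Ca * (1 + k)) := abs_mul_le_mul hμ hunnC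
    have h4 : |μ * τ α.castSucc| ≤ M * (n * k) := abs_mul_le_mul hμ (hτ _)
    have h5 := hD α
    have q1 : 0 ≤ V * M * k := by positivity
    have q2 : 0 ≤ M * k := by positivity
    have q3 : 0 ≤ M * L ^ 2 * k := by positivity
    have q4 : 0 ≤ V * n := by positivity
    have q5 : 0 ≤ M * n := by positivity
    rw [hτ', hB₁]
    rw [abs_le] at h1 h2 h3 h4 h5 hX ⊢
    constructor
    · linarith [h1.1, h1.2, h2.1, h2.2, h3.1, h3.2, h4.1, h4.2, h5.1, h5.2, hX.1, hX.2]
    · linarith [h1.1, h1.2, h2.1, h2.2, h3.1, h3.2, h4.1, h4.2, h5.1, h5.2, hX.1, hX.2]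
  have hη : ∀ a, |τ a - 1 / 2 * p| ≤ c₃ * k := fun a => by
    refine (abs_sub _ _).trans ?_
    rw [abs_of_nonneg (by positivity : 0 ≤ 1 / 2 * p), hc₃]
    linarith [hτ a]
  -- Structure condition (S3) in the normal direction, combined with the bound of σ₁ by a multiple
  -- of k.
  have hf2 : f ≤ c₂ * k * Fd (Fin.last m) := by
    have h1 : ∑ a, (τ a - 1 / 2 * p) ≤ n * (c₃ * k) := by
      refine (le_abs_self _).trans ((abs_sum_le_card_mul hη).trans (le_of_eq ?_))
      rw [Fintype.card_fin, hn]; push_cast; ring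
    have h2 : ε * f ≤ Fd (Fin.last m) * (n * (c₃ * k)) :=
      hs3.trans (mul_le_mul_of_nonneg_left h1 (hFd _).le)
    have h3 : f ≤ Fd (Fin.last m) * (n * (c₃ * k)) / ε := by
      rw [le_div_iff₀ hε]; linarith
    refine h3.trans (le_of_eq ?_)
    rw [hc₂, hc₃]; ring
  have hnorm : -(B₃ * (1 + k)) ≤ τ' (Fin.last m) - 1 / 2 * p' := by
    have hb : |2 * μ - v| ≤ c₄ := by
      refine (abs_sub _ _).trans ?_
      rw [abs_mul, abs_two]; linarith
    have hff : -(c₁ * f) ≤ f' := by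
      have h1 : |un| * (Λ * f) ≤ L * (Λ * f) := mul_le_mul_of_nonneg_right hunL (by positivity)
      have h2 := neg_abs_le f'
      rw [hc₁]
      linarith
    have h1 := normal_derivative_lower (η := fun a => τ a - 1 / 2 * p)
      (η' := fun a => τ' a - 1 / 2 * p') (E₁ := fun α => R α - S α - Snn) (E₂ := D₂) hFd heul hlin
      hff hf hc₁0 hf2 (hη _) hb hv hvV hρ hA hE0 hD0 fun α => by
        -- Since μ + u_n = v, the u_nn terms of τ' and ½p' combine to −vu_nn, and the gradient
        -- squares to −(μ − v)p. This is exactly what turns τ into η = τ − ½p, so no quadratic term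
        -- in the gradient is left over.
        simp only [hτ', hp', hpd, hunn, hun]; ring
    have q1 : 0 ≤ c₁ * c₂ := by positivity
    have q2 : 0 ≤ c₄ * c₂ := by positivity
    have q3 : 0 ≤ c₄ * c₃ := by positivity
    have q4 : 0 ≤ V * ρ * c₃ := by positivity
    rw [hB₃]
    refine le_trans ?_ h1
    linarith
  intro a
  have q1 : 0 ≤ B₁ * (1 + k) := by positivity
  have q2 : 0 ≤ B₂ * (1 + k) := by positivity
  have q3 : 0 ≤ B₃ * (1 + k) := by positivity
  refine Fin.lastCases ?_ (fun α => ?_) a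
  · linarith [(abs_le.1 hhalf).1]
  · linarith [(abs_le.1 (htan α)).1]

end BoundaryAlgebra

/-! ### Bounds for the boundary quantities and the signs from (T1) and (T2) -/

section BoundaryBounds

variable {m : ℕ} {r θ G muHat : ℝ}
  {g S : EuclideanSpace ℝ (Fin (m + 1)) → Matrix (Fin (m + 1)) (Fin (m + 1)) ℝ}
  {μ : EuclideanSpace ℝ (Fin m) → ℝ} {u : EuclideanSpace ℝ (Fin (m + 1)) → ℝ}
  {y : EuclideanSpace ℝ (Fin m)} {e : Matrix (Fin m) (Fin m) ℝ}

/-- From −2μg_{αα} = ∂_n g_{αα} and g_{αα} ≥ θ, in any one tangential direction. -/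
lemma IsUmbilicFermi.abs_curvature_le (h : IsUmbilicFermi r θ G g μ) (hm : 0 < m) (hθ : 0 < θ)
    (hy : y ∈ bdryDisc m r) : |μ y| ≤ G / (2 * θ) := by
  have hx := mapsTo_bdryPt m r hy
  set α : Fin m := ⟨0, hm⟩
  have h1 := h.pd_last_eq hy α α
  have h2 : |pd (halfBall m r) (Fin.last m) (fun x => g x α.castSucc α.castSucc) (bdryPt y)| ≤ G :=
    ((h.controlled.bound α.castSucc α.castSucc).2 (Fin.last m)).abs_le _ hx
  have h3 : θ ≤ g (bdryPt y) α.castSucc α.castSucc := by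
    have := h.controlled.lower _ hx (Pi.single α.castSucc 1)
    simpa [Pi.single_apply, ite_pow] using this
  rw [h1, abs_mul, abs_mul] at h2
  rw [le_div_iff₀ (by positivity)]
  have h4 : |(-2 : ℝ)| = 2 := by norm_num
  have h5 : 2 * |μ y| * θ ≤ 2 * |μ y| * |g (bdryPt y) α.castSucc α.castSucc| :=
    mul_le_mul_of_nonneg_left (h3.trans (le_abs_self _)) (by positivity)
  rw [h4] at h2
  linarith

/-- Each of the two connection terms contributes μS_{αβ}, so the combination in (T2) is the plain
coordinate derivative. -/
lemma IsBoundaryData.covDeriv_normal (h : IsBoundaryData r θ G muHat g S μ u)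
    (hy : y ∈ bdryDisc m r) (α β : Fin m) :
    covDeriv (halfBall m r) g S α.castSucc β.castSucc (Fin.last m) (bdryPt y)
        - 2 * μ y * S (bdryPt y) α.castSucc β.castSucc
      = pd (halfBall m r) (Fin.last m) (fun x => S x α.castSucc β.castSucc) (bdryPt y) := by
  have hx := mapsTo_bdryPt m r hy
  have h1 : ∀ (k : Fin (m + 1)) (γ : Fin m),
      christoffel (halfBall m r) g k (Fin.last m) γ.castSucc (bdryPt y)
        = christoffel (halfBall m r) g k γ.castSucc (Fin.last m) (bdryPt y) := fun k γ =>
    h.fermi.controlled.christoffel_symm hx _ _ _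
  simp only [covDeriv, h1]
  rw [Fin.sum_univ_castSucc, Fin.sum_univ_castSucc, h.fermi.christoffel_last_mixed hx,
    h.fermi.christoffel_last_mixed hx]
  simp only [h.fermi.christoffel_mixed_boundary hy, Matrix.one_apply, mul_ite, mul_one, mul_zero,
    ite_mul, zero_mul, Finset.sum_ite_eq', Finset.mem_univ, if_true]
  ring

lemma IsBoundaryData.defect_nonneg (h : IsBoundaryData r θ G muHat g S μ u)
    (hT : SatisfiesT r g S μ) (hy : y ∈ bdryDisc m r) (α : Fin m) :
    0 ≤ frameForm e (defectTwo r g S μ y) α := by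
  have h1 := hT.t2 y hy fun γ => e γ α
  simp only [h.covDeriv_normal hy] at h1
  have h2 : frameForm e (defectTwo r g S μ y) α
      = ∑ γ, ∑ δ, (covHess (bdryDisc m r) (inducedMetric g) μ y γ δ
          - riemann (halfBall m r) g γ.castSucc (Fin.last m) δ.castSucc (Fin.last m) (bdryPt y)
            * μ y) * e γ α * e δ α
        - ∑ γ, ∑ δ, pd (halfBall m r) (Fin.last m) (fun x => S x γ.castSucc δ.castSucc) (bdryPt y)
          * e γ α * e δ α := by
    exact frameForm_sub (e := e) (fun γ δ => covHess (bdryDisc m r) (inducedMetric g) μ y γ δ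
          - riemann (halfBall m r) g γ.castSucc (Fin.last m) δ.castSucc (Fin.last m) (bdryPt y)
            * μ y) (fun γ δ => pd (halfBall m r) (Fin.last m)
              (fun x => S x γ.castSucc δ.castSucc) (bdryPt y)) α
  rw [h2]
  linarith

lemma SatisfiesT.first_nonneg (hT : SatisfiesT r g S μ) (hy : y ∈ bdryDisc m r)
    (he : IsFrame (inducedMetric g y) e) (α : Fin m) :
    0 ≤ frameForm e (fun γ δ => riemann (halfBall m r) g γ.castSucc (Fin.last m) δ.castSucc
        (Fin.last m) (bdryPt y)) α
      - frameForm e (fun γ δ => S (bdryPt y) γ.castSucc δ.castSucc) α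
      - S (bdryPt y) (Fin.last m) (Fin.last m) := by
  have h1 := hT.t1 y hy fun γ => e γ α
  have h2 : frameForm e (fun γ δ => S (bdryPt y) γ.castSucc δ.castSucc
      + S (bdryPt y) (Fin.last m) (Fin.last m) * inducedMetric g y γ δ) α
      = frameForm e (fun γ δ => S (bdryPt y) γ.castSucc δ.castSucc) α
        + S (bdryPt y) (Fin.last m) (Fin.last m) := by
    have h3 : frameForm e (fun γ δ => inducedMetric g y γ δ) α = 1 := by
      have := isFrame_apply he α α
      rw [Matrix.one_apply_eq] at this
      exact this
    refine (frameForm_add (e := e) _ _ α).trans ?_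
    have h5 := frameForm_mul (e := e) (S (bdryPt y) (Fin.last m) (Fin.last m))
      (fun γ δ => inducedMetric g y γ δ) α
    rw [h3, mul_one] at h5
    rw [h5]
  have h4 : frameForm e (fun γ δ => S (bdryPt y) γ.castSucc δ.castSucc
      + S (bdryPt y) (Fin.last m) (Fin.last m) * inducedMetric g y γ δ) α
      ≤ frameForm e (fun γ δ => riemann (halfBall m r) g γ.castSucc (Fin.last m) δ.castSucc
        (Fin.last m) (bdryPt y)) α := h1
  linarith

/-- By (T0) the derivatives of μ are components of S, so two derivatives of μ cost one of S. The
curvature components are bounded through the normal derivative of Γⁿ_{αβ}, and μ itself through ∂_n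
g. -/
lemma exists_boundary_bounds (hm : 0 < m) (hθ : 0 < θ) (G σ : ℝ) :
    ∃ M, 0 ≤ M ∧ ∀ (r muHat : ℝ)
      (g S : EuclideanSpace ℝ (Fin (m + 1)) → Matrix (Fin (m + 1)) (Fin (m + 1)) ℝ)
      (μ : EuclideanSpace ℝ (Fin m) → ℝ) (u : EuclideanSpace ℝ (Fin (m + 1)) → ℝ)
      (y : EuclideanSpace ℝ (Fin m)) (e : Matrix (Fin m) (Fin m) ℝ),
      IsBoundaryData r θ G muHat g S μ u →
      (∀ i j, PdBound (halfBall m r) 2 σ (fun x => S x i j)) → y ∈ bdryDisc m r →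
      IsFrame (inducedMetric g y) e →
      |μ y| ≤ M ∧ |S (bdryPt y) (Fin.last m) (Fin.last m)| ≤ M ∧
      (∀ α, |frameForm e (fun γ δ => S (bdryPt y) γ.castSucc δ.castSucc) α| ≤ M) ∧
      (∀ α, |frameForm e (fun γ δ => riemann (halfBall m r) g γ.castSucc (Fin.last m) δ.castSucc
        (Fin.last m) (bdryPt y)) α| ≤ M) ∧
      (∀ α, |frameForm e (defectTwo r g S μ y) α| ≤ M) ∧
      (∀ β, |∑ γ, e γ β * pd (bdryDisc m r) γ μ y| ≤ M) := by
  obtain ⟨Mc, hMc, hc⟩ := exists_christoffel_pdBound (Fin (m + 1)) hθ (G := G)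
  set c : ℝ := (√θ)⁻¹ with hcd
  set κ : ℝ := G / (2 * θ) with hκ
  set R₀ : ℝ := Mc + κ * κ * G with hR₀
  set D₀ : ℝ := σ + m * (Mc * σ) + R₀ * κ + σ with hD₀
  refine ⟨|κ| + |σ| + |m * (m * (σ * c * c))| + |m * (m * (R₀ * c * c))| + |m * (m * (D₀ * c * c))|
    + |m * (c * σ)|, by positivity, ?_⟩
  intro r muHat g S μ u y e h hS hy he
  have hx := mapsTo_bdryPt m r hy
  have hr := h.fermi.pos
  have hec : ∀ γ α, |e γ α| ≤ c := fun γ α =>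
    he.abs_le hθ (h.fermi.induced_controlled.lower y hy) γ α
  have hμ : |μ y| ≤ κ := h.fermi.abs_curvature_le hm hθ hy
  have hS0 : ∀ i j, |S (bdryPt y) i j| ≤ σ := fun i j => (hS i j).abs_le _ hx
  have hS1 : ∀ k i j, |pd (halfBall m r) k (fun x => S x i j) (bdryPt y)| ≤ σ := fun k i j =>
    ((hS i j).2 k).abs_le _ hx
  have hμ1 : ∀ γ, |pd (bdryDisc m r) γ μ y| ≤ σ := fun γ => by
    rw [← h.t0 y hy]; exact hS0 _ _
  have hμ2 : ∀ α β, |pd (bdryDisc m r) α (pd (bdryDisc m r) β μ) y| ≤ σ := fun α β => by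
    rw [← pd_congr (fun z hz => h.t0 z hz β) hy, pd_bdryPt hr hy
      ((h.tensor β.castSucc (Fin.last m)).differentiableOn (by norm_num) _ hx)]
    exact hS1 _ _ _
  have hΓ : ∀ k i j, |christoffel (halfBall m r) g k i j (bdryPt y)| ≤ Mc := fun k i j =>
    (hc _ _ h.fermi.controlled k i j).abs_le _ hx
  have hΓ1 : ∀ l k i j, |pd (halfBall m r) l (christoffel (halfBall m r) g k i j) (bdryPt y)| ≤ Mc :=
    fun l k i j => ((hc _ _ h.fermi.controlled k i j).2 l).abs_le _ hx
  have hR : ∀ γ δ : Fin m, |riemann (halfBall m r) g γ.castSucc (Fin.last m) δ.castSucc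
        (Fin.last m) (bdryPt y)| ≤ R₀ := fun γ δ => by
    have h1 := h.fermi.pd_christoffel_last hy γ δ
    have h2 : riemann (halfBall m r) g γ.castSucc (Fin.last m) δ.castSucc (Fin.last m) (bdryPt y)
        = pd (halfBall m r) (Fin.last m)
          (christoffel (halfBall m r) g (Fin.last m) γ.castSucc δ.castSucc) (bdryPt y)
          + μ y * μ y * g (bdryPt y) γ.castSucc δ.castSucc := by rw [h1]; ring
    rw [h2]
    exact (abs_add_le _ _).trans (add_le_add (hΓ1 _ _ _ _)
      (abs_mul_le_mul (abs_mul_le_mul hμ hμ) ((h.fermi.controlled.bound _ _).abs_le _ hx)))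
  have hD : ∀ γ δ : Fin m, |defectTwo r g S μ y γ δ| ≤ D₀ := fun γ δ => by
    have h1 : |covHess (bdryDisc m r) (inducedMetric g) μ y γ δ| ≤ σ + m * (Mc * σ) := by
      simp only [covHess, Matrix.of_apply]
      refine (abs_sub _ _).trans (add_le_add (hμ2 _ _) ?_)
      have := abs_sum_le_card_mul (x := fun k =>
        christoffel (bdryDisc m r) (inducedMetric g) k γ δ y * pd (bdryDisc m r) k μ y) fun k =>
          abs_mul_le_mul (by rw [h.fermi.christoffel_tangent hy]; exact hΓ _ _ _) (hμ1 k)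
      simpa using this
    rw [defectTwo]
    exact (abs_sub _ _).trans (add_le_add ((abs_sub _ _).trans (add_le_add h1
      (abs_mul_le_mul (hR γ δ) hμ))) (hS1 _ _ _))
  have a1 := abs_nonneg κ
  have a2 := abs_nonneg σ
  have a3 := abs_nonneg (m * (m * (σ * c * c)))
  have a4 := abs_nonneg (m * (m * (R₀ * c * c)))
  have a5 := abs_nonneg (m * (m * (D₀ * c * c)))
  have a6 := abs_nonneg (m * (c * σ))
  refine ⟨?_, ?_, fun α => ?_, fun α => ?_, fun α => ?_, fun β => ?_⟩
  · linarith [le_abs_self κ]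
  · linarith [le_abs_self σ, hS0 (Fin.last m) (Fin.last m)]
  · linarith [le_abs_self (m * (m * (σ * c * c))), abs_frameForm_le
      (B := fun γ δ => S (bdryPt y) γ.castSucc δ.castSucc) (fun γ δ => hS0 _ _) hec α]
  · linarith [le_abs_self (m * (m * (R₀ * c * c))), abs_frameForm_le
      (B := fun γ δ => riemann (halfBall m r) g γ.castSucc (Fin.last m) δ.castSucc
        (Fin.last m) (bdryPt y)) hR hec α]
  · linarith [le_abs_self (m * (m * (D₀ * c * c))), abs_frameForm_le hD hec α]
  · have := abs_sum_le_card_mul (x := fun γ => e γ β * pd (bdryDisc m r) γ μ y) fun γ =>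
      abs_mul_le_mul (hec γ β) (hμ1 γ)
    rw [Fintype.card_fin] at this
    linarith [le_abs_self (m * (c * σ))]

end BoundaryBounds

end BoundaryEstimate

end

noncomputable section

namespace BoundaryEstimate

open Finset Filter Topology Asymptotics

/-! ### The estimate at a boundary maximum -/

section BoundaryMaximum

variable {m : ℕ} {θ : ℝ}

/-- The estimate at a maximum point on the boundary piece: a weight with large logarithmic normal
derivative excludes large values. -/
lemma exists_boundary_estimate (hm : 0 < m) (hθ : 0 < θ) (G σ : ℝ) {V ρ Λ ε : ℝ} (hV : 0 ≤ V)
    (hρ : 0 ≤ ρ) (hΛ : 0 ≤ Λ) (hε : 0 < ε) :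
    ∃ C, 0 ≤ C ∧ ∀ (r muHat A : ℝ)
      (g S : EuclideanSpace ℝ (Fin (m + 1)) → Matrix (Fin (m + 1)) (Fin (m + 1)) ℝ)
      (μ : EuclideanSpace ℝ (Fin m) → ℝ) (u q : EuclideanSpace ℝ (Fin (m + 1)) → ℝ)
      (Γ : Set (Fin (m + 1) → ℝ)) (F : (Fin (m + 1) → ℝ) → ℝ)
      (f : EuclideanSpace ℝ (Fin (m + 1)) → ℝ → ℝ)
      (y : EuclideanSpace ℝ (Fin m)) (e : Matrix (Fin m) (Fin m) ℝ) (τ : Fin (m + 1) → ℝ)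
      (o : Fin (m + 1)),
      IsBoundaryData r θ G muHat g S μ u →
      (∀ i j, PdBound (halfBall m r) 2 σ (fun x => S x i j)) → SatisfiesT r g S μ →
      IsAdmissibleCone Γ → IsStructured Γ F ε → IsRightHandSide r Λ g f →
      SolvesOn (halfBall m r) g S u Γ F (fun x => f x (u x)) →
      0 ≤ muHat → muHat * Real.exp (-u (bdryPt y)) ≤ V → (muHat = 0 ∨ ConditionA Γ F ρ) →
      ∑ α, y α ^ 2 < r ^ 2 → IsFrame (inducedMetric g y) e →
      (blockFrame e).transpose * tensorT (halfBall m r) g S u (bdryPt y) * blockFrame e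
        = Matrix.diagonal τ → (∀ a, τ a ≤ τ o) →
      DifferentiableWithinAt ℝ q (halfBall m r) (bdryPt y) → 0 < q (bdryPt y) →
      pd (halfBall m r) (Fin.last m) q (bdryPt y) = A * q (bdryPt y) →
      (∀ x ∈ halfBall m r, ∀ E : Matrix (Fin (m + 1)) (Fin (m + 1)) ℝ, IsFrame (g x) E →
        q x * ((E.transpose * tensorT (halfBall m r) g S u x * E) o o
          + ∑ a, (E.transpose * tensorT (halfBall m r) g S u x * E) a a)
        ≤ q (bdryPt y) * (τ o + ∑ a, τ a)) →
      A * (τ o + ∑ a, τ a) ≤ C * (1 + (τ o + ∑ a, τ a)) := by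
  obtain ⟨M, hM, hbd⟩ := exists_boundary_bounds hm hθ G σ
  obtain ⟨C, hC, hlow⟩ := exists_normal_lower_bound m hM hV hρ hΛ hε
  -- The m + 1 diagonal entries, with the top one counted twice.
  refine ⟨(m + 2) * C, by positivity, ?_⟩
  intro r muHat A g S μ u q Γ F f y e τ o h hSb hT hΓ hF hf hsol hmu hVy hA hys he hτ ho hq hq0 hqn
    hmax
  have hy : y ∈ bdryDisc m r := mem_bdryDisc.2 hys.le
  have hx := mapsTo_bdryPt m r hy
  have hr := h.fermi.pos
  have hEf := h.fermi.isFrame_blockFrame hy he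
  obtain ⟨δ, hδ, hmaps⟩ := exists_mapsTo_normalCurve hys
  obtain ⟨E', hE0, hEfr, hθd, hpd⟩ := h.exists_normal_expansion hy he hmaps
  obtain ⟨b1, b2, b3, b4, b5, b6⟩ := hbd r muHat g S μ u y e h hSb hy he
  set D := halfBall m r with hD
  set x := bdryPt y with hxd
  set w : Fin (m + 1) → ℝ := gradComp D u (blockFrame e) x with hw
  set p : ℝ := ∑ c, w c ^ 2 with hp
  set k : ℝ := τ o + ∑ a, τ a with hk
  set p' : ℝ := ∑ c, 2 * gradComp D u (blockFrame e) x c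
          * (∑ i, blockFrame e i c * pd D (Fin.last m) (pd D i u) x
            + Fin.snoc (α := fun _ => ℝ) (fun _ : Fin m => μ y) 0 c
              * gradComp D u (blockFrame e) x c) with hp'
  set τ' : Fin (m + 1) → ℝ := fun a => ∑ i, ∑ j, pd D (Fin.last m)
      (fun x => tensorT D g S u x i j) x * blockFrame e i a * blockFrame e j a
          + 2 * Fin.snoc (α := fun _ => ℝ) (fun _ : Fin m => μ y) 0 a
            * ((blockFrame e).transpose * tensorT D g S u x * blockFrame e) a a with hτ'
  have hdiag : ∀ a, ((blockFrame e).transpose * tensorT D g S u x * blockFrame e) a a = τ a :=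
    fun a => by rw [hτ, Matrix.diagonal_apply_eq]
  obtain ⟨hmem, hFv⟩ := hsol.eigenvalues hΓ hF hx hEf hτ
  have hp0 : 0 ≤ p := Finset.sum_nonneg fun _ _ => sq_nonneg _
  obtain ⟨k1, k2, k3, -, -⟩ := eigenvalue_bounds hΓ hp0 hmem ho hk
  have hdtan : e.transpose * tangentT r g S u y * e
      = Matrix.diagonal fun α : Fin m => τ α.castSucc := by
    ext α β
    have h1 := congrFun (congrFun hτ α.castSucc) β.castSucc
    rw [conj_apply] at h1
    have h2 := (sum_blockFrame_tangent (e := e) (fun i j => tensorT D g S u x i j) α β).symm.trans h1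
    rw [conj_apply]
    refine Eq.trans h2 ?_
    simp only [Matrix.diagonal_apply, Fin.castSucc_inj]
  have hτn : τ (Fin.last m) = tensorT D g S u x (Fin.last m) (Fin.last m) := by
    rw [← hdiag, conj_apply]
    exact sum_blockFrame_last (e := e) fun i j => tensorT D g S u x i j
  have hunn : pd D (Fin.last m) (pd D (Fin.last m) u) x
      = τ (Fin.last m) - pd D (Fin.last m) u x ^ 2 - S x (Fin.last m) (Fin.last m) := by
    rw [hτn, ← h.covHess_normal_normal hy]
    simp only [tensorT, Matrix.of_apply]; ring
  set z := u x with hz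
  have hfpos : 0 < f x z := hf.pos x hx z
  have hf' := hasDerivWithinAt_rhs hr hy hmaps hf.contDiffOn
    (h.contDiffOn.differentiableOn (by norm_num) _ hx)
  set f' : ℝ := pd D (Fin.last m) (fun x => f x z) x + pd D (Fin.last m) u x * deriv (f x) z
    with hf'd
  have hfle : |f'| ≤ Λ * f x z + |pd D (Fin.last m) u x| * (Λ * f x z) := by
    refine (abs_add_le _ _).trans (add_le_add ?_ ?_)
    · have h1 := hEf.abs_le_covectorNorm (fun i => pd D i (fun y => f y z) x) (Fin.last m)
      have h2 : ∑ i, pd D i (fun y => f y z) x * blockFrame e i (Fin.last m)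
          = pd D (Fin.last m) (fun x => f x z) x := by
        simp [Fin.sum_univ_castSucc]
      rw [h2] at h1
      exact h1.trans (hf.grad_le x hx z)
    · rw [abs_mul]
      exact mul_le_mul_of_nonneg_left (hf.deriv_le x hx z) (abs_nonneg _)
  -- The linearized equation at a boundary point is only an inequality: the nonnegative difference
  -- vanishes at t = 0 and is defined for t ≥ 0.
  have hlin : f' ≤ ∑ a, dF F a (fun a => τ a - 1 / 2 * p) * (τ' a - 1 / 2 * p') := by
    have h1 := (HasDerivWithinAt.fun_sum fun a (_ : a ∈ Finset.univ) =>
      ((hθd a).fun_sub (hpd.const_mul (1 / 2))).const_mul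
        (dF F a (fun a => τ a - 1 / 2 * p))).fun_sub hf'
    have h2 := nonneg_of_hasDerivWithinAt hδ h1 (by
      simp only [hE0, normalCurve_zero]
      rw [← hxd]
      have h3 := hF.euler hΓ hmem
      simp only [hdiag]
      refine sub_eq_zero.2 (Eq.trans h3 ?_)
      exact hFv) (by
      filter_upwards [hEfr, self_mem_nhdsWithin] with t ht1 ht2
      have h3 := hsol.le_sum hΓ hF h.fermi.controlled (h.contDiffOn.of_le (by norm_num))
        (h.tensor_symm _ (hmaps ht2)) (hmaps ht2) ht1 hmem
      exact sub_nonneg.2 h3)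
    exact sub_nonneg.1 h2
  have hs3 : ε * f x z ≤ dF F (Fin.last m) (fun a => τ a - 1 / 2 * p) * ∑ a, (τ a - 1 / 2 * p) := by
    have h1 := hF.s3 _ hmem (Fin.last m)
    have h2 := sum_pos_of_mem_cone hΓ hmem
    rw [sigma_one_eq, hFv, ← mul_div_assoc, div_le_iff₀ h2] at h1
    exact h1
  have heul := hF.euler hΓ hmem
  rw [hFv] at heul
  have hlower := hlow τ τ' (fun a => dF F a (fun a => τ a - 1 / 2 * p)) _ _ _
    (fun α => w α.castSucc) _ (μ y) (muHat * Real.exp (-z)) (pd D (Fin.last m) u x)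
    (pd D (Fin.last m) (pd D (Fin.last m) u) x) (S x (Fin.last m) (Fin.last m)) p p' (f x z) f' k
    k1 k2 (by exact_mod_cast k3) b1 (mul_nonneg hmu (Real.exp_pos _).le) hVy b2 b3 b4 b5 b6
    (fun α => h.defect_nonneg hT hy α) (fun α => hT.first_nonneg hy he α) (h.normal_eq hy) hunn
    (by rw [hp, Fin.sum_univ_castSucc, hw, gradComp_blockFrame_last])
    (h.frame_pd_gradient hy)
    (fun α => by
      simp only [hτ', hdiag, Fin.snoc_castSucc]
      rw [h.frame_pd_tensorT hy he hdtan α])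
    (fun a => hF.s2 _ hmem a) heul hfpos.le hs3 hfle hlin
    (by
      rcases hA with h0 | hA
      · left; rw [h0, zero_mul]
      · right
        intro h1
        have h2 := hA _ hmem (Fin.last m) h1
        have h3 := Finset.add_sum_erase Finset.univ
          (fun a => dF F a (fun a => τ a - 1 / 2 * p)) (Finset.mem_univ (Fin.last m))
        rw [Fin.sum_univ_castSucc] at h3
        have h4 : ∑ α : Fin m, dF F α.castSucc (fun a => τ a - 1 / 2 * p)
          = ∑ j ∈ Finset.univ.erase (Fin.last m), dF F j (fun a => τ a - 1 / 2 * p) := by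
          linarith
        rw [h4]; exact h2)
  -- At a boundary maximum the derivative of the test quantity in the inner direction is
  -- nonpositive.
  have hmaxd : 0 ≤ -(A * q x * k + q x * (τ' o + ∑ a, τ' a)) := by
    have h1 := ((hasDerivWithinAt_normalCurve hmaps hq).fun_mul ((hθd o).fun_add
      (HasDerivWithinAt.fun_sum fun a (_ : a ∈ Finset.univ) => hθd a))).const_sub (q x * k)
    have h2 := nonneg_of_hasDerivWithinAt hδ h1 (by
      simp only [hE0, normalCurve_zero]
      rw [← hxd]
      simp only [hdiag]
      rw [← hk, sub_self]) (by
      filter_upwards [hEfr, self_mem_nhdsWithin] with t ht1 ht2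
      exact sub_nonneg.2 (hmax _ (hmaps ht2) _ ht1))
    refine h2.trans (le_of_eq ?_)
    rw [hE0, normalCurve_zero, hqn]
    simp only [hτ', ← hxd, hdiag]
    rw [hk]
  have h1 : A * k ≤ -(τ' o + ∑ a, τ' a) := by
    have h2 : q x * (A * k) ≤ q x * -(τ' o + ∑ a, τ' a) := by linarith
    exact le_of_mul_le_mul_left h2 hq0
  have h2 : -((m + 1) * (C * (1 + k))) ≤ ∑ a, τ' a := by
    have := Finset.sum_le_sum fun a (_ : a ∈ Finset.univ) => hlower a
    simp only [Finset.sum_const, Finset.card_univ, Fintype.card_fin, nsmul_eq_mul] at this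
    push_cast at this
    linarith
  have h3 := hlower o
  linarith

end BoundaryMaximum

end BoundaryEstimate

end

noncomputable section

namespace BoundaryEstimate

open Finset Filter Topology Asymptotics

/-! ### The weight function -/

section Weight

/-- For a square, ∇(h²) = 2h∇h, so the gradient is bounded by a multiple of the square root of the
weight, with a constant from compactness. -/
lemma exists_sq_bounds {ι : Type*} [Fintype ι] [DecidableEq ι] {s : Set (EuclideanSpace ℝ ι)}
    (hs : GoodDomain s) (hc : IsCompact s) {h : EuclideanSpace ℝ ι → ℝ} (hh : ContDiffOn ℝ 2 h s) :
    ∃ Q, 0 ≤ Q ∧ ∀ x ∈ s, h x * h x ≤ Q ∧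
      (∀ k, |pd s k (fun x => h x * h x) x| ≤ Q * √(h x * h x)) ∧
      ∀ k l, |pd s l (pd s k fun x => h x * h x) x| ≤ Q := by
  have hq : ContDiffOn ℝ 2 (fun x => h x * h x) s := hh.mul hh
  have c1 : ∀ k, ContinuousOn (pd s k h) s := fun k =>
    (contDiffOn_pd hs (k := 2) (l := 1) (by exact_mod_cast hh) le_rfl k).continuousOn
  have c2 : ∀ k l, ContinuousOn (pd s l (pd s k fun x => h x * h x)) s := fun k l =>
    (contDiffOn_pd hs (k := 1) (l := 0) (contDiffOn_pd hs (k := 2) (l := 1)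
      (by exact_mod_cast hq) le_rfl k) le_rfl l).continuousOn
  obtain ⟨Q₀, h0⟩ := hc.exists_bound_of_continuousOn hq.continuousOn
  choose Q₁ h1 using fun k => hc.exists_bound_of_continuousOn (c1 k)
  choose Q₂ h2 using fun k l => hc.exists_bound_of_continuousOn (c2 k l)
  have n1 : 0 ≤ ∑ k, 2 * |Q₁ k| := Finset.sum_nonneg fun k _ => by positivity
  have n2 : 0 ≤ ∑ k, ∑ l, |Q₂ k l| :=
    Finset.sum_nonneg fun k _ => Finset.sum_nonneg fun l _ => abs_nonneg _
  have n0 := abs_nonneg Q₀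
  refine ⟨|Q₀| + ∑ k, 2 * |Q₁ k| + ∑ k, ∑ l, |Q₂ k l|, by positivity,
    fun x hx => ⟨?_, fun k => ?_, fun k l => ?_⟩⟩
  · have := (le_abs_self _).trans ((h0 x hx).trans (le_abs_self Q₀))
    linarith
  · have hd := hh.differentiableOn (by norm_num) x hx
    rw [pd_mul hs hx hd hd, Real.sqrt_mul_self_eq_abs]
    have e : pd s k h x * h x + h x * pd s k h x = 2 * pd s k h x * h x := by ring
    rw [e, abs_mul, abs_mul, abs_two]
    refine mul_le_mul_of_nonneg_right ?_ (abs_nonneg _)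
    have t1 : |pd s k h x| ≤ |Q₁ k| := (h1 k x hx).trans (le_abs_self _)
    have t2 := Finset.single_le_sum (f := fun k => 2 * |Q₁ k|) (fun k _ => by positivity)
      (Finset.mem_univ k)
    linarith
  · have t1 : |pd s l (pd s k fun x => h x * h x) x| ≤ |Q₂ k l| :=
      (h2 k l x hx).trans (le_abs_self _)
    have t2 := Finset.single_le_sum (f := fun l => |Q₂ k l|) (fun l _ => abs_nonneg _)
      (Finset.mem_univ l)
    have t3 := Finset.single_le_sum (f := fun k => ∑ l, |Q₂ k l|)
      (fun k _ => Finset.sum_nonneg fun l _ => abs_nonneg _) (Finset.mem_univ k)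
    linarith

variable {m : ℕ}

lemma isCompact_halfBall (m : ℕ) {r : ℝ} (hr : 0 ≤ r) : IsCompact (halfBall m r) := by
  have h1 : halfBall m r = {x : EuclideanSpace ℝ (Fin (m + 1)) | 0 ≤ x (Fin.last m)}
      ∩ Metric.closedBall 0 r := by
    ext x
    rw [Set.mem_inter_iff, mem_closedBall_zero_iff, ← sq_le_sq₀ (norm_nonneg x) hr,
      EuclideanSpace.real_norm_sq_eq]
    rfl
  rw [h1]
  exact (isCompact_closedBall 0 r).inter_left (isClosed_le continuous_const (by fun_prop))

/-- The square root of the weight: a cutoff function times an exponential in the normal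
direction. -/
def cutoff (r B : ℝ) (x : EuclideanSpace ℝ (Fin (m + 1))) : ℝ :=
  (1 - (∑ i, x i ^ 2) / r ^ 2) * Real.exp (B * x (Fin.last m))

lemma contDiff_cutoff (r B : ℝ) (k : WithTop ℕ∞) : ContDiff ℝ k (cutoff (m := m) r B) := by
  refine ContDiff.mul (contDiff_const.sub (ContDiff.div_const (ContDiff.sum fun i _ =>
    (contDiff_coord k i).pow 2) _)) ?_
  exact (contDiff_const.mul (contDiff_coord k (Fin.last m))).exp

/-- The normal derivative of |x|² is 2x_n, which vanishes on the flat piece, so only the exponential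
contributes. -/
lemma pd_cutoff {r B : ℝ} (hr : 0 < r) {y : EuclideanSpace ℝ (Fin m)} (hy : y ∈ bdryDisc m r) :
    pd (halfBall m r) (Fin.last m) (cutoff r B) (bdryPt y) = B * cutoff r B (bdryPt y) := by
  have hs := goodDomain_halfBall m hr
  have hx := mapsTo_bdryPt m r hy
  set D := halfBall m r with hD
  have dc : ∀ i : Fin (m + 1), DifferentiableWithinAt ℝ (fun x : EuclideanSpace ℝ (Fin (m + 1)) => x i)
      D (bdryPt y) := fun i =>
    ((contDiff_coord 1 i).differentiable one_ne_zero).differentiableAt.differentiableWithinAt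
  have dq : DifferentiableWithinAt ℝ (fun x : EuclideanSpace ℝ (Fin (m + 1)) =>
      1 - (r ^ 2)⁻¹ * ∑ i, x i * x i) D (bdryPt y) :=
    ((DifferentiableWithinAt.fun_sum fun i _ => (dc i).fun_mul (dc i)).const_mul _).const_sub 1
  have de : DifferentiableWithinAt ℝ (fun x : EuclideanSpace ℝ (Fin (m + 1)) =>
      Real.exp (B * x (Fin.last m))) D (bdryPt y) := ((dc _).const_mul B).exp
  have e : cutoff (m := m) r B = fun x => (1 - (r ^ 2)⁻¹ * ∑ i, x i * x i)
      * Real.exp (B * x (Fin.last m)) := by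
    funext x
    simp only [cutoff, ← sq]; rw [div_eq_inv_mul]
  rw [e, pd_mul hs hx dq de, pd_exp hs hx ((dc _).const_mul B), pd_const_mul hs hx _ (dc _),
    pd_coord hs hx, pd_sub hs hx (differentiableWithinAt_const _)
      ((DifferentiableWithinAt.fun_sum fun i _ => (dc i).fun_mul (dc i)).const_mul _), pd_const,
    pd_const_mul hs hx _ (DifferentiableWithinAt.fun_sum fun i _ => (dc i).fun_mul (dc i)),
    pd_sum hs hx _ fun i _ => (dc i).fun_mul (dc i)]
  simp only [pd_mul hs hx (dc _) (dc _), pd_coord hs hx]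
  simp [Finset.sum_add_distrib]
  ring

lemma sum_sq_lt_of_cutoff_ne_zero {r B : ℝ} (hr : 0 < r) {x : EuclideanSpace ℝ (Fin (m + 1))}
    (hx : x ∈ halfBall m r) (h : cutoff r B x ≠ 0) : ∑ i, x i ^ 2 < r ^ 2 := by
  refine lt_of_le_of_ne hx.2 fun h1 => h ?_
  rw [cutoff, h1, div_self (by positivity), sub_self, zero_mul]

/-- On the ball of half the radius the first factor is at least 1 − 1/4, and the exponential is at
least 1. -/
lemma le_cutoff {r B : ℝ} (hr : 0 < r) (hB : 0 ≤ B) {x : EuclideanSpace ℝ (Fin (m + 1))}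
    (hx : x ∈ halfBall m (r / 2)) : 3 / 4 ≤ cutoff r B x := by
  have h1 : (∑ i, x i ^ 2) / r ^ 2 ≤ 1 / 4 := by
    rw [div_le_iff₀ (by positivity)]
    have := hx.2
    linarith
  have h2 : 1 ≤ Real.exp (B * x (Fin.last m)) := Real.one_le_exp (mul_nonneg hB hx.1)
  have h3 : 3 / 4 * 1 ≤ (1 - (∑ i, x i ^ 2) / r ^ 2) * Real.exp (B * x (Fin.last m)) :=
    mul_le_mul (by linarith) h2 zero_le_one (by linarith)
  rw [cutoff]; linarith

end Weight

/-! ### Existence of a maximum of the test quantity -/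

section Maximum

variable {n : ℕ} {θ G : ℝ} {s : Set (EuclideanSpace ℝ (Fin n))}
  {g T : EuclideanSpace ℝ (Fin n) → Matrix (Fin n) (Fin n) ℝ} {q : EuclideanSpace ℝ (Fin n) → ℝ}

/-- The right-hand side does not mention the frame, which makes the trace a continuous function of
the point. -/
lemma IsFrame.trace_conj {h E : Matrix (Fin n) (Fin n) ℝ} (hE : IsFrame h E)
    (A : Matrix (Fin n) (Fin n) ℝ) : ∑ a, (E.transpose * A * E) a a = ∑ i, ∑ j, h⁻¹ i j * A j i := by
  have h1 : (E.transpose * A * E).trace = (h⁻¹ * A).trace := by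
    rw [hE.inv_eq, Matrix.mul_assoc, Matrix.trace_mul_comm, Matrix.mul_assoc, Matrix.trace_mul_comm]
  simpa [Matrix.trace, Matrix.mul_apply] using h1

/-- Bound of the Rayleigh quotient by the top eigenvalue: in the dual frame both forms are sums of
the same squares, with coefficients τ_a and 1. -/
lemma IsFrame.form_le {h E A : Matrix (Fin n) (Fin n) ℝ} (hE : IsFrame h E) (hs : h.IsSymm)
    {τ : Fin n → ℝ} (hτ : E.transpose * A * E = Matrix.diagonal τ) {o : Fin n}
    (ho : ∀ a, τ a ≤ τ o) (ξ : Fin n → ℝ) :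
    ∑ i, ∑ j, A i j * ξ i * ξ j ≤ τ o * ∑ i, ∑ j, h i j * ξ i * ξ j := by
  have key : ∀ (B : Matrix (Fin n) (Fin n) ℝ) (d : Fin n → ℝ),
      E.transpose * B * E = Matrix.diagonal d → ∑ i, ∑ j, B i j * ξ i * ξ j
        = ∑ a, d a * (∑ i, (h * E) i a * ξ i) ^ 2 := by
    intro B d hd
    have h1 : ∀ k l, B k l = ∑ a, d a * (h * E) k a * (h * E) l a := fun k l => by
      rw [hE.tensor_eq hs B k l, hd]
      simp [Matrix.diagonal_apply]
    simp only [h1, sq, Finset.mul_sum, Finset.sum_mul]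
    rw [Finset.sum_comm' (t' := Finset.univ) (s' := fun _ => Finset.univ) (by simp)]
    have : ∀ f : Fin n → Fin n → Fin n → ℝ, ∑ j, ∑ i, ∑ a, f i j a = ∑ a, ∑ i, ∑ j, f i j a := by
      intro f
      rw [Finset.sum_comm]
      simp_rw [Finset.sum_comm (γ := Fin n) (f := fun j a => f _ j a)]
      rw [Finset.sum_comm]
    rw [this]
    exact Finset.sum_congr rfl fun a _ => Finset.sum_congr rfl fun i _ =>
      Finset.sum_congr rfl fun j _ => by ring
  rw [key A τ hτ, key h (fun _ => 1) (by rw [Matrix.diagonal_one]; exact hE), Finset.mul_sum]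
  refine Finset.sum_le_sum fun a _ => ?_
  rw [one_mul]
  exact mul_le_mul_of_nonneg_right (ho a) (sq_nonneg _)

/-- The maximum of `q (λ_max(T) + tr T)` is attained. -/
lemma exists_max_frame (h : IsControlledMetric s θ G g) (hθ : 0 < θ) (hc : IsCompact s)
    (hne : s.Nonempty) (hn : 0 < n) (hT : ∀ i j, ContinuousOn (fun x => T x i j) s)
    (hq : ContinuousOn q s) (hq0 : ∀ x ∈ s, 0 ≤ q x) :
    ∃ x₀ ∈ s, ∀ (E : Matrix (Fin n) (Fin n) ℝ) (τ : Fin n → ℝ) (o : Fin n), IsFrame (g x₀) E →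
      E.transpose * T x₀ * E = Matrix.diagonal τ → (∀ a, τ a ≤ τ o) →
      ∀ x ∈ s, ∀ E', IsFrame (g x) E' → ∀ b, q x * ((E'.transpose * T x * E') b b
        + ∑ a, (E'.transpose * T x * E') a a) ≤ q x₀ * (τ o + ∑ a, τ a) := by
  set form : Matrix (Fin n) (Fin n) ℝ → EuclideanSpace ℝ (Fin n) → ℝ :=
    fun A ξ => ∑ i, ∑ j, A i j * ξ i * ξ j with hform
  -- The top eigenvalue is replaced by the Rayleigh quotient over the Euclidean unit sphere. A
  -- continuous function on a compact set is maximized, and no continuity of eigenvalues is needed.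
  set Φ : EuclideanSpace ℝ (Fin n) × EuclideanSpace ℝ (Fin n) → ℝ := fun p =>
    q p.1 * (form (T p.1) p.2 / form (g p.1) p.2 + ∑ i, ∑ j, (g p.1)⁻¹ i j * T p.1 j i) with hΦ
  set K : Set (EuclideanSpace ℝ (Fin n) × EuclideanSpace ℝ (Fin n)) :=
    s ×ˢ Metric.sphere 0 1 with hK
  have hKc : IsCompact K := hc.prod (isCompact_sphere _ _)
  have hKne : K.Nonempty := by
    obtain ⟨x, hx⟩ := hne
    exact ⟨(x, EuclideanSpace.single ⟨0, hn⟩ 1), hx, by simp⟩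
  have hgpos : ∀ x ∈ s, ∀ ξ : EuclideanSpace ℝ (Fin n), ξ ≠ 0 → 0 < form (g x) ξ := by
    intro x hx ξ hξ
    have h1 := h.lower x hx (fun i => ξ i)
    rw [← EuclideanSpace.real_norm_sq_eq] at h1
    have h2 : 0 < ‖ξ‖ := norm_pos_iff.2 hξ
    exact lt_of_lt_of_le (by positivity) h1
  have hcoord : ∀ i, ContinuousOn (fun p : EuclideanSpace ℝ (Fin n) × EuclideanSpace ℝ (Fin n) =>
      p.2 i) K := fun i => by fun_prop
  have hfst : ∀ {φ : EuclideanSpace ℝ (Fin n) → ℝ}, ContinuousOn φ s →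
      ContinuousOn (fun p : EuclideanSpace ℝ (Fin n) × EuclideanSpace ℝ (Fin n) => φ p.1) K :=
    fun hφ => hφ.comp continuousOn_fst fun p hp => hp.1
  have hformc : ∀ {A : EuclideanSpace ℝ (Fin n) → Matrix (Fin n) (Fin n) ℝ},
      (∀ i j, ContinuousOn (fun x => A x i j) s) → ContinuousOn (fun p => form (A p.1) p.2) K :=
    fun hA => continuousOn_finsetSum _ fun i _ => continuousOn_finsetSum _ fun j _ =>
      ((hfst (hA i j)).mul (hcoord i)).mul (hcoord j)
  have hKsph : ∀ p ∈ K, p.2 ≠ 0 := fun p hp h0 => by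
    have := mem_sphere_zero_iff_norm.1 hp.2
    rw [h0, norm_zero] at this
    norm_num at this
  have hΦc : ContinuousOn Φ K := by
    refine (hfst hq).mul (((hformc hT).div (hformc fun i j => (h.contDiffOn i j).continuousOn)
      fun p hp => (hgpos _ hp.1 _ (hKsph p hp)).ne').add ?_)
    exact continuousOn_finsetSum _ fun i _ => continuousOn_finsetSum _ fun j _ =>
      (hfst (h.inv_contDiffOn i j).continuousOn).mul (hfst (hT j i))
  obtain ⟨p₀, hp₀, hmax⟩ := hKc.exists_isMaxOn hKne hΦc
  refine ⟨p₀.1, hp₀.1, fun E τ o hE hτ ho x hx E' hE' b => ?_⟩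
  set ξ : EuclideanSpace ℝ (Fin n) := WithLp.toLp 2 fun i => E' i b with hξ
  have hgξ : form (g x) ξ = 1 := by
    have := isFrame_apply hE' b b
    rw [Matrix.one_apply_eq] at this
    exact this
  have hTξ : form (T x) ξ = (E'.transpose * T x * E') b b := (conj_apply E' (T x) b b).symm
  have hξ0 : ξ ≠ 0 := by
    intro h0
    rw [h0] at hgξ
    simp [hform] at hgξ
  have hnξ : ‖ξ‖ ≠ 0 := norm_ne_zero_iff.2 hξ0
  have hscale : ∀ A, form A (‖ξ‖⁻¹ • ξ) = (‖ξ‖⁻¹) ^ 2 * form A ξ := fun A => by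
    simp only [hform, Finset.mul_sum, PiLp.smul_apply, smul_eq_mul]
    exact Finset.sum_congr rfl fun i _ => Finset.sum_congr rfl fun j _ => by ring
  have h1 : Φ (x, ‖ξ‖⁻¹ • ξ) ≤ Φ p₀ := hmax (show (x, ‖ξ‖⁻¹ • ξ) ∈ K from ⟨hx, by
    rw [mem_sphere_zero_iff_norm, norm_smul, norm_inv, norm_norm, inv_mul_cancel₀ hnξ]⟩)
  have h2 : Φ (x, ‖ξ‖⁻¹ • ξ) = q x * ((E'.transpose * T x * E') b b
      + ∑ a, (E'.transpose * T x * E') a a) := by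
    simp only [hΦ, hscale]
    rw [mul_div_mul_left _ _ (by positivity), hgξ, hTξ, div_one, hE'.trace_conj]
  rw [← h2]
  refine h1.trans (mul_le_mul_of_nonneg_left ?_ (hq0 _ hp₀.1))
  have h3 : ∑ a, τ a = ∑ i, ∑ j, (g p₀.1)⁻¹ i j * T p₀.1 j i := by
    rw [← hE.trace_conj, hτ]; simp
  rw [h3]
  refine add_le_add_left ?_ _
  rw [div_le_iff₀ (hgpos _ hp₀.1 _ (hKsph _ hp₀))]
  exact hE.form_le (h.isSymm hp₀.1) hτ ho _

end Maximum

end BoundaryEstimate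

end

noncomputable section

namespace BoundaryEstimate

open Finset Filter Topology Asymptotics

/-! ### The global estimate -/

section Problem

variable {m : ℕ} {r ε Λ G θ s c muHat : ℝ}
  {g S : EuclideanSpace ℝ (Fin (m + 1)) → Matrix (Fin (m + 1)) (Fin (m + 1)) ℝ}
  {μ : EuclideanSpace ℝ (Fin m) → ℝ} {Γ : Set (Fin (m + 1) → ℝ)} {F : (Fin (m + 1) → ℝ) → ℝ}
  {f : EuclideanSpace ℝ (Fin (m + 1)) → ℝ → ℝ} {u : EuclideanSpace ℝ (Fin (m + 1)) → ℝ}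
  {x : EuclideanSpace ℝ (Fin (m + 1))}

namespace IsProblem

lemma controlled (h : IsProblem r ε Λ G θ s c g S μ muHat Γ F f u) (hr : 0 < r) :
    IsControlledMetric (halfBall m r) θ G g where
  good := goodDomain_halfBall m hr
  contDiffOn := h.metric.contDiffOn
  posDef := h.metric.posDef
  lower := h.metric_lower
  bound i j := pdBound_of_iteratedFDerivWithin (goodDomain_halfBall m hr)
    (by exact_mod_cast h.metric.contDiffOn i j) (h.metric_bound i j)

lemma tensor_pdBound (h : IsProblem r ε Λ G θ s c g S μ muHat Γ F f u) (hr : 0 < r)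
    (i j : Fin (m + 1)) : PdBound (halfBall m r) 2 s (fun x => S x i j) :=
  pdBound_of_iteratedFDerivWithin (goodDomain_halfBall m hr)
    (by exact_mod_cast h.tensor_contDiffOn i j) (h.tensor_bound i j)

/-- The boundary condition makes the principal curvature function smooth. -/
lemma contDiffOn_curvature (h : IsProblem r ε Λ G θ s c g S μ muHat Γ F f u) (hr : 0 < r) :
    ContDiffOn ℝ 2 μ (bdryDisc m r) := by
  have h1 : ContDiffOn ℝ 3 (pd (halfBall m r) (Fin.last m) u) (halfBall m r) := by
    exact_mod_cast contDiffOn_pd (goodDomain_halfBall m hr) (k := 4) (l := 3)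
      (by exact_mod_cast h.solution.contDiffOn) le_rfl _
  have h2 := (contDiffOn_comp_bdryPt h1).of_le (show (2 : WithTop ℕ∞) ≤ 3 by norm_num)
  have h3 := (contDiffOn_comp_bdryPt h.solution.contDiffOn).of_le
    (show (2 : WithTop ℕ∞) ≤ 4 by norm_num)
  refine ((contDiffOn_const (c := muHat)).mul h3.neg.exp).sub h2 |>.congr fun y hy => ?_
  have := h.solution.neumann y hy
  linarith

lemma boundaryData (h : IsProblem r ε Λ G θ s c g S μ muHat Γ F f u) (hr : 0 < r) :
    IsBoundaryData r θ G muHat g S μ u where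
  fermi :=
    { pos := hr
      controlled := h.controlled hr
      normal := h.metric.normal
      mixed := h.metric.mixed
      umbilic := h.umbilic
      smooth := h.contDiffOn_curvature hr }
  contDiffOn := h.solution.contDiffOn
  tensor := h.tensor_contDiffOn
  tensor_symm := h.tensor_symm
  neumann := h.solution.neumann
  t0 := h.tensor_T.t0

lemma rhsBound (h : IsProblem r ε Λ G θ s c g S μ muHat Γ F f u) (hx : x ∈ halfBall m r) :
    RhsBound (halfBall m r) g f c x (u x) := by
  have h0 := h.rhs_bound x hx
  have h1 := (h.rhs.pos x hx (u x)).le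
  rw [fSize] at h0
  have n1 : 0 ≤ covectorNorm (g x) (fun i => pd (halfBall m r) i (fun y => f y (u x)) x) :=
    Real.sqrt_nonneg _
  have n2 := abs_nonneg (deriv (f x) (u x))
  have n3 : 0 ≤ tensorNorm (g x) (covHess (halfBall m r) g (fun y => f y (u x)) x) :=
    Real.sqrt_nonneg _
  have n4 : 0 ≤ covectorNorm (g x) (fun i => pd (halfBall m r) i (fun y => deriv (f y) (u x)) x) :=
    Real.sqrt_nonneg _
  have n5 := abs_nonneg (deriv (deriv (f x)) (u x))
  constructor <;> linarith

lemma rhs_abs (h : IsProblem r ε Λ G θ s c g S μ muHat Γ F f u) : IsRightHandSide r |Λ| g f where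
  contDiffOn := h.rhs.contDiffOn
  pos := h.rhs.pos
  grad_le x hx z := (h.rhs.grad_le x hx z).trans
    (mul_le_mul_of_nonneg_right (le_abs_self Λ) (h.rhs.pos x hx z).le)
  deriv_le x hx z := (h.rhs.deriv_le x hx z).trans
    (mul_le_mul_of_nonneg_right (le_abs_self Λ) (h.rhs.pos x hx z).le)

end IsProblem

/-- The weighted estimate for the eigenvalues of `T`, up to the boundary piece. -/
lemma exists_weighted_estimate (hm : 3 ≤ m + 1) (hr : 0 < r) (hε : 0 < ε) (hθ : 0 < θ)
    (Λ G s c : ℝ) {V ρ : ℝ} (hV : 0 ≤ V) (hρ : 0 ≤ ρ) :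
    ∃ B C : ℝ, 0 ≤ B ∧ ∀ (muHat : ℝ)
      (g S : EuclideanSpace ℝ (Fin (m + 1)) → Matrix (Fin (m + 1)) (Fin (m + 1)) ℝ)
      (μ : EuclideanSpace ℝ (Fin m) → ℝ) (Γ : Set (Fin (m + 1) → ℝ))
      (F : (Fin (m + 1) → ℝ) → ℝ) (f : EuclideanSpace ℝ (Fin (m + 1)) → ℝ → ℝ)
      (u : EuclideanSpace ℝ (Fin (m + 1)) → ℝ),
      IsProblem r ε Λ G θ s c g S μ muHat Γ F f u → 0 ≤ muHat →
      (∀ y ∈ bdryDisc m r, muHat * Real.exp (-u (bdryPt y)) ≤ V) →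
      (muHat = 0 ∨ ConditionA Γ F ρ) →
      ∀ x ∈ halfBall m r, ∀ (E : Matrix (Fin (m + 1)) (Fin (m + 1)) ℝ) (τ : Fin (m + 1) → ℝ)
        (o : Fin (m + 1)), IsFrame (g x) E →
        E.transpose * tensorT (halfBall m r) g S u x * E = Matrix.diagonal τ →
        cutoff r B x * cutoff r B x * (τ o + ∑ a, τ a) ≤ C := by
  obtain ⟨C₁, hC₁, hbdry⟩ := exists_boundary_estimate (m := m) (by omega) hθ G s hV hρ
    (abs_nonneg Λ) hε
  -- The weight is the square of the cutoff, so its normal derivative on the flat piece is 2B = C₁ +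
  -- 1 times itself. This is not circular, since C₁ does not depend on the weight.
  set B : ℝ := (C₁ + 1) / 2 with hB
  obtain ⟨Q, hQ, hQb⟩ := exists_sq_bounds (goodDomain_halfBall m hr) (isCompact_halfBall m hr.le)
    (contDiff_cutoff (m := m) r B 2).contDiffOn
  obtain ⟨C₂, hinter⟩ := exists_interior_estimate hm (G := G) hθ s c Q
  -- The first summand covers an interior maximum, the second a boundary maximum, where K ≤ C₁ and q
  -- ≤ Q.
  refine ⟨B, |C₂| + Q * C₁, by positivity, ?_⟩
  intro muHat g S μ Γ F f u h hmu hVu hA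
  have hD := h.boundaryData hr
  have hctl := h.controlled hr
  have hsol : SolvesOn (halfBall m r) g S u Γ F (fun x => f x (u x)) := h.solution.equation
  set q : EuclideanSpace ℝ (Fin (m + 1)) → ℝ := fun x => cutoff r B x * cutoff r B x with hq
  have hqc : ContDiff ℝ 2 q := (contDiff_cutoff r B 2).mul (contDiff_cutoff r B 2)
  have hq0 : ∀ x ∈ halfBall m r, 0 ≤ q x := fun x _ => mul_self_nonneg _
  have hne : (halfBall m r).Nonempty := ⟨0, by simp, by simp; positivity⟩
  obtain ⟨x₀, hx₀, hmax⟩ := exists_max_frame hctl hθ (isCompact_halfBall m hr.le) hne (by omega)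
    (T := tensorT (halfBall m r) g S u) (fun i j x hx =>
      (hD.differentiable_tensorT hx i j).continuousWithinAt) hqc.continuous.continuousOn hq0
  have hpos : ∀ x ∈ halfBall m r, ∀ (E : Matrix (Fin (m + 1)) (Fin (m + 1)) ℝ)
      (τ : Fin (m + 1) → ℝ) (o : Fin (m + 1)), IsFrame (g x) E →
      E.transpose * tensorT (halfBall m r) g S u x * E = Matrix.diagonal τ → (∀ a, τ a ≤ τ o) →
      0 < τ o + ∑ a, τ a := fun x hx E τ o hE hτ ho =>
    (eigenvalue_bounds h.cone (Finset.sum_nonneg fun _ _ => sq_nonneg _)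
      (hsol.eigenvalues h.cone h.structured hx hE hτ).1 ho rfl).1
  have hsuff : ∃ (E : Matrix (Fin (m + 1)) (Fin (m + 1)) ℝ) (τ : Fin (m + 1) → ℝ)
      (o : Fin (m + 1)), IsFrame (g x₀) E ∧
      E.transpose * tensorT (halfBall m r) g S u x₀ * E = Matrix.diagonal τ ∧ (∀ a, τ a ≤ τ o) ∧
      q x₀ * (τ o + ∑ a, τ a) ≤ |C₂| + Q * C₁ := by
    have hr₁ : 0 ≤ |C₂| := abs_nonneg _
    have hr₂ : 0 ≤ Q * C₁ := by positivity
    have hgen : ∃ (E : Matrix (Fin (m + 1)) (Fin (m + 1)) ℝ) (τ : Fin (m + 1) → ℝ)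
        (o : Fin (m + 1)), IsFrame (g x₀) E ∧
        E.transpose * tensorT (halfBall m r) g S u x₀ * E = Matrix.diagonal τ ∧
        ∀ a, τ a ≤ τ o := by
      obtain ⟨E, τ, hE, hτ⟩ := exists_frame_diagonal (hctl.posDef x₀ hx₀)
        (tensorT_isSymm hctl (h.solution.contDiffOn.of_le (by norm_num)) (h.tensor_symm x₀ hx₀) hx₀)
      obtain ⟨o, ho⟩ := Finite.exists_max τ
      exact ⟨E, τ, o, hE, hτ, ho⟩
    by_cases hz : cutoff r B x₀ = 0
    · obtain ⟨E, τ, o, hE, hτ, ho⟩ := hgen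
      refine ⟨E, τ, o, hE, hτ, ho, ?_⟩
      simp only [hq, hz, zero_mul]
      linarith
    have hlt := sum_sq_lt_of_cutoff_ne_zero hr hx₀ hz
    have hqpos : 0 < q x₀ := mul_self_pos.2 hz
    obtain ⟨hQ0, hQ1, hQ2⟩ := hQb x₀ hx₀
    rcases hx₀.1.lt_or_eq with hin | hbd
    · obtain ⟨E, τ, o, hE, hτ, ho⟩ := hgen
      refine ⟨E, τ, o, hE, hτ, ho, ?_⟩
      have := hinter (halfBall m r) g S u q Γ F ε f x₀ E τ o hctl h.tensor_contDiffOn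
        (h.tensor_pdBound hr) h.tensor_symm h.solution.contDiffOn h.cone h.structured
        h.rhs.contDiffOn hsol (halfBall_mem_nhds hin hlt) (h.rhsBound hx₀) hqc.contDiffOn hqpos hQ0
        hQ1 hQ2 hE hτ ho fun x hx E' hE' => hmax E τ o hE hτ ho x hx E' hE' o
      have := le_abs_self C₂
      linarith
    · obtain ⟨y, hyx⟩ : ∃ y, x₀ = bdryPt y := by
        refine ⟨WithLp.toLp 2 fun α => x₀ α.castSucc, ?_⟩
        ext i
        refine Fin.lastCases ?_ (fun α => ?_) i
        · rw [bdryPt_last, ← hbd]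
        · rw [bdryPt_castSucc]
      subst hyx
      have hys : ∑ α, y α ^ 2 < r ^ 2 := by
        rw [Fin.sum_univ_castSucc] at hlt
        simpa using hlt
      have hy : y ∈ bdryDisc m r := mem_bdryDisc.2 hys.le
      have hTs := tensorT_isSymm hctl (h.solution.contDiffOn.of_le (by norm_num))
        (h.tensor_symm _ hx₀) hx₀
      -- Only the tangential block has to be diagonalized: the mixed components of T vanish, so
      -- adjoining ∂_n gives a diagonalizing frame.
      obtain ⟨e, d, he, hd⟩ := exists_frame_diagonal (hD.fermi.induced_controlled.posDef y hy)
        (T := tangentT r g S u y) (hTs.submatrix Fin.castSucc)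
      have hmix := hD.tensorT_mixed hy
      have hτ := conj_blockFrame hmix (fun γ => by rw [← hTs.apply]; exact hmix γ) hd
      set τ : Fin (m + 1) → ℝ := Fin.snoc (α := fun _ => ℝ) d
        (tensorT (halfBall m r) g S u (bdryPt y) (Fin.last m) (Fin.last m))
      obtain ⟨o, ho⟩ := Finite.exists_max τ
      have hE := hD.fermi.isFrame_blockFrame hy he
      refine ⟨blockFrame e, τ, o, hE, hτ, ho, ?_⟩
      have hcd : DifferentiableWithinAt ℝ (cutoff r B) (halfBall m r) (bdryPt y) :=
        ((contDiff_cutoff r B 2).differentiable (by norm_num)).differentiableAt.differentiableWithinAt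
      have hqn : pd (halfBall m r) (Fin.last m) q (bdryPt y) = (C₁ + 1) * q (bdryPt y) := by
        rw [hq, pd_mul (goodDomain_halfBall m hr) hx₀ hcd hcd, pd_cutoff hr hy, hB]
        ring
      have h1 := hbdry r muHat (C₁ + 1) g S μ u q Γ F f y e τ o hD (h.tensor_pdBound hr) h.tensor_T
        h.cone h.structured h.rhs_abs hsol hmu (hVu y hy) hA hys he hτ ho (hcd.fun_mul hcd) hqpos hqn
        fun x hx E' hE' => hmax _ τ o hE hτ ho x hx E' hE' o
      have h2 := hpos _ hx₀ _ τ o hE hτ ho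
      -- From (C₁ + 1)K ≤ C₁(1 + K).
      have h3 : τ o + ∑ a, τ a ≤ C₁ := by linarith
      have h4 : q (bdryPt y) * (τ o + ∑ a, τ a) ≤ Q * C₁ := mul_le_mul hQ0 h3 h2.le hQ
      linarith
  obtain ⟨E₀, τ₀, o₀, hE₀, hτ₀, ho₀, hle⟩ := hsuff
  intro x hx E τ o hE hτ
  have h1 := hmax E₀ τ₀ o₀ hE₀ hτ₀ ho₀ x hx E hE o
  rw [hτ] at h1
  simp only [Matrix.diagonal_apply_eq] at h1
  exact h1.trans hle

/-- The bound for the gradient and the Hessian in terms of the eigenvalues of `T`. -/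
lemma derivSize_le (hD : IsControlledMetric (halfBall m r) θ G g) (hθ : 0 < θ)
    (hx : x ∈ halfBall m r) (hS : ∀ i j, |S x i j| ≤ s) {E : Matrix (Fin (m + 1)) (Fin (m + 1)) ℝ}
    (hE : IsFrame (g x) E) {τ : Fin (m + 1) → ℝ} {k : ℝ}
    (hτ : E.transpose * tensorT (halfBall m r) g S u x * E = Matrix.diagonal τ)
    (hp : ∑ a, gradComp (halfBall m r) u E x a ^ 2 ≤ 2 * k) (hk : 0 ≤ k)
    (hτk : ∀ a, |τ a| ≤ (m + 1) * k) :
    derivSize r g u x ≤ 2 * k + (m + 1) * ((m + 3) * k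
      + (m + 1) * ((m + 1) * (s * (√θ)⁻¹ * (√θ)⁻¹))) := by
  set b : ℝ := (m + 3) * k + (m + 1) * ((m + 1) * (s * (√θ)⁻¹ * (√θ)⁻¹)) with hb
  have hEc : ∀ i a, |E i a| ≤ (√θ)⁻¹ := fun i a => hE.abs_le hθ (hD.lower x hx) i a
  have hSE : ∀ a c, |(E.transpose * S x * E) a c|
      ≤ (m + 1) * ((m + 1) * (s * (√θ)⁻¹ * (√θ)⁻¹)) := by
    intro a c
    rw [conj_apply]
    have := abs_sum_le_card_mul (x := fun i => ∑ j, S x i j * E i a * E j c) fun i =>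
      abs_sum_le_card_mul (x := fun j => S x i j * E i a * E j c) fun j =>
        abs_mul_le_mul (abs_mul_le_mul (hS i j) (hEc i a)) (hEc j c)
    simpa using this
  have hv : ∀ a c, |gradComp (halfBall m r) u E x a * gradComp (halfBall m r) u E x c| ≤ 2 * k := by
    intro a c
    have h1 : ∀ a, gradComp (halfBall m r) u E x a ^ 2
        ≤ ∑ a, gradComp (halfBall m r) u E x a ^ 2 := fun a =>
      Finset.single_le_sum (f := fun a => gradComp (halfBall m r) u E x a ^ 2)
        (fun _ _ => sq_nonneg _) (Finset.mem_univ a)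
    have h2 := two_mul_le_add_sq |gradComp (halfBall m r) u E x a| |gradComp (halfBall m r) u E x c|
    rw [sq_abs, sq_abs] at h2
    rw [abs_mul]
    linarith [h1 a, h1 c]
  have hH : ∀ a c, |(E.transpose * covHess (halfBall m r) g u x * E) a c| ≤ b := by
    intro a c
    have h1 := conj_tensorT (s := halfBall m r) (g := g) (S := S) (u := u) (x := x) E a c
    have h2 : |Matrix.diagonal τ a c| ≤ (m + 1) * k := by
      by_cases hac : a = c
      · rw [hac, Matrix.diagonal_apply_eq]; exact hτk c
      · rw [Matrix.diagonal_apply_ne _ hac, abs_zero]; positivity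
    rw [← hτ] at h2
    have h3 := hv a c
    have h4 := hSE a c
    rw [h1] at h2
    rw [abs_le] at h2 h3 h4 ⊢
    rw [hb]
    constructor <;> linarith [h2.1, h2.2, h3.1, h3.2, h4.1, h4.2]
  have hb0 : 0 ≤ b := (abs_nonneg _).trans (hH 0 0)
  have ht : tensorNorm (g x) (covHess (halfBall m r) g u x) ≤ (m + 1) * b := by
    rw [hE.tensorNorm_eq]
    refine Real.sqrt_le_iff.2 ⟨by positivity, ?_⟩
    have h1 : ∀ a c, (E.transpose * covHess (halfBall m r) g u x * E) a c ^ 2 ≤ b ^ 2 := fun a c => by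
      rw [← sq_abs]; exact pow_le_pow_left₀ (abs_nonneg _) (hH a c) 2
    calc _ ≤ ∑ _a : Fin (m + 1), ∑ _c : Fin (m + 1), b ^ 2 :=
          Finset.sum_le_sum fun a _ => Finset.sum_le_sum fun c _ => h1 a c
      _ = ((m + 1) * b) ^ 2 := by
          simp only [Finset.sum_const, Finset.card_univ, Fintype.card_fin, nsmul_eq_mul]
          push_cast; ring
  have hcov : covectorNormSq (g x) (fun i => pd (halfBall m r) i u x) ≤ 2 * k := by
    rw [hE.covectorNormSq_eq]; exact hp
  rw [derivSize]
  linarith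

/-- The interior and boundary estimates combined. -/
lemma exists_derivSize_bound (hm : 3 ≤ m + 1) (hr : 0 < r) (hε : 0 < ε) (hθ : 0 < θ)
    (Λ G s c : ℝ) {V ρ : ℝ} (hV : 0 ≤ V) (hρ : 0 ≤ ρ) :
    ∃ C : ℝ, ∀ (muHat : ℝ)
      (g S : EuclideanSpace ℝ (Fin (m + 1)) → Matrix (Fin (m + 1)) (Fin (m + 1)) ℝ)
      (μ : EuclideanSpace ℝ (Fin m) → ℝ) (Γ : Set (Fin (m + 1) → ℝ))
      (F : (Fin (m + 1) → ℝ) → ℝ) (f : EuclideanSpace ℝ (Fin (m + 1)) → ℝ → ℝ)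
      (u : EuclideanSpace ℝ (Fin (m + 1)) → ℝ),
      IsProblem r ε Λ G θ s c g S μ muHat Γ F f u → 0 ≤ muHat →
      (∀ y ∈ bdryDisc m r, muHat * Real.exp (-u (bdryPt y)) ≤ V) →
      (muHat = 0 ∨ ConditionA Γ F ρ) →
      ∀ x ∈ halfBall m (r / 2), derivSize r g u x ≤ C := by
  obtain ⟨B, C, hB, hC⟩ := exists_weighted_estimate hm hr hε hθ Λ G s c hV hρ
  refine ⟨2 * (2 * C) + (m + 1) * ((m + 3) * (2 * C)
    + (m + 1) * ((m + 1) * (s * (√θ)⁻¹ * (√θ)⁻¹))), ?_⟩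
  intro muHat g S μ Γ F f u h hmu hVu hA x hx
  have hxr : x ∈ halfBall m r := by
    refine ⟨hx.1, hx.2.trans ?_⟩
    exact pow_le_pow_left₀ (by positivity) (by linarith) 2
  have hctl := h.controlled hr
  have hsol : SolvesOn (halfBall m r) g S u Γ F (fun x => f x (u x)) := h.solution.equation
  obtain ⟨E, τ, hE, hτ⟩ := exists_frame_diagonal (hctl.posDef x hxr)
    (tensorT_isSymm hctl (h.solution.contDiffOn.of_le (by norm_num)) (h.tensor_symm x hxr) hxr)
  obtain ⟨o, ho⟩ := Finite.exists_max τ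
  obtain ⟨k1, k2, k3, -, -⟩ := eigenvalue_bounds h.cone (Finset.sum_nonneg fun _ _ => sq_nonneg _)
    (hsol.eigenvalues h.cone h.structured hxr hE hτ).1 ho rfl
  have h1 := hC muHat g S μ Γ F f u h hmu hVu hA x hxr E τ o hE hτ
  have h2 := le_cutoff hr hB hx
  -- The weight is at least 9/16 ≥ 1/2 here, so K ≤ 2C because K, and hence C, is positive.
  have h3 : (3 / 4 : ℝ) * (3 / 4) ≤ cutoff r B x * cutoff r B x :=
    mul_le_mul h2 h2 (by norm_num) (by linarith)
  have h4 : τ o + ∑ a, τ a ≤ 2 * C := by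
    have := mul_le_mul_of_nonneg_right h3 k1.le
    linarith
  refine (derivSize_le hctl hθ hxr (fun i j => (h.tensor_pdBound hr i j).abs_le x hxr) hE hτ k2 k1.le
    (by exact_mod_cast k3)).trans ?_
  gcongr

end Problem

end BoundaryEstimate

end

theorem theorem6 (m : ℕ) (hm : 3 ≤ m + 1) (r ε Λ G θ s c : ℝ)
    (hr : 0 < r) (hε : 0 < ε) (hθ : 0 < θ) :
    -- case (a)
    (∃ C : ℝ, ∀ (g S : EuclideanSpace ℝ (Fin (m + 1)) → Matrix (Fin (m + 1)) (Fin (m + 1)) ℝ)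
        (μ : EuclideanSpace ℝ (Fin m) → ℝ) (Γ : Set (Fin (m + 1) → ℝ))
        (F : (Fin (m + 1) → ℝ) → ℝ) (f : EuclideanSpace ℝ (Fin (m + 1)) → ℝ → ℝ)
        (u : EuclideanSpace ℝ (Fin (m + 1)) → ℝ),
        BoundaryEstimate.IsProblem r ε Λ G θ s c g S μ 0 Γ F f u →
        ∀ x ∈ BoundaryEstimate.halfBall m (r / 2),
          BoundaryEstimate.derivSize r g u x ≤ C) ∧
    -- case (b)
    (∀ ρ muHat u₀ : ℝ, 0 < ρ → 0 < muHat →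
      ∃ C : ℝ, ∀ (g S : EuclideanSpace ℝ (Fin (m + 1)) → Matrix (Fin (m + 1)) (Fin (m + 1)) ℝ)
        (μ : EuclideanSpace ℝ (Fin m) → ℝ) (Γ : Set (Fin (m + 1) → ℝ))
        (F : (Fin (m + 1) → ℝ) → ℝ) (f : EuclideanSpace ℝ (Fin (m + 1)) → ℝ → ℝ)
        (u : EuclideanSpace ℝ (Fin (m + 1)) → ℝ),
        BoundaryEstimate.IsProblem r ε Λ G θ s c g S μ muHat Γ F f u →
        BoundaryEstimate.ConditionA Γ F ρ →
        (BoundaryEstimate.posCone (m + 1) 2 ⊆ Γ ∨ Γ ⊆ BoundaryEstimate.posCone (m + 1) 2) →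
        (∀ x ∈ BoundaryEstimate.halfBall m r, u₀ ≤ u x) →
        ∀ x ∈ BoundaryEstimate.halfBall m (r / 2),
          BoundaryEstimate.derivSize r g u x ≤ C) := by
  refine ⟨?_, fun ρ muHat u₀ hρ hmu => ?_⟩
  · obtain ⟨C, hC⟩ := BoundaryEstimate.exists_derivSize_bound hm hr hε hθ Λ G s c
      (V := 0) (ρ := 0) le_rfl le_rfl
    exact ⟨C, fun g S μ Γ F f u h => hC 0 g S μ Γ F f u h le_rfl (fun y _ => by simp) (Or.inl rfl)⟩
  · obtain ⟨C, hC⟩ := BoundaryEstimate.exists_derivSize_bound hm hr hε hθ Λ G s c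
      (V := muHat * Real.exp (-u₀)) (ρ := ρ) (by positivity) hρ.le
    refine ⟨C, fun g S μ Γ F f u h hA _ hu => hC muHat g S μ Γ F f u h hmu.le (fun y hy => ?_)
      (Or.inr hA)⟩
    have := hu _ (BoundaryEstimate.mapsTo_bdryPt m r hy)
    gcongr
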